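/- **Theorem.** There is a constant $c>0$ such that the promise problem $\mathrm{coGapCVP}'_{c\sqrt n}$ is in $\mathrm{QMA}+$. Here, for a gap parameter $\beta=\beta(n)$, the promise problem $\mathrm{coGapCVP}'_{\beta}$ is the following. The input, a bit string, consists of a basis $v_1,\dots,v_n\in\mathbb{Q}^n$ of a lattice $L=\{\sum_i a_iv_i : a_i\in\mathbb{Z}\}$ of rank $n$ and of a vector $v\in\mathbb{Q}^n$, all written in binary. Let $d(v,L)=\min_{y\in L}\|v-y\|$ (Euclidean norm). The input is a YES instance if $d(v,L)>\beta(n)$ and every non-zero vector of $L$ has length at least $\beta(n)$; it is a NO instance if $d(v,L)\le 1$. A *super-verifier* is a classical polynomial-time randomized algorithm that, given an input $x$, outputs the description of a quantum circuit $V$ (acting on a witness register and on ancilla qubits in the state $|0\rangle$, with a designated output qubit) and two numbers $r,s\in[0,1]$. A promise problem is in $\mathrm{QMA}+$ if there are a super-verifier and polynomials $p_1,p_2,p_3$, with $p_2(1/N)>0$ and $p_3(1/N)>0$ for all integers $N\ge1$, such that - for every YES instance $x$ there is a density matrix $\rho$ on $p_1(|x|)$ qubits with $$\Pr_{V,r,s}\Big(\big|\mathrm{tr}(\Pi^{|1\rangle}V\rho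 V^\dagger)-r\big|\le s\Big)=1;$$ - for every NO instance $x$ and every density matrix $\rho$ on $p_1(|x|)$ qubits, $$\Pr_{V,r,s}\Big(\big|\mathrm{tr}(\Pi^{|1\rangle}V\rho V^\dagger)-r\big|\le s+p_3(1/|x|)\Big)\le 1-p_2(1/|x|).$$ The probabilities are over the random choices of the super-verifier on input $x$, the circuit $V$ acts on $\rho$ together with its ancilla qubits, and $\Pi^{|1\rangle}$ is the projection on the space where the output qubit of $V$ is $|1\rangle$. -/

import Mathlib

noncomputable section

namespace QMAPlus

open scoped Matrix Polynomial ComplexOrder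

/-! ### Bit strings -/

/-- Unary code of a natural number: `n` ones and a closing zero. -/
def encUnary (n : ℕ) : List Bool := List.replicate n true ++ [false]

/-- Self-delimiting binary code of a natural number: every binary digit (least significant first)
is preceded by a `1`, and a `0` closes the number. -/
def encNat (n : ℕ) : List Bool := n.bits.flatMap (fun b => [true, b]) ++ [false]

/-- A sign bit followed by the binary code of the absolute value. -/
def encInt (z : ℤ) : List Bool := decide (z < 0) :: encNat z.natAbs

/-! ### The classical machine: a random access machine with logarithmic cost -/

/-- The number of binary digits of `|z|`. -/
def bitLen (z : ℤ) : ℕ := z.natAbs.size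

/-- Integer expressions. `mem e` is the content of the memory cell whose address is the value
of `e` (so direct addressing is `mem (const a)` and indirect addressing `mem (mem (const a))`). -/
inductive Expr
  | const (c : ℤ)
  | mem (e : Expr)
  | add (e f : Expr)
  | sub (e f : Expr)
  | mul (e f : Expr)
  | div (e f : Expr)

/-- The value of an expression in a given memory (integer division, with `a / 0 = 0`). -/
def Expr.eval (M : ℤ → ℤ) : Expr → ℤ
  | .const c => c
  | .mem e => M (e.eval M)
  | .add e f => e.eval M + f.eval M
  | .sub e f => e.eval M - f.eval M
  | .mul e f => e.eval M * f.eval M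
  | .div e f => e.eval M / f.eval M

/-- The logarithmic cost of evaluating an expression: every operation costs one plus the number
of bits of its result, on top of the cost of its operands. -/
def Expr.cost (M : ℤ → ℤ) : Expr → ℕ
  | .const c => 1 + bitLen c
  | .mem e => e.cost M + 1 + bitLen ((Expr.mem e).eval M)
  | .add e f => e.cost M + f.cost M + 1 + bitLen ((Expr.add e f).eval M)
  | .sub e f => e.cost M + f.cost M + 1 + bitLen ((Expr.sub e f).eval M)
  | .mul e f => e.cost M + f.cost M + 1 + bitLen ((Expr.mul e f).eval M)
  | .div e f => e.cost M + f.cost M + 1 + bitLen ((Expr.div e f).eval M)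

/-- Programs. `assign a e` stores the value of `e` in the cell with address `a`; `read a` and
`flip a` store there the next bit of the input, respectively the next random bit (and the value
`2` if there is none left); `emit e` appends to the output the bit that tells whether `0 < e`;
`ite e` and `loop e` test whether `0 < e`. -/
inductive Prog
  | skip
  | assign (a e : Expr)
  | read (a : Expr)
  | flip (a : Expr)
  | emit (e : Expr)
  | seq (p q : Prog)
  | ite (e : Expr) (p q : Prog)
  | loop (e : Expr) (p : Prog)

/-- A configuration: the memory, the unread input, the unused random bits, the output so far. -/
structure Config where
  mem : ℤ → ℤ
  input : List Bool
  coins : List Bool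
  output : List Bool

/-- The value that `read` and `flip` deliver. -/
def nextBit : List Bool → ℤ
  | [] => 2
  | b :: _ => if b then 1 else 0

/-- `Exec p σ t τ`: started in `σ`, the program `p` halts in `τ` at total cost `t`. -/
inductive Exec : Prog → Config → ℕ → Config → Prop
  | skip (σ : Config) : Exec .skip σ 1 σ
  | assign (a e : Expr) (σ : Config) :
      Exec (.assign a e) σ (a.cost σ.mem + e.cost σ.mem + 1)
        { σ with mem := Function.update σ.mem (a.eval σ.mem) (e.eval σ.mem) }
  | read (a : Expr) (σ : Config) :
      Exec (.read a) σ (a.cost σ.mem + 1)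
        { σ with
          mem := Function.update σ.mem (a.eval σ.mem) (nextBit σ.input)
          input := σ.input.tail }
  | flip (a : Expr) (σ : Config) :
      Exec (.flip a) σ (a.cost σ.mem + 1)
        { σ with
          mem := Function.update σ.mem (a.eval σ.mem) (nextBit σ.coins)
          coins := σ.coins.tail }
  | emit (e : Expr) (σ : Config) :
      Exec (.emit e) σ (e.cost σ.mem + 1)
        { σ with output := σ.output ++ [decide (0 < e.eval σ.mem)] }
  | seq {p q : Prog} {σ τ υ : Config} {s t : ℕ} (hp : Exec p σ s τ) (hq : Exec q τ t υ) :
      Exec (.seq p q) σ (s + t) υ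
  | ite_true {e : Expr} {p q : Prog} {σ τ : Config} {t : ℕ} (he : 0 < e.eval σ.mem)
      (hp : Exec p σ t τ) : Exec (.ite e p q) σ (e.cost σ.mem + 1 + t) τ
  | ite_false {e : Expr} {p q : Prog} {σ τ : Config} {t : ℕ} (he : ¬ 0 < e.eval σ.mem)
      (hq : Exec q σ t τ) : Exec (.ite e p q) σ (e.cost σ.mem + 1 + t) τ
  | loop_done {e : Expr} {p : Prog} {σ : Config} (he : ¬ 0 < e.eval σ.mem) :
      Exec (.loop e p) σ (e.cost σ.mem + 1) σ
  | loop_step {e : Expr} {p : Prog} {σ τ υ : Config} {s t : ℕ} (he : 0 < e.eval σ.mem)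
      (hp : Exec p σ s τ) (hl : Exec (.loop e p) τ t υ) :
      Exec (.loop e p) σ (e.cost σ.mem + 1 + s + t) υ

/-- The initial configuration on input `x` with random string `ω`. -/
def Config.init (x ω : List Bool) : Config where
  mem := fun _ => 0
  input := x
  coins := ω
  output := []

/-! ### Quantum circuits -/

/-- The gates on `N` qubits; the qubits that a gate acts on are distinct. -/
inductive Gate (N : ℕ)
  | X (q : Fin N)
  | H (q : Fin N)
  | T (q : Fin N)
  | CNOT (c t : Fin N) (h : c ≠ t)
  | Toffoli (c d t : Fin N) (hcd : c ≠ d) (hct : c ≠ t) (hdt : d ≠ t)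

/-- Computational basis states of `N` qubits. -/
abbrev Basis (N : ℕ) : Type := Fin N → Bool

/-- Operators on `N` qubits, as matrices in the computational basis. -/
abbrev Op (N : ℕ) : Type := Matrix (Basis N) (Basis N) ℂ

/-- The operator that maps the basis state `j` to the basis state `f j`. -/
def permOp {N : ℕ} (f : Basis N → Basis N) : Op N :=
  Matrix.of fun i j => if i = f j then 1 else 0

/-- The unitary operator of a gate on the whole register. -/
def Gate.op {N : ℕ} : Gate N → Op N
  | .X q => permOp fun j => Function.update j q (!j q)
  | .H q => Matrix.of fun i j =>
      if ∀ k, k ≠ q → i k = j k then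
        (if i q && j q then -1 else 1) / ((Real.sqrt 2 : ℝ) : ℂ)
      else 0
  | .T q => Matrix.diagonal fun j =>
      if j q then Complex.exp (Complex.I * (Real.pi / 4 : ℝ)) else 1
  | .CNOT c t _ => permOp fun j => Function.update j t (xor (j t) (j c))
  | .Toffoli c d t _ _ _ => permOp fun j => Function.update j t (xor (j t) (j c && j d))

def Gate.encode {N : ℕ} : Gate N → List Bool
  | .X q => [false, false, false] ++ encUnary q
  | .H q => [false, false, true] ++ encUnary q
  | .T q => [false, true, false] ++ encUnary q
  | .CNOT c t _ => [false, true, true] ++ encUnary c ++ encUnary t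
  | .Toffoli c d t _ _ _ => [true, false, false] ++ encUnary c ++ encUnary d ++ encUnary t

/-- A quantum circuit on an input register of `k` qubits. It adds `anc` ancilla qubits in state
`|0⟩` (they come after the input qubits), applies the gates from the head of the list to its end,
and its output is the qubit `out`. -/
structure Circuit (k : ℕ) where
  anc : ℕ
  gates : List (Gate (k + anc))
  out : Fin (k + anc)

/-- The product of the gates, the first gate of the list being applied first. -/
def gatesOp {N : ℕ} : List (Gate N) → Op N
  | [] => 1
  | g :: gs => gatesOp gs * g.op

/-- `ρ ⊗ |0…0⟩⟨0…0|` with `a` ancilla qubits. -/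
def withAncilla {k : ℕ} (a : ℕ) (ρ : Op k) : Op (k + a) :=
  Matrix.of fun i j =>
    if ∀ q : Fin a, i (Fin.natAdd k q) = false ∧ j (Fin.natAdd k q) = false then
      ρ (fun q => i (Fin.castAdd a q)) (fun q => j (Fin.castAdd a q))
    else 0

/-- The projection on the space where the qubit `q` is `|1⟩`. -/
def projOne {N : ℕ} (q : Fin N) : Op N :=
  Matrix.diagonal fun j => if j q then 1 else 0

/-- The probability `tr (Π V ρ V†)` of measuring `1` on the output qubit. -/
def Circuit.accept {k : ℕ} (V : Circuit k) (ρ : Op k) : ℝ :=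
  (Matrix.trace (projOne V.out *
    (gatesOp V.gates * withAncilla V.anc ρ * (gatesOp V.gates)ᴴ))).re

def Circuit.encode {k : ℕ} (V : Circuit k) : List Bool :=
  encUnary V.anc ++ V.gates.flatMap (fun g => true :: g.encode) ++ [false] ++ encUnary V.out

/-- Density matrices. -/
def IsDensity {k : ℕ} (ρ : Op k) : Prop := ρ.PosSemidef ∧ ρ.trace = 1

/-! ### The class QMA+ -/

/-- A promise problem over bit strings. -/
structure PromiseProblem where
  yes : Set (List Bool)
  no : Set (List Bool)

/-- What a super-verifier outputs: a circuit `V` on `k` qubits and two fractions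
`r = rNum / rDen` and `s = sNum / sDen` in `[0,1]`. -/
structure Triple (k : ℕ) where
  V : Circuit k
  rNum : ℕ
  rDen : ℕ
  sNum : ℕ
  sDen : ℕ
  rDen_pos : 0 < rDen
  sDen_pos : 0 < sDen
  r_le : rNum ≤ rDen
  s_le : sNum ≤ sDen

def Triple.r {k : ℕ} (o : Triple k) : ℝ := (o.rNum : ℝ) / (o.rDen : ℝ)

def Triple.s {k : ℕ} (o : Triple k) : ℝ := (o.sNum : ℝ) / (o.sDen : ℝ)

def Triple.encode {k : ℕ} (o : Triple k) : List Bool :=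
  o.V.encode ++ encNat o.rNum ++ encNat o.rDen ++ encNat o.sNum ++ encNat o.sDen

/-- A super-verifier for witnesses of `p₁(|x|)` qubits: a classical program that, on every input
`x` and every string of `coinLen(|x|)` random bits, halts at cost at most `time(|x|)` and outputs
the description of a triple `(V, r, s)`. -/
structure SuperVerifier (p₁ : ℕ[X]) where
  prog : Prog
  coinLen : ℕ[X]
  time : ℕ[X]
  triple : (x : List Bool) → (Fin (coinLen.eval x.length) → Bool) → Triple (p₁.eval x.length)
  runs : ∀ (x : List Bool) (ω : Fin (coinLen.eval x.length) → Bool),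
    ∃ (t : ℕ) (τ : Config), t ≤ time.eval x.length ∧
      Exec prog (Config.init x (List.ofFn ω)) t τ ∧ τ.output = (triple x ω).encode

/-- The probability, over the random bits of the super-verifier on input `x`, that its output
satisfies `P`. -/
def SuperVerifier.prob {p₁ : ℕ[X]} (S : SuperVerifier p₁) (x : List Bool)
    (P : Triple (p₁.eval x.length) → Prop) : ℝ :=
  ({ω : Fin (S.coinLen.eval x.length) → Bool | P (S.triple x ω)}.ncard : ℝ) /
    2 ^ (S.coinLen.eval x.length)

/-- Membership of a promise problem in QMA+. The error terms `p₂(1/|x|)` and `p₃(1/|x|)` are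
polynomials in `1/|x|` with positive values, that is, inverse polynomial quantities. -/
def MemQMAPlus (A : PromiseProblem) : Prop :=
  ∃ (p₁ : ℕ[X]) (p₂ p₃ : ℝ[X]) (S : SuperVerifier p₁),
    (∀ N : ℕ, 0 < N → 0 < p₂.eval (1 / (N : ℝ)) ∧ 0 < p₃.eval (1 / (N : ℝ))) ∧
    (∀ x ∈ A.yes, ∃ ρ : Op (p₁.eval x.length), IsDensity ρ ∧
      S.prob x (fun o => |o.V.accept ρ - o.r| ≤ o.s) = 1) ∧
    (∀ x ∈ A.no, ∀ ρ : Op (p₁.eval x.length), IsDensity ρ →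
      S.prob x (fun o => |o.V.accept ρ - o.r| ≤ o.s + p₃.eval (1 / (x.length : ℝ))) ≤
        1 - p₂.eval (1 / (x.length : ℝ)))

/-! ### The lattice problem -/

/-- Rational input data in dimension `n`, written over a common denominator `den`:
the vectors `v₁, …, vₙ` and the target `v` have the numerators `basis 1, …, basis n`
and `target`. -/
structure Instance where
  n : ℕ
  den : ℕ
  den_pos : 0 < den
  basis : Fin n → Fin n → ℤ
  target : Fin n → ℤ

/-- The vector with the given numerators. -/
def Instance.vec (I : Instance) (z : Fin I.n → ℤ) : EuclideanSpace ℝ (Fin I.n) :=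
  WithLp.toLp 2 fun j => (z j : ℝ) / (I.den : ℝ)

/-- The vectors `v₁, …, vₙ` form a basis. -/
def Instance.IsBasis (I : Instance) : Prop :=
  LinearIndependent ℝ fun i => I.vec (I.basis i)

/-- The lattice `L` of all integer combinations of `v₁, …, vₙ`. -/
def Instance.lattice (I : Instance) : Submodule ℤ (EuclideanSpace ℝ (Fin I.n)) :=
  Submodule.span ℤ (Set.range fun i => I.vec (I.basis i))

/-- The distance `d(v, L)`. -/
def Instance.dist (I : Instance) : ℝ :=
  Metric.infDist (I.vec I.target) (I.lattice : Set (EuclideanSpace ℝ (Fin I.n)))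

def Instance.encode (I : Instance) : List Bool :=
  encUnary I.n ++ encNat I.den ++
    (List.ofFn fun i => (List.ofFn fun j => encInt (I.basis i j)).flatten).flatten ++
    (List.ofFn fun j => encInt (I.target j)).flatten

/-- The promise problem coGapCVP′ with gap `β`. -/
def coGapCVP' (β : ℕ → ℝ) : PromiseProblem where
  yes := {x | ∃ I : Instance, x = I.encode ∧ I.IsBasis ∧ β I.n < I.dist ∧
    ∀ u ∈ I.lattice, u ≠ 0 → β I.n ≤ ‖u‖}
  no := {x | ∃ I : Instance, x = I.encode ∧ I.IsBasis ∧ I.dist ≤ 1}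

end QMAPlus

end

noncomputable section
namespace QMAPlus
open scoped Matrix Polynomial ComplexOrder

/-! Every circuit used here applies Hadamard gates to fresh ancillas and then permutes basis states,
so it sees only the diagonal of the density matrix (`accept_eq`). A witness is therefore a
probability distribution on bit strings, which are read as vectors u in ℝⁿ with coordinates of size
at most m², where m = |x| + 100. Since a test compares an acceptance probability with a prescribed
number, instead of asking for it to be large, the super-verifier can prescribe moments of u. Write
tri t for twice the distance of t to the nearest integer. The tests demand that E tri(2^l ⟨u, v_j⟩)
is almost 0 for every basis vector v_j and all l < m³, that the covariances E u_i u_j are tiny for i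
≠ j and the E u_i² are small, and that E tri⟨u, v⟩ is at least 0.3 for the target v. Thus u should
behave like a short random vector of the dual lattice whose inner product with v is spread out
modulo 1.

Soundness (`Instance.not_sound`, `soundness`). If v = y + e with y in L and e short, then tri⟨u, v⟩
≤ tri⟨u, y⟩ + 2|⟨u, e⟩|. The coefficients of y in the basis are at most exponential in m² by
Cramer's rule (`Instance.exists_close`), and the tests with powers of two control tri of such huge
multiples (`tri_intCast_mul_le_sum`); so the first term is small on average. The covariance tests
bound E⟨u, e⟩². Together E tri⟨u, v⟩ ≤ 0.11, which contradicts the target test.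

Completeness (`exists_random_angles`, `Instance.exists_random_dual`). Refine the grid to ℤⁿ / (M
den), so that L becomes a subgroup Λ of ℤⁿ of finite index. Characters of ℤⁿ/Λ are dual lattice
vectors modulo the dual of the grid. Choose a character with probability proportional to the squared
modulus of the Fourier transform of a product of bump functions on a box of radius 1000 in the
original scale. The expectation of a cosine is then an autocorrelation of the bump, periodized over
Λ. As non-zero lattice vectors are longer than the differences of points of the box, there is no
overlap, and second, fourth and mixed moments are those of the one-dimensional bump. As v is farther
from L than such differences, E cos(2π⟨u, v⟩) = 0, whence E tri⟨u, v⟩ ≥ 1/π > 0.31. The factor √n of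
the gap is the ratio between the Euclidean and the maximum norm on the box. Truncating u to |u_i| <
m² and rounding it to m⁴ binary digits costs little (`Instance.exists_random_encoding`).

The circuit. A number modulo a power of two Q ≥ m¹⁶ is stored in one-hot code, and each witness bit
conditionally shifts it into the next block of wires. Adding a uniform number below Q/2 and asking
whether the result is at least Q/2 yields a bit that is one with probability tri(A/Q), A being the
value of the linear form (`card_tri`). Two such chains are combined by XOR, which has probability p
+ q - 2pq; with p = 1/2 + a/2 and q = 1/2 + b/2 this is (1 - ab)/2 and gives access to products of
coordinates (`TestData.acc_cov`).

The machine. A program on bounded memory prints the circuit for every input and every coin string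
(`superProg_runs`). The coins modulo 2 m⁶ select the test, and every test has probability at least
1/(4 m⁶), so a success probability above 1 - 1/m⁸ forces all tests to pass (`exists_coins`). -/

/-! ### Bounds on the cost of expressions -/

/-- Every memory cell holds a number of at most `W` bits. -/
def Bounded (W : ℕ) (M : ℤ → ℤ) : Prop := ∀ a, bitLen (M a) ≤ W

theorem bitLen_le_iff {z : ℤ} {W : ℕ} : bitLen z ≤ W ↔ z.natAbs < 2 ^ W := Nat.size_le

theorem bitLen_add_le (a b : ℤ) : bitLen (a + b) ≤ bitLen a + bitLen b + 1 := by
  rw [bitLen_le_iff]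
  have ha : a.natAbs < 2 ^ bitLen a := Nat.lt_size_self _
  have hb : b.natAbs < 2 ^ bitLen b := Nat.lt_size_self _
  have h1 : 2 ^ bitLen a ≤ 2 ^ (bitLen a + bitLen b) := Nat.pow_le_pow_right (by norm_num) (by omega)
  have h2 : 2 ^ bitLen b ≤ 2 ^ (bitLen a + bitLen b) := Nat.pow_le_pow_right (by norm_num) (by omega)
  have := Int.natAbs_add_le a b
  rw [pow_succ]
  omega

theorem bitLen_neg (a : ℤ) : bitLen (-a) = bitLen a := by simp [bitLen]

theorem bitLen_sub_le (a b : ℤ) : bitLen (a - b) ≤ bitLen a + bitLen b + 1 := by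
  rw [sub_eq_add_neg, ← bitLen_neg b]
  exact bitLen_add_le a (-b)

theorem bitLen_mul_le (a b : ℤ) : bitLen (a * b) ≤ bitLen a + bitLen b := by
  rw [bitLen_le_iff, Int.natAbs_mul, pow_add]
  exact Nat.mul_lt_mul'' (Nat.lt_size_self _) (Nat.lt_size_self _)

theorem bitLen_ediv_le (a b : ℤ) : bitLen (a / b) ≤ bitLen a := by
  rw [bitLen_le_iff]
  refine lt_of_le_of_lt ?_ (Nat.lt_size_self _)
  have := Int.abs_ediv_le_abs a b
  rw [Int.abs_eq_natAbs, Int.abs_eq_natAbs] at this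
  exact_mod_cast this

/-- The size of an expression, constants being counted by their digits. -/
def Expr.size : Expr → ℕ
  | .const c => 1 + bitLen c
  | .mem e => e.size + 1
  | .add e f => e.size + f.size + 1
  | .sub e f => e.size + f.size + 1
  | .mul e f => e.size + f.size + 1
  | .div e f => e.size + f.size + 1

/-- An operation yields at most one bit more than its operands have together, and a memory access
yields at most `W` bits; so each unit of size pays for `W + 1` bits. -/
theorem Expr.bitLen_eval_le {W : ℕ} {M : ℤ → ℤ} (hM : Bounded W M) (e : Expr) :
    bitLen (e.eval M) ≤ e.size * (W + 1) := by
  induction e with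
  | const c => simp only [Expr.eval, Expr.size]; nlinarith
  | mem e ih => simp only [Expr.eval, Expr.size]; have := hM (e.eval M); nlinarith
  | add e f he hf =>
    simp only [Expr.eval, Expr.size]; have := bitLen_add_le (e.eval M) (f.eval M); nlinarith
  | sub e f he hf =>
    simp only [Expr.eval, Expr.size]; have := bitLen_sub_le (e.eval M) (f.eval M); nlinarith
  | mul e f he hf =>
    simp only [Expr.eval, Expr.size]; have := bitLen_mul_le (e.eval M) (f.eval M); nlinarith
  | div e f he hf =>
    simp only [Expr.eval, Expr.size]; have := bitLen_ediv_le (e.eval M) (f.eval M); nlinarith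

/-- One factor `size` counts the operations, the other bounds the length of each result; the unit
charged per operation turns `W + 1` into `W + 2`. -/
theorem Expr.cost_le {W : ℕ} {M : ℤ → ℤ} (hM : Bounded W M) (e : Expr) :
    e.cost M ≤ e.size ^ 2 * (W + 2) := by
  induction e with
  | const c => simp only [Expr.cost, Expr.size]; nlinarith
  | mem e ih =>
    have := (Expr.mem e).bitLen_eval_le hM
    simp only [Expr.cost, Expr.size] at *; nlinarith
  | add e f he hf =>
    have := (Expr.add e f).bitLen_eval_le hM
    simp only [Expr.cost, Expr.size] at *; nlinarith [Nat.zero_le (e.size * f.size * (W + 2))]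
  | sub e f he hf =>
    have := (Expr.sub e f).bitLen_eval_le hM
    simp only [Expr.cost, Expr.size] at *; nlinarith [Nat.zero_le (e.size * f.size * (W + 2))]
  | mul e f he hf =>
    have := (Expr.mul e f).bitLen_eval_le hM
    simp only [Expr.cost, Expr.size] at *; nlinarith [Nat.zero_le (e.size * f.size * (W + 2))]
  | div e f he hf =>
    have := (Expr.div e f).bitLen_eval_le hM
    simp only [Expr.cost, Expr.size] at *; nlinarith [Nat.zero_le (e.size * f.size * (W + 2))]

/-- An upper bound for the cost of an elementary step with expressions of size at most `300` in a
memory of `W`-bit numbers. -/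
def stepCost (W : ℕ) : ℕ := 100000 * (W + 2)

/-- Size 300 gives cost at most `90000 * (W + 2)`. The rest of `stepCost` leaves room for the
evaluation of the address and for the statement itself. -/
theorem Expr.cost_add_le {W : ℕ} {M : ℤ → ℤ} (hM : Bounded W M) {e : Expr} (he : e.size ≤ 300) :
    e.cost M + 9000 ≤ stepCost W := by
  have h := e.cost_le hM
  have h2 : e.size ^ 2 ≤ 90000 := by nlinarith
  unfold stepCost
  nlinarith

/-! ### Runs: executions in bounded memory with a bound on the number of steps -/

/-- If the memory of `σ` is bounded, then `p` leads from `σ` to `τ` in `k` elementary steps, and the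
memory of `τ` is bounded. -/
def Run (W : ℕ) (p : Prog) (σ : Config) (k : ℕ) (τ : Config) : Prop :=
  Bounded W σ.mem → Bounded W τ.mem ∧ ∃ t ≤ k * stepCost W, Exec p σ t τ

theorem Run.mono {W : ℕ} {p : Prog} {σ τ : Config} {k l : ℕ} (h : Run W p σ k τ) (hkl : k ≤ l) :
    Run W p σ l τ := fun hσ => by
  obtain ⟨h1, t, ht, h2⟩ := h hσ
  exact ⟨h1, t, ht.trans (Nat.mul_le_mul_right _ hkl), h2⟩

theorem Bounded.update {W : ℕ} {M : ℤ → ℤ} (hM : Bounded W M) {z : ℤ} (a : ℤ) (hz : bitLen z ≤ W) :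
    Bounded W (Function.update M a z) := fun b => by
  rw [Function.update_apply]
  split_ifs
  · exact hz
  · exact hM b

theorem Run.assign {W : ℕ} {a : ℤ} {e : Expr} {σ : Config} (ha : bitLen a ≤ 100)
    (he : e.size ≤ 300) (hv : (e.eval σ.mem).natAbs < 2 ^ W) :
    Run W (.assign (.const a) e) σ 1
      { σ with mem := Function.update σ.mem a (e.eval σ.mem) } := fun hσ => by
  refine ⟨hσ.update _ (bitLen_le_iff.2 hv), _, ?_, Exec.assign _ _ _⟩
  have := Expr.cost_add_le hσ he
  simp only [Expr.cost]
  omega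

theorem nextBit_bitLen_le (l : List Bool) : bitLen (nextBit l) ≤ 2 := by
  rw [bitLen_le_iff]
  rcases l with _ | ⟨_ | _, _⟩ <;> simp [nextBit]

theorem Run.read {W : ℕ} {a : ℤ} {σ : Config} (ha : bitLen a ≤ 100) (hW : 2 ≤ W) :
    Run W (.read (.const a)) σ 1
      { σ with
        mem := Function.update σ.mem a (nextBit σ.input)
        input := σ.input.tail } := fun hσ => by
  refine ⟨hσ.update _ ((nextBit_bitLen_le _).trans hW), _, ?_, Exec.read _ _⟩
  simp only [Expr.cost, stepCost]
  omega

theorem Run.flip {W : ℕ} {a : ℤ} {σ : Config} (ha : bitLen a ≤ 100) (hW : 2 ≤ W) :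
    Run W (.flip (.const a)) σ 1
      { σ with
        mem := Function.update σ.mem a (nextBit σ.coins)
        coins := σ.coins.tail } := fun hσ => by
  refine ⟨hσ.update _ ((nextBit_bitLen_le _).trans hW), _, ?_, Exec.flip _ _⟩
  simp only [Expr.cost, stepCost]
  omega

theorem Run.emit {W : ℕ} {e : Expr} {σ : Config} (he : e.size ≤ 300) :
    Run W (.emit e) σ 1 { σ with output := σ.output ++ [decide (0 < e.eval σ.mem)] } := fun hσ => by
  refine ⟨hσ, _, ?_, Exec.emit _ _⟩
  have := Expr.cost_add_le hσ he
  omega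

theorem Run.seq {W : ℕ} {p q : Prog} {σ τ υ : Config} {k l : ℕ} (hp : Run W p σ k τ)
    (hq : Run W q τ l υ) : Run W (.seq p q) σ (k + l) υ := fun hσ => by
  obtain ⟨h1, s, hs, h2⟩ := hp hσ
  obtain ⟨h3, t, ht, h4⟩ := hq h1
  refine ⟨h3, s + t, ?_, Exec.seq h2 h4⟩
  rw [add_mul]
  omega

theorem Run.loop_done {W : ℕ} {e : Expr} {p : Prog} {σ : Config} (hs : e.size ≤ 300)
    (he : ¬ 0 < e.eval σ.mem) : Run W (.loop e p) σ 1 σ := fun hσ => by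
  refine ⟨hσ, _, ?_, Exec.loop_done he⟩
  have := Expr.cost_add_le hσ hs
  omega

theorem Run.loop_step {W : ℕ} {e : Expr} {p : Prog} {σ τ υ : Config} {k l : ℕ} (hs : e.size ≤ 300)
    (he : 0 < e.eval σ.mem) (hp : Run W p σ k τ) (hl : Run W (.loop e p) τ l υ) :
    Run W (.loop e p) σ (1 + k + l) υ := fun hσ => by
  obtain ⟨h1, s, hs', h2⟩ := hp hσ
  obtain ⟨h3, t, ht, h4⟩ := hl h1
  refine ⟨h3, _, ?_, Exec.loop_step he h2 h4⟩
  have := Expr.cost_add_le hσ hs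
  rw [add_mul, add_mul]
  omega

/-- A loop whose body leads from `S j` to `S (j + 1)` for `j < N`. -/
theorem Run.loop_iterate {W : ℕ} {e : Expr} {p : Prog} (S : ℕ → Config) (N k : ℕ)
    (hs : e.size ≤ 300) (hpos : ∀ j < N, 0 < e.eval (S j).mem) (hend : ¬ 0 < e.eval (S N).mem)
    (hp : ∀ j < N, Run W p (S j) k (S (j + 1))) :
    Run W (.loop e p) (S 0) (N * (k + 1) + 1) (S N) := by
  -- Induction on the number of remaining iterations, since the rule for loops peels off the first
  -- one.
  suffices h : ∀ d ≤ N, Run W (.loop e p) (S (N - d)) (d * (k + 1) + 1) (S N) by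
    simpa using h N le_rfl
  intro d
  induction d with
  | zero => intro _; simpa using Run.loop_done hs hend
  | succ d ih =>
    intro hd
    have h := Run.loop_step hs (hpos (N - (d + 1)) (by omega)) (hp (N - (d + 1)) (by omega))
      (by rw [show N - (d + 1) + 1 = N - d by omega]; exact ih (by omega))
    exact h.mono (by ring_nf; omega)

/-! ### Programs with finitely many variables -/

/-- The variables of the program of the super-verifier. -/
structure Vars where
  x : ℤ
  b : ℤ
  p : ℤ
  m : ℤ
  nc : ℤ
  n : ℤ
  den : ℤ
  q : ℤ
  k : ℤ
  d₁ : ℤ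
  d₂ : ℤ
  kd : ℤ
  pw : ℤ
  a : ℤ
  s : ℤ
  cur : ℤ
  i : ℤ
  j : ℤ
  t : ℤ
  u : ℤ
  num : ℤ
  dd : ℤ
  c : ℤ
  w : ℤ
  kk : ℤ

/-- The memory that holds the variables in the cells `0, …, 24`. -/
def Vars.mem (v : Vars) : ℤ → ℤ
  | 0 => v.x
  | 1 => v.b
  | 2 => v.p
  | 3 => v.m
  | 4 => v.nc
  | 5 => v.n
  | 6 => v.den
  | 7 => v.q
  | 8 => v.k
  | 9 => v.d₁
  | 10 => v.d₂
  | 11 => v.kd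
  | 12 => v.pw
  | 13 => v.a
  | 14 => v.s
  | 15 => v.cur
  | 16 => v.i
  | 17 => v.j
  | 18 => v.t
  | 19 => v.u
  | 20 => v.num
  | 21 => v.dd
  | 22 => v.c
  | 23 => v.w
  | 24 => v.kk
  | _ => 0

/-- The variable in cell `a`, as an expression. -/
abbrev cell (a : ℤ) : Expr := .mem (.const a)

/-- The memory is treated as a record of named variables: writing a cell becomes the update of a
field, so that states can be written as `{ v with … }` and most values agree by `rfl`. -/
theorem Vars.update_eq {v v' : Vars} {a z : ℤ} (ha : v'.mem a = z)
    (h : ∀ b, b ≠ a → v.mem b = v'.mem b) : Function.update v.mem a z = v'.mem := by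
  funext b
  rw [Function.update_apply]
  split_ifs with hb
  · rw [hb, ha]
  · exact h b hb

theorem Vars.update_x (v : Vars) (z : ℤ) :
    Function.update v.mem 0 z = ({ v with x := z } : Vars).mem :=
  Vars.update_eq rfl fun b hb => by unfold Vars.mem; split <;> first | rfl | exact absurd rfl hb

theorem Vars.update_b (v : Vars) (z : ℤ) :
    Function.update v.mem 1 z = ({ v with b := z } : Vars).mem :=
  Vars.update_eq rfl fun b hb => by unfold Vars.mem; split <;> first | rfl | exact absurd rfl hb

theorem Vars.update_p (v : Vars) (z : ℤ) :
    Function.update v.mem 2 z = ({ v with p := z } : Vars).mem :=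
  Vars.update_eq rfl fun b hb => by unfold Vars.mem; split <;> first | rfl | exact absurd rfl hb

theorem Vars.update_m (v : Vars) (z : ℤ) :
    Function.update v.mem 3 z = ({ v with m := z } : Vars).mem :=
  Vars.update_eq rfl fun b hb => by unfold Vars.mem; split <;> first | rfl | exact absurd rfl hb

theorem Vars.update_nc (v : Vars) (z : ℤ) :
    Function.update v.mem 4 z = ({ v with nc := z } : Vars).mem :=
  Vars.update_eq rfl fun b hb => by unfold Vars.mem; split <;> first | rfl | exact absurd rfl hb

theorem Vars.update_n (v : Vars) (z : ℤ) :
    Function.update v.mem 5 z = ({ v with n := z } : Vars).mem :=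
  Vars.update_eq rfl fun b hb => by unfold Vars.mem; split <;> first | rfl | exact absurd rfl hb

theorem Vars.update_den (v : Vars) (z : ℤ) :
    Function.update v.mem 6 z = ({ v with den := z } : Vars).mem :=
  Vars.update_eq rfl fun b hb => by unfold Vars.mem; split <;> first | rfl | exact absurd rfl hb

theorem Vars.update_q (v : Vars) (z : ℤ) :
    Function.update v.mem 7 z = ({ v with q := z } : Vars).mem :=
  Vars.update_eq rfl fun b hb => by unfold Vars.mem; split <;> first | rfl | exact absurd rfl hb

theorem Vars.update_k (v : Vars) (z : ℤ) :
    Function.update v.mem 8 z = ({ v with k := z } : Vars).mem :=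
  Vars.update_eq rfl fun b hb => by unfold Vars.mem; split <;> first | rfl | exact absurd rfl hb

theorem Vars.update_d₁ (v : Vars) (z : ℤ) :
    Function.update v.mem 9 z = ({ v with d₁ := z } : Vars).mem :=
  Vars.update_eq rfl fun b hb => by unfold Vars.mem; split <;> first | rfl | exact absurd rfl hb

theorem Vars.update_d₂ (v : Vars) (z : ℤ) :
    Function.update v.mem 10 z = ({ v with d₂ := z } : Vars).mem :=
  Vars.update_eq rfl fun b hb => by unfold Vars.mem; split <;> first | rfl | exact absurd rfl hb

theorem Vars.update_kd (v : Vars) (z : ℤ) :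
    Function.update v.mem 11 z = ({ v with kd := z } : Vars).mem :=
  Vars.update_eq rfl fun b hb => by unfold Vars.mem; split <;> first | rfl | exact absurd rfl hb

theorem Vars.update_pw (v : Vars) (z : ℤ) :
    Function.update v.mem 12 z = ({ v with pw := z } : Vars).mem :=
  Vars.update_eq rfl fun b hb => by unfold Vars.mem; split <;> first | rfl | exact absurd rfl hb

theorem Vars.update_a (v : Vars) (z : ℤ) :
    Function.update v.mem 13 z = ({ v with a := z } : Vars).mem :=
  Vars.update_eq rfl fun b hb => by unfold Vars.mem; split <;> first | rfl | exact absurd rfl hb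

theorem Vars.update_s (v : Vars) (z : ℤ) :
    Function.update v.mem 14 z = ({ v with s := z } : Vars).mem :=
  Vars.update_eq rfl fun b hb => by unfold Vars.mem; split <;> first | rfl | exact absurd rfl hb

theorem Vars.update_cur (v : Vars) (z : ℤ) :
    Function.update v.mem 15 z = ({ v with cur := z } : Vars).mem :=
  Vars.update_eq rfl fun b hb => by unfold Vars.mem; split <;> first | rfl | exact absurd rfl hb

theorem Vars.update_i (v : Vars) (z : ℤ) :
    Function.update v.mem 16 z = ({ v with i := z } : Vars).mem :=
  Vars.update_eq rfl fun b hb => by unfold Vars.mem; split <;> first | rfl | exact absurd rfl hb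

theorem Vars.update_j (v : Vars) (z : ℤ) :
    Function.update v.mem 17 z = ({ v with j := z } : Vars).mem :=
  Vars.update_eq rfl fun b hb => by unfold Vars.mem; split <;> first | rfl | exact absurd rfl hb

theorem Vars.update_t (v : Vars) (z : ℤ) :
    Function.update v.mem 18 z = ({ v with t := z } : Vars).mem :=
  Vars.update_eq rfl fun b hb => by unfold Vars.mem; split <;> first | rfl | exact absurd rfl hb

theorem Vars.update_u (v : Vars) (z : ℤ) :
    Function.update v.mem 19 z = ({ v with u := z } : Vars).mem :=
  Vars.update_eq rfl fun b hb => by unfold Vars.mem; split <;> first | rfl | exact absurd rfl hb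

theorem Vars.update_num (v : Vars) (z : ℤ) :
    Function.update v.mem 20 z = ({ v with num := z } : Vars).mem :=
  Vars.update_eq rfl fun b hb => by unfold Vars.mem; split <;> first | rfl | exact absurd rfl hb

theorem Vars.update_dd (v : Vars) (z : ℤ) :
    Function.update v.mem 21 z = ({ v with dd := z } : Vars).mem :=
  Vars.update_eq rfl fun b hb => by unfold Vars.mem; split <;> first | rfl | exact absurd rfl hb

theorem Vars.update_c (v : Vars) (z : ℤ) :
    Function.update v.mem 22 z = ({ v with c := z } : Vars).mem :=
  Vars.update_eq rfl fun b hb => by unfold Vars.mem; split <;> first | rfl | exact absurd rfl hb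

theorem Vars.update_w (v : Vars) (z : ℤ) :
    Function.update v.mem 23 z = ({ v with w := z } : Vars).mem :=
  Vars.update_eq rfl fun b hb => by unfold Vars.mem; split <;> first | rfl | exact absurd rfl hb

theorem Vars.update_kk (v : Vars) (z : ℤ) :
    Function.update v.mem 24 z = ({ v with kk := z } : Vars).mem :=
  Vars.update_eq rfl fun b hb => by unfold Vars.mem; split <;> first | rfl | exact absurd rfl hb

/-- The configuration with the given variables and output, the input and the coins being used up. -/
def cfg (v : Vars) (o : List Bool) : Config := ⟨v.mem, [], [], o⟩

theorem Run.set {W : ℕ} {a : ℤ} {e : Expr} {v v' : Vars} {o : List Bool} {z : ℤ}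
    (hf : Function.update v.mem a z = v'.mem) (hz : e.eval v.mem = z)
    (hv : z.natAbs < 2 ^ W) (ha : bitLen a ≤ 100) (he : e.size ≤ 300) :
    Run W (.assign (.const a) e) (cfg v o) 1 (cfg v' o) := by
  have h := Run.assign (W := W) (σ := cfg v o) ha he (by rw [← hz] at hv; exact hv)
  have h2 : e.eval (cfg v o).mem = z := hz
  rw [h2] at h
  simp only [cfg] at h ⊢
  rwa [hf] at h

theorem Run.out {W : ℕ} {e : Expr} {v : Vars} {o : List Bool} (b : Bool)
    (hb : (0 < e.eval v.mem) ↔ b = true) (he : e.size ≤ 300) :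
    Run W (.emit e) (cfg v o) 1 (cfg v (o ++ [b])) := by
  have h := Run.emit (W := W) (σ := cfg v o) he
  have h2 : decide (0 < e.eval (cfg v o).mem) = b := by
    have : (0 < e.eval (cfg v o).mem) ↔ b = true := hb
    simp [this]
  rw [h2] at h
  exact h

/-! ### Printing -/

infixr:60 ";;" => Prog.seq

/-- Emit a fixed bit string. -/
def emitBits : List Bool → Prog
  | [] => .skip
  | b :: l => .emit (.const (if b then 1 else 0)) ;; emitBits l

/-- Emit the unary code of the value of `e`. -/
def emitUnary (e : Expr) : Prog :=
  .assign (.const 19) e ;;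
  .loop (cell 19) (.emit (.const 1) ;; .assign (.const 19) (.sub (cell 19) (.const 1))) ;;
  .emit (.const 0)

/-- The remainder of `e` modulo `f`, as an expression. -/
abbrev modE (e f : Expr) : Expr := .sub e (.mul (.div e f) f)

/-- Emit the binary code of the value of `e`. -/
def emitNat (e : Expr) : Prog :=
  .assign (.const 19) e ;;
  .loop (cell 19) (.emit (.const 1) ;; .emit (modE (cell 19) (.const 2)) ;;
    .assign (.const 19) (.div (cell 19) (.const 2))) ;;
  .emit (.const 0)

theorem modE_eval (M : ℤ → ℤ) (e f : Expr) : (modE e f).eval M = e.eval M % f.eval M := by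
  simp only [Expr.eval]
  rw [Int.emod_def, mul_comm]

theorem Run.skip {W : ℕ} (σ : Config) : Run W .skip σ 1 σ := fun hσ =>
  ⟨hσ, 1, by simp only [stepCost]; omega, Exec.skip σ⟩

theorem Run.emitBits {W : ℕ} (v : Vars) (l o : List Bool) :
    Run W (emitBits l) (cfg v o) (l.length + 1) (cfg v (o ++ l)) := by
  induction l generalizing o with
  | nil => simpa [QMAPlus.emitBits] using Run.skip (W := W) (cfg v o)
  | cons b l ih =>
    have h1 : Run W (.emit (.const (if b then 1 else 0))) (cfg v o) 1 (cfg v (o ++ [b])) := by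
      refine Run.out b ?_ ?_
      · cases b <;> simp [Expr.eval]
      · cases b <;> decide
    have h := h1.seq (ih (o ++ [b]))
    rw [List.append_assoc, List.singleton_append] at h
    exact h.mono (by simp; omega)

/-- Cell 19 is a scratch counter that is zero before and after, so the variables come back unchanged
and printing steps can be chained freely. -/
theorem Run.emitUnary {W : ℕ} {v : Vars} {o : List Bool} {e : Expr} (k : ℕ) (hu : v.u = 0)
    (he : e.eval v.mem = k) (hk : k < 2 ^ W) (hs : e.size ≤ 300) :
    Run W (emitUnary e) (cfg v o) (3 * k + 3) (cfg v (o ++ encUnary k)) := by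
  have h1 : Run W (.assign (.const 19) e) (cfg v o) 1 (cfg { v with u := k } o) :=
    Run.set (v.update_u _) he (by simpa using hk) (by decide) hs
  let S : ℕ → Config := fun j => cfg { v with u := (k : ℤ) - j } (o ++ List.replicate j true)
  have h2 : Run W (.loop (cell 19)
      (.emit (.const 1) ;; .assign (.const 19) (.sub (cell 19) (.const 1)))) (S 0)
      (k * (2 + 1) + 1) (S k) := by
    refine Run.loop_iterate S k 2 (by decide) (fun j hj => ?_) ?_ (fun j hj => ?_)
    · change (0 : ℤ) < (k : ℤ) - j
      omega
    · change ¬ (0 : ℤ) < (k : ℤ) - k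
      omega
    · refine Run.seq (k := 1) (l := 1) (Run.out true (by simp [Expr.eval]) (by decide)) ?_
      simp only [S, List.append_assoc, ← List.replicate_succ']
      refine Run.set (Vars.update_u _ _) ?_ ?_ (by decide) (by decide)
      · change (k : ℤ) - j - 1 = _
        push_cast
        ring
      · push_cast
        omega
  have h3 : Run W (.emit (.const 0)) (S k) 1 (cfg v (o ++ encUnary k)) := by
    have : S k = cfg v (o ++ List.replicate k true) := by
      simp only [S, sub_self]
      rw [← hu]
    rw [this, encUnary, ← List.append_assoc]
    exact Run.out false (by simp [Expr.eval]) (by decide)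
  have h0 : S 0 = cfg { v with u := k } o := by simp [S]
  rw [h0] at h2
  exact (h1.seq (h2.seq h3)).mono (by omega)

theorem encNat_eq (k : ℕ) :
    encNat k = if k = 0 then [false] else [true, decide (k % 2 = 1)] ++ encNat (k / 2) := by
  split_ifs with h
  · simp [h, encNat]
  · obtain ⟨b, r, hk, hne⟩ : ∃ (b : Bool) (r : ℕ), k = Nat.bit b r ∧ (r = 0 → b = true) :=
      ⟨decide (k % 2 = 1), k / 2, by rw [Nat.bit_val]; rcases Nat.mod_two_eq_zero_or_one k with h | h <;>
        simp [h] <;> omega, fun h0 => by simp; omega⟩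
    have hd : k / 2 = r := by rw [hk, Nat.bit_div_two]
    have hm : decide (k % 2 = 1) = b := by rw [hk, Nat.bit_mod_two]; cases b <;> rfl
    rw [hd, hm]
    simp only [encNat]
    rw [hk, Nat.bits_append_bit _ _ hne]
    simp

theorem Run.emitNat_loop {W : ℕ} {v : Vars} (k : ℕ) (hk : k < 2 ^ W) (o : List Bool) :
    Run W (.loop (cell 19) (.emit (.const 1) ;; .emit (modE (cell 19) (.const 2)) ;;
    .assign (.const 19) (.div (cell 19) (.const 2))) ;; .emit (.const 0)) (cfg { v with u := k } o)
      (4 * k.size + 2) (cfg { v with u := 0 } (o ++ encNat k)) := by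
  induction k using Nat.strong_induction_on generalizing o with
  | _ k ih =>
    rcases Nat.eq_zero_or_pos k with h0 | hpos
    · subst h0
      have h := (Run.loop_done (W := W) (e := cell 19) (p := .emit (.const 1) ;; .emit (modE (cell 19) (.const 2)) ;;
        .assign (.const 19) (.div (cell 19) (.const 2))) (σ := cfg { v with u := 0 } o) (by decide)
        (lt_irrefl 0)).seq
        (Run.out (v := { v with u := 0 }) (o := o) (e := .const 0) false (by simp [Expr.eval]) (by decide))
      simpa [encNat] using h
    · intro hσ
      have hlt : k / 2 < k := Nat.div_lt_self hpos (by norm_num)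
      have hbody : Run W (.emit (.const 1) ;; .emit (modE (cell 19) (.const 2)) ;;
          .assign (.const 19) (.div (cell 19) (.const 2))) (cfg { v with u := k } o) 3
          (cfg { v with u := ((k / 2 : ℕ) : ℤ) } (o ++ [true] ++ [decide (k % 2 = 1)])) := by
        refine (Run.out true (by simp [Expr.eval]) (by decide)).seq (k := 1) (l := 2)
          ((Run.out (decide (k % 2 = 1)) ?_ (by decide)).seq (k := 1) (l := 1)
          (Run.set (Vars.update_u _ _) ?_ ?_ (by decide) (by decide)))
        · rw [modE_eval]
          change (0 : ℤ) < (k : ℤ) % 2 ↔ _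
          rw [decide_eq_true_iff]
          omega
        · change (k : ℤ) / 2 = _
          push_cast
          rfl
        · rw [Int.natAbs_natCast]
          omega
      obtain ⟨hb, s, hs, hex⟩ := hbody hσ
      obtain ⟨hb', s', hs', hex'⟩ := ih _ hlt (lt_trans hlt hk) _ hb
      -- The induction hypothesis concerns the loop together with the final `emit`; its execution is
      -- split so that one more round can be put in front of the loop.
      cases hex' with
      | seq hl he =>
        rename_i τ s1 s2
        have henc : o ++ encNat k = o ++ [true] ++ [decide (k % 2 = 1)] ++ encNat (k / 2) := by
          conv_lhs => rw [encNat_eq k, if_neg (by omega)]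
          simp
        rw [← henc] at he
        refine ⟨hb', _, ?_, Exec.seq (Exec.loop_step ?_ hex hl) he⟩
        · have hc := Expr.cost_add_le hσ (show (cell 19).size ≤ 300 by decide)
          have hsz : (k / 2).size + 1 = k.size := by
            conv_rhs => rw [← Nat.bit_bodd_div2 k]
            rw [Nat.size_bit (by rw [Nat.bit_bodd_div2]; omega), Nat.div2_val]
          have : (4 * k.size + 2) * stepCost W
              = (4 * (k / 2).size + 2) * stepCost W + 4 * stepCost W := by rw [← hsz]; ring
          omega
        · change (0 : ℤ) < (k : ℤ)
          exact_mod_cast hpos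

theorem Run.emitNat {W : ℕ} {v : Vars} {o : List Bool} {e : Expr} (k : ℕ) (hu : v.u = 0)
    (he : e.eval v.mem = k) (hk : k < 2 ^ W) (hs : e.size ≤ 300) :
    Run W (emitNat e) (cfg v o) (4 * W + 3) (cfg v (o ++ encNat k)) := by
  have h1 : Run W (.assign (.const 19) e) (cfg v o) 1 (cfg { v with u := k } o) :=
    Run.set (v.update_u _) he (by simpa using hk) (by decide) hs
  have h2 := h1.seq (Run.emitNat_loop (v := v) k hk o)
  have hv : ({ v with u := 0 } : Vars) = v := by rw [← hu]
  rw [hv] at h2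
  have := Nat.size_le.2 hk
  exact h2.mono (by omega)

/-! ### Reading numbers from a bit string that is stored as an integer -/

/-- The integer with the given binary digits, the least significant one first. -/
def val : List Bool → ℕ
  | [] => 0
  | b :: l => b.toNat + 2 * val l

theorem val_mod_two (l : List Bool) : val l % 2 = (l.headD false).toNat := by
  cases l with
  | nil => rfl
  | cons b l => cases b <;> simp [val]

theorem val_div_two (l : List Bool) : val l / 2 = val l.tail := by
  cases l with
  | nil => rfl
  | cons b l => cases b <;> simp [val] ; omega

theorem val_lt (l : List Bool) : val l < 2 ^ l.length := by
  induction l with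
  | nil => simp [val]
  | cons b l ih => simp only [val, List.length_cons, pow_succ]; have := b.toNat_lt; omega

/-- Read a number in self-delimiting binary code; the closing zero is not consumed. -/
def readNatL : List Bool → ℕ × List Bool
  | true :: b :: l => (b.toNat + 2 * (readNatL l).1, (readNatL l).2)
  | [true] => (0, [])
  | l => (0, l)

/-- Read a signed number. -/
def readIntL (l : List Bool) : ℤ × List Bool :=
  ((readNatL l.tail).1 * (1 - 2 * (l.headD false).toNat), (readNatL l.tail).2.tail)

/-- Read a number in unary code. -/
def readUnaryL : List Bool → ℕ × List Bool
  | true :: l => ((readUnaryL l).1 + 1, (readUnaryL l).2)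
  | l => (0, l.tail)

theorem readNatL_length (l : List Bool) : (readNatL l).2.length ≤ l.length := by
  fun_induction readNatL l <;> simp_all; omega

theorem readNatL_lt (l : List Bool) : (readNatL l).1 < 2 ^ l.length := by
  fun_induction readNatL l with
  | case1 b l ih => have := b.toNat_lt; simp only [List.length_cons, pow_succ]; omega
  | case2 => simp
  | case3 => simp

theorem readIntL_length (l : List Bool) : (readIntL l).2.length ≤ l.length := by
  have := readNatL_length l.tail
  simp only [readIntL, List.length_tail] at *
  omega

theorem readIntL_natAbs (l : List Bool) : (readIntL l).1.natAbs < 2 ^ l.length := by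
  have h1 := readNatL_lt l.tail
  have h2 : 2 ^ l.tail.length ≤ 2 ^ l.length := Nat.pow_le_pow_right (by norm_num) (by simp)
  have : (readIntL l).1.natAbs = (readNatL l.tail).1 := by
    simp only [readIntL, Int.natAbs_mul]
    cases l.headD false <;> simp
  omega

theorem readUnaryL_le (l : List Bool) : (readUnaryL l).1 + (readUnaryL l).2.length ≤ l.length := by
  fun_induction readUnaryL l <;> simp_all; omega

/-- Halving the variable `x` drops the first bit of the list. -/
theorem Run.half {W : ℕ} {v : Vars} {o : List Bool} (l : List Bool) (hx : v.x = val l)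
    (hl : l.length ≤ W) :
    Run W (.assign (.const 0) (.div (cell 0) (.const 2))) (cfg v o) 1
      (cfg { v with x := val l.tail } o) := by
  refine Run.set (Vars.update_x _ _) ?_ ?_ (by decide) (by decide)
  · change v.x / 2 = _
    rw [hx, ← val_div_two]
    push_cast
    rfl
  · have h1 := val_lt l.tail
    have h2 : 2 ^ l.tail.length ≤ 2 ^ W :=
      Nat.pow_le_pow_right (by norm_num) (le_trans (by simp) hl)
    rw [Int.natAbs_natCast]
    omega

theorem eval_headBit {v : Vars} {l : List Bool} (hx : v.x = val l) :
    (modE (cell 0) (.const 2)).eval v.mem = (l.headD false).toNat := by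
  rw [modE_eval]
  change v.x % 2 = _
  rw [hx, ← val_mod_two]
  push_cast
  rfl

theorem headBit_pos_iff {v : Vars} {o : List Bool} {l : List Bool} (hx : v.x = val l) :
    0 < (modE (cell 0) (.const 2)).eval (cfg v o).mem ↔ l.headD false = true := by
  have h : (modE (cell 0) (.const 2)).eval (cfg v o).mem = _ := eval_headBit hx
  rw [h]
  cases l.headD false <;> simp

/-- The body of the loop of `readNat`. -/
def readNatBody : Prog :=
  .assign (.const 0) (.div (cell 0) (.const 2)) ;;
  .assign (.const 13) (.add (cell 13) (.mul (cell 2) (modE (cell 0) (.const 2)))) ;;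
  .assign (.const 0) (.div (cell 0) (.const 2)) ;;
  .assign (.const 2) (.mul (.const 2) (cell 2))

/-- `P` is the weight of the next digit. As `A < P`, the new accumulator is below the next weight `2
* P`, so one bound on the weight controls both variables. -/
theorem Run.readNatBody {W : ℕ} (l : List Bool) (v : Vars) (o : List Bool) (A P : ℕ)
    (hAP : A < P) (hP : 2 * P < 2 ^ W) (hl : l.length ≤ W) :
    Run W readNatBody (cfg { v with x := val l, a := A, p := P } o) 4
      (cfg { v with x := val l.tail.tail, a := (A + P * (l.tail.headD false).toNat : ℕ), p := (2 * P : ℕ) } o) := by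
  refine (Run.half l rfl hl).seq (k := 1) (l := 3) (Run.seq (k := 1) (l := 2)
    (τ := cfg { v with x := val l.tail, a := (A + P * (l.tail.headD false).toNat : ℕ), p := P } o)
    ?_ (Run.seq (k := 1) (l := 1) (Run.half l.tail rfl (le_trans (by simp) hl)) ?_))
  · refine Run.set (Vars.update_a _ _) ?_ ?_ (by decide) (by decide)
    · change (A : ℤ) + P * ((modE (cell 0) (.const 2)).eval _) = _
      rw [eval_headBit (l := l.tail) rfl]
      push_cast
      rfl
    · rw [Int.natAbs_natCast]
      have := (l.tail.headD false).toNat_le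
      nlinarith
  · refine Run.set (Vars.update_p _ _) ?_ ?_ (by decide) (by decide)
    · change (2 : ℤ) * P = _
      push_cast
      rfl
    · rw [Int.natAbs_natCast]
      exact hP

/-- The bound on `P * 2 ^ l.length` survives a round, because a round consumes bits while the weight
only doubles. The final weight does not matter, as the caller resets it. -/
theorem Run.readNat_loop {W : ℕ} (l : List Bool) (v : Vars) (o : List Bool) (A P : ℕ) (hAP : A < P)
    (hP : P * 2 ^ l.length < 2 ^ W) (hl : l.length ≤ W) :
    ∃ P' : ℕ, Run W (.loop (modE (cell 0) (.const 2)) QMAPlus.readNatBody)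
      (cfg { v with x := val l, a := A, p := P } o) (5 * l.length + 1)
      (cfg { v with x := val (readNatL l).2, a := (A + P * (readNatL l).1 : ℕ), p := P' } o) := by
  fun_induction readNatL l generalizing A P with
  | case1 b l ih =>
    have hlen : 2 * P * 2 ^ l.length < 2 ^ W := by
      refine lt_of_le_of_lt ?_ hP
      simp only [List.length_cons, pow_succ]
      nlinarith [Nat.zero_le (P * 2 ^ l.length)]
    have hb := b.toNat_le
    have hAP' : A + P * b.toNat < 2 * P := by nlinarith
    have hl' : l.length ≤ W := by simp only [List.length_cons] at hl; omega
    obtain ⟨P', h⟩ := ih (A + P * b.toNat) (2 * P) hAP' hlen hl'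
    have h2P : 2 * P < 2 ^ W := lt_of_le_of_lt (Nat.le_mul_of_pos_right _ (by positivity)) hlen
    refine ⟨P', ?_⟩
    have h' := Run.loop_step (W := W) (e := modE (cell 0) (.const 2)) (by decide)
      ((headBit_pos_iff (l := true :: b :: l) rfl).2 rfl) (Run.readNatBody (true :: b :: l) v o A P hAP h2P hl) h
    rw [show A + P * (b.toNat + 2 * (readNatL l).1) = A + P * b.toNat + 2 * P * (readNatL l).1 by
      ring]
    exact h'.mono (by simp; omega)
  -- A continuation bit without a digit occurs only in malformed input, which the program must
  -- survive as well: the missing digit reads as zero and the exhausted list stops the loop.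
  | case2 =>
    have h2P : 2 * P < 2 ^ W := by simpa [mul_comm] using hP
    have h := Run.readNatBody [true] v o A P hAP h2P hl
    refine ⟨2 * P, ?_⟩
    have h' := Run.loop_step (W := W) (e := modE (cell 0) (.const 2)) (by decide)
      ((headBit_pos_iff (l := [true]) rfl).2 rfl) h (Run.loop_done (by decide) (by
          rw [headBit_pos_iff (l := []) rfl]
          simp))
    exact h'.mono (by simp)
  | case3 l h1 h2 =>
    refine ⟨P, ?_⟩
    have h := Run.loop_done (W := W) (e := modE (cell 0) (.const 2)) (p := QMAPlus.readNatBody)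
      (σ := cfg { v with x := val l, a := A, p := P } o) (by decide) (by
          rw [headBit_pos_iff (l := l) rfl]
          rcases l with _ | ⟨_ | _, _ | ⟨b, l⟩⟩
          · simp
          · simp
          · simp
          · exact absurd rfl h2
          · exact absurd rfl (h1 b l))
    exact h.mono (by omega)

/-- The program that reads a number into the variable `a`. -/
def readNat : Prog :=
  .assign (.const 13) (.const 0) ;; .assign (.const 2) (.const 1) ;;
  .loop (modE (cell 0) (.const 2)) readNatBody ;;
  .assign (.const 0) (.div (cell 0) (.const 2)) ;; .assign (.const 2) (.const 0)

theorem Run.readNat {W : ℕ} {l : List Bool} {v : Vars} (o : List Bool) (hx : v.x = val l)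
    (hp : v.p = 0) (hl : l.length < W) :
    Run W readNat (cfg v o) (5 * l.length + 5)
      (cfg { v with x := val (readNatL l).2.tail, a := (readNatL l).1 } o) := by
  have hW : 2 ^ l.length < 2 ^ W := Nat.pow_lt_pow_right (by norm_num) hl
  have hW1 : 1 ≤ 2 ^ l.length := Nat.one_le_two_pow
  obtain ⟨P', h⟩ := Run.readNat_loop (W := W) l v o 0 1 (by norm_num) (by simpa using hW) hl.le
  have h1 : Run W (.assign (.const 13) (.const 0)) (cfg v o) 1 (cfg { v with a := 0 } o) :=
    Run.set (Vars.update_a _ _) rfl (by simp) (by decide) (by decide)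
  have h2 : Run W (.assign (.const 2) (.const 1)) (cfg { v with a := 0 } o) 1
      (cfg { v with x := val l, a := (0 : ℕ), p := (1 : ℕ) } o) := by
    rw [← hx]
    exact Run.set (Vars.update_p _ _) rfl (by simp; omega) (by decide) (by decide)
  have h3 := Run.half (W := W) (v := { v with x := val (readNatL l).2, a := (0 + 1 * (readNatL l).1 : ℕ), p := P' }) (o := o) (readNatL l).2 rfl
    ((readNatL_length l).trans hl.le)
  have h4 : Run W (.assign (.const 2) (.const 0)) (cfg { v with x := val (readNatL l).2.tail, a := (0 + 1 * (readNatL l).1 : ℕ), p := P' } o) 1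
      (cfg { v with x := val (readNatL l).2.tail, a := (readNatL l).1 } o) := by
    have : ({ v with x := val (readNatL l).2.tail, a := (readNatL l).1 } : Vars) =
      { v with x := val (readNatL l).2.tail, a := (0 + 1 * (readNatL l).1 : ℕ), p := 0 } := by
      rw [← hp]
      simp
    rw [this]
    exact Run.set (Vars.update_p _ _) rfl (by simp) (by decide) (by decide)
  exact (h1.seq (h2.seq (h.seq (h3.seq h4)))).mono (by omega)

/-- The program that reads a signed number into the variable `a`. -/
def readInt : Prog :=
  .assign (.const 14) (modE (cell 0) (.const 2)) ;; .assign (.const 0) (.div (cell 0) (.const 2)) ;;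
  readNat ;; .assign (.const 13) (.mul (cell 13) (.sub (.const 1) (.mul (.const 2) (cell 14)))) ;;
  .assign (.const 14) (.const 0)

theorem Run.readInt {W : ℕ} {l : List Bool} {v : Vars} (o : List Bool) (hx : v.x = val l)
    (hp : v.p = 0) (hs : v.s = 0) (hl : l.length < W) :
    Run W readInt (cfg v o) (5 * l.length + 9)
      (cfg { v with x := val (readIntL l).2, a := (readIntL l).1 } o) := by
  have h1 : Run W (.assign (.const 14) (modE (cell 0) (.const 2))) (cfg v o) 1
      (cfg { v with s := (l.headD false).toNat } o) := by
    refine Run.set (Vars.update_s _ _) (eval_headBit hx) ?_ (by decide) (by decide)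
    rw [Int.natAbs_natCast]
    have := (l.headD false).toNat_lt
    have : 2 ^ 1 ≤ 2 ^ W := Nat.pow_le_pow_right (by norm_num) (by omega)
    omega
  have h2 := Run.half (W := W) (v := { v with s := (l.headD false).toNat }) (o := o) l hx hl.le
  have h3 := Run.readNat (W := W) (l := l.tail) (v := { v with s := (l.headD false).toNat, x := val l.tail }) o rfl hp (lt_of_le_of_lt (by simp) hl)
  have h4 : Run W (.assign (.const 13) (.mul (cell 13) (.sub (.const 1) (.mul (.const 2) (cell 14)))))
      (cfg { v with s := (l.headD false).toNat, x := val (readNatL l.tail).2.tail, a := (readNatL l.tail).1 } o) 1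
      (cfg { v with s := (l.headD false).toNat, x := val (readIntL l).2, a := (readIntL l).1 } o) := by
    refine Run.set (Vars.update_a _ _) rfl ?_ (by decide) (by decide)
    exact (readIntL_natAbs l).trans (Nat.pow_lt_pow_right (by norm_num) hl)
  have h5 : Run W (.assign (.const 14) (.const 0)) (cfg { v with s := (l.headD false).toNat, x := val (readIntL l).2, a := (readIntL l).1 } o) 1
      (cfg { v with x := val (readIntL l).2, a := (readIntL l).1 } o) := by
    have : ({ v with x := val (readIntL l).2, a := (readIntL l).1 } : Vars) =
      { v with x := val (readIntL l).2, a := (readIntL l).1, s := 0 } := by rw [← hs]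
    rw [this]
    exact Run.set (Vars.update_s _ _) rfl (by simp) (by decide) (by decide)
  exact (h1.seq (h2.seq (h3.seq (h4.seq h5)))).mono (by simp; omega)

/-- The program that reads a number in unary code into the variable `n`. -/
def readUnary : Prog :=
  .loop (modE (cell 0) (.const 2)) (.assign (.const 0) (.div (cell 0) (.const 2)) ;;
    .assign (.const 5) (.add (cell 5) (.const 1))) ;;
  .assign (.const 0) (.div (cell 0) (.const 2))

/-- The loop stops in front of the closing zero, which `r` still contains; the halving that follows
removes it. -/
theorem Run.readUnary_loop {W : ℕ} (l : List Bool) (v : Vars) (o : List Bool) (k : ℕ)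
    (hk : k + l.length < W) :
    ∃ r : List Bool, r.tail = (readUnaryL l).2 ∧ r.length ≤ l.length ∧
      Run W (.loop (modE (cell 0) (.const 2)) (.assign (.const 0) (.div (cell 0) (.const 2)) ;;
        .assign (.const 5) (.add (cell 5) (.const 1))))
      (cfg { v with x := val l, n := k } o) (3 * l.length + 1)
      (cfg { v with x := val r, n := (k + (readUnaryL l).1 : ℕ) } o) := by
  fun_induction readUnaryL l generalizing k with
  | case1 l ih =>
    obtain ⟨r, hr, hrl, h⟩ := ih (k + 1) (by simp at hk; omega)
    refine ⟨r, hr, by simp; omega, ?_⟩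
    have hb : Run W (.assign (.const 0) (.div (cell 0) (.const 2)) ;;
        .assign (.const 5) (.add (cell 5) (.const 1))) (cfg { v with x := val (true :: l), n := k } o)
        2 (cfg { v with x := val l, n := (k + 1 : ℕ) } o) := by
      refine (Run.half (true :: l) rfl (by omega)).seq (k := 1) (l := 1) ?_
      refine Run.set (Vars.update_n _ _) rfl ?_ (by decide) (by decide)
      have := Nat.lt_two_pow_self (n := W)
      rw [Int.natAbs_natCast]
      omega
    have h' := Run.loop_step (W := W) (e := modE (cell 0) (.const 2)) (by decide)
      ((headBit_pos_iff (l := true :: l) rfl).2 rfl) hb h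
    rw [show k + ((readUnaryL l).1 + 1) = k + 1 + (readUnaryL l).1 by ring]
    exact h'.mono (by simp; omega)
  | case2 l h1 =>
    refine ⟨l, rfl, le_rfl, ?_⟩
    have h := Run.loop_done (W := W) (e := modE (cell 0) (.const 2))
      (p := .assign (.const 0) (.div (cell 0) (.const 2)) ;;
        .assign (.const 5) (.add (cell 5) (.const 1)))
      (σ := cfg { v with x := val l, n := k } o) (by decide) (by
          rw [headBit_pos_iff (l := l) rfl]
          rcases l with _ | ⟨_ | _, l⟩
          · simp
          · simp
          · exact absurd rfl (h1 l))
    exact h.mono (by omega)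

theorem Run.readUnary {W : ℕ} {l : List Bool} {v : Vars} (o : List Bool) (hx : v.x = val l)
    (hn : v.n = 0) (hl : l.length < W) :
    Run W readUnary (cfg v o) (3 * l.length + 2)
      (cfg { v with x := val (readUnaryL l).2, n := (readUnaryL l).1 } o) := by
  obtain ⟨r, hr, hrl, h⟩ := Run.readUnary_loop (W := W) l v o 0 (by omega)
  have h2 := Run.half (W := W) (v := { v with x := val r, n := (0 + (readUnaryL l).1 : ℕ) })
    (o := o) r rfl (by omega)
  have h3 := h.seq h2
  rw [hr, zero_add] at h3
  have h0 : ({ v with x := val l, n := (0 : ℕ) } : Vars) = v := by rw [← hx, Nat.cast_zero, ← hn]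
  rw [h0] at h3
  exact h3.mono (by omega)

/-! ### The circuit as a list of gates with numerical wires -/

/-- Gates on wires that are numbered by natural numbers. -/
inductive RawGate
  | H (a : ℕ)
  | X (a : ℕ)
  | CNOT (a b : ℕ)
  | Tof (a b c : ℕ)

def RawGate.encode : RawGate → List Bool
  | .X a => [false, false, false] ++ encUnary a
  | .H a => [false, false, true] ++ encUnary a
  | .CNOT a b => [false, true, true] ++ encUnary a ++ encUnary b
  | .Tof a b c => [true, false, false] ++ encUnary a ++ encUnary b ++ encUnary c

/-- The code of a list of gates, every gate being preceded by a one. -/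
def encGates (l : List RawGate) : List Bool := l.flatMap fun g => true :: g.encode

theorem encGates_append (l₁ l₂ : List RawGate) :
    encGates (l₁ ++ l₂) = encGates l₁ ++ encGates l₂ := by simp [encGates]

/-- A block of `Q` wires starting at `cur` holds a number modulo `Q` in one-hot code. These gates
write into the next block that number, increased by `c` if the wire `ctl` is one. -/
def layerStep (Q cur ctl c t : ℕ) : List RawGate :=
  [.CNOT (cur + t) (cur + Q + t), .Tof ctl (cur + t) (cur + Q + t),
    .Tof ctl (cur + t) (cur + Q + (t + c) % Q)]

def layerGates (Q cur ctl c : ℕ) : List RawGate :=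
  (List.range Q).flatMap (layerStep Q cur ctl c)

/-- Successive layers, each with its control wire and its increment. -/
def layersGates (Q : ℕ) : ℕ → List (ℕ × ℕ) → List RawGate
  | _, [] => []
  | cur, l :: ls => layerGates Q cur l.1 l.2 ++ layersGates Q (cur + Q) ls

theorem layersGates_append (Q cur : ℕ) (l₁ l₂ : List (ℕ × ℕ)) :
    layersGates Q cur (l₁ ++ l₂) =
      layersGates Q cur l₁ ++ layersGates Q (cur + l₁.length * Q) l₂ := by
  induction l₁ generalizing cur with
  | nil => simp [layersGates]
  | cons a l ih =>
    simp only [List.cons_append, layersGates, ih, List.length_cons, List.append_assoc]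
    congr 3
    ring

/-- A chain of layers that starts with the number `start` and finally adds to the wire `out`
the bit that tells whether the result is at least `Q / 2`. -/
def chainGates (Q out cur start : ℕ) (ls : List (ℕ × ℕ)) : List RawGate :=
  [.X (cur + start)] ++ layersGates Q cur ls ++
    (List.range (Q / 2)).map fun t => .CNOT (cur + ls.length * Q + Q / 2 + t) out

/-! ### The programs that print the circuit -/

def emitX (e : Expr) : Prog := emitBits [true, false, false, false] ;; emitUnary e

def emitH (e : Expr) : Prog := emitBits [true, false, false, true] ;; emitUnary e

def emitCNOT (e f : Expr) : Prog :=
  emitBits [true, false, true, true] ;; emitUnary e ;; emitUnary f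

def emitTof (e f g : Expr) : Prog :=
  emitBits [true, true, false, false] ;; emitUnary e ;; emitUnary f ;; emitUnary g

section Gates

variable {W : ℕ} {v : Vars} {o : List Bool} {e f g : Expr}

theorem Run.emitX (a B : ℕ) (hu : v.u = 0) (he : e.eval v.mem = a) (ha : a ≤ B) (hB : B < 2 ^ W)
    (hs : e.size ≤ 300) :
    Run W (emitX e) (cfg v o) (3 * B + 8) (cfg v (o ++ encGates [.X a])) := by
  have h := (Run.emitBits (W := W) v [true, false, false, false] o).seq
    (Run.emitUnary a hu he (by omega) hs)
  have ho : o ++ encGates [.X a] = o ++ [true, false, false, false] ++ encUnary a := by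
    simp [encGates, RawGate.encode]
  rw [ho]
  exact h.mono (by simp only [List.length_cons, List.length_nil]; omega)

theorem Run.emitH (a B : ℕ) (hu : v.u = 0) (he : e.eval v.mem = a) (ha : a ≤ B) (hB : B < 2 ^ W)
    (hs : e.size ≤ 300) :
    Run W (emitH e) (cfg v o) (3 * B + 8) (cfg v (o ++ encGates [.H a])) := by
  have h := (Run.emitBits (W := W) v [true, false, false, true] o).seq
    (Run.emitUnary a hu he (by omega) hs)
  have ho : o ++ encGates [.H a] = o ++ [true, false, false, true] ++ encUnary a := by
    simp [encGates, RawGate.encode]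
  rw [ho]
  exact h.mono (by simp only [List.length_cons, List.length_nil]; omega)

theorem Run.emitCNOT (a b B : ℕ) (hu : v.u = 0) (he : e.eval v.mem = a) (hf : f.eval v.mem = b)
    (ha : a ≤ B) (hb : b ≤ B) (hB : B < 2 ^ W) (hs : e.size ≤ 300) (hs' : f.size ≤ 300) :
    Run W (emitCNOT e f) (cfg v o) (6 * B + 11) (cfg v (o ++ encGates [.CNOT a b])) := by
  have h := (Run.emitBits (W := W) v [true, false, true, true] o).seq
    ((Run.emitUnary a hu he (by omega) hs).seq (Run.emitUnary b hu hf (by omega) hs'))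
  have ho : o ++ encGates [.CNOT a b] =
      o ++ [true, false, true, true] ++ encUnary a ++ encUnary b := by
    simp [encGates, RawGate.encode]
  rw [ho]
  exact h.mono (by simp only [List.length_cons, List.length_nil]; omega)

theorem Run.emitTof (a b c B : ℕ) (hu : v.u = 0) (he : e.eval v.mem = a) (hf : f.eval v.mem = b)
    (hg : g.eval v.mem = c) (ha : a ≤ B) (hb : b ≤ B) (hc : c ≤ B) (hB : B < 2 ^ W)
    (hs : e.size ≤ 300) (hs' : f.size ≤ 300) (hs'' : g.size ≤ 300) :
    Run W (emitTof e f g) (cfg v o) (9 * B + 14) (cfg v (o ++ encGates [.Tof a b c])) := by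
  have h := (Run.emitBits (W := W) v [true, true, false, false] o).seq
    ((Run.emitUnary a hu he (by omega) hs).seq ((Run.emitUnary b hu hf (by omega) hs').seq
      (Run.emitUnary c hu hg (by omega) hs'')))
  have ho : o ++ encGates [.Tof a b c] =
      o ++ [true, true, false, false] ++ encUnary a ++ encUnary b ++ encUnary c := by
    simp [encGates, RawGate.encode]
  rw [ho]
  exact h.mono (by simp only [List.length_cons, List.length_nil]; omega)

end Gates

/-! ### Printing layers, rows and chains -/

/-- Print a layer whose control wire is the value of `e`; the block starts at `cur`, the increment
is `c`. -/
def emitLayer (e : Expr) : Prog :=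
  .loop (.sub (cell 7) (cell 18))
    (emitCNOT (.add (cell 15) (cell 18)) (.add (.add (cell 15) (cell 7)) (cell 18)) ;;
      emitTof e (.add (cell 15) (cell 18)) (.add (.add (cell 15) (cell 7)) (cell 18)) ;;
      emitTof e (.add (cell 15) (cell 18)) (.add (.add (cell 15) (cell 7))
        (modE (.add (cell 18) (cell 22)) (cell 7))) ;;
      .assign (.const 18) (.add (cell 18) (.const 1))) ;;
  .assign (.const 18) (.const 0)

/-- Cell 18 is the loop counter, so the expression for the control wire is required to have the same
value for every content of that cell. The bound `cur + 2 * Q ≤ B` covers the source block and the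
target block. -/
theorem Run.emitLayer {W : ℕ} {v : Vars} {e : Expr} (o : List Bool) (Q cur ctl c B : ℕ)
    (hq : v.q = Q) (hcur : v.cur = cur) (hc : v.c = c) (ht : v.t = 0) (hu : v.u = 0)
    (he : ∀ t : ℤ, e.eval ({ v with t := t } : Vars).mem = ctl) (hs : e.size ≤ 300)
    (hctl : ctl ≤ B) (hcB : cur + 2 * Q ≤ B) (hB : B < 2 ^ W) :
    Run W (emitLayer e) (cfg v o) (Q * (30 * B + 50) + 2)
      (cfg v (o ++ encGates (layerGates Q cur ctl c))) := by
  let S : ℕ → Config := fun t => cfg { v with t := t }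
    (o ++ encGates ((List.range t).flatMap (layerStep Q cur ctl c)))
  have h1 : Run W (.loop (.sub (cell 7) (cell 18))
      (QMAPlus.emitCNOT (.add (cell 15) (cell 18)) (.add (.add (cell 15) (cell 7)) (cell 18)) ;;
      QMAPlus.emitTof e (.add (cell 15) (cell 18)) (.add (.add (cell 15) (cell 7)) (cell 18)) ;;
      QMAPlus.emitTof e (.add (cell 15) (cell 18)) (.add (.add (cell 15) (cell 7))
        (modE (.add (cell 18) (cell 22)) (cell 7))) ;;
      .assign (.const 18) (.add (cell 18) (.const 1)))) (S 0) (Q * (30 * B + 49 + 1) + 1) (S Q) := by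
    refine Run.loop_iterate S Q _ (by decide) (fun t ht => ?_) ?_ (fun t ht => ?_)
    · change 0 < v.q - t
      omega
    · change ¬ 0 < v.q - Q
      omega
    · have hmod : (t + c) % Q < Q := Nat.mod_lt _ (by omega)
      have e1 : (Expr.add (cell 15) (cell 18)).eval ({ v with t := t } : Vars).mem
          = (cur + t : ℕ) := by
        change v.cur + (t : ℤ) = _
        rw [hcur]; push_cast; rfl
      have e2 : (Expr.add (.add (cell 15) (cell 7)) (cell 18)).eval ({ v with t := t } : Vars).mem
          = (cur + Q + t : ℕ) := by
        change v.cur + v.q + (t : ℤ) = _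
        rw [hcur, hq]; push_cast; rfl
      have e3 : (Expr.add (.add (cell 15) (cell 7)) (modE (.add (cell 18) (cell 22)) (cell 7))).eval
          ({ v with t := t } : Vars).mem = (cur + Q + (t + c) % Q : ℕ) := by
        change v.cur + v.q + (modE (.add (cell 18) (cell 22)) (cell 7)).eval _ = _
        rw [modE_eval]
        change v.cur + v.q + ((t : ℤ) + v.c) % v.q = _
        rw [hcur, hq, hc]; push_cast; rfl
      have g1 := Run.emitCNOT (W := W) (v := { v with t := t })
        (o := o ++ encGates ((List.range t).flatMap (layerStep Q cur ctl c))) _ _ B hu e1 e2 (by omega) (by omega) hB (by decide) (by decide)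
      have g2 := fun o => Run.emitTof (W := W) (v := { v with t := t }) (o := o) _ _ _ B hu (he t) e1
        e2 (by omega) (by omega) (by omega) hB hs (by decide) (by decide)
      have g3 := fun o => Run.emitTof (W := W) (v := { v with t := t }) (o := o) _ _ _ B hu (he t) e1
        e3 (by omega) (by omega) (by omega) hB hs (by decide) (by decide)
      have g4 : ∀ o, Run W (.assign (.const 18) (.add (cell 18) (.const 1)))
          (cfg { v with t := (t : ℤ) } o) 1 (cfg { v with t := (t + 1 : ℕ) } o) := fun o =>
        Run.set (Vars.update_t _ _) rfl (by rw [Int.natAbs_natCast]; omega) (by decide) (by decide)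
      have g := g1.seq ((g2 _).seq ((g3 _).seq (g4 _)))
      have ho : encGates ((List.range (t + 1)).flatMap (layerStep Q cur ctl c)) =
          encGates ((List.range t).flatMap (layerStep Q cur ctl c)) ++
          encGates [.CNOT (cur + t) (cur + Q + t)] ++ encGates [.Tof ctl (cur + t) (cur + Q + t)] ++
          encGates [.Tof ctl (cur + t) (cur + Q + (t + c) % Q)] := by
        rw [List.range_succ, List.flatMap_append, encGates_append]
        simp [encGates, layerStep]
      simp only [S, ho, ← List.append_assoc]
      exact g.mono (by omega)
  have h0 : S 0 = cfg v o := by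
    simp only [S, Nat.cast_zero, ← ht]
    simp [encGates]
  have h2 : Run W (.assign (.const 18) (.const 0)) (S Q) 1
      (cfg v (o ++ encGates (layerGates Q cur ctl c))) := by
    have hv : v = { v with t := 0 } := by rw [← ht]
    conv_rhs => rw [hv]
    exact Run.set (Vars.update_t _ _) rfl (by simp) (by decide) (by decide)
  rw [h0] at h1
  exact (h1.seq h2).mono (by rw [add_assoc (30 * B)])

/-- The integer `⌊± z / (D 2 ^ b)⌋` modulo `Q`, with the minus sign for `b = 0`. -/
def coefOf (Q : ℕ) (z D : ℤ) (b : ℕ) : ℕ := (((if b = 0 then -z else z) / (D * 2 ^ b)) % Q).toNat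

/-- The expression that is `1` if the values of `e` and `f` agree, and `0` otherwise. -/
abbrev eqE (e f : Expr) : Expr := .div (.const 1) (.add (.const 1) (.mul (.sub e f) (.sub e f)))

/-- Integer division serves as an equality test inside expressions: for distinct integers the
denominator is at least two. -/
theorem one_div_one_add_sq (a b : ℤ) :
    (1 : ℤ) / (1 + (a - b) * (a - b)) = if a = b then 1 else 0 := by
  split_ifs with h
  · simp [h]
  · have : 0 < (a - b) * (a - b) := mul_self_pos.2 (sub_ne_zero.2 h)
    exact Int.ediv_eq_zero_of_lt (by norm_num) (by omega)

/-- The numerator of the coefficients of a row. -/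
abbrev numE (f : Bool) : Expr :=
  .add (.mul (.mul (.sub (.const 1) (cell 11)) (.mul (.mul (.mul (.mul (cell 7) (cell 12)) (cell 3))
    (cell 3)) (.const (!f).toNat))) (cell 13))
    (.mul (.mul (cell 11) (cell 7)) (eqE (cell 16) (cell (if f then 10 else 9))))

/-- The denominator of the coefficients. -/
abbrev denE : Expr := .add (.mul (.sub (.const 1) (cell 11)) (cell 6)) (.mul (cell 11) (.const 4))

/-- The value of `numE`. -/
def Vars.numer (v : Vars) (f : Bool) (a i : ℤ) : ℤ :=
  (1 - v.kd) * (v.q * v.pw * v.m * v.m * (!f).toNat) * a +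
    v.kd * v.q * (if i = (if f then v.d₂ else v.d₁) then 1 else 0)

theorem numE_eval (v : Vars) (f : Bool) : (numE f).eval v.mem = v.numer f v.a v.i := by
  cases f
  · exact congrArg₂ (· + ·) rfl (congrArg₂ (· * ·) rfl (one_div_one_add_sq v.i v.d₁))
  · exact congrArg₂ (· + ·) rfl (congrArg₂ (· * ·) rfl (one_div_one_add_sq v.i v.d₂))

/-- The value of `denE`. -/
def Vars.denom (v : Vars) : ℤ := (1 - v.kd) * v.den + v.kd * 4

/-- Print the layer of one bit of a row. -/
def emitBitLayer (f : Bool) : Prog :=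
  .assign (.const 22) (.div (cell 20) (cell 21)) ;;
  .assign (.const 22) (modE (cell 22) (cell 7)) ;;
  emitLayer (.add (.mul (cell 16) (cell 23)) (cell 17)) ;;
  .assign (.const 15) (.add (cell 15) (cell 7)) ;;
  .assign (.const 21) (.mul (.const 2) (cell 21)) ;;
  .assign (.const 20) (numE f) ;;
  .assign (.const 22) (.const 0) ;;
  .assign (.const 17) (.add (cell 17) (.const 1))

/-- Print the layers of a row. -/
def emitRow (f : Bool) : Prog :=
  readInt ;; .assign (.const 20) (.sub (.const 0) (numE f)) ;; .assign (.const 21) denE ;;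
  .loop (.sub (cell 23) (cell 17)) (emitBitLayer f) ;;
  .assign (.const 17) (.const 0) ;; .assign (.const 13) (.const 0) ;; .assign (.const 20) (.const 0) ;;
  .assign (.const 21) (.const 0) ;; .assign (.const 16) (.add (cell 16) (.const 1))

/-- The layers of row `i` whose numerator is `z`. -/
def rowLayers (Q w : ℕ) (z D : ℤ) (i : ℕ) : List (ℕ × ℕ) :=
  (List.range w).map fun b => (i * w + b, coefOf Q z D b)

theorem rowLayers_succ (Q w : ℕ) (z D : ℤ) (i j : ℕ) :
    (List.range (j + 1)).map (fun b => (i * w + b, coefOf Q z D b)) =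
      (List.range j).map (fun b => (i * w + b, coefOf Q z D b)) ++ [(i * w + j, coefOf Q z D j)] := by
  rw [List.range_succ, List.map_append]
  rfl

theorem layersGates_snoc (Q cur : ℕ) (l : List (ℕ × ℕ)) (a : ℕ × ℕ) :
    layersGates Q cur (l ++ [a]) =
      layersGates Q cur l ++ layerGates Q (cur + l.length * Q) a.1 a.2 := by
  rw [layersGates_append]
  simp [layersGates]

/-- The state in the loop over the bits of a row. -/
def Vars.bitState (v : Vars) (Q cur : ℕ) (z D : ℤ) (j : ℕ) : Vars :=
  { v with cur := (cur + j * Q : ℕ), dd := D * 2 ^ j, num := if j = 0 then -z else z, j := j }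

/-- The leading bit of a coordinate has negative weight. The row preloads `-z`, and the body
restores `z` for the later bits; the denominator doubles from one bit to the next. -/
theorem Run.emitBitLayer {W : ℕ} {v : Vars} {f : Bool} (o : List Bool) (Q cur i w B j : ℕ) (z D : ℤ)
    (hq : v.q = Q) (hi : v.i = i) (hw : v.w = w) (hz : v.numer f v.a v.i = z) (hjw : j < w)
    (hc : v.c = 0) (ht : v.t = 0) (hu : v.u = 0) (hQ : 0 < Q) (hiw : i * w + w ≤ B)
    (hcB : cur + w * Q + 2 * Q ≤ B) (hB : B < 2 ^ W) (hzW : z.natAbs < 2 ^ W)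
    (hD : D.natAbs * 2 ^ w < 2 ^ W) :
    Run W (emitBitLayer f) (cfg (v.bitState Q cur z D j) o) (Q * (30 * B + 50) + 9)
      (cfg (v.bitState Q cur z D (j + 1))
        (o ++ encGates (layerGates Q (cur + j * Q) (i * w + j) (coefOf Q z D j)))) := by
  have hjQ : j * Q + Q ≤ w * Q := by rw [← Nat.succ_mul]; exact Nat.mul_le_mul_right _ hjw
  set y : ℤ := (if j = 0 then -z else z) / (D * 2 ^ j) with hy
  have hyW : y.natAbs < 2 ^ W := by
    refine lt_of_le_of_lt ?_ hzW
    have h1 := Int.abs_ediv_le_abs (if j = 0 then -z else z) (D * 2 ^ j)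
    rw [Int.abs_eq_natAbs, Int.abs_eq_natAbs] at h1
    have h2 : (if j = 0 then -z else z).natAbs = z.natAbs := by split_ifs <;> simp
    rw [h2] at h1
    exact_mod_cast h1
  have hc0 : 0 ≤ y % Q := Int.emod_nonneg _ (by omega)
  have hcQ : y % Q < Q := Int.emod_lt_of_pos _ (by omega)
  have hcoef : ((coefOf Q z D j : ℕ) : ℤ) = y % Q := by
    rw [coefOf, Int.toNat_of_nonneg hc0]
  have s1 : Run W (.assign (.const 22) (.div (cell 20) (cell 21))) (cfg (v.bitState Q cur z D j) o) 1
      (cfg { v.bitState Q cur z D j with c := y } o) :=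
    Run.set (Vars.update_c _ _) rfl hyW (by decide) (by decide)
  have s2 : Run W (.assign (.const 22) (modE (cell 22) (cell 7)))
      (cfg { v.bitState Q cur z D j with c := y } o) 1
      (cfg { v.bitState Q cur z D j with c := (coefOf Q z D j : ℕ) } o) := by
    refine Run.set (Vars.update_c _ _) ?_ ?_ (by decide) (by decide)
    · rw [modE_eval]
      change y % v.q = _
      rw [hq, hcoef]
    · omega
  have s3 := Run.emitLayer (W := W) (v := { v.bitState Q cur z D j with c := (coefOf Q z D j : ℕ) })
    (e := .add (.mul (cell 16) (cell 23)) (cell 17)) o Q (cur + j * Q) (i * w + j) (coefOf Q z D j) B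
    hq rfl rfl ht hu (fun t => by
      change v.i * v.w + (j : ℤ) = _
      rw [hi, hw]; push_cast; rfl) (by decide) (by omega) (by omega) hB
  have s4 : ∀ o, Run W (.assign (.const 15) (.add (cell 15) (cell 7)))
      (cfg { v.bitState Q cur z D j with c := (coefOf Q z D j : ℕ) } o) 1
      (cfg { v.bitState Q cur z D j with c := (coefOf Q z D j : ℕ), cur := (cur + (j + 1) * Q : ℕ) } o) := by
    intro o
    refine Run.set (Vars.update_cur _ _) ?_ ?_ (by decide) (by decide)
    · change ((cur + j * Q : ℕ) : ℤ) + v.q = _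
      rw [hq]; push_cast; ring
    · rw [Int.natAbs_natCast, Nat.succ_mul]; omega
  have s5 : ∀ o, Run W (.assign (.const 21) (.mul (.const 2) (cell 21)))
      (cfg { v.bitState Q cur z D j with c := (coefOf Q z D j : ℕ), cur := (cur + (j + 1) * Q : ℕ) } o) 1
      (cfg { v.bitState Q cur z D j with c := (coefOf Q z D j : ℕ), cur := (cur + (j + 1) * Q : ℕ), dd := D * 2 ^ (j + 1) } o) := by
    intro o
    refine Run.set (Vars.update_dd _ _) ?_ ?_ (by decide) (by decide)
    · change 2 * (D * 2 ^ j) = _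
      ring
    · rw [Int.natAbs_mul, Int.natAbs_pow]
      refine lt_of_le_of_lt (Nat.mul_le_mul_left _ ?_) hD
      exact Nat.pow_le_pow_right (by norm_num) hjw
  have s6 : ∀ o, Run W (.assign (.const 20) (numE f))
      (cfg { v.bitState Q cur z D j with c := (coefOf Q z D j : ℕ), cur := (cur + (j + 1) * Q : ℕ), dd := D * 2 ^ (j + 1) } o) 1
      (cfg { v.bitState Q cur z D j with c := (coefOf Q z D j : ℕ), cur := (cur + (j + 1) * Q : ℕ), dd := D * 2 ^ (j + 1), num := z } o) := by
    intro o
    refine Run.set (Vars.update_num _ _) ?_ hzW (by decide) (by cases f <;> decide)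
    rw [numE_eval]
    exact hz
  have s7 : ∀ o, Run W (.assign (.const 22) (.const 0))
      (cfg { v.bitState Q cur z D j with c := (coefOf Q z D j : ℕ), cur := (cur + (j + 1) * Q : ℕ), dd := D * 2 ^ (j + 1), num := z } o) 1
      (cfg { v.bitState Q cur z D j with c := 0, cur := (cur + (j + 1) * Q : ℕ), dd := D * 2 ^ (j + 1), num := z } o) := by
    intro o
    exact Run.set (Vars.update_c _ _) rfl (by simp) (by decide) (by decide)
  have s8 : ∀ o, Run W (.assign (.const 17) (.add (cell 17) (.const 1)))
      (cfg { v.bitState Q cur z D j with c := 0, cur := (cur + (j + 1) * Q : ℕ), dd := D * 2 ^ (j + 1), num := z } o) 1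
      (cfg (v.bitState Q cur z D (j + 1)) o) := by
    intro o
    have hv : v.bitState Q cur z D (j + 1) = { v.bitState Q cur z D j with c := 0, cur := (cur + (j + 1) * Q : ℕ), dd := D * 2 ^ (j + 1), num := z, j := (j + 1 : ℕ) } := by
      simp [Vars.bitState, hc]
    rw [hv]
    refine Run.set (Vars.update_j _ _) rfl ?_ (by decide) (by decide)
    rw [Int.natAbs_natCast]
    omega
  exact (s1.seq (s2.seq (s3.seq ((s4 _).seq ((s5 _).seq ((s6 _).seq ((s7 _).seq (s8 _)))))))).mono
    (by omega)

/-- The rest of a bit string after `k` signed numbers have been read. -/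
def dropInts (l : List Bool) : ℕ → List Bool
  | 0 => l
  | k + 1 => (readIntL (dropInts l k)).2

/-- The `k`-th signed number in a bit string. -/
def entry (l : List Bool) (k : ℕ) : ℤ := (readIntL (dropInts l k)).1

theorem dropInts_length (l : List Bool) (k : ℕ) : (dropInts l k).length ≤ l.length := by
  induction k with
  | zero => exact le_rfl
  | succ k ih => exact (readIntL_length _).trans ih

theorem dropInts_add (l : List Bool) (j k : ℕ) : dropInts l (j + k) = dropInts (dropInts l j) k := by
  induction k with
  | zero => rfl
  | succ k ih => rw [← add_assoc, dropInts, ih, dropInts]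

theorem entry_natAbs_lt (l : List Bool) (k : ℕ) : (entry l k).natAbs < 2 ^ l.length :=
  (readIntL_natAbs _).trans_le (Nat.pow_le_pow_right (by norm_num) (dropInts_length l k))

/-- The state in the loop over the rows. -/
def Vars.rowState (v : Vars) (Q cur w : ℕ) (l : List Bool) (i : ℕ) : Vars :=
  { v with cur := (cur + i * w * Q : ℕ), x := val (dropInts l i), i := i }

/-- The unread numbers are the binary digits of the single integer `x`, so the row index also counts
the numbers consumed. All scratch variables are reset, which makes rows composable. -/
theorem Run.emitRow {W : ℕ} {v : Vars} {f : Bool} (o : List Bool) (Q cur i w n B : ℕ) (z D : ℤ)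
    (l : List Bool) (hq : v.q = Q) (hw : v.w = w) (hz : v.numer f (entry l i) i = z)
    (hDv : v.denom = D) (hin : i < n) (hp : v.p = 0) (hs : v.s = 0) (hj : v.j = 0) (ha : v.a = 0)
    (hnum : v.num = 0) (hdd : v.dd = 0) (hc : v.c = 0) (ht : v.t = 0) (hu : v.u = 0) (hQ : 0 < Q)
    (hnB : n * w ≤ B) (hnB' : n ≤ B) (hcB : cur + n * w * Q + 2 * Q ≤ B) (hB : B < 2 ^ W)
    (hzW : z.natAbs < 2 ^ W) (hD : D.natAbs * 2 ^ w < 2 ^ W) (hl : l.length < W) :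
    Run W (emitRow f) (cfg (v.rowState Q cur w l i) o)
      (5 * l.length + w * (Q * (30 * B + 50) + 10) + 20)
      (cfg (v.rowState Q cur w l (i + 1))
        (o ++ encGates (layersGates Q (cur + i * w * Q) (rowLayers Q w z D i)))) := by
  have hiw : i * w + w ≤ n * w := by rw [← Nat.succ_mul]; exact Nat.mul_le_mul_right _ hin
  have hiwQ : i * w * Q + w * Q ≤ n * w * Q := by
    rw [← add_mul]; exact Nat.mul_le_mul_right _ hiw
  have hlen := dropInts_length l i
  have hW1 : 1 < 2 ^ W := Nat.one_lt_two_pow (by omega)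
  let v₁ : Vars := { v.rowState Q cur w l i with x := val (dropInts l (i + 1)), a := entry l i }
  have s1 : Run W QMAPlus.readInt (cfg (v.rowState Q cur w l i) o) (5 * l.length + 9) (cfg v₁ o) :=
    (Run.readInt (W := W) (l := dropInts l i) (v := v.rowState Q cur w l i) o rfl hp hs
      (by omega)).mono (by omega)
  have s2 : Run W (.assign (.const 20) (.sub (.const 0) (numE f))) (cfg v₁ o) 1
      (cfg { v₁ with num := -z } o) := by
    refine Run.set (Vars.update_num _ _) ?_ (by simpa using hzW) (by decide) (by cases f <;> decide)
    change 0 - (numE f).eval v₁.mem = _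
    rw [numE_eval, ← hz, zero_sub]
    rfl
  have s3 : Run W (.assign (.const 21) denE) (cfg { v₁ with num := -z } o) 1
      (cfg (v₁.bitState Q (cur + i * w * Q) z D 0) o) := by
    have hv : v₁.bitState Q (cur + i * w * Q) z D 0 = { v₁ with num := -z, dd := D } := by
      simp [Vars.bitState, v₁, Vars.rowState, hj]
    rw [hv]
    refine Run.set (Vars.update_dd _ _) hDv ?_ (by decide) (by decide)
    exact lt_of_le_of_lt (Nat.le_mul_of_pos_right _ (by positivity)) hD
  let S : ℕ → Config := fun j => cfg (v₁.bitState Q (cur + i * w * Q) z D j)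
    (o ++ encGates (layersGates Q (cur + i * w * Q)
      ((List.range j).map fun b => (i * w + b, coefOf Q z D b))))
  have s4 : Run W (.loop (.sub (cell 23) (cell 17)) (QMAPlus.emitBitLayer f)) (S 0)
      (w * (Q * (30 * B + 50) + 9 + 1) + 1) (S w) := by
    refine Run.loop_iterate S w _ (by decide) (fun j hj => ?_) ?_ (fun j hj => ?_)
    · change 0 < v.w - j
      omega
    · change ¬ 0 < v.w - w
      omega
    · have h := Run.emitBitLayer (W := W) (v := v₁) (f := f)
        (o ++ encGates (layersGates Q (cur + i * w * Q)
          ((List.range j).map fun b => (i * w + b, coefOf Q z D b)))) Q (cur + i * w * Q) i w B j z D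
        hq rfl hw hz hj hc ht hu hQ (by omega) (by omega) hB hzW hD
      simp only [S, rowLayers_succ, layersGates_snoc, encGates_append, List.length_map,
        List.length_range, ← List.append_assoc]
      exact h
  have h0 : S 0 = cfg (v₁.bitState Q (cur + i * w * Q) z D 0) o := by
    simp [S, layersGates, encGates]
  rw [h0] at s4
  set o' := o ++ encGates (layersGates Q (cur + i * w * Q) (rowLayers Q w z D i)) with ho'
  have hSw : S w = cfg (v₁.bitState Q (cur + i * w * Q) z D w) o' := rfl
  rw [hSw] at s4
  let v₂ : Vars := v₁.bitState Q (cur + i * w * Q) z D w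
  have s5 : Run W (.assign (.const 17) (.const 0)) (cfg v₂ o') 1 (cfg { v₂ with j := 0 } o') :=
    Run.set (Vars.update_j _ _) rfl (by simp) (by decide) (by decide)
  have s6 : Run W (.assign (.const 13) (.const 0)) (cfg { v₂ with j := 0 } o') 1
      (cfg { v₂ with j := 0, a := 0 } o') :=
    Run.set (Vars.update_a _ _) rfl (by simp) (by decide) (by decide)
  have s7 : Run W (.assign (.const 20) (.const 0)) (cfg { v₂ with j := 0, a := 0 } o') 1
      (cfg { v₂ with j := 0, a := 0, num := 0 } o') :=
    Run.set (Vars.update_num _ _) rfl (by simp) (by decide) (by decide)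
  have s8 : Run W (.assign (.const 21) (.const 0)) (cfg { v₂ with j := 0, a := 0, num := 0 } o') 1
      (cfg { v₂ with j := 0, a := 0, num := 0, dd := 0 } o') :=
    Run.set (Vars.update_dd _ _) rfl (by simp) (by decide) (by decide)
  have s9 : Run W (.assign (.const 16) (.add (cell 16) (.const 1)))
      (cfg { v₂ with j := 0, a := 0, num := 0, dd := 0 } o') 1
      (cfg (v.rowState Q cur w l (i + 1)) o') := by
    have hv : v.rowState Q cur w l (i + 1) =
        { v₂ with j := 0, a := 0, num := 0, dd := 0, i := (i + 1 : ℕ) } := by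
      simp only [v₂, v₁, Vars.rowState, Vars.bitState, ha, hnum, hdd, hj, Vars.mk.injEq, true_and,
        and_true]
      push_cast
      ring
    rw [hv]
    exact Run.set (Vars.update_i _ _) rfl (by rw [Int.natAbs_natCast]; omega) (by decide) (by decide)
  replace s4 := s4.mono (show _ ≤ w * (Q * (30 * B + 50) + 10) + 1 from le_rfl)
  have h := s1.seq (s2.seq (s3.seq (s4.seq (s5.seq (s6.seq (s7.seq (s8.seq s9)))))))
  exact h.mono (by omega)

/-- Print the layers of the random bits. -/
def emitRandom (f : Bool) : Prog :=
  .assign (.const 22) (.const 1) ;;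
  .loop (.sub (cell 8) (cell 17))
    (emitLayer (.add (.add (cell 24) (.mul (.const f.toNat) (cell 8))) (cell 17)) ;;
      .assign (.const 15) (.add (cell 15) (cell 7)) ;;
      .assign (.const 22) (.mul (.const 2) (cell 22)) ;;
      .assign (.const 17) (.add (cell 17) (.const 1))) ;;
  .assign (.const 17) (.const 0) ;; .assign (.const 22) (.const 0)

/-- Increments `2 ^ r` controlled by `κ` random wires amount to the addition of a number below `2 ^
κ`. The flag `f` selects one of two disjoint groups of random wires, so the two chains are shifted
independently. -/
theorem Run.emitRandom {W : ℕ} {v : Vars} {f : Bool} (o : List Bool) (Q cur K κ B : ℕ)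
    (hq : v.q = Q) (hcur : v.cur = cur) (hK : v.kk = K) (hk : v.k = κ) (hj : v.j = 0)
    (hc : v.c = 0) (ht : v.t = 0) (hu : v.u = 0) (hκ : 2 ^ κ ≤ B) (hKB : K + 2 * κ ≤ B)
    (hcB : cur + κ * Q + 2 * Q ≤ B) (hB : B < 2 ^ W) (hB1 : 1 ≤ B) :
    Run W (emitRandom f) (cfg v o) (κ * (Q * (30 * B + 50) + 10) + 10)
      (cfg { v with cur := (cur + κ * Q : ℕ) } (o ++ encGates (layersGates Q cur
        ((List.range κ).map fun r => (K + f.toNat * κ + r, 2 ^ r))))) := by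
  have s1 : Run W (.assign (.const 22) (.const 1)) (cfg v o) 1 (cfg { v with c := 1 } o) :=
    Run.set (Vars.update_c _ _) rfl (by rw [Int.natAbs_one]; omega) (by decide) (by decide)
  let V : ℕ → Vars := fun j => { v with cur := (cur + j * Q : ℕ), c := (2 ^ j : ℕ), j := j }
  let G : ℕ → List Bool := fun j => o ++ encGates (layersGates Q cur
        ((List.range j).map fun r => (K + f.toNat * κ + r, 2 ^ r)))
  have s2 : Run W (.loop (.sub (cell 8) (cell 17))
    (QMAPlus.emitLayer (.add (.add (cell 24) (.mul (.const f.toNat) (cell 8))) (cell 17)) ;;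
      .assign (.const 15) (.add (cell 15) (cell 7)) ;;
      .assign (.const 22) (.mul (.const 2) (cell 22)) ;;
      .assign (.const 17) (.add (cell 17) (.const 1)))) (cfg (V 0) (G 0))
      (κ * (Q * (30 * B + 50) + 6 + 1) + 1) (cfg (V κ) (G κ)) := by
    refine Run.loop_iterate (fun j => cfg (V j) (G j)) κ _ (by decide) (fun j hj => ?_) ?_
      (fun j hj => ?_)
    · change 0 < v.k - j
      omega
    · change ¬ 0 < v.k - κ
      omega
    · have hjQ : j * Q + Q ≤ κ * Q := by rw [← Nat.succ_mul]; exact Nat.mul_le_mul_right _ hj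
      have hf : f.toNat * κ ≤ κ := by
        have := f.toNat_le
        nlinarith
      have h2j : 2 ^ (j + 1) ≤ B := le_trans (Nat.pow_le_pow_right (by norm_num) hj) hκ
      have g1 := Run.emitLayer (W := W) (v := V j)
        (e := .add (.add (cell 24) (.mul (.const f.toNat) (cell 8))) (cell 17)) (G j) Q (cur + j * Q)
        (K + f.toNat * κ + j) (2 ^ j) B hq rfl rfl ht hu (fun t => by
          change v.kk + f.toNat * v.k + (j : ℤ) = _
          rw [hK, hk]; push_cast; rfl) (by cases f <;> decide) (by omega) (by omega) hB
      have g2 : ∀ o, Run W (.assign (.const 15) (.add (cell 15) (cell 7))) (cfg (V j) o) 1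
          (cfg { V j with cur := (cur + (j + 1) * Q : ℕ) } o) := by
        intro o
        refine Run.set (Vars.update_cur _ _) ?_ ?_ (by decide) (by decide)
        · change ((cur + j * Q : ℕ) : ℤ) + v.q = _
          rw [hq]; push_cast; ring
        · rw [Int.natAbs_natCast, Nat.succ_mul]; omega
      have g3 : ∀ o, Run W (.assign (.const 22) (.mul (.const 2) (cell 22)))
          (cfg { V j with cur := (cur + (j + 1) * Q : ℕ) } o) 1
          (cfg { V j with cur := (cur + (j + 1) * Q : ℕ), c := (2 ^ (j + 1) : ℕ) } o) := by
        intro o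
        refine Run.set (Vars.update_c _ _) ?_ ?_ (by decide) (by decide)
        · change 2 * ((2 ^ j : ℕ) : ℤ) = _
          push_cast; ring
        · rw [Int.natAbs_natCast]; omega
      have g4 : ∀ o, Run W (.assign (.const 17) (.add (cell 17) (.const 1)))
          (cfg { V j with cur := (cur + (j + 1) * Q : ℕ), c := (2 ^ (j + 1) : ℕ) } o) 1
          (cfg (V (j + 1)) o) := by
        intro o
        exact Run.set (Vars.update_j _ _) rfl (by rw [Int.natAbs_natCast]; omega) (by decide)
          (by decide)
      have hG : G (j + 1) = G j ++ encGates (layerGates Q (cur + j * Q) (K + f.toNat * κ + j) (2 ^ j)) := by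
        simp only [G]
        rw [List.range_succ, List.map_append, List.map_singleton, layersGates_snoc, encGates_append]
        simp
      simp only [hG]
      exact (g1.seq ((g2 _).seq ((g3 _).seq (g4 _)))).mono (by omega)
  have h0 : cfg (V 0) (G 0) = cfg { v with c := 1 } o := by
    have : V 0 = { v with c := 1 } := by simp [V, hj, hcur]
    rw [this]
    simp [G, layersGates, encGates]
  rw [h0] at s2
  have s3 : Run W (.assign (.const 17) (.const 0)) (cfg (V κ) (G κ)) 1
      (cfg { V κ with j := 0 } (G κ)) :=
    Run.set (Vars.update_j _ _) rfl (by simp) (by decide) (by decide)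
  have s4 : Run W (.assign (.const 22) (.const 0)) (cfg { V κ with j := 0 } (G κ)) 1
      (cfg { v with cur := (cur + κ * Q : ℕ) } (G κ)) := by
    have hv : ({ v with cur := (cur + κ * Q : ℕ) } : Vars) = { V κ with j := 0, c := 0 } := by
      simp [V, hj, hc]
    rw [hv]
    exact Run.set (Vars.update_c _ _) rfl (by simp) (by decide) (by decide)
  exact (s1.seq (s2.seq (s3.seq s4))).mono (by
    have : κ * (Q * (30 * B + 50) + 6 + 1) ≤ κ * (Q * (30 * B + 50) + 10) :=
      Nat.mul_le_mul_left _ (by omega)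
    omega)

/-- The layers of a chain: the rows `0, …, n - 1` with numerators `z 0, …, z (n - 1)`, and the random
bits. -/
def chainLayers (Q w κ K n : ℕ) (f : Bool) (z : ℕ → ℤ) (D : ℤ) : List (ℕ × ℕ) :=
  (List.range n).flatMap (fun i => rowLayers Q w (z i) D i) ++
    (List.range κ).map fun r => (K + f.toNat * κ + r, 2 ^ r)

theorem rows_length (Q w n : ℕ) (z : ℕ → ℤ) (D : ℤ) :
    ((List.range n).flatMap (fun i => rowLayers Q w (z i) D i)).length = n * w := by
  induction n with
  | zero => simp
  | succ n ih => simp [List.range_succ, List.flatMap_append, rowLayers, Nat.succ_mul]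

theorem chainLayers_length (Q w κ K n : ℕ) (f : Bool) (z : ℕ → ℤ) (D : ℤ) :
    (chainLayers Q w κ K n f z D).length = n * w + κ := by
  simp only [chainLayers, List.length_append, rows_length, List.length_map, List.length_range]

/-- The first wire of the chain `f`. -/
abbrev baseE (f : Bool) : Expr :=
  .add (.add (cell 24) (.add (.mul (.const 2) (cell 8)) (.const 1)))
    (.mul (.const f.toNat) (.mul (.add (.mul (cell 5) (cell 23)) (.add (cell 8) (.const 1))) (cell 7)))

/-- The output wire. -/
abbrev outE : Expr := .add (cell 24) (.mul (.const 2) (cell 8))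

/-- Print a chain. -/
def emitChain (f : Bool) : Prog :=
  .assign (.const 15) (baseE f) ;;
  emitX (.add (cell 15) (.mul (cell 11) (.div (cell 7) (.const 4)))) ;;
  .loop (.sub (cell 5) (cell 16)) (emitRow f) ;;
  .assign (.const 16) (.const 0) ;;
  emitRandom f ;;
  .loop (.sub (.div (cell 7) (.const 2)) (cell 18))
    (emitCNOT (.add (.add (cell 15) (.div (cell 7) (.const 2))) (cell 18)) outE ;;
      .assign (.const 18) (.add (cell 18) (.const 1))) ;;
  .assign (.const 18) (.const 0) ;; .assign (.const 15) (.const 0)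

/-- The first wire of the chain `f`. -/
def chainBase (Q w κ K n : ℕ) (f : Bool) : ℕ := K + (2 * κ + 1) + f.toNat * ((n * w + (κ + 1)) * Q)

/-- A chain of `n * w + κ` layers occupies one block more than it has layers, hence the shape of
`htot`. A number is read for each row even if its coefficient is not used, which keeps one program
for all kinds of tests. -/
theorem Run.emitChain {W : ℕ} {v : Vars} (f : Bool) (o : List Bool) (Q w κ K n kd B : ℕ) (D : ℤ)
    (l : List Bool) (hx : v.x = val l) (hq : v.q = Q) (hw : v.w = w) (hk : v.k = κ) (hK : v.kk = K)
    (hn : v.n = n) (hkd : v.kd = kd) (hkd1 : kd ≤ 1) (hDv : v.denom = D) (hp : v.p = 0) (hs : v.s = 0)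
    (hi : v.i = 0) (hcur : v.cur = 0) (hj : v.j = 0) (ha : v.a = 0) (hnum : v.num = 0)
    (hdd : v.dd = 0) (hc : v.c = 0) (ht : v.t = 0) (hu : v.u = 0) (hQ : 0 < Q)
    (hnB : n ≤ B) (hnwB : n * w ≤ B) (hκ : 2 ^ κ ≤ B)
    (htot : chainBase Q w κ K n f + (n * w + (κ + 1)) * Q + 2 * Q ≤ B) (hB : B < 2 ^ W)
    (hzW : ∀ i, (v.numer f (entry l i) i).natAbs < 2 ^ W) (hD : D.natAbs * 2 ^ w < 2 ^ W)
    (hl : l.length < W) :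
    Run W (emitChain f) (cfg v o)
      (n * (5 * l.length + w * (Q * (30 * B + 50) + 10) + 21) + κ * (Q * (30 * B + 50) + 10) +
        Q * (6 * B + 20) + 3 * B + 30)
      (cfg { v with x := val (dropInts l n) }
        (o ++ encGates (chainGates Q (K + 2 * κ) (chainBase Q w κ K n f) (kd * (Q / 4))
          (chainLayers Q w κ K n f (fun i => v.numer f (entry l i) i) D)))) := by
  set base := chainBase Q w κ K n f with hbase
  have hQ4 : kd * (Q / 4) ≤ Q := by
    calc kd * (Q / 4) ≤ 1 * (Q / 4) := Nat.mul_le_mul_right _ hkd1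
      _ ≤ Q := by omega
  have hK2 : K + 2 * κ < base := by rw [hbase, chainBase]; omega
  have htot' : (n * w + (κ + 1)) * Q = n * w * Q + κ * Q + Q := by ring
  have s1 : Run W (.assign (.const 15) (baseE f)) (cfg v o) 1 (cfg { v with cur := base } o) := by
    refine Run.set (Vars.update_cur _ _) ?_ (by rw [Int.natAbs_natCast]; omega) (by decide)
      (by cases f <;> decide)
    change v.kk + (2 * v.k + 1) + f.toNat * ((v.n * v.w + (v.k + 1)) * v.q) = _
    rw [hK, hk, hn, hw, hq, hbase, chainBase]
    push_cast
    rfl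
  have s2 := Run.emitX (W := W) (v := { v with cur := base }) (o := o)
    (e := .add (cell 15) (.mul (cell 11) (.div (cell 7) (.const 4)))) (base + kd * (Q / 4)) B hu (by
      change (base : ℤ) + v.kd * (v.q / 4) = _
      rw [hkd, hq]; push_cast; rfl) (by omega) hB (by decide)
  set o₁ := o ++ encGates [.X (base + kd * (Q / 4))] with ho₁
  let z : ℕ → ℤ := fun i => v.numer f (entry l i) i
  let G : ℕ → List Bool := fun i => o₁ ++ encGates (layersGates Q base
    ((List.range i).flatMap (fun i => rowLayers Q w (z i) D i)))
  have s3 : Run W (.loop (.sub (cell 5) (cell 16)) (QMAPlus.emitRow f))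
      (cfg (v.rowState Q base w l 0) (G 0))
      (n * (5 * l.length + w * (Q * (30 * B + 50) + 10) + 20 + 1) + 1)
      (cfg (v.rowState Q base w l n) (G n)) := by
    refine Run.loop_iterate (fun i => cfg (v.rowState Q base w l i) (G i)) n _ (by decide)
      (fun i hi => ?_) ?_ (fun i hi => ?_)
    · change 0 < v.n - i
      omega
    · change ¬ 0 < v.n - n
      omega
    · have h := Run.emitRow (W := W) (v := v) (f := f) (G i) Q base i w n B (z i) D l hq hw rfl hDv hi
        hp hs hj ha hnum hdd hc ht hu hQ hnwB hnB (by omega) hB (hzW i) hD hl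
      have hG : G (i + 1) = G i ++ encGates (layersGates Q (base + i * w * Q)
          (rowLayers Q w (z i) D i)) := by
        simp only [G]
        rw [List.range_succ, List.flatMap_append, List.flatMap_singleton, layersGates_append,
          encGates_append, rows_length]
        simp only [List.append_assoc]
      rw [hG]
      exact h
  have h0 : cfg (v.rowState Q base w l 0) (G 0) = cfg { v with cur := base } o₁ := by
    have : v.rowState Q base w l 0 = { v with cur := base } := by
      simp [Vars.rowState, hi, hx, dropInts]
    rw [this]
    simp [G, layersGates, encGates]
  rw [h0] at s3
  let v₁ : Vars := { v with cur := (base + n * w * Q : ℕ), x := val (dropInts l n) }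
  have s4 : Run W (.assign (.const 16) (.const 0)) (cfg (v.rowState Q base w l n) (G n)) 1
      (cfg v₁ (G n)) := by
    have hv : v₁ = { v.rowState Q base w l n with i := 0 } := by
      simp [v₁, Vars.rowState, hi]
    rw [hv]
    exact Run.set (Vars.update_i _ _) rfl (by simp) (by decide) (by decide)
  have s5 := Run.emitRandom (W := W) (v := v₁) (f := f) (G n) Q (base + n * w * Q) K κ B hq rfl hK hk
    hj hc ht hu hκ (by omega) (by omega) hB (by omega)
  set ls := chainLayers Q w κ K n f z D with hls
  have hlen : ls.length = n * w + κ := chainLayers_length _ _ _ _ _ _ _ _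
  have hG' : G n ++ encGates (layersGates Q (base + n * w * Q)
      ((List.range κ).map fun r => (K + f.toNat * κ + r, 2 ^ r))) =
      o₁ ++ encGates (layersGates Q base ls) := by
    simp only [G, hls, chainLayers]
    rw [layersGates_append, encGates_append, rows_length]
    simp only [List.append_assoc]
  rw [hG'] at s5
  let v₂ : Vars := { v with cur := (base + n * w * Q + κ * Q : ℕ), x := val (dropInts l n) }
  let F : ℕ → List Bool := fun t => o₁ ++ encGates (layersGates Q base ls) ++ encGates
    ((List.range t).map fun t => .CNOT (base + ls.length * Q + Q / 2 + t) (K + 2 * κ))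
  have s6 : Run W (.loop (.sub (.div (cell 7) (.const 2)) (cell 18))
    (QMAPlus.emitCNOT (.add (.add (cell 15) (.div (cell 7) (.const 2))) (cell 18)) outE ;;
      .assign (.const 18) (.add (cell 18) (.const 1)))) (cfg { v₂ with t := (0 : ℕ) } (F 0))
      (Q / 2 * (6 * B + 12 + 1) + 1) (cfg { v₂ with t := (Q / 2 : ℕ) } (F (Q / 2))) := by
    refine Run.loop_iterate (fun t => cfg { v₂ with t := (t : ℕ) } (F t)) (Q / 2) _ (by decide)
      (fun t ht => ?_) ?_ (fun t ht => ?_)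
    · change 0 < v.q / 2 - t
      omega
    · change ¬ 0 < v.q / 2 - (Q / 2 : ℕ)
      omega
    · have hlQ : ls.length * Q = n * w * Q + κ * Q := by rw [hlen]; ring
      have g1 := Run.emitCNOT (W := W) (v := { v₂ with t := (t : ℕ) }) (o := F t)
        (e := .add (.add (cell 15) (.div (cell 7) (.const 2))) (cell 18)) (f := outE)
        (base + ls.length * Q + Q / 2 + t) (K + 2 * κ) B hu (by
          change ((base + n * w * Q + κ * Q : ℕ) : ℤ) + v.q / 2 + (t : ℤ) = _
          rw [hlQ, hq]; push_cast; ring) (by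
          change v.kk + 2 * v.k = _
          rw [hK, hk]; push_cast; rfl) (by omega) (by omega) hB (by decide) (by decide)
      have g2 : ∀ o, Run W (.assign (.const 18) (.add (cell 18) (.const 1)))
          (cfg { v₂ with t := (t : ℕ) } o) 1 (cfg { v₂ with t := (t + 1 : ℕ) } o) := fun o =>
        Run.set (Vars.update_t _ _) rfl (by rw [Int.natAbs_natCast]; omega) (by decide) (by decide)
      have hF : F (t + 1) = F t ++ encGates [.CNOT (base + ls.length * Q + Q / 2 + t) (K + 2 * κ)] := by
        simp only [F]
        rw [List.range_succ, List.map_append, encGates_append, List.map_singleton]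
        simp only [List.append_assoc]
      rw [hF]
      exact (g1.seq (g2 _)).mono (by omega)
  have h60 : cfg { v₂ with t := (0 : ℕ) } (F 0) =
      cfg v₂ (o₁ ++ encGates (layersGates Q base ls)) := by
    have : ({ v₂ with t := (0 : ℕ) } : Vars) = v₂ := by simp [v₂, ht]
    rw [this]
    simp [F, encGates]
  rw [h60] at s6
  have s7 : Run W (.assign (.const 18) (.const 0)) (cfg { v₂ with t := (Q / 2 : ℕ) } (F (Q / 2))) 1
      (cfg { v₂ with t := 0 } (F (Q / 2))) :=
    Run.set (Vars.update_t _ _) rfl (by simp) (by decide) (by decide)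
  have s8 : Run W (.assign (.const 15) (.const 0)) (cfg { v₂ with t := 0 } (F (Q / 2))) 1
      (cfg { v with x := val (dropInts l n) } (F (Q / 2))) := by
    have hv : ({ v with x := val (dropInts l n) } : Vars) = { v₂ with t := 0, cur := 0 } := by
      simp [v₂, ht, hcur]
    rw [hv]
    exact Run.set (Vars.update_cur _ _) rfl (by simp) (by decide) (by decide)
  have hfin : o ++ encGates (chainGates Q (K + 2 * κ) base (kd * (Q / 4)) ls) = F (Q / 2) := by
    simp only [F, ho₁, chainGates, encGates_append, List.append_assoc]
  rw [hfin]
  have h := s1.seq (s2.seq (s3.seq (s4.seq (s5.seq (s6.seq (s7.seq s8))))))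
  refine h.mono ?_
  have hQ2 : Q / 2 * (6 * B + 12 + 1) ≤ Q * (6 * B + 20) := Nat.mul_le_mul (by omega) (by omega)
  have e1 : n * (5 * l.length + w * (Q * (30 * B + 50) + 10) + 20 + 1) =
    n * (5 * l.length + w * (Q * (30 * B + 50) + 10) + 21) := rfl
  omega

/-! ### Reading the input and the coins -/

/-- All variables are zero. -/
def Vars.zero : Vars :=
  ⟨0, 0, 0, 0, 0, 0, 0, 0, 0, 0, 0, 0, 0, 0, 0, 0, 0, 0, 0, 0, 0, 0, 0, 0, 0⟩

theorem Vars.zero_mem : Vars.zero.mem = fun _ => 0 := by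
  funext a
  unfold Vars.mem
  split <;> rfl

/-- The counterpart of `Run.set` for the phase in which input and coins are not yet used up. -/
theorem Run.setCell {W : ℕ} {a : ℤ} {e : Expr} {v v' : Vars} {inp co o : List Bool} {z : ℤ}
    (hf : Function.update v.mem a z = v'.mem) (hz : e.eval v.mem = z)
    (hv : z.natAbs < 2 ^ W) (ha : bitLen a ≤ 100) (he : e.size ≤ 300) :
    Run W (.assign (.const a) e) ⟨v.mem, inp, co, o⟩ 1 ⟨v'.mem, inp, co, o⟩ := by
  have h := Run.assign (W := W) (σ := ⟨v.mem, inp, co, o⟩) ha he (by rw [← hz] at hv; exact hv)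
  have h2 : e.eval (⟨v.mem, inp, co, o⟩ : Config).mem = z := hz
  rw [h2] at h
  simp only at h ⊢
  rwa [hf] at h

def readInput : Prog :=
  .assign (.const 2) (.const 1) ;; .read (.const 1) ;;
  .loop (.sub (.const 2) (cell 1))
    (.assign (.const 0) (.add (cell 0) (.mul (cell 1) (cell 2))) ;;
      .assign (.const 2) (.mul (.const 2) (cell 2)) ;;
      .assign (.const 3) (.add (cell 3) (.const 1)) ;; .read (.const 1)) ;;
  .assign (.const 2) (.const 0) ;; .assign (.const 3) (.add (cell 3) (.const 100)) ;;
  .assign (.const 1) (.const 0)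

/-- Cell 1 holds a lookahead bit, which is why the unread input is `l.tail`; the value `2` delivered
at the end of the input makes the loop condition fail. The whole input is packed into one integer,
first bit least significant. -/
theorem Run.readInput_loop {W : ℕ} (l : List Bool) (v : Vars) (co : List Bool) (X P j : ℕ)
    (hX : X < P) (hP : P * 2 ^ l.length < 2 ^ W) (hj : j + l.length < W) :
    Run W (.loop (.sub (.const 2) (cell 1))
    (.assign (.const 0) (.add (cell 0) (.mul (cell 1) (cell 2))) ;;
      .assign (.const 2) (.mul (.const 2) (cell 2)) ;;
      .assign (.const 3) (.add (cell 3) (.const 1)) ;; .read (.const 1)))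
      ⟨({ v with x := X, p := P, m := j, b := nextBit l } : Vars).mem, l.tail, co, []⟩
      (5 * l.length + 1)
      ⟨({ v with x := (X + P * val l : ℕ), p := (P * 2 ^ l.length : ℕ), m := (j + l.length : ℕ), b := 2 } :
        Vars).mem, [], co, []⟩ := by
  induction l generalizing X P j with
  | nil =>
    have h := Run.loop_done (W := W) (e := .sub (.const 2) (cell 1))
      (p := (.assign (.const 0) (.add (cell 0) (.mul (cell 1) (cell 2))) ;;
      .assign (.const 2) (.mul (.const 2) (cell 2)) ;;
      .assign (.const 3) (.add (cell 3) (.const 1)) ;; .read (.const 1)))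
      (σ := ⟨({ v with x := X, p := P, m := j, b := 2 } : Vars).mem, [], co, []⟩) (by decide)
      (by change ¬ (0 : ℤ) < 2 - 2; norm_num)
    simpa [val, nextBit] using h
  | cons b l ih =>
    have hb := b.toNat_le
    have hbit : nextBit (b :: l) = b.toNat := by cases b <;> rfl
    have hP' : 2 * P * 2 ^ l.length < 2 ^ W := by
      refine lt_of_le_of_lt (le_of_eq ?_) hP
      simp only [List.length_cons, pow_succ]
      ring
    have h2P : 2 * P < 2 ^ W := lt_of_le_of_lt (Nat.le_mul_of_pos_right _ (by positivity)) hP'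
    have hX' : X + P * b.toNat < 2 * P := by nlinarith
    have hlen : (b :: l).length = l.length + 1 := rfl
    have hW := Nat.lt_two_pow_self (n := W)
    have h := ih (X + P * b.toNat) (2 * P) (j + 1) hX' hP' (by omega)
    have s1 : Run W (.assign (.const 0) (.add (cell 0) (.mul (cell 1) (cell 2))))
        ⟨({ v with x := X, p := P, m := j, b := nextBit (b :: l) } : Vars).mem, l, co, []⟩ 1
        ⟨({ v with x := (X + P * b.toNat : ℕ), p := P, m := j, b := nextBit (b :: l) } : Vars).mem, l, co, []⟩ := by
      refine Run.setCell (Vars.update_x _ _) ?_ ?_ (by decide) (by decide)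
      · change (X : ℤ) + nextBit (b :: l) * P = _
        rw [hbit]; push_cast; ring
      · rw [Int.natAbs_natCast]; omega
    have s2 : Run W (.assign (.const 2) (.mul (.const 2) (cell 2)))
        ⟨({ v with x := (X + P * b.toNat : ℕ), p := P, m := j, b := nextBit (b :: l) } : Vars).mem, l, co, []⟩ 1
        ⟨({ v with x := (X + P * b.toNat : ℕ), p := (2 * P : ℕ), m := j, b := nextBit (b :: l) } : Vars).mem, l, co, []⟩ :=
      Run.setCell (Vars.update_p _ _) rfl (by rw [Int.natAbs_natCast]; omega) (by decide) (by decide)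
    have s3 : Run W (.assign (.const 3) (.add (cell 3) (.const 1)))
        ⟨({ v with x := (X + P * b.toNat : ℕ), p := (2 * P : ℕ), m := j, b := nextBit (b :: l) } : Vars).mem, l, co, []⟩ 1
        ⟨({ v with x := (X + P * b.toNat : ℕ), p := (2 * P : ℕ), m := (j + 1 : ℕ), b := nextBit (b :: l) } : Vars).mem, l, co, []⟩ :=
      Run.setCell (Vars.update_m _ _) rfl (by rw [Int.natAbs_natCast]; omega) (by decide) (by decide)
    have s4 := Run.read (W := W) (a := 1) (σ := ⟨({ v with x := (X + P * b.toNat : ℕ), p := (2 * P : ℕ), m := (j + 1 : ℕ), b := nextBit (b :: l) } : Vars).mem, l, co, []⟩) (by decide) (by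
      by_contra hcon
      have : W ≤ 1 := by omega
      have : 2 ^ W ≤ 2 ^ 1 := Nat.pow_le_pow_right (by norm_num) this
      omega)
    simp only [Vars.update_b] at s4
    have h' := Run.loop_step (W := W) (e := .sub (.const 2) (cell 1)) (by decide)
      (by
        change (0 : ℤ) < 2 - nextBit (b :: l)
        rw [hbit]
        omega) (s1.seq (s2.seq (s3.seq s4))) h
    have e1 : X + P * val (b :: l) = X + P * b.toNat + 2 * P * val l := by simp only [val]; ring
    have e2 : P * 2 ^ (b :: l).length = 2 * P * 2 ^ l.length := by rw [hlen, pow_succ]; ring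
    have e3 : j + (b :: l).length = j + 1 + l.length := by rw [hlen]; ring
    rw [e1, e2, e3]
    exact h'.mono (by omega)

/-- The parameter `m` is the input length plus 100: all later estimates compare powers of `m` and
rely on `m ≥ 100`, whatever the input is. -/
theorem Run.readInput {W : ℕ} (l co : List Bool) (hl : l.length + 100 < W) :
    Run W readInput (Config.init l co) (5 * l.length + 10)
      ⟨({ Vars.zero with x := val l, m := (l.length + 100 : ℕ) } : Vars).mem, [], co, []⟩ := by
  have hW1 : 2 ^ l.length < 2 ^ W := Nat.pow_lt_pow_right (by norm_num) (by omega)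
  have hW := Nat.lt_two_pow_self (n := W)
  have h0 : Config.init l co = ⟨Vars.zero.mem, l, co, []⟩ := by rw [Vars.zero_mem]; rfl
  rw [h0]
  have s1 : Run W (.assign (.const 2) (.const 1)) ⟨Vars.zero.mem, l, co, []⟩ 1
      ⟨({ Vars.zero with p := (1 : ℕ) } : Vars).mem, l, co, []⟩ :=
    Run.setCell (Vars.update_p _ _) rfl (by rw [Int.natAbs_natCast]; omega) (by decide) (by decide)
  have s2 := Run.read (W := W) (a := 1)
    (σ := ⟨({ Vars.zero with p := (1 : ℕ) } : Vars).mem, l, co, []⟩) (by decide) (by omega)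
  simp only [Vars.update_b] at s2
  have s3 := Run.readInput_loop (W := W) l Vars.zero co 0 1 0 (by omega) (by simpa using hW1)
    (by omega)
  have s4 : Run W (.assign (.const 2) (.const 0))
      ⟨({ Vars.zero with x := (0 + 1 * val l : ℕ), p := (1 * 2 ^ l.length : ℕ), m := (0 + l.length : ℕ), b := 2 } :
        Vars).mem, [], co, []⟩ 1
      ⟨({ Vars.zero with x := (0 + 1 * val l : ℕ), p := 0, m := (0 + l.length : ℕ), b := 2 } :
        Vars).mem, [], co, []⟩ :=
    Run.setCell (Vars.update_p _ _) rfl (by simp) (by decide) (by decide)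
  have s5 : Run W (.assign (.const 3) (.add (cell 3) (.const 100)))
      ⟨({ Vars.zero with x := (0 + 1 * val l : ℕ), p := 0, m := (0 + l.length : ℕ), b := 2 } :
        Vars).mem, [], co, []⟩ 1
      ⟨({ Vars.zero with x := (0 + 1 * val l : ℕ), p := 0, m := (0 + l.length + 100 : ℕ), b := 2 } :
        Vars).mem, [], co, []⟩ :=
    Run.setCell (Vars.update_m _ _) rfl (by rw [Int.natAbs_natCast]; omega) (by decide) (by decide)
  have s6 : Run W (.assign (.const 1) (.const 0))
      ⟨({ Vars.zero with x := (0 + 1 * val l : ℕ), p := 0, m := (0 + l.length + 100 : ℕ), b := 2 } :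
        Vars).mem, [], co, []⟩ 1
      ⟨({ Vars.zero with x := val l, m := (l.length + 100 : ℕ) } : Vars).mem, [], co, []⟩ := by
    have hv : ({ Vars.zero with x := val l, m := (l.length + 100 : ℕ) } : Vars) =
      { Vars.zero with x := (0 + 1 * val l : ℕ), p := 0, m := (0 + l.length + 100 : ℕ), b := 0 } := by
      simp [Vars.zero]
    rw [hv]
    exact Run.setCell (Vars.update_b _ _) rfl (by simp) (by decide) (by decide)
  exact (s1.seq (s2.seq (s3.seq (s4.seq (s5.seq s6))))).mono (by omega)

def readCoins : Prog :=
  .assign (.const 2) (.const 1) ;; .flip (.const 1) ;;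
  .loop (.sub (.const 2) (cell 1))
    (.assign (.const 4) (.add (cell 4) (.mul (cell 1) (cell 2))) ;;
      .assign (.const 2) (.mul (.const 2) (cell 2)) ;; .flip (.const 1)) ;;
  .assign (.const 2) (.const 0) ;; .assign (.const 1) (.const 0)

theorem Run.readCoins_loop {W : ℕ} (l : List Bool) (v : Vars) (X P : ℕ)
    (hX : X < P) (hP : P * 2 ^ l.length < 2 ^ W) :
    Run W (.loop (.sub (.const 2) (cell 1))
    (.assign (.const 4) (.add (cell 4) (.mul (cell 1) (cell 2))) ;;
      .assign (.const 2) (.mul (.const 2) (cell 2)) ;; .flip (.const 1)))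
      ⟨({ v with nc := X, p := P, b := nextBit l } : Vars).mem, [], l.tail, []⟩
      (4 * l.length + 1)
      ⟨({ v with nc := (X + P * val l : ℕ), p := (P * 2 ^ l.length : ℕ), b := 2 } :
        Vars).mem, [], [], []⟩ := by
  induction l generalizing X P with
  | nil =>
    have h := Run.loop_done (W := W) (e := .sub (.const 2) (cell 1))
      (p := (.assign (.const 4) (.add (cell 4) (.mul (cell 1) (cell 2))) ;;
      .assign (.const 2) (.mul (.const 2) (cell 2)) ;; .flip (.const 1)))
      (σ := ⟨({ v with nc := X, p := P, b := 2 } : Vars).mem, [], [], []⟩) (by decide)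
      (by change ¬ (0 : ℤ) < 2 - 2; norm_num)
    simpa [val, nextBit] using h
  | cons b l ih =>
    have hb := b.toNat_le
    have hbit : nextBit (b :: l) = b.toNat := by cases b <;> rfl
    have hP' : 2 * P * 2 ^ l.length < 2 ^ W := by
      refine lt_of_le_of_lt (le_of_eq ?_) hP
      simp only [List.length_cons, pow_succ]
      ring
    have h2P : 2 * P < 2 ^ W := lt_of_le_of_lt (Nat.le_mul_of_pos_right _ (by positivity)) hP'
    have hX' : X + P * b.toNat < 2 * P := by nlinarith
    have hlen : (b :: l).length = l.length + 1 := rfl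
    have h := ih (X + P * b.toNat) (2 * P) hX' hP'
    have s1 : Run W (.assign (.const 4) (.add (cell 4) (.mul (cell 1) (cell 2))))
        ⟨({ v with nc := X, p := P, b := nextBit (b :: l) } : Vars).mem, [], l, []⟩ 1
        ⟨({ v with nc := (X + P * b.toNat : ℕ), p := P, b := nextBit (b :: l) } : Vars).mem, [], l, []⟩ := by
      refine Run.setCell (Vars.update_nc _ _) ?_ ?_ (by decide) (by decide)
      · change (X : ℤ) + nextBit (b :: l) * P = _
        rw [hbit]; push_cast; ring
      · rw [Int.natAbs_natCast]; omega
    have s2 : Run W (.assign (.const 2) (.mul (.const 2) (cell 2)))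
        ⟨({ v with nc := (X + P * b.toNat : ℕ), p := P, b := nextBit (b :: l) } : Vars).mem, [], l, []⟩ 1
        ⟨({ v with nc := (X + P * b.toNat : ℕ), p := (2 * P : ℕ), b := nextBit (b :: l) } : Vars).mem, [], l, []⟩ :=
      Run.setCell (Vars.update_p _ _) rfl (by rw [Int.natAbs_natCast]; omega) (by decide) (by decide)
    have s4 := Run.flip (W := W) (a := 1) (σ := ⟨({ v with nc := (X + P * b.toNat : ℕ), p := (2 * P : ℕ), b := nextBit (b :: l) } : Vars).mem, [], l, []⟩) (by decide) (by
      by_contra hcon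
      have : W ≤ 1 := by omega
      have : 2 ^ W ≤ 2 ^ 1 := Nat.pow_le_pow_right (by norm_num) this
      omega)
    simp only [Vars.update_b] at s4
    have h' := Run.loop_step (W := W) (e := .sub (.const 2) (cell 1)) (by decide)
      (by
        change (0 : ℤ) < 2 - nextBit (b :: l)
        rw [hbit]
        omega) (s1.seq (s2.seq s4)) h
    have e1 : X + P * val (b :: l) = X + P * b.toNat + 2 * P * val l := by simp only [val]; ring
    have e2 : P * 2 ^ (b :: l).length = 2 * P * 2 ^ l.length := by rw [hlen, pow_succ]; ring
    rw [e1, e2]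
    exact h'.mono (by omega)

theorem Run.readCoins {W : ℕ} {v : Vars} (co : List Bool) (hnc : v.nc = 0) (hp : v.p = 0)
    (hb : v.b = 0) (hl : co.length + 2 < W) :
    Run W readCoins ⟨v.mem, [], co, []⟩ (4 * co.length + 10)
      (cfg { v with nc := val co } []) := by
  have hW1 : 2 ^ co.length < 2 ^ W := Nat.pow_lt_pow_right (by norm_num) (by omega)
  have hW := Nat.lt_two_pow_self (n := W)
  have s1 : Run W (.assign (.const 2) (.const 1)) ⟨v.mem, [], co, []⟩ 1
      ⟨({ v with nc := (0 : ℕ), p := (1 : ℕ) } : Vars).mem, [], co, []⟩ := by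
    rw [Nat.cast_zero, ← hnc]
    exact Run.setCell (Vars.update_p _ _) rfl (by rw [Int.natAbs_natCast]; omega) (by decide)
      (by decide)
  have s2 := Run.flip (W := W) (a := 1)
    (σ := ⟨({ v with nc := (0 : ℕ), p := (1 : ℕ) } : Vars).mem, [], co, []⟩) (by decide) (by omega)
  simp only [Vars.update_b] at s2
  have s3 := Run.readCoins_loop (W := W) co v 0 1 (by omega) (by simpa using hW1)
  have s4 : Run W (.assign (.const 2) (.const 0))
      ⟨({ v with nc := (0 + 1 * val co : ℕ), p := (1 * 2 ^ co.length : ℕ), b := 2 } :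
        Vars).mem, [], [], []⟩ 1
      ⟨({ v with nc := (0 + 1 * val co : ℕ), p := 0, b := 2 } : Vars).mem, [], [], []⟩ :=
    Run.setCell (Vars.update_p _ _) rfl (by simp) (by decide) (by decide)
  have s5 : Run W (.assign (.const 1) (.const 0))
      ⟨({ v with nc := (0 + 1 * val co : ℕ), p := 0, b := 2 } : Vars).mem, [], [], []⟩ 1
      (cfg { v with nc := val co } []) := by
    have hv : ({ v with nc := val co } : Vars) =
        { v with nc := (0 + 1 * val co : ℕ), p := 0, b := 0 } := by
      simp [hp, hb]
    rw [hv]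
    exact Run.setCell (Vars.update_b _ _) rfl (by simp) (by decide) (by decide)
  exact (s1.seq (s2.seq (s3.seq (s4.seq s5)))).mono (by omega)

/-! ### The tests of the super-verifier -/

/-- The parameters of a test: `m` is the length of the input plus `100`, `n` the dimension, `den` the
common denominator, `2 ^ (κ + 1)` the modulus of the one-hot counters, `kd` the kind of the test,
`d₁` and `d₂` its indices, and `ent` the numerators of the vector that is tested. -/
structure TestData where
  m : ℕ
  n : ℕ
  den : ℕ
  κ : ℕ
  kd : ℕ
  d₁ : ℕ
  d₂ : ℕ
  ent : ℕ → ℤ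

namespace TestData

variable (T : TestData)

/-- The modulus. -/
def Q : ℕ := 2 ^ (T.κ + 1)

/-- The number of bits of a coordinate. -/
def w : ℕ := T.m ^ 4

/-- The number of witness qubits. -/
def K : ℕ := T.m ^ 5

/-- The power of two by which the linear form is multiplied. -/
def pw : ℕ := 2 ^ (if T.d₁ = T.n then 0 else T.d₂)

/-- The numerators of the coefficients of the linear forms. -/
def numer (f : Bool) (i : ℕ) : ℤ :=
  if T.kd = 0 then (if f then 0 else T.Q * T.pw * T.m * T.m * T.ent i)
  else if i = (if f then T.d₂ else T.d₁) then T.Q else 0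

/-- The denominator of the coefficients of the linear forms. -/
def denom : ℤ := if T.kd = 0 then T.den else 4

/-- The constant terms of the linear forms. -/
def start : ℕ := T.kd * (T.Q / 4)

/-- The output wire. -/
def out : ℕ := T.K + 2 * T.κ

/-- The number of ancilla qubits. -/
def anc : ℕ := 2 * T.κ + 1 + 2 * ((T.n * T.w + (T.κ + 1)) * T.Q)

/-- The first wire of a chain. -/
def base (f : Bool) : ℕ := chainBase T.Q T.w T.κ T.K T.n f

def layers (f : Bool) : List (ℕ × ℕ) := chainLayers T.Q T.w T.κ T.K T.n f (T.numer f) T.denom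

def chain (f : Bool) : List RawGate := chainGates T.Q T.out (T.base f) T.start (T.layers f)

def hadamards : List RawGate := (List.range (2 * T.κ)).map fun r => .H (T.K + r)

/-- The circuit. -/
def gates : List RawGate := T.hadamards ++ T.chain false ++ T.chain true

/-- The test of the target vector. -/
def IsTarget : Prop := T.kd = 0 ∧ T.d₁ = T.n

instance : Decidable T.IsTarget := inferInstanceAs (Decidable (_ ∧ _))

def rNum : ℕ := if T.kd = 0 then (if T.d₁ = T.n then 13 else 0) else 10

def sNum : ℕ := if T.IsTarget then 7 else 1

def sDen : ℕ :=
  if T.IsTarget then 20 else 10000 * T.m ^ 4 * (if T.kd ≠ 0 ∧ T.d₁ = T.d₂ then 1 else T.m)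

/-- The output of the super-verifier. -/
def output : List Bool :=
  encUnary T.anc ++ encGates T.gates ++ [false] ++ encUnary T.out ++ encNat T.rNum ++ encNat 20 ++
    encNat T.sNum ++ encNat T.sDen

end TestData

/-! ### The program of the super-verifier -/

/-- Find a power of two that is at least `m ^ 16`, and store `m ^ 4` and `m ^ 5`. -/
def setModulus : Prog :=
  .assign (.const 23) (.mul (.mul (cell 3) (cell 3)) (.mul (cell 3) (cell 3))) ;;
  .assign (.const 24) (.mul (cell 23) (cell 3)) ;;
  .assign (.const 7) (.const 2) ;;
  .loop (.sub (.mul (.mul (cell 23) (cell 23)) (.mul (cell 23) (cell 23))) (cell 7))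
    (.assign (.const 7) (.mul (.const 2) (cell 7)) ;; .assign (.const 8) (.add (cell 8) (.const 1)))

/-- The exponent of the modulus. -/
def modExp (m : ℕ) : ℕ := Nat.clog 2 (m ^ 16) - 1

/-- This makes the truncated subtraction in `modExp` harmless and the modulus divisible by four. -/
theorem one_lt_clog {m : ℕ} (hm : 2 ≤ m) : 16 ≤ Nat.clog 2 (m ^ 16) := by
  by_contra h
  have h1 : m ^ 16 ≤ 2 ^ Nat.clog 2 (m ^ 16) := Nat.le_pow_clog (by norm_num) _
  have h2 : 2 ^ Nat.clog 2 (m ^ 16) ≤ 2 ^ 15 := Nat.pow_le_pow_right (by norm_num) (by omega)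
  have h3 : 2 ^ 16 ≤ m ^ 16 := Nat.pow_le_pow_left hm 16
  norm_num at h2 h3
  omega

theorem le_modulus {m : ℕ} (hm : 2 ≤ m) : m ^ 16 ≤ 2 ^ (modExp m + 1) := by
  have h := one_lt_clog hm
  have h1 : m ^ 16 ≤ 2 ^ Nat.clog 2 (m ^ 16) := Nat.le_pow_clog (by norm_num) _
  rwa [modExp, Nat.sub_add_cancel (by omega)]

theorem modulus_lt {m : ℕ} (hm : 2 ≤ m) : 2 ^ modExp m < m ^ 16 := by
  have h3 : 2 ^ 16 ≤ m ^ 16 := Nat.pow_le_pow_left hm 16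
  exact Nat.pow_pred_clog_lt_self (by norm_num) (by norm_num at h3; omega)

theorem Run.setModulus {W : ℕ} {v : Vars} (o : List Bool) (m : ℕ) (hm : v.m = m) (hm2 : 2 ≤ m)
    (hk : v.k = 0) (hW : 2 * m ^ 16 < 2 ^ W) :
    Run W setModulus (cfg v o) (3 * m ^ 16 + 10)
      (cfg { v with w := (m ^ 4 : ℕ), kk := (m ^ 5 : ℕ), q := (2 ^ (modExp m + 1) : ℕ), k := modExp m } o) := by
  have hp : ∀ j, j ≤ 16 → m ^ j ≤ m ^ 16 := fun j hj => Nat.pow_le_pow_right (by omega) hj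
  have h4 := hp 4 (by norm_num)
  have h5 := hp 5 (by norm_num)
  have h1 := hp 1 (by norm_num)
  have hlt := modulus_lt hm2
  have hexp := Nat.lt_two_pow_self (n := modExp m)
  let v₁ : Vars := { v with w := (m ^ 4 : ℕ), kk := (m ^ 5 : ℕ) }
  have s1 : Run W (.assign (.const 23) (.mul (.mul (cell 3) (cell 3)) (.mul (cell 3) (cell 3))))
      (cfg v o) 1 (cfg { v with w := (m ^ 4 : ℕ) } o) := by
    refine Run.set (Vars.update_w _ _) ?_ (by rw [Int.natAbs_natCast]; omega) (by decide) (by decide)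
    change v.m * v.m * (v.m * v.m) = _
    rw [hm]; push_cast; ring
  have s2 : Run W (.assign (.const 24) (.mul (cell 23) (cell 3)))
      (cfg { v with w := (m ^ 4 : ℕ) } o) 1 (cfg v₁ o) := by
    refine Run.set (Vars.update_kk _ _) ?_ (by rw [Int.natAbs_natCast]; omega) (by decide) (by decide)
    change ((m ^ 4 : ℕ) : ℤ) * v.m = _
    rw [hm]; push_cast; ring
  let S : ℕ → Config := fun j => cfg { v₁ with q := (2 ^ (j + 1) : ℕ), k := j } o
  have s3 : Run W (.assign (.const 7) (.const 2)) (cfg v₁ o) 1 (S 0) := by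
    have : ({ v₁ with q := (2 ^ (0 + 1) : ℕ), k := (0 : ℕ) } : Vars) = { v₁ with q := 2 } := by
      simp [v₁, hk]
    simp only [S, this]
    refine Run.set (Vars.update_q _ _) rfl ?_ (by decide) (by decide)
    change 2 < 2 ^ W
    have : 1 ≤ m ^ 16 := Nat.one_le_pow _ _ (by omega)
    have : 2 ^ 16 ≤ m ^ 16 := Nat.pow_le_pow_left hm2 16
    omega
  have s4 : Run W (.loop (.sub (.mul (.mul (cell 23) (cell 23)) (.mul (cell 23) (cell 23))) (cell 7))
    (.assign (.const 7) (.mul (.const 2) (cell 7)) ;; .assign (.const 8) (.add (cell 8) (.const 1))))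
      (S 0) (modExp m * (2 + 1) + 1) (S (modExp m)) := by
    refine Run.loop_iterate S _ _ (by decide) (fun j hj => ?_) ?_ (fun j hj => ?_)
    · change (0 : ℤ) < ((m ^ 4 : ℕ) : ℤ) * (m ^ 4 : ℕ) * (((m ^ 4 : ℕ) : ℤ) * (m ^ 4 : ℕ)) - (2 ^ (j + 1) : ℕ)
      have h : 2 ^ (j + 1) < m ^ 16 :=
        lt_of_le_of_lt (Nat.pow_le_pow_right (by norm_num) hj) hlt
      have h' : ((2 ^ (j + 1) : ℕ) : ℤ) < ((m ^ 16 : ℕ) : ℤ) := by exact_mod_cast h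
      have e : ((m ^ 4 : ℕ) : ℤ) * (m ^ 4 : ℕ) * (((m ^ 4 : ℕ) : ℤ) * (m ^ 4 : ℕ)) = (m ^ 16 : ℕ) := by
        push_cast; ring
      rw [e]
      omega
    · change ¬ (0 : ℤ) < ((m ^ 4 : ℕ) : ℤ) * (m ^ 4 : ℕ) * (((m ^ 4 : ℕ) : ℤ) * (m ^ 4 : ℕ)) -
        (2 ^ (modExp m + 1) : ℕ)
      have h' : ((m ^ 16 : ℕ) : ℤ) ≤ ((2 ^ (modExp m + 1) : ℕ) : ℤ) := by exact_mod_cast le_modulus hm2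
      have e : ((m ^ 4 : ℕ) : ℤ) * (m ^ 4 : ℕ) * (((m ^ 4 : ℕ) : ℤ) * (m ^ 4 : ℕ)) = (m ^ 16 : ℕ) := by
        push_cast; ring
      rw [e]
      omega
    · have h : 2 ^ (j + 1) < m ^ 16 :=
        lt_of_le_of_lt (Nat.pow_le_pow_right (by norm_num) hj) hlt
      refine Run.seq (k := 1) (l := 1)
        (τ := cfg { v₁ with q := (2 ^ (j + 1 + 1) : ℕ), k := j } o) ?_ ?_
      · refine Run.set (Vars.update_q _ _) ?_ ?_ (by decide) (by decide)
        · change 2 * ((2 ^ (j + 1) : ℕ) : ℤ) = _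
          push_cast; ring
        · rw [Int.natAbs_natCast, pow_succ]; omega
      · exact Run.set (Vars.update_k _ _) rfl (by rw [Int.natAbs_natCast]; omega) (by decide)
          (by decide)
  exact (s1.seq (s2.seq (s3.seq s4))).mono (by omega)

/-- Determine the kind and the indices of the test. -/
def setTest : Prog :=
  .assign (.const 11) (modE (cell 4) (.const 2)) ;;
  .assign (.const 9) (modE (.div (cell 4) (.const 2)) (.mul (.mul (cell 3) (cell 3)) (cell 3))) ;;
  .assign (.const 10) (modE (.div (.div (cell 4) (.const 2)) (.mul (.mul (cell 3) (cell 3)) (cell 3)))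
    (.mul (.mul (cell 3) (cell 3)) (cell 3))) ;;
  .assign (.const 12) (.const 1) ;;
  .assign (.const 16) (.mul (cell 10) (.sub (.const 1) (eqE (cell 9) (cell 5)))) ;;
  .loop (cell 16) (.assign (.const 12) (.mul (.const 2) (cell 12)) ;;
    .assign (.const 16) (.sub (cell 16) (.const 1)))

/-- The coin number is read in mixed radix 2, m³, m³ as kind, row and exponent. The factor `1 - eqE`
cancels the exponent when the row is the target, which is tested without scaling. -/
theorem Run.setTest {W : ℕ} {v : Vars} (o : List Bool) (m n c kd d₁ d₂ : ℕ) (hm : v.m = m)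
    (hn : v.n = n) (hc : v.nc = c) (hi : v.i = 0) (hkd : kd = c % 2) (hd₁ : d₁ = c / 2 % m ^ 3)
    (hd₂ : d₂ = c / 2 / m ^ 3 % m ^ 3) (hm0 : 0 < m) (hW : m ^ 3 < W) :
    Run W setTest (cfg v o) (3 * m ^ 3 + 10)
      (cfg { v with kd := kd, d₁ := d₁, d₂ := d₂, pw := (2 ^ (if d₁ = n then 0 else d₂) : ℕ) } o) := by
  have hm3 : 0 < m ^ 3 := by positivity
  have hWW := Nat.lt_two_pow_self (n := W)
  have hd₁' : d₁ < m ^ 3 := hd₁ ▸ Nat.mod_lt _ hm3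
  have hd₂' : d₂ < m ^ 3 := hd₂ ▸ Nat.mod_lt _ hm3
  have hkd' : kd < 2 := hkd ▸ Nat.mod_lt _ (by norm_num)
  have s1 : Run W (.assign (.const 11) (modE (cell 4) (.const 2))) (cfg v o) 1
      (cfg { v with kd := kd } o) := by
    refine Run.set (Vars.update_kd _ _) ?_ (by rw [Int.natAbs_natCast]; omega) (by decide) (by decide)
    rw [modE_eval]
    change v.nc % 2 = _
    rw [hc, hkd]; push_cast; rfl
  have s2 : Run W (.assign (.const 9) (modE (.div (cell 4) (.const 2)) (.mul (.mul (cell 3) (cell 3)) (cell 3))))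
      (cfg { v with kd := kd } o) 1 (cfg { v with kd := kd, d₁ := d₁ } o) := by
    refine Run.set (Vars.update_d₁ _ _) ?_ (by rw [Int.natAbs_natCast]; omega) (by decide) (by decide)
    rw [modE_eval]
    change v.nc / 2 % (v.m * v.m * v.m) = _
    rw [hc, hd₁, hm]; push_cast; congr 1; ring
  have s3 : Run W (.assign (.const 10) (modE (.div (.div (cell 4) (.const 2)) (.mul (.mul (cell 3) (cell 3)) (cell 3)))
    (.mul (.mul (cell 3) (cell 3)) (cell 3))))
      (cfg { v with kd := kd, d₁ := d₁ } o) 1 (cfg { v with kd := kd, d₁ := d₁, d₂ := d₂ } o) := by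
    refine Run.set (Vars.update_d₂ _ _) ?_ (by rw [Int.natAbs_natCast]; omega) (by decide) (by decide)
    rw [modE_eval]
    change v.nc / 2 / (v.m * v.m * v.m) % (v.m * v.m * v.m) = _
    have e : (m : ℤ) * m * m = (m ^ 3 : ℕ) := by push_cast; ring
    rw [hc, hd₂, hm, e]; push_cast; rfl
  set L := if d₁ = n then 0 else d₂ with hL
  have hLm : L < m ^ 3 := by rw [hL]; split_ifs <;> omega
  let v₁ : Vars := { v with kd := kd, d₁ := d₁, d₂ := d₂ }
  have s4 : Run W (.assign (.const 12) (.const 1)) (cfg v₁ o) 1 (cfg { v₁ with pw := 1 } o) :=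
    Run.set (Vars.update_pw _ _) rfl (by rw [Int.natAbs_one]; omega) (by decide) (by decide)
  let S : ℕ → Config := fun j => cfg { v₁ with pw := (2 ^ j : ℕ), i := (L : ℤ) - j } o
  have s5 : Run W (.assign (.const 16) (.mul (cell 10) (.sub (.const 1) (eqE (cell 9) (cell 5)))))
      (cfg { v₁ with pw := 1 } o) 1 (S 0) := by
    refine Run.set (Vars.update_i _ _) ?_ (by omega) (by decide) (by decide)
    change (d₂ : ℤ) * (1 - (1 : ℤ) / (1 + ((d₁ : ℤ) - v.n) * (d₁ - v.n))) = _
    rw [one_div_one_add_sq, hn, hL]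
    by_cases h : d₁ = n
    · simp [h]
    · have : (d₁ : ℤ) ≠ n := by exact_mod_cast h
      simp [h]
  have s6 : Run W (.loop (cell 16) (.assign (.const 12) (.mul (.const 2) (cell 12)) ;;
    .assign (.const 16) (.sub (cell 16) (.const 1)))) (S 0) (L * (2 + 1) + 1) (S L) := by
    refine Run.loop_iterate S _ _ (by decide) (fun j hj => ?_) ?_ (fun j hj => ?_)
    · change (0 : ℤ) < (L : ℤ) - j
      omega
    · change ¬ (0 : ℤ) < (L : ℤ) - L
      omega
    · refine Run.seq (k := 1) (l := 1)
        (τ := cfg { v₁ with pw := (2 ^ (j + 1) : ℕ), i := (L : ℤ) - j } o) ?_ ?_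
      · refine Run.set (Vars.update_pw _ _) ?_ ?_ (by decide) (by decide)
        · change 2 * ((2 ^ j : ℕ) : ℤ) = _
          push_cast; ring
        · rw [Int.natAbs_natCast]; exact Nat.pow_lt_pow_right (by norm_num) (by omega)
      · refine Run.set (Vars.update_i _ _) ?_ ?_ (by decide) (by decide)
        · change (L : ℤ) - j - 1 = _
          push_cast; ring
        · push_cast; omega
  have hS : S L = cfg { v with kd := kd, d₁ := d₁, d₂ := d₂, pw := (2 ^ L : ℕ) } o := by
    simp [S, v₁, hi]
  rw [hS] at s6
  exact (s1.seq (s2.seq (s3.seq (s4.seq (s5.seq s6))))).mono (by omega)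

/-- Skip the rows before the row `d₁`. -/
def skipRows : Prog :=
  .assign (.const 16) (.mul (cell 9) (cell 5)) ;;
  .loop (cell 16) (readInt ;; .assign (.const 16) (.sub (cell 16) (.const 1))) ;;
  .assign (.const 13) (.const 0)

theorem Run.skipRows {W : ℕ} {v : Vars} (o l : List Bool) (N : ℕ) (hx : v.x = val l)
    (hN : v.d₁ * v.n = N) (hi : v.i = 0) (ha : v.a = 0) (hp : v.p = 0) (hs : v.s = 0)
    (hl : l.length < W) (hNW : N < 2 ^ W) :
    Run W skipRows (cfg v o) (N * (5 * l.length + 12) + 5)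
      (cfg { v with x := val (dropInts l N) } o) := by
  have s1 : Run W (.assign (.const 16) (.mul (cell 9) (cell 5))) (cfg v o) 1
      (cfg { v with i := N } o) :=
    Run.set (Vars.update_i _ _) hN (by rw [Int.natAbs_natCast]; omega) (by decide) (by decide)
  -- The variable `a` keeps the number read last; before the first round it is still zero.
  let A : ℕ → ℤ := fun j => match j with | 0 => 0 | j + 1 => entry l j
  let S : ℕ → Config := fun j => cfg { v with x := val (dropInts l j), a := A j, i := (N : ℤ) - j } o
  have s2 : Run W (.loop (cell 16) (QMAPlus.readInt ;; .assign (.const 16) (.sub (cell 16) (.const 1))))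
      (S 0) (N * (5 * l.length + 10 + 1) + 1) (S N) := by
    refine Run.loop_iterate S _ _ (by decide) (fun j hj => ?_) ?_ (fun j hj => ?_)
    · change (0 : ℤ) < (N : ℤ) - j
      omega
    · change ¬ (0 : ℤ) < (N : ℤ) - N
      omega
    · have hlen := dropInts_length l j
      have g1 := Run.readInt (W := W) (l := dropInts l j) (v := { v with x := val (dropInts l j), a := A j, i := (N : ℤ) - j }) o rfl hp hs (by omega)
      have g2 : Run W (.assign (.const 16) (.sub (cell 16) (.const 1)))
          (cfg { v with x := val (dropInts l (j + 1)), a := A (j + 1), i := (N : ℤ) - j } o) 1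
          (S (j + 1)) := by
        refine Run.set (Vars.update_i _ _) ?_ ?_ (by decide) (by decide)
        · change (N : ℤ) - j - 1 = _
          push_cast; ring
        · push_cast; omega
      exact (g1.seq g2).mono (by omega)
  have h0 : S 0 = cfg { v with i := N } o := by simp [S, A, dropInts, hx, ha]
  rw [h0] at s2
  have s3 : Run W (.assign (.const 13) (.const 0)) (S N) 1
      (cfg { v with x := val (dropInts l N) } o) := by
    have hv : ({ v with x := val (dropInts l N) } : Vars) =
        { v with x := val (dropInts l N), a := 0, i := (N : ℤ) - N } := by simp [hi, ha]
    rw [hv]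
    exact Run.set (Vars.update_a _ _) rfl (by simp) (by decide) (by decide)
  refine (s1.seq (s2.seq s3)).mono ?_
  have : N * (5 * l.length + 10 + 1) ≤ N * (5 * l.length + 12) := Nat.mul_le_mul_left _ (by omega)
  omega

/-- Print the Hadamard gates. -/
def emitHadamards : Prog :=
  .loop (.sub (.mul (.const 2) (cell 8)) (cell 16))
    (emitH (.add (cell 24) (cell 16)) ;; .assign (.const 16) (.add (cell 16) (.const 1))) ;;
  .assign (.const 16) (.const 0)

theorem Run.emitHadamards {W : ℕ} {v : Vars} (o : List Bool) (K κ B : ℕ) (hk : v.k = κ)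
    (hK : v.kk = K) (hi : v.i = 0) (hu : v.u = 0) (hKB : K + 2 * κ ≤ B) (hB : B < 2 ^ W) :
    Run W emitHadamards (cfg v o) (2 * κ * (3 * B + 10) + 2)
      (cfg v (o ++ encGates ((List.range (2 * κ)).map fun r => .H (K + r)))) := by
  let G : ℕ → List Bool := fun i => o ++ encGates ((List.range i).map fun r => .H (K + r))
  have s1 : Run W (.loop (.sub (.mul (.const 2) (cell 8)) (cell 16))
      (QMAPlus.emitH (.add (cell 24) (cell 16)) ;; .assign (.const 16) (.add (cell 16) (.const 1))))
      (cfg { v with i := (0 : ℕ) } (G 0)) (2 * κ * (3 * B + 9 + 1) + 1)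
      (cfg { v with i := (2 * κ : ℕ) } (G (2 * κ))) := by
    refine Run.loop_iterate (fun i => cfg { v with i := (i : ℕ) } (G i)) _ _ (by decide)
      (fun i hi => ?_) ?_ (fun i hi => ?_)
    · change 0 < 2 * v.k - i
      omega
    · change ¬ 0 < 2 * v.k - (2 * κ : ℕ)
      omega
    · have g1 := Run.emitH (W := W) (v := { v with i := (i : ℕ) }) (o := G i)
        (e := .add (cell 24) (cell 16)) (K + i) B hu (by
          change v.kk + (i : ℤ) = _
          rw [hK]; push_cast; rfl) (by omega) hB (by decide)
      have g2 : ∀ o, Run W (.assign (.const 16) (.add (cell 16) (.const 1)))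
          (cfg { v with i := (i : ℕ) } o) 1 (cfg { v with i := (i + 1 : ℕ) } o) := fun o =>
        Run.set (Vars.update_i _ _) rfl (by rw [Int.natAbs_natCast]; omega) (by decide) (by decide)
      have hG : G (i + 1) = G i ++ encGates [.H (K + i)] := by
        simp only [G]
        rw [List.range_succ, List.map_append, encGates_append, List.map_singleton]
        simp only [List.append_assoc]
      rw [hG]
      exact (g1.seq (g2 _)).mono (by omega)
  have h0 : cfg { v with i := (0 : ℕ) } (G 0) = cfg v o := by
    have : ({ v with i := (0 : ℕ) } : Vars) = v := by simp [← hi]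
    rw [this]
    simp [G, encGates]
  rw [h0] at s1
  have s2 : Run W (.assign (.const 16) (.const 0)) (cfg { v with i := (2 * κ : ℕ) } (G (2 * κ))) 1
      (cfg v (G (2 * κ))) := by
    have hv : v = { v with i := 0 } := by rw [← hi]
    conv_rhs => rw [hv]
    exact Run.set (Vars.update_i _ _) rfl (by simp) (by decide) (by decide)
  exact (s1.seq s2).mono le_rfl

/-- One if the target vector is tested, and zero otherwise. -/
abbrev targetE : Expr := .mul (.sub (.const 1) (cell 11)) (eqE (cell 9) (cell 5))

abbrev sDenE : Expr :=
  .add (.mul targetE (.const 20)) (.mul (.sub (.const 1) targetE)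
    (.mul (.mul (.const 10000) (cell 23)) (.sub (cell 3) (.mul (.mul (cell 11)
      (eqE (cell 9) (cell 10))) (.sub (cell 3) (.const 1))))))

/-- Print the output wire and the numbers `r` and `s`. -/
def emitTail : Prog :=
  emitBits [false] ;; emitUnary outE ;;
  emitNat (.add (.mul (.const 10) (cell 11)) (.mul (.const 13) targetE)) ;; emitNat (.const 20) ;;
  emitNat (.add (.const 1) (.mul (.const 6) targetE)) ;; emitNat sDenE

/-- The variables describe the test. -/
structure TestData.Describes (T : TestData) (v : Vars) : Prop where
  m : v.m = T.m
  n : v.n = T.n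
  den : v.den = T.den
  q : v.q = T.Q
  k : v.k = T.κ
  d₁ : v.d₁ = T.d₁
  d₂ : v.d₂ = T.d₂
  kd : v.kd = T.kd
  pw : v.pw = T.pw
  w : v.w = T.w
  kk : v.kk = T.K
  p : v.p = 0
  a : v.a = 0
  s : v.s = 0
  cur : v.cur = 0
  i : v.i = 0
  j : v.j = 0
  t : v.t = 0
  u : v.u = 0
  num : v.num = 0
  dd : v.dd = 0
  c : v.c = 0

/-- The sizes of the parameters of a test. -/
structure TestData.Valid (T : TestData) : Prop where
  m : 100 ≤ T.m
  n : T.n ≤ T.m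
  den : T.den < 2 ^ T.m
  κ : T.κ = modExp T.m
  kd : T.kd ≤ 1
  d₁ : T.d₁ < T.m ^ 3
  d₂ : T.d₂ < T.m ^ 3
  ent : ∀ i, (T.ent i).natAbs < 2 ^ T.m

theorem eval_targetE {T : TestData} {v : Vars} (h : T.Describes v) (hkd : T.kd ≤ 1) :
    targetE.eval v.mem = if T.IsTarget then 1 else 0 := by
  change (1 - v.kd) * ((1 : ℤ) / (1 + (v.d₁ - v.n) * (v.d₁ - v.n))) = _
  rw [one_div_one_add_sq, h.kd, h.d₁, h.n]
  rcases Nat.le_one_iff_eq_zero_or_eq_one.1 hkd with hk | hk <;> by_cases hd : T.d₁ = T.n <;>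
    simp [TestData.IsTarget, hk, hd]

theorem numer_eq {T : TestData} {v : Vars} (h : T.Describes v) (hkd : T.kd ≤ 1) (a : ℤ) (f : Bool)
    (i : ℕ) (ha : f = false → a = T.ent i) : v.numer f a i = T.numer f i := by
  unfold Vars.numer TestData.numer
  rw [h.kd, h.q, h.pw, h.m, h.d₁, h.d₂]
  interval_cases hk : T.kd
  · cases f
    · simp [ha rfl]
    · simp
  · cases f <;> simp

theorem denom_eq {T : TestData} {v : Vars} (h : T.Describes v) (hkd : T.kd ≤ 1) :
    v.denom = T.denom := by
  unfold Vars.denom TestData.denom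
  rw [h.kd, h.den]
  interval_cases hk : T.kd <;> simp

/-! ### Sizes of the numbers that occur in a test -/

namespace TestData.Valid

variable {T : TestData}

theorem le_Q (h : T.Valid) : T.m ^ 16 ≤ T.Q := by
  rw [TestData.Q, h.κ]
  exact le_modulus (by have := h.m; omega)

theorem Q_lt (h : T.Valid) : T.Q < 2 * T.m ^ 16 := by
  rw [TestData.Q, h.κ, pow_succ]
  have := modulus_lt (m := T.m) (by have := h.m; omega)
  omega

/-- From `m < 2 ^ m` one gets `m ^ 100 < 2 ^ (100 * m)`, and `100 * m ≤ m ^ 2`. -/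
theorem pow_lt_two_pow (h : T.Valid) (j : ℕ) (hj : j ≤ 100) : T.m ^ j < 2 ^ (T.m ^ 2) := by
  have h0 := h.m
  have h1 : T.m ^ j ≤ T.m ^ 100 := Nat.pow_le_pow_right (by omega) hj
  have h2 : T.m ^ 100 < (2 ^ T.m) ^ 100 := Nat.pow_lt_pow_left Nat.lt_two_pow_self (by norm_num)
  have h3 : (2 ^ T.m) ^ 100 ≤ 2 ^ (T.m ^ 2) := by
    rw [← pow_mul]
    exact Nat.pow_le_pow_right (by norm_num) (by nlinarith)
  omega

theorem κ_lt (h : T.Valid) : T.κ + 1 ≤ T.m ^ 2 := by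
  have h1 : 2 ^ T.κ < 2 ^ (T.m ^ 2) := by
    rw [h.κ]
    exact (modulus_lt (by have := h.m; omega)).trans (h.pow_lt_two_pow 16 (by norm_num))
  exact (Nat.pow_lt_pow_iff_right (by norm_num)).1 h1

/-- A constant up to 100 is absorbed by one further factor `m`. The polynomial bounds below are
obtained by feeding instances of this to `omega`. -/
theorem mul_pow_le (h : T.Valid) (c j k : ℕ) (hc : c ≤ 100) (hjk : j < k) : c * T.m ^ j ≤ T.m ^ k := by
  have := h.m
  calc c * T.m ^ j ≤ T.m * T.m ^ j := Nat.mul_le_mul_right _ (by omega)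
    _ = T.m ^ (j + 1) := by ring
    _ ≤ T.m ^ k := Nat.pow_le_pow_right (by omega) hjk

theorem size_le (h : T.Valid) : (T.n * T.w + (T.κ + 1)) * T.Q ≤ T.m ^ 22 := by
  have h1 : T.n * T.w ≤ T.m ^ 5 := by
    calc T.n * T.w ≤ T.m * T.m ^ 4 := Nat.mul_le_mul_right _ h.n
      _ = T.m ^ 5 := by ring
  have h2 := h.κ_lt
  have h3 := h.mul_pow_le 1 2 5 (by norm_num) (by norm_num)
  calc (T.n * T.w + (T.κ + 1)) * T.Q ≤ (2 * T.m ^ 5) * (2 * T.m ^ 16) :=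
        Nat.mul_le_mul (by omega) h.Q_lt.le
    _ = 4 * T.m ^ 21 := by ring
    _ ≤ T.m ^ 22 := h.mul_pow_le 4 21 22 (by norm_num) (by norm_num)

/-- It makes `m ^ 23` a common bound for all wire numbers. -/
theorem total_le (h : T.Valid) (f : Bool) :
    T.base f + (T.n * T.w + (T.κ + 1)) * T.Q + 2 * T.Q + T.anc + T.out ≤ T.m ^ 23 := by
  have h1 := h.size_le
  have h2 := h.κ_lt
  have h3 := h.Q_lt
  have h4 := h.mul_pow_le 10 2 22 (by norm_num) (by norm_num)
  have h5 := h.mul_pow_le 10 5 22 (by norm_num) (by norm_num)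
  have h6 := h.mul_pow_le 10 16 22 (by norm_num) (by norm_num)
  have h7 := h.mul_pow_le 20 22 23 (by norm_num) (by norm_num)
  have h8 : f.toNat * ((T.n * T.w + (T.κ + 1)) * T.Q) ≤ 1 * ((T.n * T.w + (T.κ + 1)) * T.Q) :=
    Nat.mul_le_mul_right _ f.toNat_le
  simp only [TestData.base, chainBase, TestData.anc, TestData.out, TestData.K]
  omega

/-- The dominant factor is the power of two, with exponent below m³. With the shift by m⁴ digits in
the denominator this is why `m ^ 5` bits per memory cell suffice. -/
theorem numer_lt (h : T.Valid) (f : Bool) (i : ℕ) : (T.numer f i).natAbs < 2 ^ (T.m ^ 5) := by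
  have hm := h.m
  have hQ : T.Q < 2 ^ (T.m ^ 2) := by
    have := h.Q_lt
    have := h.mul_pow_le 2 16 17 (by norm_num) (by norm_num)
    have := h.pow_lt_two_pow 17 (by norm_num)
    omega
  have hpw : T.pw ≤ 2 ^ T.m ^ 3 := by
    refine Nat.pow_le_pow_right (by norm_num) ?_
    have := h.d₂
    split_ifs <;> omega
  have hm2 : T.m < 2 ^ T.m := Nat.lt_two_pow_self
  have hent := h.ent i
  have hexp : T.m ^ 2 + T.m ^ 3 + T.m + T.m + T.m ≤ T.m ^ 5 := by
    have h2 := h.mul_pow_le 10 2 4 (by norm_num) (by norm_num)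
    have h3 := h.mul_pow_le 10 3 4 (by norm_num) (by norm_num)
    have h4 := h.mul_pow_le 10 1 4 (by norm_num) (by norm_num)
    have h5 := h.mul_pow_le 10 4 5 (by norm_num) (by norm_num)
    rw [pow_one] at h4
    omega
  have hQ5 : T.Q < 2 ^ (T.m ^ 5) := hQ.trans_le (Nat.pow_le_pow_right (by norm_num) (by omega))
  unfold TestData.numer
  split_ifs
  · simp
  · rw [Int.natAbs_mul, Int.natAbs_mul, Int.natAbs_mul, Int.natAbs_mul]
    simp only [Int.natAbs_natCast]
    calc T.Q * T.pw * T.m * T.m * (T.ent i).natAbs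
        < 2 ^ (T.m ^ 2) * 2 ^ (T.m ^ 3) * 2 ^ T.m * 2 ^ T.m * 2 ^ T.m := by
          refine Nat.mul_lt_mul_of_le_of_lt (by gcongr) hent (by positivity)
      _ = 2 ^ (T.m ^ 2 + T.m ^ 3 + T.m + T.m + T.m) := by simp only [pow_add]
      _ ≤ 2 ^ (T.m ^ 5) := Nat.pow_le_pow_right (by norm_num) hexp
  all_goals first | simpa using hQ5 | simp

theorem denom_lt (h : T.Valid) : T.denom.natAbs * 2 ^ T.w < 2 ^ (T.m ^ 5) := by
  have hm := h.m
  have h1 : T.denom.natAbs < 2 ^ T.m := by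
    unfold TestData.denom
    split_ifs
    · simpa using h.den
    · have : 2 ^ 3 ≤ 2 ^ T.m := Nat.pow_le_pow_right (by norm_num) (by omega)
      change 4 < _
      omega
  have h4 := h.mul_pow_le 10 1 4 (by norm_num) (by norm_num)
  have h5 := h.mul_pow_le 10 4 5 (by norm_num) (by norm_num)
  rw [pow_one] at h4
  calc T.denom.natAbs * 2 ^ T.w < 2 ^ T.m * 2 ^ T.w := Nat.mul_lt_mul_of_pos_right h1 (by positivity)
    _ = 2 ^ (T.m + T.w) := by rw [pow_add]
    _ ≤ 2 ^ (T.m ^ 5) := Nat.pow_le_pow_right (by norm_num) (by unfold TestData.w; omega)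

end TestData.Valid

/-! ### Running time of the whole program -/

/-- Print a test. -/
def emitTest : Prog :=
  emitUnary (.add (.add (.mul (.const 2) (cell 8)) (.const 1)) (.mul (.const 2)
    (.mul (.add (.mul (cell 5) (cell 23)) (.add (cell 8) (.const 1))) (cell 7)))) ;;
  emitHadamards ;; emitChain false ;; emitChain true ;; emitTail

theorem Run.emitTail {T : TestData} {v : Vars} (hT : T.Valid) (hv : T.Describes v)
    (o : List Bool) :
    Run (T.m ^ 5) emitTail (cfg v o) (T.m ^ 25) (cfg v (o ++ ([false] ++ encUnary T.out ++
      encNat T.rNum ++ encNat 20 ++ encNat T.sNum ++ encNat T.sDen))) := by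
  have hm := hT.m
  have htot := hT.total_le false
  have hB : T.m ^ 23 < 2 ^ (T.m ^ 5) := (hT.pow_lt_two_pow 23 (by norm_num)).trans_le
    (Nat.pow_le_pow_right (by norm_num) (Nat.pow_le_pow_right (by omega) (by norm_num)))
  have h20 : 100 ≤ T.m ^ 23 := hm.trans (Nat.le_self_pow (by norm_num) _)
  have hsd : T.sDen ≤ T.m ^ 23 := by
    unfold TestData.sDen
    split_ifs
    · omega
    · calc 10000 * T.m ^ 4 * 1 = 100 * (100 * T.m ^ 4) := by ring
        _ ≤ 100 * T.m ^ 5 := Nat.mul_le_mul_left _ (hT.mul_pow_le 100 4 5 le_rfl (by norm_num))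
        _ ≤ T.m ^ 23 := hT.mul_pow_le 100 5 23 le_rfl (by norm_num)
    · calc 10000 * T.m ^ 4 * T.m = 100 * (100 * T.m ^ 5) := by ring
        _ ≤ 100 * T.m ^ 6 := Nat.mul_le_mul_left _ (hT.mul_pow_le 100 5 6 le_rfl (by norm_num))
        _ ≤ T.m ^ 23 := hT.mul_pow_le 100 6 23 le_rfl (by norm_num)
  have htE := eval_targetE hv hT.kd
  have s1 := Run.emitBits (W := T.m ^ 5) v [false] o
  have s2 := fun o => Run.emitUnary (W := T.m ^ 5) (v := v) (o := o) (e := outE) T.out hv.u (by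
    change v.kk + 2 * v.k = _
    rw [hv.kk, hv.k, TestData.out]; push_cast; rfl) (by omega) (by decide)
  have s3 := fun o => Run.emitNat (W := T.m ^ 5) (v := v) (o := o)
    (e := .add (.mul (.const 10) (cell 11)) (.mul (.const 13) targetE)) T.rNum hv.u (by
      change 10 * v.kd + 13 * targetE.eval v.mem = _
      rw [htE, hv.kd]
      rcases Nat.le_one_iff_eq_zero_or_eq_one.1 hT.kd with hk | hk <;> by_cases hd : T.d₁ = T.n <;>
        simp [TestData.rNum, TestData.IsTarget, hk, hd]) (by
      have : T.rNum ≤ 13 := by unfold TestData.rNum; split_ifs <;> omega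
      omega) (by decide)
  have s4 := fun o => Run.emitNat (W := T.m ^ 5) (v := v) (o := o) (e := .const 20) 20 hv.u rfl
    (by omega) (by decide)
  have s5 := fun o => Run.emitNat (W := T.m ^ 5) (v := v) (o := o)
    (e := .add (.const 1) (.mul (.const 6) targetE)) T.sNum hv.u (by
      change 1 + 6 * targetE.eval v.mem = _
      rw [htE]
      unfold TestData.sNum
      split_ifs <;> rfl) (by
      have : T.sNum ≤ 7 := by unfold TestData.sNum; split_ifs <;> omega
      omega) (by decide)
  have s6 := fun o => Run.emitNat (W := T.m ^ 5) (v := v) (o := o) (e := sDenE) T.sDen hv.u (by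
      change targetE.eval v.mem * 20 + (1 - targetE.eval v.mem) * (10000 * v.w *
        (v.m - v.kd * ((1 : ℤ) / (1 + (v.d₁ - v.d₂) * (v.d₁ - v.d₂))) * (v.m - 1))) = _
      rw [htE, one_div_one_add_sq, hv.kd, hv.d₁, hv.d₂, hv.w, hv.m, TestData.w]
      unfold TestData.sDen
      by_cases hI : T.IsTarget
      · simp [hI]
      · simp only [hI, if_false]
        rcases Nat.le_one_iff_eq_zero_or_eq_one.1 hT.kd with hk | hk
        · simp [hk]
        · by_cases h : T.d₁ = T.d₂ <;> simp [h, hk]) (by omega) (by decide)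
  have hs := s1.seq ((s2 _).seq ((s3 _).seq ((s4 _).seq ((s5 _).seq (s6 _)))))
  simp only [List.append_assoc] at hs ⊢
  refine hs.mono ?_
  have h1 := hT.mul_pow_le 50 5 23 (by norm_num) (by norm_num)
  have h2 := hT.mul_pow_le 50 23 25 (by norm_num) (by norm_num)
  have : T.out ≤ T.m ^ 23 := by omega
  have : [false].length = 1 := rfl
  omega

/-- The final content of `x` is left unspecified because nothing is read afterwards. The second
chain starts reading where the first one stopped; its coefficients do not depend on what it reads.
-/
theorem Run.emitTest {T : TestData} {v : Vars} (hT : T.Valid) (hv : T.Describes v) (l : List Bool)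
    (hx : v.x = val l) (hl : l.length ≤ T.m) (hent : T.ent = entry l) :
    ∃ x' : ℤ, Run (T.m ^ 5) emitTest (cfg v []) (T.m ^ 50) (cfg { v with x := x' } T.output) := by
  have hm := hT.m
  have htot := hT.total_le
  have htf := htot false
  have hB : T.m ^ 23 < 2 ^ (T.m ^ 5) := (hT.pow_lt_two_pow 23 (by norm_num)).trans_le
    (Nat.pow_le_pow_right (by norm_num) (Nat.pow_le_pow_right (by omega) (by norm_num)))
  have hl5 : l.length < T.m ^ 5 := by
    have := hT.mul_pow_le 2 1 5 (by norm_num) (by norm_num)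
    rw [pow_one] at this
    omega
  have hnw : T.n * T.w ≤ T.m ^ 23 := by
    calc T.n * T.w ≤ T.m * T.m ^ 4 := Nat.mul_le_mul_right _ hT.n
      _ = 1 * T.m ^ 5 := by ring
      _ ≤ T.m ^ 23 := hT.mul_pow_le 1 5 23 (by norm_num) (by norm_num)
  have hn : T.n ≤ T.m ^ 23 := hT.n.trans (Nat.le_self_pow (by norm_num) _)
  have hκ : 2 ^ T.κ ≤ T.m ^ 23 := by
    have : T.Q = 2 * 2 ^ T.κ := by rw [TestData.Q, pow_succ, mul_comm]
    omega
  have hQ : 0 < T.Q := by unfold TestData.Q; positivity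
  let v' : Vars := { v with x := val (dropInts l T.n) }
  have hv' : T.Describes v' := ⟨hv.m, hv.n, hv.den, hv.q, hv.k, hv.d₁, hv.d₂, hv.kd, hv.pw, hv.w,
    hv.kk, hv.p, hv.a, hv.s, hv.cur, hv.i, hv.j, hv.t, hv.u, hv.num, hv.dd, hv.c⟩
  let v'' : Vars := { v with x := val (dropInts (dropInts l T.n) T.n) }
  have hv'' : T.Describes v'' := ⟨hv.m, hv.n, hv.den, hv.q, hv.k, hv.d₁, hv.d₂, hv.kd, hv.pw, hv.w,
    hv.kk, hv.p, hv.a, hv.s, hv.cur, hv.i, hv.j, hv.t, hv.u, hv.num, hv.dd, hv.c⟩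
  have hnum : (fun i : ℕ => v.numer false (entry l i) i) = T.numer false := by
    funext i
    exact numer_eq hv hT.kd _ _ _ fun _ => by rw [hent]
  have hnum' : (fun i : ℕ => v'.numer true (entry (dropInts l T.n) i) i) = T.numer true := by
    funext i
    exact numer_eq hv' hT.kd _ _ _ fun h => by simp at h
  have s1 := Run.emitUnary (W := T.m ^ 5) (v := v) (o := [])
    (e := .add (.add (.mul (.const 2) (cell 8)) (.const 1)) (.mul (.const 2)
    (.mul (.add (.mul (cell 5) (cell 23)) (.add (cell 8) (.const 1))) (cell 7)))) T.anc hv.u (by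
      change 2 * v.k + 1 + 2 * ((v.n * v.w + (v.k + 1)) * v.q) = _
      rw [hv.k, hv.n, hv.w, hv.q, TestData.anc]; push_cast; rfl) (by omega) (by decide)
  have s2 := fun o => Run.emitHadamards (W := T.m ^ 5) (v := v) o T.K T.κ (T.m ^ 23) hv.k hv.kk hv.i
    hv.u (by change T.out ≤ _; omega) hB
  have s3 := fun o => Run.emitChain (W := T.m ^ 5) (v := v) false o T.Q T.w T.κ T.K T.n T.kd (T.m ^ 23)
    T.denom l hx hv.q hv.w hv.k hv.kk hv.n hv.kd hT.kd (denom_eq hv hT.kd) hv.p hv.s hv.i hv.cur hv.j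
    hv.a hv.num hv.dd hv.c hv.t hv.u hQ hn hnw hκ
    (by have := htot false; unfold TestData.base at this; omega) hB (fun i => by
      rw [congrFun hnum i]; exact hT.numer_lt _ _) hT.denom_lt hl5
  have s4 := fun o => Run.emitChain (W := T.m ^ 5) (v := v') true o T.Q T.w T.κ T.K T.n T.kd (T.m ^ 23)
    T.denom (dropInts l T.n) rfl hv'.q hv'.w hv'.k hv'.kk hv'.n hv'.kd hT.kd (denom_eq hv' hT.kd) hv'.p
    hv'.s hv'.i hv'.cur hv'.j hv'.a hv'.num hv'.dd hv'.c hv'.t hv'.u hQ hn hnw hκ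
    (by have := htot true; unfold TestData.base at this; omega) hB (fun i => by
      rw [congrFun hnum' i]; exact hT.numer_lt _ _) hT.denom_lt
    ((dropInts_length l T.n).trans_lt hl5)
  have s5 := fun o => Run.emitTail hT hv'' o
  rw [hnum] at s3
  rw [hnum'] at s4
  have hs := s1.seq ((s2 _).seq ((s3 _).seq ((s4 _).seq (s5 _))))
  refine ⟨val (dropInts (dropInts l T.n) T.n), ?_⟩
  have ho : T.output = [] ++ encUnary T.anc ++ encGates T.hadamards ++ encGates (T.chain false) ++
      encGates (T.chain true) ++ ([false] ++ encUnary T.out ++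
      encNat T.rNum ++ encNat 20 ++ encNat T.sNum ++ encNat T.sDen) := by
    simp only [TestData.output, TestData.gates, encGates_append, List.append_assoc, List.nil_append]
  rw [ho]
  refine Run.mono hs ?_
  have hd := dropInts_length l T.n
  have b1 : T.Q * (30 * T.m ^ 23 + 50) + 10 ≤ T.m ^ 42 := by
    have h1 := hT.mul_pow_le 2 16 17 (by norm_num) (by norm_num)
    have h2 := hT.mul_pow_le 31 23 24 (by norm_num) (by norm_num)
    have h3 := hT.mul_pow_le 20 41 42 (by norm_num) (by norm_num)
    have hQ := hT.Q_lt
    have h4 : T.Q * (30 * T.m ^ 23 + 50) ≤ T.m ^ 17 * T.m ^ 24 :=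
      Nat.mul_le_mul (by omega) (by have := hm.trans (Nat.le_self_pow (n := 23) (by norm_num) T.m); omega)
    have h5 : T.m ^ 17 * T.m ^ 24 = T.m ^ 41 := by ring
    have h6 : T.m ≤ T.m ^ 41 := Nat.le_self_pow (by norm_num) _
    omega
  have b2 : T.Q * (6 * T.m ^ 23 + 20) ≤ T.m ^ 42 := by
    refine le_trans ?_ b1
    exact (Nat.mul_le_mul_left _ (by omega)).trans (Nat.le_add_right _ _)
  have b3 : ∀ l' : List Bool, l'.length ≤ T.m →
      T.n * (5 * l'.length + T.w * (T.Q * (30 * T.m ^ 23 + 50) + 10) + 21) ≤ T.m ^ 48 := by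
    intro l' hl'
    have h1 : T.w * (T.Q * (30 * T.m ^ 23 + 50) + 10) ≤ T.m ^ 4 * T.m ^ 42 := Nat.mul_le_mul_left _ b1
    have h2 : T.m ^ 4 * T.m ^ 42 = T.m ^ 46 := by ring
    have h3 := hT.mul_pow_le 10 1 46 (by norm_num) (by norm_num)
    have h4 := hT.mul_pow_le 10 46 47 (by norm_num) (by norm_num)
    rw [pow_one] at h3
    calc T.n * (5 * l'.length + T.w * (T.Q * (30 * T.m ^ 23 + 50) + 10) + 21)
        ≤ T.m * T.m ^ 47 := Nat.mul_le_mul hT.n (by omega)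
      _ = T.m ^ 48 := by ring
  have b4 : T.κ * (T.Q * (30 * T.m ^ 23 + 50) + 10) ≤ T.m ^ 44 := by
    calc T.κ * (T.Q * (30 * T.m ^ 23 + 50) + 10) ≤ T.m ^ 2 * T.m ^ 42 :=
          Nat.mul_le_mul (by have := hT.κ_lt; omega) b1
      _ = T.m ^ 44 := by ring
  have b5 : 2 * T.κ * (3 * T.m ^ 23 + 10) ≤ T.m ^ 44 := by
    have h1 := hT.mul_pow_le 4 23 24 (by norm_num) (by norm_num)
    have h2 : 100 ≤ T.m ^ 23 := hm.trans (Nat.le_self_pow (by norm_num) _)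
    calc 2 * T.κ * (3 * T.m ^ 23 + 10) ≤ (2 * T.m ^ 2) * T.m ^ 24 :=
          Nat.mul_le_mul (by have := hT.κ_lt; omega) (by omega)
      _ = 2 * T.m ^ 26 := by ring
      _ ≤ T.m ^ 44 := hT.mul_pow_le 2 26 44 (by norm_num) (by norm_num)
  have b6 := b3 l hl
  have b7 := b3 (dropInts l T.n) (hd.trans hl)
  have c1 := hT.mul_pow_le 50 23 44 (by norm_num) (by norm_num)
  have c2 := hT.mul_pow_le 50 25 44 (by norm_num) (by norm_num)
  have c3 := hT.mul_pow_le 50 42 44 (by norm_num) (by norm_num)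
  have c4 := hT.mul_pow_le 50 44 48 (by norm_num) (by norm_num)
  have c5 := hT.mul_pow_le 50 48 50 (by norm_num) (by norm_num)
  have h100 : 100 ≤ T.m ^ 44 := hm.trans (Nat.le_self_pow (by norm_num) _)
  omega

/-- The program of the super-verifier. -/
def superProg : Prog :=
  readInput ;; readCoins ;; readUnary ;; readNat ;; .assign (.const 6) (cell 13) ;;
  .assign (.const 13) (.const 0) ;; setModulus ;; setTest ;; skipRows ;; emitTest

/-- The part of the input that contains the entries of the vectors. -/
def entryBits (x : List Bool) : List Bool := (readNatL (readUnaryL x).2).2.tail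

/-- The test that is determined by the input `x` and the coins `co`. -/
def testOf (x co : List Bool) : TestData where
  m := x.length + 100
  n := (readUnaryL x).1
  den := (readNatL (readUnaryL x).2).1
  κ := modExp (x.length + 100)
  kd := val co % 2
  d₁ := val co / 2 % (x.length + 100) ^ 3
  d₂ := val co / 2 / (x.length + 100) ^ 3 % (x.length + 100) ^ 3
  ent := entry (dropInts (entryBits x) (val co / 2 % (x.length + 100) ^ 3 * (readUnaryL x).1))

theorem entryBits_length (x : List Bool) : (entryBits x).length ≤ x.length := by
  have h1 := readNatL_length (readUnaryL x).2
  have h2 := readUnaryL_le x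
  simp only [entryBits, List.length_tail]
  omega

theorem testOf_valid (x co : List Bool) : (testOf x co).Valid where
  m := by change 100 ≤ x.length + 100; omega
  n := by
    have := readUnaryL_le x
    change (readUnaryL x).1 ≤ x.length + 100
    omega
  den := by
    have := readUnaryL_le x
    refine (readNatL_lt _).trans_le (Nat.pow_le_pow_right (by norm_num) ?_)
    change _ ≤ x.length + 100
    omega
  κ := rfl
  kd := Nat.le_of_lt_succ (Nat.mod_lt _ (by norm_num))
  d₁ := Nat.mod_lt _ (by positivity)
  d₂ := Nat.mod_lt _ (by positivity)
  ent := fun i => by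
    refine (entry_natAbs_lt _ i).trans_le (Nat.pow_le_pow_right (by norm_num) ?_)
    have := dropInts_length (entryBits x) (val co / 2 % (x.length + 100) ^ 3 * (readUnaryL x).1)
    have := entryBits_length x
    change _ ≤ x.length + 100
    omega

/-- Cells of m⁵ bits suffice. There are at most m⁵¹ elementary steps of cost at most m⁹ each. No
assumption is made on the format of `x`. -/
theorem superProg_runs (x co : List Bool) (hco : co.length = x.length + 100) :
    ∃ (t : ℕ) (τ : Config), t ≤ (x.length + 100) ^ 60 ∧
      Exec superProg (Config.init x co) t τ ∧ τ.output = (testOf x co).output := by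
  set T := testOf x co with hTdef
  have hT : T.Valid := testOf_valid x co
  have hm100 := hT.m
  have hm : x.length + 100 = T.m := rfl
  have hm5 : T.m + 100 ≤ T.m ^ 5 := by
    have := hT.mul_pow_le 2 1 5 (by norm_num) (by norm_num)
    rw [pow_one] at this
    omega
  have hW := Nat.lt_two_pow_self (n := T.m ^ 5)
  have hpw := hT.pow_lt_two_pow
  have h25 : 2 ^ (T.m ^ 2) ≤ 2 ^ (T.m ^ 5) :=
    Nat.pow_le_pow_right (by norm_num) (Nat.pow_le_pow_right (by omega) (by norm_num))
  have hU := readUnaryL_le x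
  have hE := entryBits_length x
  have s1 := Run.readInput (W := T.m ^ 5) x co (by omega)
  have s2 := Run.readCoins (W := T.m ^ 5)
    (v := { Vars.zero with x := val x, m := (x.length + 100 : ℕ) }) co rfl rfl rfl (by omega)
  have s3 := Run.readUnary (W := T.m ^ 5) (l := x)
    (v := { Vars.zero with x := val x, m := (x.length + 100 : ℕ), nc := val co }) [] rfl rfl (by omega)
  have s4 := Run.readNat (W := T.m ^ 5) (l := (readUnaryL x).2)
    (v := { Vars.zero with x := val (readUnaryL x).2, m := (x.length + 100 : ℕ), nc := val co, n := T.n }) [] rfl rfl (by omega)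
  let v₁ : Vars := { Vars.zero with x := val (entryBits x), m := (x.length + 100 : ℕ), nc := val co, n := T.n, a := T.den }
  have s5 : Run (T.m ^ 5) (.assign (.const 6) (cell 13)) (cfg v₁ []) 1
      (cfg { v₁ with den := T.den } []) := by
    refine Run.set (Vars.update_den _ _) rfl ?_ (by decide) (by decide)
    rw [Int.natAbs_natCast]
    exact hT.den.trans_le (Nat.pow_le_pow_right (by norm_num) (by omega))
  let v₂ : Vars := { Vars.zero with x := val (entryBits x), m := (x.length + 100 : ℕ), nc := val co, n := T.n, den := T.den }
  have s6 : Run (T.m ^ 5) (.assign (.const 13) (.const 0)) (cfg { v₁ with den := T.den } []) 1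
      (cfg v₂ []) :=
    Run.set (Vars.update_a _ 0) rfl (by simp) (by decide) (by decide)
  have s7 := Run.setModulus (W := T.m ^ 5) (v := v₂) [] T.m rfl (by omega) rfl (by
    have := hT.mul_pow_le 2 16 17 (by norm_num) (by norm_num)
    have := hpw 17 (by norm_num)
    omega)
  let v₃ : Vars := { v₂ with w := (T.m ^ 4 : ℕ), kk := (T.m ^ 5 : ℕ), q := (2 ^ (modExp T.m + 1) : ℕ), k := modExp T.m }
  have s8 := Run.setTest (W := T.m ^ 5) (v := v₃) [] T.m T.n (val co) T.kd T.d₁ T.d₂ rfl rfl rfl rfl rfl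
    rfl rfl (by omega) (by
      have := hT.mul_pow_le 2 3 5 (by norm_num) (by norm_num)
      have : 0 < T.m ^ 3 := by positivity
      omega)
  let v₄ : Vars := { v₃ with kd := T.kd, d₁ := T.d₁, d₂ := T.d₂, pw := (2 ^ (if T.d₁ = T.n then 0 else T.d₂) : ℕ) }
  have hN : T.d₁ * T.n ≤ T.m ^ 4 := by
    calc T.d₁ * T.n ≤ T.m ^ 3 * T.m := Nat.mul_le_mul hT.d₁.le hT.n
      _ = T.m ^ 4 := by ring
  have s9 := Run.skipRows (W := T.m ^ 5) (v := v₄) [] (entryBits x) (T.d₁ * T.n) rfl (by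
    change (T.d₁ : ℤ) * T.n = _
    push_cast; rfl) rfl rfl rfl rfl (by omega) (by
      have := hpw 4 (by norm_num)
      omega)
  let v₅ : Vars := { v₄ with x := val (dropInts (entryBits x) (T.d₁ * T.n)) }
  have hd : T.Describes v₅ := ⟨rfl, rfl, rfl, rfl, rfl, rfl, rfl, rfl, rfl, rfl, rfl, rfl, rfl, rfl, rfl,
    rfl, rfl, rfl, rfl, rfl, rfl, rfl⟩
  obtain ⟨x', s10⟩ := Run.emitTest hT hd (dropInts (entryBits x) (T.d₁ * T.n)) rfl
    (by have := dropInts_length (entryBits x) (T.d₁ * T.n); omega) rfl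
  have hs := s1.seq (s2.seq (s3.seq (s4.seq (s5.seq (s6.seq (s7.seq (s8.seq (s9.seq s10))))))))
  -- The initial memory is zero everywhere, hence bounded, and this starts the chain of runs.
  obtain ⟨_, t, ht, hex⟩ := hs (fun a => by simp [Config.init, bitLen])
  refine ⟨t, _, ht.trans ?_, hex, rfl⟩
  rw [hm]
  have e1 : T.d₁ * T.n * (5 * (entryBits x).length + 12) ≤ T.m ^ 6 := by
    have h1 := hT.mul_pow_le 6 1 2 (by norm_num) (by norm_num)
    rw [pow_one] at h1
    calc T.d₁ * T.n * (5 * (entryBits x).length + 12) ≤ T.m ^ 4 * T.m ^ 2 :=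
          Nat.mul_le_mul hN (by omega)
      _ = T.m ^ 6 := by ring
  have c1 := hT.mul_pow_le 50 1 6 (by norm_num) (by norm_num)
  have c2 := hT.mul_pow_le 50 3 6 (by norm_num) (by norm_num)
  have c3 := hT.mul_pow_le 50 6 16 (by norm_num) (by norm_num)
  have c4 := hT.mul_pow_le 50 16 50 (by norm_num) (by norm_num)
  have c5 := hT.mul_pow_le 50 50 51 (by norm_num) (by norm_num)
  rw [pow_one] at c1
  have e2 : stepCost (T.m ^ 5) ≤ T.m ^ 9 := by
    unfold stepCost
    have d1 := hT.mul_pow_le 100 5 6 (by norm_num) (by norm_num)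
    have d2 := hT.mul_pow_le 100 6 7 (by norm_num) (by norm_num)
    have d3 := hT.mul_pow_le 20 7 9 (by norm_num) (by norm_num)
    have : 100 ≤ T.m ^ 5 := hm100.trans (Nat.le_self_pow (by norm_num) _)
    omega
  calc _ ≤ T.m ^ 51 * T.m ^ 9 := Nat.mul_le_mul (by omega) e2
    _ = T.m ^ 60 := by ring

/-! ### Circuits of Hadamard gates and classical gates -/

/-- The wires of the gate are distinct and smaller than `N`. -/
def RawGate.Ok (N : ℕ) : RawGate → Prop
  | .H a => a < N
  | .X a => a < N
  | .CNOT a b => a < N ∧ b < N ∧ a ≠ b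
  | .Tof a b c => a < N ∧ b < N ∧ c < N ∧ a ≠ b ∧ a ≠ c ∧ b ≠ c

/-- The gate as a gate on `N` qubits. -/
def RawGate.toGate {N : ℕ} : (g : RawGate) → g.Ok N → Gate N
  | .H a, h => .H ⟨a, h⟩
  | .X a, h => .X ⟨a, h⟩
  | .CNOT a b, h => .CNOT ⟨a, h.1⟩ ⟨b, h.2.1⟩ (by simpa using h.2.2)
  | .Tof a b c, h => .Toffoli ⟨a, h.1⟩ ⟨b, h.2.1⟩ ⟨c, h.2.2.1⟩ (by simpa using h.2.2.2.1)
      (by simpa using h.2.2.2.2.1) (by simpa using h.2.2.2.2.2)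

theorem RawGate.encode_toGate {N : ℕ} (g : RawGate) (h : g.Ok N) :
    (g.toGate h).encode = g.encode := by cases g <;> rfl

/-- The list of gates as gates on `N` qubits. -/
def toGates {N : ℕ} (l : List RawGate) (h : ∀ g ∈ l, g.Ok N) : List (Gate N) :=
  l.pmap RawGate.toGate h

theorem encode_toGates {N : ℕ} (l : List RawGate) (h : ∀ g ∈ l, g.Ok N) :
    (toGates l h).flatMap (fun g => true :: g.encode) = encGates l := by
  induction l with
  | nil => rfl
  | cons g l ih =>
    have := ih fun g hg => h g (List.mem_cons_of_mem _ hg)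
    simp only [toGates, List.pmap_cons, List.flatMap_cons, encGates, RawGate.encode_toGate] at this ⊢
    rw [this]

/-- The action of a classical gate on bits; Hadamard gates are ignored. -/
def RawGate.act : RawGate → (ℕ → Bool) → (ℕ → Bool)
  | .H _, s => s
  | .X a, s => Function.update s a (!s a)
  | .CNOT a b, s => Function.update s b (xor (s b) (s a))
  | .Tof a b c, s => Function.update s c (xor (s c) (s a && s b))

/-- The gate is not a Hadamard gate. -/
def RawGate.Classical : RawGate → Prop
  | .H _ => False
  | _ => True

/-- The action of a list of gates, the head being applied first. -/
def actGates : List RawGate → (ℕ → Bool) → (ℕ → Bool)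
  | [], s => s
  | g :: l, s => actGates l (g.act s)

theorem actGates_append (l₁ l₂ : List RawGate) (s : ℕ → Bool) :
    actGates (l₁ ++ l₂) s = actGates l₂ (actGates l₁ s) := by
  induction l₁ generalizing s with
  | nil => rfl
  | cons g l ih => exact ih _

/-- A basis state as a sequence of bits. -/
def extend {N : ℕ} (j : Basis N) : ℕ → Bool := fun q => if h : q < N then j ⟨q, h⟩ else false

/-- The first `N` bits of a sequence. -/
def restrict (N : ℕ) (s : ℕ → Bool) : Basis N := fun q => s q

theorem restrict_extend {N : ℕ} (j : Basis N) : restrict N (extend j) = j := by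
  funext q
  simp [restrict, extend]

theorem extend_restrict {N : ℕ} {s : ℕ → Bool} (hs : ∀ q, N ≤ q → s q = false) :
    extend (restrict N s) = s := by
  funext q
  by_cases h : q < N
  · simp [restrict, extend, h]
  · simp [extend, h, hs q (by omega)]

theorem extend_apply_of_le {N : ℕ} (j : Basis N) {q : ℕ} (h : N ≤ q) : extend j q = false := by
  simp [extend, show ¬ q < N by omega]

theorem RawGate.act_of_le {N : ℕ} {g : RawGate} (hg : g.Ok N) {s : ℕ → Bool} {q : ℕ} (hq : N ≤ q) :
    g.act s q = s q := by
  cases g with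
  | H a => rfl
  | X a => exact Function.update_of_ne (by change a < N at hg; omega) _ _
  | CNOT a b => exact Function.update_of_ne (by have := hg.2.1; omega) _ _
  | Tof a b c => exact Function.update_of_ne (by have := hg.2.2.1; omega) _ _

/-- The target differs from the controls, so the controls keep their values and the second
application undoes the first. -/
theorem RawGate.act_act {N : ℕ} {g : RawGate} (hg : g.Ok N) (s : ℕ → Bool) : g.act (g.act s) = s := by
  cases g with
  | H a => rfl
  | X a => simp [RawGate.act]
  | CNOT a b => simp [RawGate.act, Function.update_of_ne hg.2.2]
  | Tof a b c => simp [RawGate.act, Function.update_of_ne hg.2.2.2.2.1,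
      Function.update_of_ne hg.2.2.2.2.2]

theorem restrict_update {N : ℕ} (s : ℕ → Bool) {a : ℕ} (ha : a < N) (b : Bool) :
    restrict N (Function.update s a b) = Function.update (restrict N s) ⟨a, ha⟩ b := by
  funext q
  simp only [restrict, Function.update_apply, Fin.ext_iff]

theorem extend_apply {N : ℕ} (j : Basis N) {a : ℕ} (ha : a < N) : extend j a = j ⟨a, ha⟩ := by
  simp [extend, ha]

theorem RawGate.op_toGate {N : ℕ} {g : RawGate} (hg : g.Ok N) (hc : g.Classical) :
    (g.toGate hg).op = permOp fun j => restrict N (g.act (extend j)) := by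
  cases g with
  | H a => exact hc.elim
  | X a =>
    simp only [RawGate.toGate, Gate.op, RawGate.act]
    congr 1
    funext j
    rw [restrict_update _ hg, restrict_extend, extend_apply _ hg]
  | CNOT a b =>
    simp only [RawGate.toGate, Gate.op, RawGate.act]
    congr 1
    funext j
    rw [restrict_update _ hg.2.1, restrict_extend, extend_apply _ hg.1, extend_apply _ hg.2.1]
  | Tof a b c =>
    simp only [RawGate.toGate, Gate.op, RawGate.act]
    congr 1
    funext j
    rw [restrict_update _ hg.2.2.1, restrict_extend, extend_apply _ hg.1, extend_apply _ hg.2.1,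
      extend_apply _ hg.2.2.1]

theorem permOp_mul {N : ℕ} (f g : Basis N → Basis N) : permOp f * permOp g = permOp (f ∘ g) := by
  ext i j
  simp [permOp, Matrix.mul_apply]

theorem gatesOp_toGates {N : ℕ} (l : List RawGate) (h : ∀ g ∈ l, g.Ok N)
    (hc : ∀ g ∈ l, g.Classical) :
    gatesOp (toGates l h) = permOp fun j => restrict N (actGates l (extend j)) := by
  induction l with
  | nil =>
    ext i j
    simp [toGates, gatesOp, permOp, actGates, restrict_extend, Matrix.one_apply]
  | cons g l ih =>
    have hg := h g List.mem_cons_self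
    have := ih (fun g hg => h g (List.mem_cons_of_mem _ hg)) (fun g hg => hc g (List.mem_cons_of_mem _ hg))
    simp only [toGates, List.pmap_cons, gatesOp] at this ⊢
    rw [this, RawGate.op_toGate hg (hc g List.mem_cons_self), permOp_mul]
    congr 1
    funext j
    simp only [Function.comp, actGates]
    rw [extend_restrict fun q hq => by rw [RawGate.act_of_le hg hq, extend_apply_of_le _ hq]]

theorem actGates_injective {N : ℕ} (l : List RawGate) (h : ∀ g ∈ l, g.Ok N) :
    Function.Injective (actGates l) := by
  induction l with
  | nil => exact fun _ _ h => h
  | cons g l ih =>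
    intro s t hst
    have h1 := ih (fun g hg => h g (List.mem_cons_of_mem _ hg)) hst
    have h2 := congrArg g.act h1
    rwa [RawGate.act_act (h g List.mem_cons_self), RawGate.act_act (h g List.mem_cons_self)] at h2

theorem actGates_of_le {N : ℕ} {l : List RawGate} (h : ∀ g ∈ l, g.Ok N) {s : ℕ → Bool} {q : ℕ}
    (hq : N ≤ q) : actGates l s q = s q := by
  induction l generalizing s with
  | nil => rfl
  | cons g l ih =>
    rw [actGates, ih fun g hg => h g (List.mem_cons_of_mem _ hg),
      RawGate.act_of_le (h g List.mem_cons_self) hq]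

theorem restrict_actGates_injective {N : ℕ} (l : List RawGate) (h : ∀ g ∈ l, g.Ok N) :
    Function.Injective fun j : Basis N => restrict N (actGates l (extend j)) := by
  intro i j hij
  have h1 := congrArg extend hij
  simp only at h1
  rw [extend_restrict fun q hq => by rw [actGates_of_le h hq, extend_apply_of_le _ hq],
    extend_restrict fun q hq => by rw [actGates_of_le h hq, extend_apply_of_le _ hq]] at h1
  have h2 := actGates_injective l h h1
  rw [← restrict_extend i, h2, restrict_extend]

/-- A permutation of the basis moves diagonal entries to diagonal entries, and the projection is
diagonal; by injectivity no off-diagonal entry of `σ` contributes to the trace. -/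
theorem trace_projOne_permOp {N : ℕ} (q : Fin N) {f : Basis N → Basis N} (hf : Function.Injective f)
    (σ : Op N) :
    Matrix.trace (projOne q * (permOp f * σ * (permOp f)ᴴ)) =
      ∑ j, if f j q then σ j j else 0 := by
  have h1 : ∀ i, (projOne q * (permOp f * σ * (permOp f)ᴴ)) i i =
      ∑ a, ∑ b, if i = f a ∧ i = f b ∧ i q = true then σ a b else 0 := by
    intro i
    rw [projOne, Matrix.diagonal_mul]
    simp only [Matrix.mul_apply, permOp, Matrix.of_apply, Matrix.conjTranspose_apply]
    simp only [Finset.sum_mul, Finset.mul_sum]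
    rw [Finset.sum_comm]
    refine Finset.sum_congr rfl fun a _ => Finset.sum_congr rfl fun b _ => ?_
    by_cases h1 : i = f b <;> by_cases h2 : i = f a <;> by_cases h3 : i q = true <;> simp [h1, h2, h3] <;> simp_all
  simp only [Matrix.trace, Matrix.diag_apply, h1]
  rw [Finset.sum_comm]
  refine Finset.sum_congr rfl fun a _ => ?_
  rw [Finset.sum_comm]
  rw [Finset.sum_eq_single a]
  · rw [Finset.sum_eq_single (f a)]
    · simp
    · intro i _ hi; simp [hi]
    · simp
  · intro b _ hb
    refine Finset.sum_eq_zero fun i _ => ?_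
    rw [if_neg]
    rintro ⟨h2, h3, _⟩
    exact hb (hf (h3.symm.trans h2))
  · simp

theorem gatesOp_append {N : ℕ} (l₁ l₂ : List (Gate N)) :
    gatesOp (l₁ ++ l₂) = gatesOp l₂ * gatesOp l₁ := by
  induction l₁ with
  | nil => simp [gatesOp]
  | cons g l ih => rw [List.cons_append, gatesOp, ih, gatesOp, mul_assoc]

/-! ### Hadamard gates on fresh ancillas -/

/-- A Hadamard gate on a qubit in state `|0⟩`. -/
theorem hadamard_conj {N : ℕ} (q : Fin N) (σ : Op N)
    (hσ : ∀ i j, (i q = true ∨ j q = true) → σ i j = 0) (i j : Basis N) :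
    ((Gate.H q).op * σ * ((Gate.H q).op)ᴴ) i j =
      1 / 2 * σ (Function.update i q false) (Function.update j q false) := by
  -- Only columns in which the qubit is zero meet the support of `σ`; there the sign of the Hadamard
  -- matrix is always positive.
  have hH : ∀ i a : Basis N, a q = false → (Gate.H q).op i a =
      if a = Function.update i q false then 1 / ((Real.sqrt 2 : ℝ) : ℂ) else 0 := by
    intro i a ha
    have hiff : (∀ k, k ≠ q → i k = a k) ↔ a = Function.update i q false := by
      constructor
      · intro h
        funext k
        by_cases hk : k = q
        · subst hk; simp [ha]
        · rw [Function.update_of_ne hk, h k hk]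
      · rintro h k hk
        rw [h, Function.update_of_ne hk]
    simp only [Gate.op, Matrix.of_apply, hiff, ha, Bool.and_false]
    simp
  have hsq : (1 / ((Real.sqrt 2 : ℝ) : ℂ)) * star (1 / ((Real.sqrt 2 : ℝ) : ℂ)) = 1 / 2 := by
    have : star (1 / ((Real.sqrt 2 : ℝ) : ℂ)) = 1 / ((Real.sqrt 2 : ℝ) : ℂ) := by
      rw [Complex.star_def, map_div₀, map_one, Complex.conj_ofReal]
    rw [this, div_mul_div_comm, one_mul, ← Complex.ofReal_mul,
      Real.mul_self_sqrt (by norm_num)]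
    norm_num
  simp only [Matrix.mul_apply, Matrix.conjTranspose_apply, Finset.sum_mul]
  rw [Finset.sum_eq_single (Function.update j q false)]
  · rw [Finset.sum_eq_single (Function.update i q false)]
    · rw [hH _ _ (by simp), hH _ _ (by simp), if_pos rfl, if_pos rfl, mul_right_comm, hsq]
    · intro a _ ha
      by_cases haq : a q = true
      · rw [hσ _ _ (Or.inl haq)]; simp
      · rw [hH i a (by simpa using haq), if_neg ha]; simp
    · simp
  · intro b _ hb
    refine Finset.sum_eq_zero fun a _ => ?_
    by_cases hbq : b q = true
    · rw [hσ _ _ (Or.inr hbq)]; simp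
    · rw [hH j b (by simpa using hbq), if_neg hb]; simp
  · simp

/-- The initial bits: the witness `x`, the random bits `y`, and zeros. -/
def initBits {k h : ℕ} (x : Basis k) (y : Basis h) : ℕ → Bool := fun q =>
  if q < k then extend x q else extend y (q - k)

/-- The state after Hadamard gates on the first `r` ancilla qubits. -/
theorem hadamards_conj {k a : ℕ} (r : ℕ) (hr : r ≤ a) (ρ : Op k)
    (hok : ∀ g ∈ (List.range r).map (fun r => RawGate.H (k + r)), g.Ok (k + a)) (i j : Basis (k + a)) :
    (gatesOp (toGates _ hok) * withAncilla a ρ * (gatesOp (toGates _ hok))ᴴ) i j =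
      if ∀ q : Fin a, r ≤ q → i (Fin.natAdd k q) = false ∧ j (Fin.natAdd k q) = false then
        (1 / 2) ^ r * ρ (fun q => i (Fin.castAdd a q)) (fun q => j (Fin.castAdd a q))
      else 0 := by
  induction r generalizing i j with
  | zero => simp [toGates, gatesOp, withAncilla]
  | succ r ih =>
    have hok' : ∀ g ∈ (List.range r).map (fun r => RawGate.H (k + r)), g.Ok (k + a) := by
      intro g hg
      refine hok g ?_
      rw [List.range_succ, List.map_append]
      exact List.mem_append_left _ hg
    have hlt : k + r < k + a := by omega
    have hg : gatesOp (toGates _ hok) = (Gate.H ⟨k + r, hlt⟩).op * gatesOp (toGates _ hok') := by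
      have : toGates _ hok = toGates _ hok' ++ [Gate.H ⟨k + r, hlt⟩] := by
        simp only [toGates, List.range_succ, List.map_append, List.pmap_append]
        rfl
      rw [this, gatesOp_append]
      simp [gatesOp]
    rw [hg, Matrix.conjTranspose_mul]
    have hassoc : (Gate.H ⟨k + r, hlt⟩).op * gatesOp (toGates _ hok') * withAncilla a ρ *
        ((gatesOp (toGates _ hok'))ᴴ * ((Gate.H (N := k + a) ⟨k + r, hlt⟩).op)ᴴ) =
        (Gate.H ⟨k + r, hlt⟩).op * (gatesOp (toGates _ hok') * withAncilla a ρ *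
          (gatesOp (toGates _ hok'))ᴴ) * ((Gate.H (N := k + a) ⟨k + r, hlt⟩).op)ᴴ := by
      simp only [mul_assoc]
    have hnat : (⟨k + r, hlt⟩ : Fin (k + a)) = Fin.natAdd k ⟨r, by omega⟩ := rfl
    rw [hassoc, hadamard_conj]
    · rw [ih (by omega) hok']
      have hne : ∀ q : Fin k, Fin.castAdd a q ≠ (⟨k + r, hlt⟩ : Fin (k + a)) := by
        intro q h
        have := congrArg Fin.val h
        simp at this
        omega
      have hiff : (∀ q : Fin a, r ≤ q →
          Function.update i (⟨k + r, hlt⟩ : Fin (k + a)) false (Fin.natAdd k q) = false ∧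
          Function.update j (⟨k + r, hlt⟩ : Fin (k + a)) false (Fin.natAdd k q) = false) ↔
          ∀ q : Fin a, r + 1 ≤ q → i (Fin.natAdd k q) = false ∧ j (Fin.natAdd k q) = false := by
        have hne' : ∀ q : Fin a, (q : ℕ) ≠ r → Fin.natAdd k q ≠ (⟨k + r, hlt⟩ : Fin (k + a)) := by
          intro q hq h
          have := congrArg Fin.val h
          simp at this
          omega
        constructor
        · intro h q hq
          have := h q (by omega)
          rwa [Function.update_of_ne (hne' q (by omega)), Function.update_of_ne (hne' q (by omega))]
            at this
        · intro h q hq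
          by_cases hqr : (q : ℕ) = r
          · have : Fin.natAdd k q = (⟨k + r, hlt⟩ : Fin (k + a)) := by
              ext; simp [hqr]
            rw [this]
            simp
          · rw [Function.update_of_ne (hne' q hqr), Function.update_of_ne (hne' q hqr)]
            exact h q (by omega)
      simp only [hiff]
      have h1 : ∀ i : Basis (k + a), (fun q => Function.update i (⟨k + r, hlt⟩ : Fin (k + a)) false
          (Fin.castAdd a q)) = fun q => i (Fin.castAdd a q) := fun i => by
        funext q
        rw [Function.update_of_ne (hne q)]
      rw [h1, h1]
      split_ifs
      · ring
      · simp
    · intro i j hij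
      rw [ih (by omega) hok', if_neg]
      intro h
      have := h ⟨r, by omega⟩ le_rfl
      rw [← hnat] at this
      rcases hij with hij | hij
      · rw [this.1] at hij; simp at hij
      · rw [this.2] at hij; simp at hij

/-- After the Hadamard gates the diagonal of the state is `ρ x x / 2 ^ h` on the strings formed by
`x`, any `y` and zeros. So the witness acts as a distribution on bit strings and `y` as uniform
random bits. -/
theorem accept_eq {k a h : ℕ} (hha : h ≤ a) (cl : List RawGate)
    (hH : ∀ g ∈ (List.range h).map (fun r => RawGate.H (k + r)), g.Ok (k + a))
    (hok : ∀ g ∈ cl, g.Ok (k + a)) (hc : ∀ g ∈ cl, g.Classical) (out : Fin (k + a)) (ρ : Op k) :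
    (Circuit.accept ⟨a, toGates _ hH ++ toGates cl hok, out⟩ ρ) =
      ∑ x : Basis k, (ρ x x).re *
        ((∑ y : Basis h, if actGates cl (initBits x y) out then (1 : ℝ) else 0) / 2 ^ h) := by
  unfold Circuit.accept
  simp only
  rw [gatesOp_append, Matrix.conjTranspose_mul, gatesOp_toGates cl hok hc]
  set P := permOp fun j : Basis (k + a) => restrict (k + a) (actGates cl (extend j)) with hP
  have hassoc : P * gatesOp (toGates _ hH) * withAncilla a ρ * ((gatesOp (toGates _ hH))ᴴ * Pᴴ) =
      P * (gatesOp (toGates _ hH) * withAncilla a ρ * (gatesOp (toGates _ hH))ᴴ) * Pᴴ := by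
    simp only [mul_assoc]
  rw [hassoc, hP, trace_projOne_permOp out (restrict_actGates_injective cl hok)]
  simp only [hadamards_conj h hha ρ hH, and_self]
  rw [Complex.re_sum]
  let J : Basis k × Basis h → Basis (k + a) := fun p => restrict (k + a) (initBits p.1 p.2)
  let L : Basis (k + a) → Basis k × Basis h := fun j =>
    (fun q => j (Fin.castAdd a q), fun q => j (Fin.natAdd k ⟨q, by omega⟩))
  have hJ0 : ∀ (p : Basis k × Basis h) (q : ℕ), k + a ≤ q → initBits (k := k) (h := h) p.1 p.2 q = false := by
    intro p q hq
    rw [initBits, if_neg (by omega), extend_apply_of_le _ (by omega)]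
  have hLJ : ∀ p, L (J p) = p := by
    rintro ⟨x, y⟩
    ext q
    · simp [L, J, restrict, initBits, extend]
    · simp [L, J, restrict, initBits, extend]
  have hsum : ∀ φ : Basis (k + a) → ℝ,
      (∑ j, if ∀ q : Fin a, h ≤ q → j (Fin.natAdd k q) = false then φ j else 0) =
      ∑ p : Basis k × Basis h, φ (J p) := by
    intro φ
    rw [← Finset.sum_filter]
    -- Basis states with zeros on the ancillas that carry no random bit correspond to pairs of a
    -- witness string and a random string.
    refine Finset.sum_nbij' L J (fun _ _ => Finset.mem_univ _) ?_ ?_ (fun p _ => hLJ p) ?_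
    · intro p _
      simp only [Finset.mem_filter, Finset.mem_univ, true_and]
      intro q hq
      simp only [J, restrict, initBits, Fin.val_natAdd]
      rw [if_neg (by omega), extend_apply_of_le _ (by omega)]
    · intro j hj
      simp only [Finset.mem_filter, Finset.mem_univ, true_and] at hj
      funext q
      refine Fin.addCases (fun q => ?_) (fun q => ?_) q
      · simp [L, J, restrict, initBits, extend]
      · by_cases hq : (q : ℕ) < h
        · simp [L, J, restrict, initBits, extend, hq]
          rfl
        · rw [hj q (by omega)]
          simp [J, restrict, initBits, extend, hq]
    · intro j hj
      congr 1
      simp only [Finset.mem_filter, Finset.mem_univ, true_and] at hj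
      funext q
      refine Fin.addCases (fun q => ?_) (fun q => ?_) q
      · simp [L, J, restrict, initBits, extend]
      · by_cases hq : (q : ℕ) < h
        · simp [L, J, restrict, initBits, extend, hq]
          rfl
        · rw [hj q (by omega)]
          simp [J, restrict, initBits, extend, hq]
  have hrw : ∀ j : Basis (k + a), (if restrict (k + a) (actGates cl (extend j)) out = true then
      (if ∀ q : Fin a, h ≤ q → j (Fin.natAdd k q) = false then
        (1 / 2 : ℂ) ^ h * ρ (fun q => j (Fin.castAdd a q)) (fun q => j (Fin.castAdd a q)) else 0)
      else 0).re = if ∀ q : Fin a, h ≤ q → j (Fin.natAdd k q) = false then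
        (if actGates cl (extend j) out then
          (1 / 2 : ℝ) ^ h * (ρ (L j).1 (L j).1).re else 0) else 0 := by
    intro j
    have h1 : restrict (k + a) (actGates cl (extend j)) out = actGates cl (extend j) out := rfl
    have h2 : ∀ z : ℂ, ((1 / 2 : ℂ) ^ h * z).re = (1 / 2 : ℝ) ^ h * z.re := by
      intro z
      have : (1 / 2 : ℂ) ^ h = (((1 / 2 : ℝ) ^ h : ℝ) : ℂ) := by push_cast; rfl
      rw [this, Complex.re_ofReal_mul]
    rw [h1]
    split_ifs
    · exact h2 _
    · rfl
    · rfl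
    · rfl
  rw [Finset.sum_congr rfl fun j _ => hrw j, hsum, Fintype.sum_prod_type]
  refine Finset.sum_congr rfl fun x _ => ?_
  rw [Finset.sum_div, Finset.mul_sum]
  refine Finset.sum_congr rfl fun y _ => ?_
  have h3 : extend (J (x, y)) = initBits x y := extend_restrict (hJ0 (x, y))
  rw [h3, hLJ]
  split_ifs
  · rw [one_div, inv_pow]; ring
  · simp

/-! ### What the circuit computes -/

theorem layerStep_act_of_false {Q cur ctl c t : ℕ} {s : ℕ → Bool} (h : s (cur + t) = false)
    (ht : t < Q) : actGates (layerStep Q cur ctl c t) s = s := by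
  simp [layerStep, actGates, RawGate.act, h]

/-- The CNOT copies the token to the same position of the next block. If the control is set, the
first Toffoli gate erases this copy and the second one writes it at the shifted position; this is
also right when both positions coincide. -/
theorem layerStep_act_of_true {Q cur ctl c t : ℕ} {s : ℕ → Bool} (h : s (cur + t) = true)
    (ht : t < Q) (hctl : ctl < cur) (hs : ∀ q, q < Q → s (cur + Q + q) = false) :
    actGates (layerStep Q cur ctl c t) s =
      Function.update s (cur + Q + (t + if s ctl then c else 0) % Q) true := by
  have hm : (t + c) % Q < Q := Nat.mod_lt _ (by omega)
  have h1 : cur + t ≠ cur + Q + t := by omega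
  have h2 : ctl ≠ cur + Q + t := by omega
  cases hc : s ctl
  · simp [layerStep, actGates, RawGate.act, h, hc, hs t ht, Function.update_of_ne h1,
      Function.update_of_ne h2, Nat.mod_eq_of_lt ht]
  · simp [layerStep, actGates, RawGate.act, h, hc, hs t ht, Function.update_of_ne h1,
      Function.update_of_ne h2, hs _ hm]
    have hu : Function.update s (cur + Q + t) false = s := by
      rw [← hs t ht, Function.update_eq_self]
    rw [hu, hs _ hm, Bool.not_false]

/-- In one-hot code the wire `a` is the only one that is set, so only the step `t = a` acts. The
induction is over the initial segments of the steps. -/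
theorem layerGates_act {Q cur ctl c a : ℕ} {s : ℕ → Bool} (ha : a < Q)
    (h : ∀ t, t < Q → s (cur + t) = decide (t = a)) (hctl : ctl < cur)
    (hs : ∀ q, q < Q → s (cur + Q + q) = false) :
    actGates (layerGates Q cur ctl c) s =
      Function.update s (cur + Q + (a + if s ctl then c else 0) % Q) true := by
  have key : ∀ j, j ≤ Q → actGates ((List.range j).flatMap (layerStep Q cur ctl c)) s =
      if a < j then Function.update s (cur + Q + (a + if s ctl then c else 0) % Q) true else s := by
    intro j hj
    have hb : (a + if s ctl then c else 0) % Q < Q := Nat.mod_lt _ (by omega)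
    induction j with
    | zero => simp [actGates]
    | succ j ih =>
      rw [List.range_succ, List.flatMap_append, actGates_append, ih (by omega),
        List.flatMap_singleton]
      rcases lt_trichotomy a j with haj | haj | haj
      · rw [if_pos haj, if_pos (show a < j + 1 by omega), layerStep_act_of_false _ (by omega)]
        rw [Function.update_of_ne (by omega), h j (by omega)]
        simp; omega
      · rw [if_neg (by omega), if_pos (show a < j + 1 by omega), layerStep_act_of_true _ (by omega) hctl hs, haj]
        rw [h j (by omega)]
        simp [haj]
      · rw [if_neg (by omega), if_neg (by omega), layerStep_act_of_false _ (by omega)]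
        rw [h j (by omega)]
        simp; omega
  rw [layerGates, key Q le_rfl, if_pos ha]

/-- The number that the layers add. -/
def layersSum (s : ℕ → Bool) (ls : List (ℕ × ℕ)) : ℕ :=
  (ls.map fun l => if s l.1 then l.2 else 0).sum

theorem layersSum_congr {s s' : ℕ → Bool} {ls : List (ℕ × ℕ)} (h : ∀ l ∈ ls, s l.1 = s' l.1) :
    layersSum s ls = layersSum s' ls := by
  unfold layersSum
  congr 1
  exact List.map_congr_left fun l hl => by rw [h l hl]

/-- The wires outside the blocks are unchanged, so that later control wires still carry their
initial values and a second chain can follow in fresh blocks. -/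
theorem layersGates_act {Q : ℕ} (ls : List (ℕ × ℕ)) {cur a : ℕ} {s : ℕ → Bool} (ha : a < Q)
    (h : ∀ t, t < Q → s (cur + t) = decide (t = a)) (hctl : ∀ l ∈ ls, l.1 < cur)
    (hs : ∀ q, cur + Q ≤ q → q < cur + (ls.length + 1) * Q → s q = false) :
    (∀ q, q < cur → actGates (layersGates Q cur ls) s q = s q) ∧
    (∀ q, cur + (ls.length + 1) * Q ≤ q → actGates (layersGates Q cur ls) s q = s q) ∧
    ∀ t, t < Q → actGates (layersGates Q cur ls) s (cur + ls.length * Q + t) =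
      decide (t = (a + layersSum s ls) % Q) := by
  induction ls generalizing cur a s with
  | nil =>
    refine ⟨fun _ _ => rfl, fun _ _ => rfl, fun t ht => ?_⟩
    simp only [layersGates, actGates, List.length_nil, zero_mul, add_zero, layersSum, List.map_nil,
      List.sum_nil, Nat.mod_eq_of_lt ha]
    exact h t ht
  | cons l ls ih =>
    have hl := hctl l List.mem_cons_self
    have hlen : (ls.length + 1 + 1) * Q = Q + (ls.length + 1) * Q := by ring
    have hlen' : (ls.length + 1) * Q = Q + ls.length * Q := by ring
    simp only [List.length_cons] at hs ⊢
    rw [hlen] at hs ⊢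
    have hb : (a + if s l.1 then l.2 else 0) % Q < Q := Nat.mod_lt _ (by omega)
    rw [layersGates, actGates_append, layerGates_act ha h hl fun q hq => hs _ (by omega) (by omega)]
    set b := (a + if s l.1 then l.2 else 0) % Q with hbdef
    obtain ⟨h1, h2, h3⟩ := ih (cur := cur + Q) (a := b) (s := Function.update s (cur + Q + b) true) hb
      (fun t ht => by
        by_cases htb : t = b
        · simp [htb]
        · rw [Function.update_of_ne (by omega), hs _ (by omega) (by omega)]
          simp [htb])
      (fun l' hl' => by have := hctl l' (List.mem_cons_of_mem _ hl'); omega)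
      (fun q hq hq' => by rw [Function.update_of_ne (by omega), hs _ (by omega) (by omega)])
    refine ⟨fun q hq => ?_, fun q hq => ?_, fun t ht => ?_⟩
    · rw [h1 q (by omega), Function.update_of_ne (by omega)]
    · rw [h2 q (by omega), Function.update_of_ne (by omega)]
    · have := h3 t ht
      rw [show cur + (ls.length + 1) * Q + t = cur + Q + ls.length * Q + t by rw [hlen']; ring, this]
      congr 2
      rw [layersSum_congr (s' := s) fun l' hl' => by
        rw [Function.update_of_ne]
        have := hctl l' (List.mem_cons_of_mem _ hl'); omega]
      rw [hbdef, Nat.mod_add_mod, add_assoc]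
      rfl

/-- At most one of the wires is set, so the parity collected on the output is an indicator. -/
theorem cnots_act (s : ℕ → Bool) {p out : ℕ} (ho : out < p) (a j : ℕ)
    (h : ∀ t, t < j → s (p + t) = decide (t = a)) :
    actGates ((List.range j).map fun t => RawGate.CNOT (p + t) out) s =
      Function.update s out (xor (s out) (decide (a < j))) := by
  induction j with
  | zero => simp [actGates]
  | succ j ih =>
    rw [List.range_succ, List.map_append, actGates_append, ih fun t ht => h t (by omega)]
    simp only [List.map_cons, List.map_nil, actGates, RawGate.act, Function.update_self,
      Function.update_idem]
    rw [Function.update_of_ne (by omega), h j (by omega)]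
    congr 1
    rw [Bool.xor_assoc]
    congr 1
    rcases lt_trichotomy a j with haj | haj | haj
    · simp [haj, show a < j + 1 by omega, show j ≠ a by omega]
    · simp [haj]
    · simp [show ¬ a < j by omega, show ¬ a < j + 1 by omega, show j ≠ a by omega]

theorem chainGates_act {H out cur start : ℕ} (ls : List (ℕ × ℕ)) {s : ℕ → Bool} (hout : out < cur)
    (hstart : start < 2 * H) (hctl : ∀ l ∈ ls, l.1 < cur)
    (hs : ∀ q, cur ≤ q → q < cur + (ls.length + 1) * (2 * H) → s q = false) :
    (∀ q, q < cur → q ≠ out → actGates (chainGates (2 * H) out cur start ls) s q = s q) ∧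
    (∀ q, cur + (ls.length + 1) * (2 * H) ≤ q →
      actGates (chainGates (2 * H) out cur start ls) s q = s q) ∧
    actGates (chainGates (2 * H) out cur start ls) s out =
      xor (s out) (decide (H ≤ (start + layersSum s ls) % (2 * H))) := by
  have hlen : (ls.length + 1) * (2 * H) = 2 * H + ls.length * (2 * H) := by ring
  set s₁ := Function.update s (cur + start) true with hs₁
  have hX : actGates [RawGate.X (cur + start)] s = s₁ := by
    simp [actGates, RawGate.act, hs₁, hs (cur + start) (by omega) (by omega)]
  obtain ⟨h1, h2, h3⟩ := layersGates_act (Q := 2 * H) ls (cur := cur) (a := start) (s := s₁) hstart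
    (fun t ht => by
      by_cases htb : t = start
      · simp [htb, hs₁]
      · rw [hs₁, Function.update_of_ne (by omega), hs _ (by omega) (by omega)]
        simp [htb]) hctl
    (fun q hq hq' => by rw [hs₁, Function.update_of_ne (by omega), hs _ (by omega) (by omega)])
  have hsum : layersSum s₁ ls = layersSum s ls := layersSum_congr fun l hl => by
    rw [hs₁, Function.update_of_ne]
    have := hctl l hl; omega
  rw [hsum] at h3
  set A := (start + layersSum s ls) % (2 * H) with hA
  have hAlt : A < 2 * H := Nat.mod_lt _ (by omega)
  set s₂ := actGates (layersGates (2 * H) cur ls) s₁ with hs₂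
  have hfin : actGates (chainGates (2 * H) out cur start ls) s =
      Function.update s₂ out (xor (s₂ out) (decide (H ≤ A))) := by
    rw [chainGates, actGates_append, actGates_append, hX, ← hs₂,
      show 2 * H / 2 = H by omega]
    by_cases hHA : H ≤ A
    · rw [cnots_act s₂ (p := cur + ls.length * (2 * H) + H) (by omega) (A - H) H fun t ht => by
        rw [add_assoc, h3 _ (by omega)]
        simp only [decide_eq_decide]
        omega]
      simp [hHA, show A - H < H by omega]
    -- The token is in the lower half; position `H`, just outside the range of the CNOT gates,
    -- stands for no token in the upper half.
    · rw [cnots_act s₂ (p := cur + ls.length * (2 * H) + H) (by omega) H H fun t ht => by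
        rw [add_assoc, h3 _ (by omega)]
        simp only [decide_eq_decide]
        omega]
      simp [hHA]
  rw [hfin]
  refine ⟨fun q hq hqo => ?_, fun q hq => ?_, ?_⟩
  · rw [Function.update_of_ne hqo, h1 q hq, hs₁, Function.update_of_ne (by omega)]
  · rw [Function.update_of_ne (by omega), h2 q hq, hs₁, Function.update_of_ne (by omega)]
  · rw [Function.update_self, h1 out hout, hs₁, Function.update_of_ne (by omega)]

theorem layersGates_ok {Q N : ℕ} (ls : List (ℕ × ℕ)) {cur : ℕ} (hctl : ∀ l ∈ ls, l.1 < cur)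
    (hN : cur + (ls.length + 1) * Q ≤ N) :
    ∀ g ∈ layersGates Q cur ls, g.Ok N ∧ g.Classical := by
  induction ls generalizing cur with
  | nil => simp [layersGates]
  | cons l ls ih =>
    have hl := hctl l List.mem_cons_self
    have hlen : (ls.length + 1 + 1) * Q = Q + (ls.length + 1) * Q := by ring
    have hlen' : (ls.length + 1) * Q = Q + ls.length * Q := by ring
    simp only [List.length_cons] at hN
    rw [hlen] at hN
    intro g hg
    rw [layersGates, List.mem_append] at hg
    rcases hg with hg | hg
    · simp only [layerGates, List.mem_flatMap, List.mem_range, layerStep, List.mem_cons,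
        List.not_mem_nil, or_false] at hg
      obtain ⟨t, ht, hg⟩ := hg
      have hm : (t + l.2) % Q < Q := Nat.mod_lt _ (by omega)
      rcases hg with rfl | rfl | rfl <;> refine ⟨?_, trivial⟩ <;> simp only [RawGate.Ok] <;> omega
    · exact ih (fun l' hl' => by have := hctl l' (List.mem_cons_of_mem _ hl'); omega) (by omega) g hg

theorem chainGates_ok {H out cur start N : ℕ} (ls : List (ℕ × ℕ)) (hout : out < cur)
    (hstart : start < 2 * H) (hctl : ∀ l ∈ ls, l.1 < cur)
    (hN : cur + (ls.length + 1) * (2 * H) ≤ N) :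
    ∀ g ∈ chainGates (2 * H) out cur start ls, g.Ok N ∧ g.Classical := by
  have hlen : (ls.length + 1) * (2 * H) = 2 * H + ls.length * (2 * H) := by ring
  intro g hg
  rw [chainGates, List.mem_append, List.mem_append] at hg
  rcases hg with (hg | hg) | hg
  · simp only [List.mem_singleton] at hg
    subst hg
    refine ⟨?_, trivial⟩
    simp only [RawGate.Ok]
    omega
  · exact layersGates_ok ls hctl hN g hg
  · simp only [List.mem_map, List.mem_range] at hg
    obtain ⟨t, ht, rfl⟩ := hg
    refine ⟨?_, trivial⟩
    simp only [RawGate.Ok]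
    omega

/-! ### The acceptance probability -/

/-- Twice the distance to the nearest integer. -/
def tri (x : ℝ) : ℝ := 2 * |x - round x|

/-- The number of `u < H` with `(A + u) mod 2 H` at least `H`. -/
theorem card_tri {H : ℕ} (hH : 0 < H) (A : ℕ) :
    ((∑ u ∈ Finset.range H, if H ≤ (A + u) % (2 * H) then (1 : ℝ) else 0) / H) =
      tri ((A : ℝ) / (2 * H : ℕ)) := by
  have hH' : (0 : ℝ) < H := by exact_mod_cast hH
  rw [tri, abs_sub_round_eq_min, Int.fract_div_natCast_eq_div_natCast_mod]
  set a := A % (2 * H) with ha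
  have hlt : a < 2 * H := Nat.mod_lt _ (by omega)
  rw [← Finset.sum_filter, Finset.sum_const, nsmul_eq_mul, mul_one]
  -- For `a < H` the last `a` values of `u` reach the upper half; for `a ≥ H` the first `2 * H - a`
  -- values stay in it before wrapping around. These are the two branches of the distance to the
  -- nearest integer.
  by_cases haH : a < H
  · have : (Finset.range H).filter (fun u => H ≤ (A + u) % (2 * H)) = Finset.Ico (H - a) H := by
      ext u
      simp only [Finset.mem_filter, Finset.mem_range, Finset.mem_Ico]
      refine ⟨fun ⟨h1, h2⟩ => ?_, fun h => ?_⟩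
      · rw [Nat.add_mod, ← ha, Nat.mod_eq_of_lt (a := u) (by omega), Nat.mod_eq_of_lt (by omega)] at h2
        omega
      · rw [Nat.add_mod, ← ha, Nat.mod_eq_of_lt (a := u) (by omega), Nat.mod_eq_of_lt (by omega)]
        omega
    rw [this, Nat.card_Ico, show H - (H - a) = a by omega, min_eq_left]
    · push_cast
      field_simp
    · have : (a : ℝ) ≤ H := by exact_mod_cast haH.le
      push_cast
      rw [le_sub_iff_add_le, ← add_div, div_le_one (by positivity)]
      linarith
  · have : (Finset.range H).filter (fun u => H ≤ (A + u) % (2 * H)) = Finset.range (2 * H - a) := by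
      ext u
      simp only [Finset.mem_filter, Finset.mem_range]
      refine ⟨fun ⟨h1, h2⟩ => ?_, fun h => ?_⟩
      · by_contra hcon
        rw [Nat.add_mod, ← ha, Nat.mod_eq_of_lt (a := u) (by omega), Nat.mod_eq_sub_mod (by omega),
          Nat.mod_eq_of_lt (by omega)] at h2
        omega
      · rw [Nat.add_mod, ← ha, Nat.mod_eq_of_lt (a := u) (by omega), Nat.mod_eq_of_lt (by omega)]
        omega
    rw [this, Finset.card_range, min_eq_right]
    · rw [Nat.cast_sub hlt.le]
      push_cast
      field_simp
    · have : (H : ℝ) ≤ a := by exact_mod_cast not_lt.1 haH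
      push_cast
      rw [sub_le_iff_le_add, ← add_div, le_div_iff₀ (by positivity)]
      linarith

/-- The number with binary digits `y` (least significant first). -/
def binVal {κ : ℕ} (y : Basis κ) : ℕ := ∑ r : Fin κ, if y r then 2 ^ (r : ℕ) else 0

theorem sum_binVal {κ : ℕ} (φ : ℕ → ℝ) :
    ∑ y : Basis κ, φ (binVal y) = ∑ u ∈ Finset.range (2 ^ κ), φ u := by
  rw [← Fin.sum_univ_eq_sum_range]
  refine Fintype.sum_equiv
    ((Equiv.arrowCongr (Equiv.refl (Fin κ)) finTwoEquiv.symm).trans finFunctionFinEquiv) _ _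
    fun y => ?_
  congr 1
  simp only [Equiv.trans_apply, finFunctionFinEquiv_apply, binVal]
  refine Finset.sum_congr rfl fun r _ => ?_
  cases h : y r <;> simp [Equiv.arrowCongr, h, finTwoEquiv]

/-- The two halves of the random string are independent, so the XOR of two events with probabilities
p and q has probability p + q - 2pq. -/
theorem sum_xor {κ : ℕ} (g : Bool → ℕ → Prop) [∀ f u, Decidable (g f u)] :
    (∑ y : Basis (2 * κ), if xor
        (decide (g false (binVal fun r : Fin κ => y ⟨r, by omega⟩)))
        (decide (g true (binVal fun r : Fin κ => y ⟨κ + r, by omega⟩))) then (1 : ℝ) else 0) /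
        2 ^ (2 * κ) =
      (∑ u ∈ Finset.range (2 ^ κ), if g false u then (1 : ℝ) else 0) / (2 ^ κ : ℕ) +
      (∑ u ∈ Finset.range (2 ^ κ), if g true u then (1 : ℝ) else 0) / (2 ^ κ : ℕ) -
      2 * ((∑ u ∈ Finset.range (2 ^ κ), if g false u then (1 : ℝ) else 0) / (2 ^ κ : ℕ)) *
      ((∑ u ∈ Finset.range (2 ^ κ), if g true u then (1 : ℝ) else 0) / (2 ^ κ : ℕ)) := by
  have h1 : (∑ y : Basis (2 * κ), if xor
        (decide (g false (binVal fun r : Fin κ => y ⟨r, by omega⟩)))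
        (decide (g true (binVal fun r : Fin κ => y ⟨κ + r, by omega⟩))) then (1 : ℝ) else 0) =
      ∑ p : Basis κ × Basis κ, if xor (decide (g false (binVal p.1))) (decide (g true (binVal p.2)))
        then (1 : ℝ) else 0 := by
    symm
    refine Fintype.sum_equiv ((Fin.appendEquiv κ κ).trans
      (Equiv.arrowCongr (finCongr (two_mul κ).symm) (Equiv.refl Bool))) _ _ fun p => ?_
    have e1 : (fun r : Fin κ => ((Fin.appendEquiv κ κ).trans (Equiv.arrowCongr
        (finCongr (two_mul κ).symm) (Equiv.refl Bool))) p ⟨r, by omega⟩) = p.1 := by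
      funext r
      exact Fin.append_left p.1 p.2 r
    have e2 : (fun r : Fin κ => ((Fin.appendEquiv κ κ).trans (Equiv.arrowCongr
        (finCongr (two_mul κ).symm) (Equiv.refl Bool))) p ⟨κ + r, by omega⟩) = p.2 := by
      funext r
      exact Fin.append_right p.1 p.2 r
    rw [e1, e2]
  have h2 : ∀ p : Basis κ × Basis κ,
      (if xor (decide (g false (binVal p.1))) (decide (g true (binVal p.2))) then (1 : ℝ) else 0) =
      (if g false (binVal p.1) then 1 else 0) * 1 + 1 * (if g true (binVal p.2) then 1 else 0) -
      2 * ((if g false (binVal p.1) then 1 else 0) * (if g true (binVal p.2) then 1 else 0)) := by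
    intro p
    by_cases a : g false (binVal p.1) <;> by_cases b : g true (binVal p.2) <;> simp [a, b] <;> norm_num
  rw [h1, Finset.sum_congr rfl fun p _ => h2 p, Finset.sum_sub_distrib, Finset.sum_add_distrib]
  have hprod : ∀ φ ψ : Basis κ → ℝ, ∑ p : Basis κ × Basis κ, φ p.1 * ψ p.2 =
      (∑ a, φ a) * ∑ b, ψ b := fun φ ψ => by rw [Fintype.sum_prod_type, Finset.sum_mul_sum]
  rw [hprod (fun a => if g false (binVal a) then 1 else 0) (fun _ => 1),
    hprod (fun _ => 1) (fun b => if g true (binVal b) then 1 else 0), ← Finset.mul_sum,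
    hprod (fun a => if g false (binVal a) then 1 else 0)
      (fun b => if g true (binVal b) then 1 else 0)]
  rw [sum_binVal fun u => if g false u then (1 : ℝ) else 0,
    sum_binVal fun u => if g true u then (1 : ℝ) else 0]
  have hc : ∑ _ : Basis κ, (1 : ℝ) = 2 ^ κ := by simp
  rw [hc]
  push_cast
  rw [two_mul κ, pow_add]
  field_simp

/-! ### The acceptance probability of a test circuit -/

namespace TestData

variable {T : TestData}

/-- The linear form that the chain `f` computes modulo `Q`. -/
def lin (T : TestData) (f : Bool) (s : ℕ → Bool) : ℕ :=
  T.start + ∑ i ∈ Finset.range T.n, ∑ b ∈ Finset.range T.w,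
    if s (i * T.w + b) then coefOf T.Q (T.numer f i) T.denom b else 0

theorem Valid.mul_le_K (h : T.Valid) : T.n * T.w ≤ T.K := by
  calc T.n * T.w ≤ T.m * T.w := Nat.mul_le_mul_right _ h.n
    _ = T.K := by simp only [w, K]; ring

/-- Controls are witness wires or random wires; they never lie in a block of a chain or on the
output. -/
theorem mem_layers_lt (h : T.Valid) (f : Bool) : ∀ l ∈ T.layers f, l.1 < T.out := by
  intro l hl
  have hK := h.mul_le_K
  simp only [layers, chainLayers, rowLayers, List.mem_append, List.mem_flatMap, List.mem_map,
    List.mem_range] at hl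
  rcases hl with ⟨i, hi, b, hb, rfl⟩ | ⟨r, hr, rfl⟩
  · have : (i + 1) * T.w ≤ T.n * T.w := Nat.mul_le_mul_right _ hi
    have h2 : (i + 1) * T.w = i * T.w + T.w := by ring
    simp only [out]
    omega
  · cases f <;> simp only [out, Bool.toNat_false, Bool.toNat_true, zero_mul, one_mul] <;> omega

theorem out_lt_base (f : Bool) : T.out < T.base f := by
  rw [out, base, chainBase]
  omega

/-- The second chain starts where the first one ends, so it finds only zeros. -/
theorem base_true : T.base true = T.base false + ((T.layers false).length + 1) * T.Q := by
  simp only [base, chainBase, layers, chainLayers_length, Bool.toNat_true, Bool.toNat_false]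
  ring

theorem base_true_add : T.base true + ((T.layers true).length + 1) * T.Q = T.K + T.anc := by
  simp only [base, chainBase, layers, chainLayers_length, Bool.toNat_true, anc]
  ring

theorem Q_eq : T.Q = 2 * 2 ^ T.κ := by rw [Q, pow_succ]; ring

theorem Valid.start_lt (h : T.Valid) : T.start < T.Q := by
  have : T.start ≤ 1 * (T.Q / 4) := Nat.mul_le_mul_right _ h.kd
  have : 0 < T.Q := by rw [Q]; positivity
  omega

theorem chain_ok (h : T.Valid) (f : Bool) : ∀ g ∈ T.chain f, g.Ok (T.K + T.anc) ∧ g.Classical := by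
  have hQ := T.Q_eq
  have hst := h.start_lt
  rw [hQ] at hst
  rw [chain, hQ]
  refine chainGates_ok _ (out_lt_base f) hst
    (fun l hl => (mem_layers_lt h f l hl).trans (out_lt_base f)) ?_
  rw [← hQ]
  have h1 := T.base_true_add
  cases f
  · have h2 := T.base_true
    omega
  · omega

theorem hadamards_ok (T : TestData) :
    ∀ g ∈ (List.range (2 * T.κ)).map (fun r => RawGate.H (T.K + r)), g.Ok (T.K + T.anc) := by
  intro g hg
  simp only [List.mem_map, List.mem_range] at hg
  obtain ⟨r, hr, rfl⟩ := hg
  simp only [RawGate.Ok, anc]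
  omega

theorem chains_ok (h : T.Valid) :
    ∀ g ∈ T.chain false ++ T.chain true, g.Ok (T.K + T.anc) ∧ g.Classical := by
  intro g hg
  rcases List.mem_append.1 hg with hg | hg
  exacts [chain_ok h _ g hg, chain_ok h _ g hg]

/-- The circuit of a test. -/
def circuit (T : TestData) (h : T.Valid) : Circuit T.K where
  anc := T.anc
  gates := toGates _ T.hadamards_ok ++ toGates (T.chain false ++ T.chain true) fun g hg => (chains_ok h g hg).1
  out := ⟨T.out, by simp only [out, anc]; omega⟩

theorem sum_flatMap_range {α : Type*} (g : ℕ → List α) (φ : α → ℕ) (n : ℕ) :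
    (((List.range n).flatMap g).map φ).sum = ∑ i ∈ Finset.range n, ((g i).map φ).sum := by
  induction n with
  | zero => simp
  | succ n ih => simp [List.range_succ, List.flatMap_append, Finset.sum_range_succ, ← ih]

theorem sum_map_range (φ : ℕ → ℕ) (n : ℕ) :
    ((List.range n).map φ).sum = ∑ i ∈ Finset.range n, φ i := by
  induction n with
  | zero => simp
  | succ n ih => simp [List.range_succ, Finset.sum_range_succ, ← ih]

/-- The layers of the rows give the linear form in the witness bits, and those of the random wires
add a number that is uniform over all random strings. -/
theorem start_add_layersSum (h : T.Valid) (f : Bool) (x : Basis T.K) (s : ℕ → Bool)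
    (hs : ∀ q, q < T.K → s q = extend x q) :
    T.start + layersSum s (T.layers f) =
      T.lin f (extend x) + binVal fun r : Fin T.κ => s (T.K + f.toNat * T.κ + r) := by
  have hK := h.mul_le_K
  simp only [layersSum, layers, chainLayers, List.map_append, List.sum_append, sum_flatMap_range,
    rowLayers, List.map_map, Function.comp_def, sum_map_range]
  rw [lin, add_assoc, binVal, Fin.sum_univ_eq_sum_range
    (fun r => if s (T.K + f.toNat * T.κ + r) = true then 2 ^ r else 0)]
  congr 2
  refine Finset.sum_congr rfl fun i hi => Finset.sum_congr rfl fun b hb => ?_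
  rw [hs]
  rw [Finset.mem_range] at hi hb
  have : (i + 1) * T.w ≤ T.n * T.w := Nat.mul_le_mul_right _ hi
  have h2 : (i + 1) * T.w = i * T.w + T.w := by ring
  omega

/-- The bit that the chains leave on the output wire. -/
theorem chains_act (h : T.Valid) (x : Basis T.K) (y : Basis (2 * T.κ)) :
    actGates (T.chain false ++ T.chain true) (initBits x y) T.out =
      xor (decide (2 ^ T.κ ≤ (T.lin false (extend x) + binVal fun r : Fin T.κ => y ⟨r, by omega⟩) % T.Q))
        (decide (2 ^ T.κ ≤ (T.lin true (extend x) + binVal fun r : Fin T.κ => y ⟨T.κ + r, by omega⟩) % T.Q)) := by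
  have hQ := T.Q_eq
  have hst := h.start_lt
  have hs0 : ∀ q, T.out ≤ q → initBits x y q = false := by
    intro q hq
    rw [out] at hq
    rw [initBits, if_neg (by omega), extend_apply_of_le _ (by omega)]
  have hb0 := T.out_lt_base false
  have hb1 := T.out_lt_base true
  have hbt := T.base_true
  rw [hQ] at hst hbt
  obtain ⟨h1, h2, h3⟩ := chainGates_act (H := 2 ^ T.κ) (T.layers false) (s := initBits x y) hb0 hst
    (fun l hl => (mem_layers_lt h false l hl).trans hb0) (fun q hq _ => hs0 q (by omega))
  obtain ⟨k1, k2, k3⟩ := chainGates_act (H := 2 ^ T.κ) (T.layers true)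
    (s := actGates (chainGates (2 * 2 ^ T.κ) T.out (T.base false) T.start (T.layers false))
      (initBits x y)) hb1 hst
    (fun l hl => (mem_layers_lt h true l hl).trans hb1) (fun q hq _ => by
      rw [h2 q (by omega)]; exact hs0 q (by omega))
  have hx : ∀ q, q < T.K → initBits x y q = extend x q := fun q hq => by rw [initBits, if_pos hq]
  rw [actGates_append, chain, chain, hQ, k3, h3, hs0 _ le_rfl, Bool.false_xor]
  rw [layersSum_congr (s' := initBits x y) (ls := T.layers true) fun l hl => by
    have := mem_layers_lt h true l hl
    exact h1 _ (by omega) (by omega)]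
  rw [start_add_layersSum h false x _ hx, start_add_layersSum h true x _ hx]
  have e : ∀ (r : ℕ) (hr : r < 2 * T.κ), initBits x y (T.K + r) = y ⟨r, hr⟩ := by
    intro r hr
    rw [initBits, if_neg (by omega), show T.K + r - T.K = r by omega, extend_apply _ hr]
  congr 4
  · congr 2
    funext r
    rw [Bool.toNat_false, zero_mul, add_zero, e]
  · congr 2
    funext r
    rw [Bool.toNat_true, one_mul, add_assoc, e]

/-- The probability that the test accepts the bits `s`. -/
def acc (T : TestData) (s : ℕ → Bool) : ℝ :=
  tri ((T.lin false s : ℝ) / T.Q) + tri ((T.lin true s : ℝ) / T.Q) -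
    2 * tri ((T.lin false s : ℝ) / T.Q) * tri ((T.lin true s : ℝ) / T.Q)

theorem accept_circuit (h : T.Valid) (ρ : Op T.K) :
    (T.circuit h).accept ρ = ∑ x, (ρ x x).re * T.acc (extend x) := by
  have h1 := accept_eq (k := T.K) (a := T.anc) (h := 2 * T.κ) (by rw [anc]; omega)
    (T.chain false ++ T.chain true) T.hadamards_ok (fun g hg => (chains_ok h g hg).1)
    (fun g hg => (chains_ok h g hg).2) ⟨T.out, by simp only [out, anc]; omega⟩ ρ
  rw [circuit, h1]
  refine Finset.sum_congr rfl fun x _ => ?_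
  congr 1
  simp only [chains_act h]
  have h2 := sum_xor (κ := T.κ) fun f u => 2 ^ T.κ ≤ (T.lin f (extend x) + u) % T.Q
  rw [h2, T.Q_eq, card_tri (by positivity), card_tri (by positivity), acc, ← T.Q_eq]

/-- The triple of a test. -/
def triple (T : TestData) (h : T.Valid) : Triple T.K where
  V := T.circuit h
  rNum := T.rNum
  rDen := 20
  sNum := T.sNum
  sDen := T.sDen
  rDen_pos := by norm_num
  sDen_pos := by
    have := h.m
    have : 0 < T.m := by omega
    rw [sDen]
    split_ifs <;> positivity
  r_le := by
    rw [rNum]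
    split_ifs <;> norm_num
  s_le := by
    have := h.m
    have : 0 < T.m := by omega
    have : 0 < T.m ^ 4 := by positivity
    rw [sNum, sDen]
    split_ifs
    · norm_num
    · omega
    · exact Nat.one_le_iff_ne_zero.2 (by positivity)

theorem encode_triple (h : T.Valid) : (T.triple h).encode = T.output := by
  simp only [Triple.encode, triple, Circuit.encode, circuit, List.flatMap_append, encode_toGates,
    output, gates, hadamards, encGates_append, List.append_assoc]

/-- The transport along `e` is needed because the type of a super-verifier contains the value of a
polynomial in place of `T.K`; for variable `k` it disappears by substitution. -/
theorem accept_triple (h : T.Valid) {k : ℕ} (e : T.K = k) (ρ : Op k) :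
    (e ▸ T.triple h).V.accept ρ = ∑ x, (ρ x x).re * T.acc (extend x) := by
  subst e
  exact accept_circuit h ρ

theorem encode_triple_cast (h : T.Valid) {k : ℕ} (e : T.K = k) :
    (e ▸ T.triple h).encode = T.output := by
  subst e
  exact encode_triple h

theorem r_triple (h : T.Valid) {k : ℕ} (e : T.K = k) :
    (e ▸ T.triple h).r = (T.rNum : ℝ) / 20 := by
  subst e
  simp [Triple.r, triple]

theorem s_triple (h : T.Valid) {k : ℕ} (e : T.K = k) :
    (e ▸ T.triple h).s = (T.sNum : ℝ) / T.sDen := by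
  subst e
  rfl

end TestData

theorem eval_X_add_pow (k N : ℕ) : ((Polynomial.X + 100 : ℕ[X]) ^ k).eval N = (N + 100) ^ k := by
  rw [Polynomial.eval_pow, Polynomial.eval_add, Polynomial.eval_X, Polynomial.eval_ofNat]

theorem K_testOf (x co : List Bool) :
    (testOf x co).K = ((Polynomial.X + 100 : ℕ[X]) ^ 5).eval x.length := by
  rw [eval_X_add_pow]
  rfl

/-- The super-verifier. -/
def superVerifier : SuperVerifier ((Polynomial.X + 100 : ℕ[X]) ^ 5) where
  prog := superProg
  coinLen := (Polynomial.X + 100) ^ 1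
  time := (Polynomial.X + 100) ^ 60
  triple x ω := K_testOf x (List.ofFn ω) ▸ (testOf x (List.ofFn ω)).triple (testOf_valid _ _)
  runs x ω := by
    obtain ⟨t, τ, h1, h2, h3⟩ := superProg_runs x (List.ofFn ω) (by
      rw [List.length_ofFn, eval_X_add_pow, pow_one])
    exact ⟨t, τ, by rwa [eval_X_add_pow], h2, by rw [h3, TestData.encode_triple_cast]⟩

/-! ### A smooth bump function on the integers -/

/-- The function `((W² - k²)₊)²`. -/
def bump (W : ℕ) (k : ℤ) : ℝ := (max ((W : ℝ) ^ 2 - (k : ℝ) ^ 2) 0) ^ 2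

/-- The correlation of the bump function with its translate. -/
def corr (W : ℕ) (a : ℤ) : ℝ := ∑ k ∈ Finset.Icc (-(W : ℤ)) W, bump W k * bump W (k + a)

theorem bump_neg (W : ℕ) (k : ℤ) : bump W (-k) = bump W k := by simp [bump]

theorem bump_eq_zero {W : ℕ} {k : ℤ} (h : k ∉ Finset.Icc (-(W : ℤ)) W) : bump W k = 0 := by
  rw [Finset.mem_Icc, ← abs_le, not_le] at h
  have h1 : ((W : ℤ) : ℝ) < |(k : ℝ)| := by exact_mod_cast h
  have h2 : ((W : ℤ) : ℝ) ^ 2 ≤ |(k : ℝ)| ^ 2 := pow_le_pow_left₀ (by positivity) h1.le 2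
  rw [sq_abs] at h2
  rw [bump, max_eq_right (by push_cast at h2; linarith)]
  norm_num

/-- The bump is even. This symmetry will make E cos(θ + φ) and E cos(θ - φ) equal, and so kill the
mixed moments. -/
theorem corr_neg (W : ℕ) (a : ℤ) : corr W (-a) = corr W a := by
  unfold corr
  refine Finset.sum_nbij' (fun k => -k) (fun k => -k) ?_ ?_ ?_ ?_ ?_
  · intro k hk; rw [Finset.mem_Icc] at hk ⊢; omega
  · intro k hk; rw [Finset.mem_Icc] at hk ⊢; omega
  · intro k _; simp
  · intro k _; simp
  · intro k _
    rw [bump_neg, show -k + a = -(k + -a) by ring, bump_neg]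

/-- Enlarging the interval by two on both sides provides one index set for all shifts by at most
two, so that sums with different shifts can be combined termwise. -/
theorem sum_shift {W : ℕ} {f : ℤ → ℝ} (hf : ∀ k, k ∉ Finset.Icc (-(W : ℤ)) W → f k = 0) {a : ℤ}
    (ha : |a| ≤ 2) :
    ∑ k ∈ Finset.Icc (-(W : ℤ) - 2) (W + 2), f (k + a) = ∑ k ∈ Finset.Icc (-(W : ℤ)) W, f k := by
  rw [abs_le] at ha
  have h1 : ∑ k ∈ Finset.Icc (-(W : ℤ)) W, f k =
      ∑ k ∈ Finset.Icc (-(W : ℤ) - a) (W - a), f (k + a) := by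
    refine Finset.sum_nbij' (fun k => k - a) (fun k => k + a) ?_ ?_ ?_ ?_ ?_
    · intro k hk; rw [Finset.mem_Icc] at hk ⊢; omega
    · intro k hk; rw [Finset.mem_Icc] at hk ⊢; omega
    · intro k _; simp
    · intro k _; simp
    · intro k _; simp
  rw [h1]
  symm
  refine Finset.sum_subset ?_ ?_
  · intro k hk; rw [Finset.mem_Icc] at hk ⊢; omega
  · intro k _ hk
    apply hf
    rw [Finset.mem_Icc] at hk ⊢
    omega

theorem sum_shift_corr {W : ℕ} (a b : ℤ) (hb : |b| ≤ 2) :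
    ∑ k ∈ Finset.Icc (-(W : ℤ) - 2) (W + 2), bump W (k + b) * bump W (k + b + a) = corr W a :=
  sum_shift (f := fun k => bump W k * bump W (k + a)) (fun k hk => by simp [bump_eq_zero hk]) hb

/-- After division by `corr W 0`, the right-hand side will be the expectation of 2 - 2 cos for the
random angle; the left-hand side is an energy that can be estimated pointwise. -/
theorem diff_sum (W : ℕ) :
    ∑ k ∈ Finset.Icc (-(W : ℤ) - 2) (W + 2), (bump W (k + 1) - bump W k) ^ 2 =
      2 * corr W 0 - 2 * corr W 1 := by
  rw [two_mul (corr W 0)]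
  nth_rewrite 1 [← sum_shift_corr (W := W) 0 1 (by norm_num)]
  rw [← sum_shift_corr (W := W) 0 0 (by norm_num), ← sum_shift_corr (W := W) 1 0 (by norm_num),
    Finset.mul_sum, ← Finset.sum_add_distrib, ← Finset.sum_sub_distrib]
  refine Finset.sum_congr rfl fun k _ => ?_
  simp only [add_zero]
  ring

/-- The coefficients 6, -8, 2 are those of (2 - 2 cos x)² written in cos x and cos 2x. -/
theorem second_diff_sum (W : ℕ) :
    ∑ k ∈ Finset.Icc (-(W : ℤ) - 2) (W + 2), (bump W (k + 1) - 2 * bump W k + bump W (k - 1)) ^ 2 =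
      6 * corr W 0 - 8 * corr W 1 + 2 * corr W 2 := by
  have h0 := sum_shift_corr (W := W) 0 1 (by norm_num)
  have h1 := sum_shift_corr (W := W) 0 0 (by norm_num)
  have h2 := sum_shift_corr (W := W) 0 (-1) (by norm_num)
  have h3 := sum_shift_corr (W := W) 1 0 (by norm_num)
  have h4 := sum_shift_corr (W := W) 1 (-1) (by norm_num)
  have h5 := sum_shift_corr (W := W) 2 (-1) (by norm_num)
  have : 6 * corr W 0 - 8 * corr W 1 + 2 * corr W 2 =
    corr W 0 + 4 * corr W 0 + corr W 0 - 4 * corr W 1 - 4 * corr W 1 + 2 * corr W 2 := by ring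
  rw [this]
  nth_rewrite 1 [← h0]
  nth_rewrite 1 [← h1]
  nth_rewrite 1 [← h2]
  nth_rewrite 1 [← h3]
  nth_rewrite 1 [← h4]
  rw [← h5, Finset.mul_sum, Finset.mul_sum, Finset.mul_sum, Finset.mul_sum,
    ← Finset.sum_add_distrib, ← Finset.sum_add_distrib, ← Finset.sum_sub_distrib,
    ← Finset.sum_sub_distrib, ← Finset.sum_add_distrib]
  refine Finset.sum_congr rfl fun k _ => ?_
  simp only [add_zero, neg_add_cancel_right, ← sub_eq_add_neg]
  rw [show k - 1 + 1 = k by ring, show k - 1 + 2 = k + 1 by ring]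
  ring

theorem card_Icc_le {W : ℕ} (hW : 5 ≤ W) : ((Finset.Icc (-(W : ℤ) - 2) (W + 2)).card : ℝ) ≤ 3 * W := by
  rw [Int.card_Icc]
  have : ((W : ℤ) + 2 + 1 - (-(W : ℤ) - 2)).toNat ≤ 3 * W := by omega
  exact_mod_cast this

/-- The difference of squares factors: the first factor is at most 3W since the positive part is a
contraction, the second at most 2W². There are at most 3W terms, which needs `5 ≤ W`. -/
theorem diff_sum_le {W : ℕ} (hW : 5 ≤ W) : 2 * corr W 0 - 2 * corr W 1 ≤ 108 * (W : ℝ) ^ 7 := by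
  have hW' : (5 : ℝ) ≤ W := by exact_mod_cast hW
  rw [← diff_sum]
  have h : ∀ k ∈ Finset.Icc (-(W : ℤ) - 2) (W + 2), (bump W (k + 1) - bump W k) ^ 2 ≤ 36 * (W : ℝ) ^ 6 := by
    intro k hk
    rw [Finset.mem_Icc] at hk
    have hk1 : -(W : ℝ) - 2 ≤ k := by exact_mod_cast hk.1
    have hk2 : (k : ℝ) ≤ W + 2 := by exact_mod_cast hk.2
    have e : bump W (k + 1) - bump W k = (max ((W : ℝ) ^ 2 - ((k + 1 : ℤ) : ℝ) ^ 2) 0 - max ((W : ℝ) ^ 2 - (k : ℝ) ^ 2) 0) *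
      (max ((W : ℝ) ^ 2 - ((k + 1 : ℤ) : ℝ) ^ 2) 0 + max ((W : ℝ) ^ 2 - (k : ℝ) ^ 2) 0) := by
      simp only [bump]; ring
    have h1 : |max ((W : ℝ) ^ 2 - ((k + 1 : ℤ) : ℝ) ^ 2) 0 - max ((W : ℝ) ^ 2 - (k : ℝ) ^ 2) 0| ≤ 3 * W := by
      refine (abs_max_sub_max_le_abs _ _ _).trans ?_
      push_cast
      rw [abs_le]
      constructor <;> nlinarith
    have h2 : ∀ y : ℝ, max ((W : ℝ) ^ 2 - y ^ 2) 0 ≤ (W : ℝ) ^ 2 := fun y =>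
      max_le (by nlinarith [sq_nonneg y]) (by positivity)
    have h3 : ∀ y : ℝ, 0 ≤ max ((W : ℝ) ^ 2 - y ^ 2) 0 := fun y => le_max_right _ _
    have h4 : |max ((W : ℝ) ^ 2 - ((k + 1 : ℤ) : ℝ) ^ 2) 0 + max ((W : ℝ) ^ 2 - (k : ℝ) ^ 2) 0| ≤
        2 * (W : ℝ) ^ 2 := by
      rw [abs_of_nonneg (add_nonneg (h3 _) (h3 _))]
      linarith [h2 ((k + 1 : ℤ) : ℝ), h2 (k : ℝ)]
    rw [← sq_abs, e, abs_mul]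
    calc _ ≤ (3 * (W : ℝ) * (2 * (W : ℝ) ^ 2)) ^ 2 :=
          pow_le_pow_left₀ (by positivity) (mul_le_mul h1 h4 (abs_nonneg _) (by positivity)) 2
      _ = 36 * (W : ℝ) ^ 6 := by ring
  calc _ ≤ _ := Finset.sum_le_card_nsmul _ _ _ h
    _ ≤ 3 * W * (36 * (W : ℝ) ^ 6) := by
        rw [nsmul_eq_mul]
        exact mul_le_mul_of_nonneg_right (card_Icc_le hW) (by positivity)
    _ = _ := by ring

/-- Inside the interval the bump is a polynomial with second difference 12k² + 2 - 4W². At the edge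
it vanishes to second order, so its neighbouring values are themselves O(W²); this is why the bump
is the square of a positive part. -/
theorem second_diff_sum_le {W : ℕ} (hW : 5 ≤ W) :
    6 * corr W 0 - 8 * corr W 1 + 2 * corr W 2 ≤ 432 * (W : ℝ) ^ 5 := by
  have hW' : (5 : ℝ) ≤ W := by exact_mod_cast hW
  rw [← second_diff_sum]
  have h : ∀ k ∈ Finset.Icc (-(W : ℤ) - 2) (W + 2),
      (bump W (k + 1) - 2 * bump W k + bump W (k - 1)) ^ 2 ≤ 144 * (W : ℝ) ^ 4 := by
    intro k hk
    suffices h : |bump W (k + 1) - 2 * bump W k + bump W (k - 1)| ≤ 12 * (W : ℝ) ^ 2 by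
      rw [← sq_abs]
      calc _ ≤ (12 * (W : ℝ) ^ 2) ^ 2 := pow_le_pow_left₀ (abs_nonneg _) h 2
        _ = _ := by ring
    by_cases hkW : |k| < W
    · rw [abs_lt] at hkW
      have hin : ∀ j : ℤ, -(W : ℤ) ≤ j → j ≤ W → bump W j = ((W : ℝ) ^ 2 - (j : ℝ) ^ 2) ^ 2 := by
        intro j h1 h2
        have h1' : -(W : ℝ) ≤ j := by exact_mod_cast h1
        have h2' : (j : ℝ) ≤ W := by exact_mod_cast h2
        rw [bump, max_eq_left (by nlinarith)]
      have h1' : -(W : ℝ) ≤ k := by exact_mod_cast hkW.1.le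
      have h2' : (k : ℝ) ≤ W := by exact_mod_cast hkW.2.le
      rw [hin _ (by omega) (by omega), hin _ (by omega) (by omega), hin _ (by omega) (by omega)]
      push_cast
      rw [show ((W : ℝ) ^ 2 - (k + 1) ^ 2) ^ 2 - 2 * ((W : ℝ) ^ 2 - k ^ 2) ^ 2 + ((W : ℝ) ^ 2 - (k - 1) ^ 2) ^ 2
        = 12 * (k : ℝ) ^ 2 + 2 - 4 * (W : ℝ) ^ 2 by ring, abs_le]
      have : (k : ℝ) ^ 2 ≤ (W : ℝ) ^ 2 := by nlinarith
      constructor <;> nlinarith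
    · have h0 : bump W k = 0 := by
        by_cases hk' : k ∈ Finset.Icc (-(W : ℤ)) W
        · rw [Finset.mem_Icc, ← abs_le] at hk'
          have : |k| = W := le_antisymm hk' (not_lt.1 hkW)
          have h' : |(k : ℝ)| = W := by exact_mod_cast this
          rw [bump, ← sq_abs (k : ℝ), h']
          norm_num
        · exact bump_eq_zero hk'
      have hb : ∀ j : ℤ, (W : ℤ) - 1 ≤ |j| → 0 ≤ bump W j ∧ bump W j ≤ 4 * (W : ℝ) ^ 2 := by
        intro j hj
        have h' : (W : ℝ) - 1 ≤ |(j : ℝ)| := by exact_mod_cast hj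
        refine ⟨by rw [bump]; positivity, ?_⟩
        have : max ((W : ℝ) ^ 2 - (j : ℝ) ^ 2) 0 ≤ 2 * W := by
          refine max_le ?_ (by positivity)
          rw [← sq_abs (j : ℝ)]
          nlinarith
        calc bump W j ≤ (2 * (W : ℝ)) ^ 2 := pow_le_pow_left₀ (le_max_right _ _) this 2
          _ = _ := by ring
      obtain ⟨a1, a2⟩ := hb (k + 1) (by
        have := abs_sub_abs_le_abs_sub k (k + 1)
        rw [show k - (k + 1) = -1 by ring] at this
        norm_num at this
        omega)
      obtain ⟨b1, b2⟩ := hb (k - 1) (by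
        have := abs_sub_abs_le_abs_sub k (k - 1)
        rw [show k - (k - 1) = 1 by ring] at this
        norm_num at this
        omega)
      rw [h0, abs_of_nonneg (by linarith)]
      nlinarith
  calc _ ≤ _ := Finset.sum_le_card_nsmul _ _ _ h
    _ ≤ 3 * W * (144 * (W : ℝ) ^ 4) := by
        rw [nsmul_eq_mul]
        exact mul_le_mul_of_nonneg_right (card_Icc_le hW) (by positivity)
    _ = _ := by ring

/-- On the inner half of the interval `W² - k²` is at least `3 V²`. This yields 162 V⁹, and 162 /
512 exceeds 3 / 10. -/
theorem corr_zero_ge (V : ℕ) : 3 / 10 * ((2 * V : ℕ) : ℝ) ^ 9 ≤ corr (2 * V) 0 := by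
  have hsub : Finset.Icc (-(V : ℤ)) V ⊆ Finset.Icc (-((2 * V : ℕ) : ℤ)) ((2 * V : ℕ) : ℤ) := by
    intro k hk
    rw [Finset.mem_Icc] at hk ⊢
    push_cast
    omega
  have h : ∀ k ∈ Finset.Icc (-(V : ℤ)) V, 81 * (V : ℝ) ^ 8 ≤ bump (2 * V) k * bump (2 * V) (k + 0) := by
    intro k hk
    rw [Finset.mem_Icc] at hk
    have h1 : -(V : ℝ) ≤ k := by exact_mod_cast hk.1
    have h2 : (k : ℝ) ≤ V := by exact_mod_cast hk.2
    have h3 : 3 * (V : ℝ) ^ 2 ≤ max (((2 * V : ℕ) : ℝ) ^ 2 - (k : ℝ) ^ 2) 0 := by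
      refine le_max_of_le_left ?_
      push_cast
      nlinarith
    have h4 : (3 * (V : ℝ) ^ 2) ^ 2 ≤ bump (2 * V) k := pow_le_pow_left₀ (by positivity) h3 2
    rw [add_zero]
    calc 81 * (V : ℝ) ^ 8 = (3 * (V : ℝ) ^ 2) ^ 2 * (3 * (V : ℝ) ^ 2) ^ 2 := by ring
      _ ≤ _ := mul_le_mul h4 h4 (by positivity) ((by positivity : (0 : ℝ) ≤ _).trans h4)
  have h5 := Finset.card_nsmul_le_sum _ _ _ h
  have h6 : ∑ k ∈ Finset.Icc (-(V : ℤ)) V, bump (2 * V) k * bump (2 * V) (k + 0) ≤ corr (2 * V) 0 :=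
    Finset.sum_le_sum_of_subset_of_nonneg hsub fun k _ _ => by simp only [bump]; positivity
  have hc : (2 * V : ℝ) ≤ ((Finset.Icc (-(V : ℤ)) V).card : ℝ) := by
    rw [Int.card_Icc]
    have : 2 * V ≤ ((V : ℤ) + 1 - -(V : ℤ)).toNat := by omega
    exact_mod_cast this
  rw [nsmul_eq_mul] at h5
  have h7 : 2 * V * (81 * (V : ℝ) ^ 8) ≤ corr (2 * V) 0 :=
    (mul_le_mul_of_nonneg_right hc (by positivity)).trans (h5.trans h6)
  push_cast
  have : (0 : ℝ) ≤ (V : ℝ) ^ 9 := by positivity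
  nlinarith

/-! ### Random characters of a finite quotient of `ℤⁿ` -/

/-- Expand the squared modulus into a double sum and use orthogonality of characters. The Fourier
coefficients of |F̂|² are autocorrelations of `F` pushed to the group. -/
theorem sum_normSq_mul_char {G ι : Type*} [AddCommGroup G] [Fintype G] [DecidableEq G]
    (S : Finset ι) (e : ι → G) (F : ι → ℝ) (g : G) :
    ∑ χ : AddChar G ℂ, ((‖∑ z ∈ S, (F z : ℂ) * χ (e z)‖ ^ 2 : ℝ) : ℂ) * χ g =
      ((Fintype.card G : ℝ) * ∑ z ∈ S, ∑ z' ∈ S, if g + e z - e z' = 0 then F z * F z' else 0 : ℝ) := by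
  have h1 : ∀ χ : AddChar G ℂ, ((‖∑ z ∈ S, (F z : ℂ) * χ (e z)‖ ^ 2 : ℝ) : ℂ) * χ g =
      ∑ z ∈ S, ∑ z' ∈ S, (F z : ℂ) * F z' * χ (g + e z - e z') := by
    intro χ
    push_cast
    rw [← Complex.mul_conj', map_sum, Finset.sum_mul_sum, Finset.sum_mul]
    refine Finset.sum_congr rfl fun z _ => ?_
    rw [Finset.sum_mul]
    refine Finset.sum_congr rfl fun z' _ => ?_
    rw [map_mul, Complex.conj_ofReal, ← AddChar.map_neg_eq_conj, sub_eq_add_neg,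
      AddChar.map_add_eq_mul, AddChar.map_add_eq_mul]
    ring
  rw [Finset.sum_congr rfl fun χ _ => h1 χ, Finset.sum_comm]
  push_cast
  rw [Finset.mul_sum]
  refine Finset.sum_congr rfl fun z _ => ?_
  rw [Finset.sum_comm, Finset.mul_sum]
  refine Finset.sum_congr rfl fun z' _ => ?_
  rw [← Finset.mul_sum, AddChar.sum_apply_eq_ite]
  split_ifs
  · push_cast; ring
  · simp

/-- The box `[-W, W]ⁿ`. -/
def box (n W : ℕ) : Finset (Fin n → ℤ) := Fintype.piFinset fun _ => Finset.Icc (-(W : ℤ)) W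

/-- The product of bump functions. -/
def prodBump {n : ℕ} (W : ℕ) (z : Fin n → ℤ) : ℝ := ∏ i, bump W (z i)

theorem prodBump_eq_zero {n W : ℕ} {z : Fin n → ℤ} (hz : z ∉ box n W) : prodBump W z = 0 := by
  simp only [box, Fintype.mem_piFinset, not_forall] at hz
  obtain ⟨i, hi⟩ := hz
  exact Finset.prod_eq_zero (Finset.mem_univ i) (bump_eq_zero hi)

theorem sum_prodBump {n W : ℕ} (a : Fin n → ℤ) :
    ∑ z ∈ box n W, prodBump W z * prodBump W (z + a) = ∏ i, corr W (a i) := by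
  simp only [corr, Finset.prod_univ_sum, box, prodBump, ← Finset.prod_mul_distrib, Pi.add_apply]

/-- The angles of a character of a quotient of `ℤⁿ`. -/
def angle {n : ℕ} {Λ : AddSubgroup (Fin n → ℤ)} (χ : AddChar ((Fin n → ℤ) ⧸ Λ) ℂ) (i : Fin n) : ℝ :=
  (χ ((Pi.single i 1 : Fin n → ℤ) : (Fin n → ℤ) ⧸ Λ)).arg / (2 * Real.pi)

theorem abs_angle_le {n : ℕ} {Λ : AddSubgroup (Fin n → ℤ)} (χ : AddChar ((Fin n → ℤ) ⧸ Λ) ℂ)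
    (i : Fin n) : |angle χ i| ≤ 1 / 2 := by
  have h := Complex.abs_arg_le_pi (χ ((Pi.single i 1 : Fin n → ℤ) : (Fin n → ℤ) ⧸ Λ))
  have hpi := Real.pi_pos
  rw [angle, abs_div, abs_of_pos (by positivity : (0 : ℝ) < 2 * Real.pi), div_le_iff₀ (by positivity)]
  linarith

/-- A character is determined by its values on the unit vectors. They have modulus one because the
group is finite, so they are given by their arguments. -/
theorem char_apply {n : ℕ} {Λ : AddSubgroup (Fin n → ℤ)} [Finite ((Fin n → ℤ) ⧸ Λ)]
    (χ : AddChar ((Fin n → ℤ) ⧸ Λ) ℂ) (z : Fin n → ℤ) :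
    χ (z : (Fin n → ℤ) ⧸ Λ) =
      Complex.exp ((2 * Real.pi * ∑ i, angle χ i * z i : ℝ) * Complex.I) := by
  have h1 : ∀ i, χ ((Pi.single i 1 : Fin n → ℤ) : (Fin n → ℤ) ⧸ Λ) =
      Complex.exp ((2 * Real.pi * angle χ i : ℝ) * Complex.I) := by
    intro i
    have hpi := Real.pi_pos.ne'
    conv_lhs => rw [← Complex.norm_mul_exp_arg_mul_I (χ _), AddChar.norm_apply]
    rw [Complex.ofReal_one, one_mul, angle]
    congr 3
    field_simp
  have h2 : z = ∑ i, z i • (Pi.single i 1 : Fin n → ℤ) := by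
    funext j
    simp [Finset.sum_apply, Pi.single_apply]
  have h3 : ∀ s : Finset (Fin n), χ ((∑ i ∈ s, z i • (Pi.single i 1 : Fin n → ℤ) : Fin n → ℤ) : (Fin n → ℤ) ⧸ Λ) =
      Complex.exp ((2 * Real.pi * ∑ i ∈ s, angle χ i * z i : ℝ) * Complex.I) := by
    intro s
    induction s using Finset.induction_on with
    | empty => simp
    | insert i s hi ih =>
      rw [Finset.sum_insert hi, Finset.sum_insert hi, QuotientAddGroup.mk_add, AddChar.map_add_eq_mul,
        ih, QuotientAddGroup.mk_zsmul, AddChar.map_zsmul_eq_zpow, h1, ← Complex.exp_int_mul,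
        ← Complex.exp_add]
      congr 1
      push_cast
      ring
  conv_lhs => rw [h2]
  exact h3 _

theorem re_char_apply {n : ℕ} {Λ : AddSubgroup (Fin n → ℤ)} [Finite ((Fin n → ℤ) ⧸ Λ)]
    (χ : AddChar ((Fin n → ℤ) ⧸ Λ) ℂ) (z : Fin n → ℤ) :
    (χ (z : (Fin n → ℤ) ⧸ Λ)).re = Real.cos (2 * Real.pi * ∑ i, angle χ i * z i) := by
  rw [char_apply, Complex.exp_ofReal_mul_I_re]

/-- The character is trivial on `Λ`, so the vector of angles belongs to the dual of `Λ`. -/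
theorem exists_int_of_mem {n : ℕ} {Λ : AddSubgroup (Fin n → ℤ)} [Finite ((Fin n → ℤ) ⧸ Λ)]
    (χ : AddChar ((Fin n → ℤ) ⧸ Λ) ℂ) {z : Fin n → ℤ} (hz : z ∈ Λ) :
    ∃ k : ℤ, ∑ i, angle χ i * z i = k := by
  have h1 : χ (z : (Fin n → ℤ) ⧸ Λ) = 1 := by
    rw [(QuotientAddGroup.eq_zero_iff z).2 hz, AddChar.map_zero_eq_one]
  rw [char_apply, Complex.exp_eq_one_iff] at h1
  obtain ⟨k, hk⟩ := h1
  refine ⟨k, ?_⟩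
  have hpi := Real.pi_pos.ne'
  have h2 := congrArg Complex.im hk
  have e : (k : ℂ) * (2 * (Real.pi : ℂ) * Complex.I) = ((2 * Real.pi * k : ℝ) : ℂ) * Complex.I := by
    push_cast; ring
  rw [e] at h2
  simp only [Complex.re_ofReal_mul, Complex.im_ofReal_mul, Complex.I_im, mul_one] at h2
  have h3 : (0:ℝ) < 2 * Real.pi := by positivity
  exact mul_left_cancel₀ h3.ne' h2

/-- A random character whose moments at short vectors are the normalized correlations. -/
theorem exists_random_angles {n W : ℕ} (hW : 0 < W) (Λ : AddSubgroup (Fin n → ℤ))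
    [Finite ((Fin n → ℤ) ⧸ Λ)] :
    ∃ (Ω : Type) (_ : Fintype Ω) (p : Ω → ℝ) (θ : Ω → Fin n → ℝ), (∀ ω, 0 ≤ p ω) ∧
      (∀ ω i, |θ ω i| ≤ 1 / 2) ∧ (∀ ω, ∀ z ∈ Λ, ∃ k : ℤ, ∑ i, θ ω i * z i = k) ∧
      (∀ a : Fin n → ℤ, (∀ z ∈ box n W, ∀ z' ∈ box n W, a + z - z' ∈ Λ → a + z - z' = 0) →
        ∑ ω, p ω * Real.cos (2 * Real.pi * ∑ i, θ ω i * a i) = ∏ i, corr W (a i) / corr W 0) ∧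
      (∀ a : Fin n → ℤ, (∀ z ∈ box n W, ∀ z' ∈ box n W, a + z - z' ∉ Λ) →
        ∑ ω, p ω * Real.cos (2 * Real.pi * ∑ i, θ ω i * a i) = 0) := by
  classical
  haveI : Fintype ((Fin n → ℤ) ⧸ Λ) := Fintype.ofFinite _
  have hc0 : 0 < corr W 0 := by
    refine Finset.sum_pos' (fun k _ => by simp only [bump]; positivity) ⟨0, ?_, ?_⟩
    · rw [Finset.mem_Icc]; omega
    · have : (0 : ℝ) < W := by exact_mod_cast hW
      simp only [bump, add_zero, Int.cast_zero]
      rw [show (W : ℝ) ^ 2 - 0 ^ 2 = (W : ℝ) ^ 2 by ring, max_eq_left (by positivity)]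
      positivity
  have hcard : (0 : ℝ) < Fintype.card ((Fin n → ℤ) ⧸ Λ) := by exact_mod_cast Fintype.card_pos
  -- `D` is the total mass of the weights `P`: taking `a = 0` leaves the sum of the squares of the
  -- bump, which is `corr W 0 ^ n`, provided distinct points of the box are not identified modulo
  -- `Λ`.
  set D : ℝ := Fintype.card ((Fin n → ℤ) ⧸ Λ) * corr W 0 ^ n with hD
  have hDpos : 0 < D := by positivity
  let P : AddChar ((Fin n → ℤ) ⧸ Λ) ℂ → ℝ := fun χ =>
    ‖∑ z ∈ box n W, (prodBump W z : ℂ) * χ (z : (Fin n → ℤ) ⧸ Λ)‖ ^ 2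
  have key : ∀ a : Fin n → ℤ, ∑ χ, P χ / D * Real.cos (2 * Real.pi * ∑ i, angle χ i * a i) =
      (∑ z ∈ box n W, ∑ z' ∈ box n W, if a + z - z' ∈ Λ then prodBump W z * prodBump W z' else 0) /
        corr W 0 ^ n := by
    intro a
    have h1 := congrArg Complex.re (sum_normSq_mul_char (box n W)
      (fun z => (z : (Fin n → ℤ) ⧸ Λ)) (prodBump W) (a : (Fin n → ℤ) ⧸ Λ))
    rw [Complex.re_sum, Complex.ofReal_re] at h1
    simp only [Complex.re_ofReal_mul, re_char_apply, ← QuotientAddGroup.mk_add,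
      ← QuotientAddGroup.mk_sub, QuotientAddGroup.eq_zero_iff] at h1
    have h2 : ∑ χ, P χ / D * Real.cos (2 * Real.pi * ∑ i, angle χ i * a i) =
        (∑ χ, P χ * Real.cos (2 * Real.pi * ∑ i, angle χ i * a i)) / D := by
      rw [Finset.sum_div]
      exact Finset.sum_congr rfl fun χ _ => by ring
    rw [h2, h1, hD, mul_div_mul_left _ _ hcard.ne']
  refine ⟨AddChar ((Fin n → ℤ) ⧸ Λ) ℂ, inferInstance, fun χ => P χ / D, angle, fun χ => by positivity,
    abs_angle_le, fun χ z hz => exists_int_of_mem χ hz, fun a ha => ?_, fun a ha => ?_⟩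
  · rw [key, Finset.prod_div_distrib, Finset.prod_const, Finset.card_univ, Fintype.card_fin,
      ← sum_prodBump]
    congr 1
    refine Finset.sum_congr rfl fun z hz => ?_
    -- By the hypothesis on `a` the box does not overlap its translates, and of the periodized
    -- autocorrelation only the term `z' = z + a` remains.
    have h3 : ∀ z' ∈ box n W, (if a + z - z' ∈ Λ then prodBump W z * prodBump W z' else 0) =
        if z' = z + a then prodBump W z * prodBump W z' else 0 := by
      intro z' hz'
      congr 1
      rw [eq_iff_iff]
      constructor
      · intro h
        have := ha z hz z' hz' h
        rw [sub_eq_zero] at this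
        rw [← this, add_comm]
      · rintro rfl
        rw [add_comm a z, sub_self]
        exact Λ.zero_mem
    rw [Finset.sum_congr rfl h3, Finset.sum_ite_eq']
    split_ifs with h
    · rfl
    · rw [prodBump_eq_zero h, mul_zero]
  · rw [key, Finset.sum_eq_zero, zero_div]
    intro z hz
    exact Finset.sum_eq_zero fun y hy => if_neg (ha z hz y hy)

/-! ### Moments -/

/-- Jordan's inequality: 2 - 2 cos(2πθ) = 4 sin²(πθ), and sin(π|θ|) ≥ 2|θ| for |θ| ≤ 1/2. -/
theorem sixteen_mul_sq_le {θ : ℝ} (h : |θ| ≤ 1 / 2) :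
    16 * θ ^ 2 ≤ 2 - 2 * Real.cos (2 * Real.pi * θ) := by
  have hpi := Real.pi_pos
  have h1 : 2 / Real.pi * (Real.pi * |θ|) ≤ Real.sin (Real.pi * |θ|) :=
    Real.mul_le_sin (by positivity) (by nlinarith)
  have h2 : 2 / Real.pi * (Real.pi * |θ|) = 2 * |θ| := by field_simp
  rw [h2] at h1
  have h3 : Real.cos (2 * Real.pi * θ) = 1 - 2 * Real.sin (Real.pi * |θ|) ^ 2 := by
    have : Real.sin (Real.pi * |θ|) ^ 2 = Real.sin (Real.pi * θ) ^ 2 := by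
      rcases abs_choice θ with h | h <;> rw [h]
      rw [mul_neg, Real.sin_neg, neg_sq]
    rw [this, mul_assoc, Real.cos_two_mul, Real.cos_sq']
    ring
  have h4 : (2 * |θ|) ^ 2 ≤ Real.sin (Real.pi * |θ|) ^ 2 := pow_le_pow_left₀ (by positivity) h1 2
  rw [mul_pow, sq_abs] at h4
  rw [h3]
  linarith

theorem abs_sub_sin_le (x : ℝ) : |x - Real.sin x| ≤ 2 * |x| ^ 3 := by
  have key : ∀ x : ℝ, 0 < x → |x - Real.sin x| ≤ 2 * x ^ 3 := by
    intro x hx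
    have h1 := Real.sin_lt hx
    rw [abs_of_pos (by linarith)]
    have := Real.sin_gt_sub_cube hx
    have : 0 < x ^ 3 := by positivity
    linarith
  rcases lt_trichotomy x 0 with h | h | h
  · have := key (-x) (by linarith)
    rw [Real.sin_neg, ← neg_sub', abs_neg] at this
    rwa [abs_of_neg h]
  · simp [h]
  · rw [abs_of_pos h]
    exact key x h

theorem corr_zero_pos {V : ℕ} (hV : 0 < V) : 0 < corr (2 * V) 0 := by
  have : (0 : ℝ) < ((2 * V : ℕ) : ℝ) := by exact_mod_cast (by omega : 0 < 2 * V)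
  exact lt_of_lt_of_le (by positivity) (corr_zero_ge V)

/-- The quotient of 108 W⁷ by 3/10 W⁹. -/
theorem one_sub_corr_le {V : ℕ} (hV : 5 ≤ V) :
    2 - 2 * (corr (2 * V) 1 / corr (2 * V) 0) ≤ 360 / ((2 * V : ℕ) : ℝ) ^ 2 := by
  have h0 := corr_zero_pos (V := V) (by omega)
  have hV' : (0 : ℝ) < ((2 * V : ℕ) : ℝ) := by exact_mod_cast (by omega : 0 < 2 * V)
  have h1 := corr_zero_ge V
  have h2 := diff_sum_le (W := 2 * V) (by omega)
  generalize ((2 * V : ℕ) : ℝ) = W at *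
  have e : 2 - 2 * (corr (2 * V) 1 / corr (2 * V) 0) =
      (2 * corr (2 * V) 0 - 2 * corr (2 * V) 1) / corr (2 * V) 0 := by field_simp
  rw [e, div_le_div_iff₀ h0 (by positivity)]
  calc _ ≤ 108 * W ^ 7 * W ^ 2 := mul_le_mul_of_nonneg_right h2 (by positivity)
    _ = 360 * (3 / 10 * W ^ 9) := by ring
    _ ≤ _ := by linarith

theorem six_sub_corr_le {V : ℕ} (hV : 5 ≤ V) :
    6 - 8 * (corr (2 * V) 1 / corr (2 * V) 0) + 2 * (corr (2 * V) 2 / corr (2 * V) 0) ≤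
      1440 / ((2 * V : ℕ) : ℝ) ^ 4 := by
  have h0 := corr_zero_pos (V := V) (by omega)
  have hV' : (0 : ℝ) < ((2 * V : ℕ) : ℝ) := by exact_mod_cast (by omega : 0 < 2 * V)
  have h1 := corr_zero_ge V
  have h2 := second_diff_sum_le (W := 2 * V) (by omega)
  generalize ((2 * V : ℕ) : ℝ) = W at *
  have e : 6 - 8 * (corr (2 * V) 1 / corr (2 * V) 0) + 2 * (corr (2 * V) 2 / corr (2 * V) 0) =
      (6 * corr (2 * V) 0 - 8 * corr (2 * V) 1 + 2 * corr (2 * V) 2) / corr (2 * V) 0 := by field_simp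
  rw [e, div_le_div_iff₀ h0 (by positivity)]
  calc _ ≤ 432 * W ^ 5 * W ^ 4 := mul_le_mul_of_nonneg_right h2 (by positivity)
    _ = 1440 * (3 / 10 * W ^ 9) := by ring
    _ ≤ _ := by linarith

/-- The bump has width W = 1000 R, so its Fourier transform is concentrated at angles of order 1 / W
and `R * θ` is small: the bound obtained is 360 / (16 · 10⁶). -/
theorem moment_two_le {Ω : Type*} [Fintype Ω] {p θ : Ω → ℝ} (hp : ∀ ω, 0 ≤ p ω)
    (hθ : ∀ ω, |θ ω| ≤ 1 / 2) (h1 : ∑ ω, p ω = 1) {R : ℕ} (hR : 0 < R)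
    (hc : ∑ ω, p ω * Real.cos (2 * Real.pi * θ ω) = corr (2 * (500 * R)) 1 / corr (2 * (500 * R)) 0) :
    ∑ ω, p ω * (R * θ ω) ^ 2 ≤ 1 / 10000 := by
  have hR' : (0 : ℝ) < R := by exact_mod_cast hR
  have h2 : ∑ ω, p ω * (R * θ ω) ^ 2 ≤
      (R : ℝ) ^ 2 / 16 * ∑ ω, p ω * (2 - 2 * Real.cos (2 * Real.pi * θ ω)) := by
    rw [Finset.mul_sum]
    refine Finset.sum_le_sum fun ω _ => ?_
    have := mul_le_mul_of_nonneg_left (sixteen_mul_sq_le (hθ ω))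
      (mul_nonneg (hp ω) (by positivity : (0 : ℝ) ≤ (R : ℝ) ^ 2 / 16))
    nlinarith
  have h3 : ∑ ω, p ω * (2 - 2 * Real.cos (2 * Real.pi * θ ω)) =
      2 - 2 * (corr (2 * (500 * R)) 1 / corr (2 * (500 * R)) 0) := by
    rw [← hc, Finset.mul_sum]
    simp only [mul_sub, Finset.sum_sub_distrib, ← Finset.sum_mul, h1, one_mul]
    congr 1
    exact Finset.sum_congr rfl fun ω _ => by ring
  have h4 := one_sub_corr_le (V := 500 * R) (by omega)
  rw [← h3] at h4
  refine h2.trans ((mul_le_mul_of_nonneg_left h4 (by positivity)).trans ?_)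
  push_cast
  rw [show (R : ℝ) ^ 2 / 16 * (360 / (2 * (500 * (R : ℝ))) ^ 2) = 360 / 16000000 by field_simp; norm_num]
  norm_num

/-- The square of the inequality behind the second moment, with (2 - 2 cos x)² = 6 - 8 cos x + 2 cos
2x. Fourth moments are needed for the mixed moments and for the truncation. -/
theorem moment_four_le {Ω : Type*} [Fintype Ω] {p θ : Ω → ℝ} (hp : ∀ ω, 0 ≤ p ω)
    (hθ : ∀ ω, |θ ω| ≤ 1 / 2) (h1 : ∑ ω, p ω = 1) {R : ℕ} (hR : 0 < R)
    (hc : ∑ ω, p ω * Real.cos (2 * Real.pi * θ ω) = corr (2 * (500 * R)) 1 / corr (2 * (500 * R)) 0)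
    (hc2 : ∑ ω, p ω * Real.cos (2 * Real.pi * (θ ω * 2)) =
      corr (2 * (500 * R)) 2 / corr (2 * (500 * R)) 0) :
    ∑ ω, p ω * (R * θ ω) ^ 4 ≤ 1 / 1000 := by
  have hR' : (0 : ℝ) < R := by exact_mod_cast hR
  have h2 : ∑ ω, p ω * (R * θ ω) ^ 4 ≤
      (R : ℝ) ^ 4 / 256 * ∑ ω, p ω * (6 - 8 * Real.cos (2 * Real.pi * θ ω) +
        2 * Real.cos (2 * Real.pi * (θ ω * 2))) := by
    rw [Finset.mul_sum]
    refine Finset.sum_le_sum fun ω _ => ?_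
    have h5 := pow_le_pow_left₀ (by positivity) (sixteen_mul_sq_le (hθ ω)) 2
    have h6 : (2 - 2 * Real.cos (2 * Real.pi * θ ω)) ^ 2 = 6 - 8 * Real.cos (2 * Real.pi * θ ω) +
        2 * Real.cos (2 * Real.pi * (θ ω * 2)) := by
      rw [show 2 * Real.pi * (θ ω * 2) = 2 * (2 * Real.pi * θ ω) by ring, Real.cos_two_mul]
      ring
    rw [h6] at h5
    have := mul_le_mul_of_nonneg_left h5
      (mul_nonneg (hp ω) (by positivity : (0 : ℝ) ≤ (R : ℝ) ^ 4 / 256))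
    nlinarith
  have h3 : ∑ ω, p ω * (6 - 8 * Real.cos (2 * Real.pi * θ ω) +
        2 * Real.cos (2 * Real.pi * (θ ω * 2))) =
      6 - 8 * (corr (2 * (500 * R)) 1 / corr (2 * (500 * R)) 0) +
        2 * (corr (2 * (500 * R)) 2 / corr (2 * (500 * R)) 0) := by
    rw [← hc, ← hc2, Finset.mul_sum, Finset.mul_sum]
    simp only [mul_add, mul_sub, Finset.sum_sub_distrib, Finset.sum_add_distrib, ← Finset.sum_mul, h1,
      one_mul]
    congr 2
    · exact Finset.sum_congr rfl fun ω _ => by ring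
    · exact funext fun ω => by ring
  have h4 := six_sub_corr_le (V := 500 * R) (by omega)
  rw [← h3] at h4
  refine h2.trans ((mul_le_mul_of_nonneg_left h4 (by positivity)).trans ?_)
  push_cast
  rw [show (R : ℝ) ^ 4 / 256 * (1440 / (2 * (500 * (R : ℝ))) ^ 4) = 1440 / 256000000000000 by
    field_simp; norm_num]
  norm_num

/-- By `hc` the expectation of sin(2πθ) sin(2πφ) is zero. Replacing θ by sin(2πθ)/(2π) has a cubic
error, so the product changes by O(θ⁴ + φ⁴); after scaling by R² this is R⁻² times fourth moments of
`R * θ` and `R * φ`. -/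
theorem mixed_moment_le {Ω : Type*} [Fintype Ω] {p θ φ : Ω → ℝ} (hp : ∀ ω, 0 ≤ p ω) {R : ℝ}
    (hR : 0 < R) (h4 : ∑ ω, p ω * (R * θ ω) ^ 4 ≤ 1) (h4' : ∑ ω, p ω * (R * φ ω) ^ 4 ≤ 1)
    (hc : ∑ ω, p ω * Real.cos (2 * Real.pi * (θ ω + φ ω)) =
      ∑ ω, p ω * Real.cos (2 * Real.pi * (θ ω - φ ω))) :
    |∑ ω, p ω * ((R * θ ω) * (R * φ ω))| ≤ 160 / R ^ 2 := by
  have hpi := Real.pi_pos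
  have hsin : ∑ ω, p ω * (Real.sin (2 * Real.pi * θ ω) * Real.sin (2 * Real.pi * φ ω)) = 0 := by
    have e : ∀ ω, p ω * (Real.sin (2 * Real.pi * θ ω) * Real.sin (2 * Real.pi * φ ω)) =
        (p ω * Real.cos (2 * Real.pi * (θ ω - φ ω)) - p ω * Real.cos (2 * Real.pi * (θ ω + φ ω))) / 2 := by
      intro ω
      rw [mul_sub, mul_add, Real.cos_sub, Real.cos_add]
      ring
    rw [Finset.sum_congr rfl fun ω _ => e ω, ← Finset.sum_div, Finset.sum_sub_distrib, hc, sub_self,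
      zero_div]
  have h40 : 8 * Real.pi ^ 2 ≤ 80 := by nlinarith [Real.pi_lt_d2]
  have hpt : ∀ x y : ℝ, |R * x * (R * y) - (R / (2 * Real.pi)) ^ 2 *
      (Real.sin (2 * Real.pi * x) * Real.sin (2 * Real.pi * y))| ≤
      80 / R ^ 2 * ((R * x) ^ 4 + (R * y) ^ 4) := by
    intro x y
    have hd : ∀ x : ℝ, |x - Real.sin (2 * Real.pi * x) / (2 * Real.pi)| ≤ 80 * |x| ^ 3 := by
      intro x
      have h1 := abs_sub_sin_le (2 * Real.pi * x)
      have e : x - Real.sin (2 * Real.pi * x) / (2 * Real.pi) =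
          (2 * Real.pi * x - Real.sin (2 * Real.pi * x)) / (2 * Real.pi) := by field_simp
      rw [e, abs_div, abs_of_pos (by positivity : 0 < 2 * Real.pi), div_le_iff₀ (by positivity)]
      refine h1.trans ?_
      rw [abs_mul, abs_of_pos (by positivity : 0 < 2 * Real.pi), mul_pow]
      have h3 : 0 ≤ |x| ^ 3 * (2 * Real.pi) := by positivity
      nlinarith
    have hs : ∀ x : ℝ, |Real.sin (2 * Real.pi * x) / (2 * Real.pi)| ≤ |x| := by
      intro x
      rw [abs_div, abs_of_pos (by positivity : 0 < 2 * Real.pi), div_le_iff₀ (by positivity)]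
      refine Real.abs_sin_le_abs.trans ?_
      rw [abs_mul, abs_of_pos (by positivity : 0 < 2 * Real.pi), mul_comm]
    have e : R * x * (R * y) - (R / (2 * Real.pi)) ^ 2 *
        (Real.sin (2 * Real.pi * x) * Real.sin (2 * Real.pi * y)) =
        R ^ 2 * ((x - Real.sin (2 * Real.pi * x) / (2 * Real.pi)) * y +
          Real.sin (2 * Real.pi * x) / (2 * Real.pi) *
          (y - Real.sin (2 * Real.pi * y) / (2 * Real.pi))) := by
      field_simp
      ring
    rw [e, abs_mul, abs_of_pos (by positivity : 0 < R ^ 2)]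
    have h1 : |(x - Real.sin (2 * Real.pi * x) / (2 * Real.pi)) * y +
          Real.sin (2 * Real.pi * x) / (2 * Real.pi) *
          (y - Real.sin (2 * Real.pi * y) / (2 * Real.pi))| ≤ 80 * (x ^ 4 + y ^ 4) := by
      refine (abs_add_le _ _).trans ?_
      rw [abs_mul, abs_mul]
      have a1 := mul_le_mul_of_nonneg_right (hd x) (abs_nonneg y)
      have a2 := mul_le_mul (hs x) (hd y) (abs_nonneg _) (abs_nonneg _)
      have hx : x ^ 4 = |x| ^ 4 := by rw [← abs_pow, abs_of_nonneg (by positivity)]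
      have hy : y ^ 4 = |y| ^ 4 := by rw [← abs_pow, abs_of_nonneg (by positivity)]
      rw [hx, hy]
      have hxy : |x| ^ 3 * |y| + |x| * |y| ^ 3 ≤ |x| ^ 4 + |y| ^ 4 := by
        nlinarith [mul_nonneg (sq_nonneg (|x| - |y|)) (by positivity : 0 ≤ |x| ^ 2 + |x| * |y| + |y| ^ 2)]
      nlinarith
    calc _ ≤ R ^ 2 * (80 * (x ^ 4 + y ^ 4)) := mul_le_mul_of_nonneg_left h1 (by positivity)
      _ = _ := by field_simp
  have h5 : ∑ ω, p ω * ((R * θ ω) * (R * φ ω)) = ∑ ω, p ω * (R * θ ω * (R * φ ω) -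
      (R / (2 * Real.pi)) ^ 2 * (Real.sin (2 * Real.pi * θ ω) * Real.sin (2 * Real.pi * φ ω))) := by
    simp only [mul_sub, Finset.sum_sub_distrib]
    have : ∑ ω, p ω * ((R / (2 * Real.pi)) ^ 2 *
        (Real.sin (2 * Real.pi * θ ω) * Real.sin (2 * Real.pi * φ ω))) = 0 := by
      have : ∀ ω, p ω * ((R / (2 * Real.pi)) ^ 2 *
        (Real.sin (2 * Real.pi * θ ω) * Real.sin (2 * Real.pi * φ ω))) = (R / (2 * Real.pi)) ^ 2 *
        (p ω * (Real.sin (2 * Real.pi * θ ω) * Real.sin (2 * Real.pi * φ ω))) := fun ω => by ring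
      rw [Finset.sum_congr rfl fun ω _ => this ω, ← Finset.mul_sum, hsin, mul_zero]
    rw [this, sub_zero]
  rw [h5]
  refine (Finset.abs_sum_le_sum_abs _ _).trans ?_
  calc _ ≤ ∑ ω, p ω * (80 / R ^ 2 * ((R * θ ω) ^ 4 + (R * φ ω) ^ 4)) := by
        refine Finset.sum_le_sum fun ω _ => ?_
        rw [abs_mul, abs_of_nonneg (hp ω)]
        exact mul_le_mul_of_nonneg_left (hpt _ _) (hp ω)
    _ = 80 / R ^ 2 * (∑ ω, p ω * (R * θ ω) ^ 4 + ∑ ω, p ω * (R * φ ω) ^ 4) := by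
        rw [← Finset.sum_add_distrib, Finset.mul_sum]
        exact Finset.sum_congr rfl fun ω _ => by ring
    _ ≤ 80 / R ^ 2 * 2 := mul_le_mul_of_nonneg_left (by linarith) (by positivity)
    _ = 160 / R ^ 2 := by ring

/-! ### The random dual vector of an instance with a large gap -/

namespace Instance

variable {I : Instance}

theorem den_pos' (I : Instance) : (0 : ℝ) < I.den := by exact_mod_cast I.den_pos

theorem IsBasis.det_ne_zero (h : I.IsBasis) : (Matrix.of I.basis).det ≠ 0 := by
  intro h0
  obtain ⟨v, hv, hv0⟩ := Matrix.exists_vecMul_eq_zero_iff.2 h0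
  apply hv
  have h1 := Fintype.linearIndependent_iff.1 h (fun i => (v i : ℝ)) (by
    ext j
    have h2 := congrFun hv0 j
    simp only [Matrix.vecMul, dotProduct, Matrix.of_apply, Pi.zero_apply] at h2
    have h3 : ∑ i, (v i : ℝ) * (I.basis i j : ℝ) = 0 := by exact_mod_cast h2
    simp only [vec, WithLp.ofLp_sum, Finset.sum_apply, PiLp.smul_apply, smul_eq_mul, PiLp.zero_apply]
    calc ∑ i, (v i : ℝ) * ((I.basis i j : ℝ) / I.den) = (∑ i, (v i : ℝ) * (I.basis i j : ℝ)) / I.den := by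
          rw [Finset.sum_div]; exact Finset.sum_congr rfl fun i _ => by ring
      _ = 0 := by rw [h3, zero_div])
  funext i
  exact_mod_cast h1 i

/-- The vector `z / (M den)`. -/
def scaled (I : Instance) (M : ℕ) : (Fin I.n → ℤ) →+ EuclideanSpace ℝ (Fin I.n) where
  toFun z := WithLp.toLp 2 fun j => (z j : ℝ) / (M * I.den)
  map_zero' := by ext j; simp
  map_add' y z := by ext j; simp [add_div]

theorem scaled_apply (I : Instance) (M : ℕ) (z : Fin I.n → ℤ) (j : Fin I.n) :
    I.scaled M z j = (z j : ℝ) / (M * I.den) := rfl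

theorem scaled_smul {M : ℕ} (hM : 0 < M) (z : Fin I.n → ℤ) : I.scaled M ((M : ℤ) • z) = I.vec z := by
  have : (M : ℝ) ≠ 0 := by exact_mod_cast hM.ne'
  ext j
  rw [scaled_apply]
  simp only [vec, Pi.smul_apply, smul_eq_mul]
  push_cast
  rw [mul_div_mul_left _ _ this]

/-- The passage from the maximum norm to the Euclidean norm; this is the source of the factor √n in
the gap. -/
theorem norm_scaled_le {M : ℕ} (hM : 0 < M) {z : Fin I.n → ℤ} {b : ℝ} (hb : 0 ≤ b)
    (hz : ∀ i, |(z i : ℝ)| ≤ b) : ‖I.scaled M z‖ ≤ b / (M * I.den) * Real.sqrt I.n := by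
  have hM' : (0 : ℝ) < M := by exact_mod_cast hM
  have hd := I.den_pos'
  rw [EuclideanSpace.norm_eq]
  have h1 : ∑ i, ‖I.scaled M z i‖ ^ 2 ≤ (b / (M * I.den)) ^ 2 * I.n := by
    calc _ ≤ ∑ _i : Fin I.n, (b / (M * I.den)) ^ 2 := by
          refine Finset.sum_le_sum fun i _ => pow_le_pow_left₀ (norm_nonneg _) ?_ 2
          rw [scaled_apply, Real.norm_eq_abs, abs_div, abs_of_pos (by positivity : 0 < (M : ℝ) * I.den)]
          exact div_le_div_of_nonneg_right (hz i) (by positivity)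
      _ = _ := by simp [mul_comm]
  refine (Real.sqrt_le_sqrt h1).trans_eq ?_
  rw [Real.sqrt_mul (by positivity), Real.sqrt_sq (by positivity)]

theorem scaled_eq_zero {M : ℕ} (hM : 0 < M) {z : Fin I.n → ℤ} (h : I.scaled M z = 0) : z = 0 := by
  have hM' : (M : ℝ) ≠ 0 := by exact_mod_cast hM.ne'
  have hd := I.den_pos'.ne'
  funext j
  have h1 : I.scaled M z j = 0 := by rw [h]; rfl
  rw [scaled_apply, div_eq_zero_iff] at h1
  rcases h1 with h1 | h1
  · exact Int.cast_eq_zero.1 h1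
  · exact absurd h1 (mul_ne_zero hM' hd)

/-- The integer vectors `z` for which `z / (M den)` lies in the lattice. -/
def scaledLattice (I : Instance) (M : ℕ) : AddSubgroup (Fin I.n → ℤ) :=
  I.lattice.toAddSubgroup.comap (I.scaled M)

theorem mem_scaledLattice {M : ℕ} {z : Fin I.n → ℤ} :
    z ∈ I.scaledLattice M ↔ I.scaled M z ∈ I.lattice := Iff.rfl

theorem smul_basis_mem {M : ℕ} (hM : 0 < M) (j : Fin I.n) : (M : ℤ) • I.basis j ∈ I.scaledLattice M := by
  rw [mem_scaledLattice, scaled_smul hM]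
  exact Submodule.subset_span ⟨j, rfl⟩

/-- By the adjugate, `M * det` maps every integer vector into the sublattice. The quotient is
finitely generated and torsion, hence finite. -/
theorem IsBasis.finite_quotient (h : I.IsBasis) {M : ℕ} (hM : 0 < M) :
    Finite ((Fin I.n → ℤ) ⧸ I.scaledLattice M) := by
  set A : Matrix (Fin I.n) (Fin I.n) ℤ := Matrix.of I.basis with hA
  have hdet : A.det ≠ 0 := h.det_ne_zero
  have key : ∀ z : Fin I.n → ℤ, ((M : ℤ) * A.det) • z ∈ I.scaledLattice M := by
    intro z
    have h1 : (z ᵥ* A.adjugate) ᵥ* A = A.det • z := by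
      rw [Matrix.vecMul_vecMul, Matrix.adjugate_mul, Matrix.vecMul_smul, Matrix.vecMul_one]
    have h2 : ((M : ℤ) * A.det) • z = ∑ j, (z ᵥ* A.adjugate) j • ((M : ℤ) • I.basis j) := by
      rw [mul_smul, ← h1, Matrix.vecMul_eq_sum, Finset.smul_sum]
      refine Finset.sum_congr rfl fun j _ => ?_
      rw [smul_comm]
      rfl
    rw [h2]
    exact AddSubgroup.sum_mem _ fun j _ => AddSubgroup.zsmul_mem _ (smul_basis_mem hM j) _
  refine AddCommGroup.finite_of_fg_isAddTorsion _ fun g => ?_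
  induction g using QuotientAddGroup.induction_on with
  | H z =>
    refine isOfFinAddOrder_iff_zsmul_eq_zero.2
      ⟨(M : ℤ) * A.det, mul_ne_zero (by exact_mod_cast hM.ne') hdet, ?_⟩
    rw [← QuotientAddGroup.mk_zsmul]
    exact (QuotientAddGroup.eq_zero_iff _).2 (key z)

theorem abs_le_of_mem_box {n W : ℕ} {z z' : Fin n → ℤ} (hz : z ∈ box n W) (hz' : z' ∈ box n W)
    {a : Fin n → ℤ} {b : ℕ} (ha : ∀ i, |a i| ≤ b) (i : Fin n) :
    |((a + z - z') i : ℝ)| ≤ 2 * W + b := by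
  simp only [box, Fintype.mem_piFinset, Finset.mem_Icc] at hz hz'
  have h1 := hz i
  have h2 := hz' i
  have h3 := abs_le.1 (ha i)
  have : |(a + z - z') i| ≤ 2 * W + b := by
    rw [abs_le, Pi.sub_apply, Pi.add_apply]
    omega
  exact_mod_cast this

/-- In the original scale, `a` plus a difference of two points of the box has length at most 2002
√n, since W = 1000 M den and the entries of `a` are at most 2. A non-zero lattice vector is longer.
-/
theorem short_of_gap (hn : 0 < I.n) (hmin : ∀ u ∈ I.lattice, u ≠ 0 → 4000 * Real.sqrt I.n ≤ ‖u‖)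
    {M : ℕ} (hM : 0 < M) {a : Fin I.n → ℤ} (ha : ∀ i, |a i| ≤ (2 : ℕ)) :
    ∀ z ∈ box I.n (2 * (500 * (M * I.den))), ∀ z' ∈ box I.n (2 * (500 * (M * I.den))),
      a + z - z' ∈ I.scaledLattice M → a + z - z' = 0 := by
  intro z hz z' hz' h
  by_contra hne
  have h1 := hmin _ h fun h0 => hne (scaled_eq_zero hM h0)
  have h2 := norm_scaled_le hM (by positivity) (abs_le_of_mem_box hz hz' ha)
  have hR : (1 : ℝ) ≤ M * I.den := by exact_mod_cast Nat.mul_pos hM I.den_pos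
  have hs : 0 < Real.sqrt I.n := Real.sqrt_pos.2 (by exact_mod_cast hn)
  have h3 := le_of_mul_le_mul_right (h1.trans h2) hs
  rw [le_div_iff₀ (by linarith)] at h3
  push_cast at h3
  linarith

/-- The vector would be a lattice point at distance at most 2000 √n from the target, as two points
of the box differ by at most that. -/
theorem far_of_gap (hdist : 4000 * Real.sqrt I.n < I.dist) {M : ℕ} (hM : 0 < M) :
    ∀ z ∈ box I.n (2 * (500 * (M * I.den))), ∀ z' ∈ box I.n (2 * (500 * (M * I.den))),
      (M : ℤ) • I.target + z - z' ∉ I.scaledLattice M := by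
  intro z hz z' hz' h
  have h1 : I.dist ≤ Dist.dist (I.vec I.target) (I.scaled M ((M : ℤ) • I.target + z - z')) :=
    Metric.infDist_le_dist_of_mem h
  have h2 := norm_scaled_le (I := I) hM (by positivity)
    (abs_le_of_mem_box (a := 0) (b := 0) hz' hz (by simp))
  have e : Dist.dist (I.vec I.target) (I.scaled M ((M : ℤ) • I.target + z - z')) =
      ‖I.scaled M (0 + z' - z)‖ := by
    rw [dist_eq_norm, ← scaled_smul hM, ← map_sub]
    congr 2
    abel
  rw [e] at h1
  have hR : (1 : ℝ) ≤ M * I.den := by exact_mod_cast Nat.mul_pos hM I.den_pos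
  have h3 := hdist.trans_le (h1.trans h2)
  have h4 : ((2 * ((2 * (500 * (M * I.den)) : ℕ) : ℝ) + (0 : ℕ)) / (M * I.den)) = 2000 := by
    rw [div_eq_iff (by positivity)]
    push_cast
    ring
  rw [h4] at h3
  have hs : 0 ≤ Real.sqrt I.n := Real.sqrt_nonneg _
  linarith

/-- The random vector in the dual lattice. -/
theorem exists_random_dual (hI : I.IsBasis) (hdist : 4000 * Real.sqrt I.n < I.dist)
    (hmin : ∀ u ∈ I.lattice, u ≠ 0 → 4000 * Real.sqrt I.n ≤ ‖u‖) {ε : ℝ} (hε : 0 < ε) :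
    ∃ (Ω : Type) (_ : Fintype Ω) (p : Ω → ℝ) (u : Ω → Fin I.n → ℝ), (∀ ω, 0 ≤ p ω) ∧
      ∑ ω, p ω = 1 ∧ (∀ ω j, ∃ k : ℤ, ∑ i, u ω i * (I.basis j i / I.den) = k) ∧
      (∀ i, ∑ ω, p ω * u ω i ^ 2 ≤ 1 / 10000) ∧ (∀ i, ∑ ω, p ω * u ω i ^ 4 ≤ 1 / 1000) ∧
      (∀ i j, i ≠ j → |∑ ω, p ω * (u ω i * u ω j)| ≤ ε) ∧
      ∑ ω, p ω * Real.cos (2 * Real.pi * ∑ i, u ω i * (I.target i / I.den)) = 0 := by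
  -- In dimension zero the target is the zero vector and has distance zero, against `hdist`.
  have hn : 0 < I.n := by
    by_contra h
    have h0 : I.n = 0 := by omega
    have : I.vec I.target ∈ I.lattice := by
      have : I.vec I.target = 0 := by
        ext j
        exact absurd j.2 (by omega)
      rw [this]
      exact I.lattice.zero_mem
    have h1 : I.dist = 0 := Metric.infDist_zero_of_mem this
    rw [h1] at hdist
    have := Real.sqrt_nonneg (I.n : ℝ)
    linarith
  -- The refinement `M` of the grid serves only the mixed moments: `R ≥ M` makes 160 / R² at most
  -- `ε`.
  obtain ⟨M, hMε⟩ := exists_nat_gt (160 / ε)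
  have hM : 0 < M := by
    have : (0 : ℝ) < M := lt_trans (by positivity) hMε
    exact_mod_cast this
  have hM' : (1 : ℝ) ≤ M := by exact_mod_cast hM
  haveI := hI.finite_quotient hM
  set R := M * I.den with hR
  have hRpos : 0 < R := Nat.mul_pos hM I.den_pos
  have hR' : (0 : ℝ) < R := by exact_mod_cast hRpos
  have hRM : (M : ℝ) ≤ R := by
    have : M ≤ R := Nat.le_mul_of_pos_right _ I.den_pos
    exact_mod_cast this
  obtain ⟨Ω, inst, p, θ, hp, hθ, hInt, hcos, htar⟩ :=
    exists_random_angles (W := 2 * (500 * R)) (by omega) (I.scaledLattice M)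
  have hc0 := corr_zero_pos (V := 500 * R) (by omega)
  set W := 2 * (500 * R) with hW
  have hone : corr W 0 / corr W 0 = 1 := div_self hc0.ne'
  have hsingle : ∀ (i : Fin I.n) (k : ℤ), |k| ≤ 2 →
      ∑ ω, p ω * Real.cos (2 * Real.pi * (θ ω i * k)) = corr W k / corr W 0 := by
    intro i k hk
    have h1 := hcos (Pi.single i k) (short_of_gap hn hmin hM fun j => by
      by_cases hj : j = i
      · subst hj; simpa using hk
      · rw [Pi.single_eq_of_ne hj]; simp)
    rw [Fintype.prod_eq_single i fun j hj => by rw [Pi.single_eq_of_ne hj, hone],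
      Pi.single_eq_same] at h1
    rw [← h1]
    refine Finset.sum_congr rfl fun ω _ => ?_
    rw [Fintype.sum_eq_single i fun j hj => by rw [Pi.single_eq_of_ne hj]; simp, Pi.single_eq_same]
  -- With k = 1 and k = -1 these are the cosines of the sum and of the difference of two angles;
  -- both values agree because `corr` is even.
  have hpair : ∀ (i j : Fin I.n) (k : ℤ), i ≠ j → |k| ≤ 2 →
      ∑ ω, p ω * Real.cos (2 * Real.pi * (θ ω i + θ ω j * k)) =
        corr W 1 / corr W 0 * (corr W k / corr W 0) := by
    intro i j k hij hk
    have hv : ∀ l, (Pi.single i 1 + Pi.single j k : Fin I.n → ℤ) l =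
        if l = i then 1 else if l = j then k else 0 := by
      intro l
      simp only [Pi.add_apply, Pi.single_apply]
      by_cases h1 : l = i
      · rw [if_pos h1, if_neg (h1 ▸ hij), if_pos h1, add_zero]
      · rw [if_neg h1, if_neg h1, zero_add]
    have h1 := hcos (Pi.single i 1 + Pi.single j k) (short_of_gap hn hmin hM fun l => by
      rw [hv]
      split_ifs
      · norm_num
      · exact_mod_cast hk
      · norm_num)
    simp only [hv] at h1
    rw [Fintype.prod_eq_mul i j hij fun l hl => by rw [if_neg hl.1, if_neg hl.2, hone], if_pos rfl,
      if_neg hij.symm, if_pos rfl] at h1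
    rw [← h1]
    refine Finset.sum_congr rfl fun ω _ => ?_
    rw [Fintype.sum_eq_add i j hij fun l hl => by rw [if_neg hl.1, if_neg hl.2]; simp, if_pos rfl,
      if_neg hij.symm, if_pos rfl]
    simp
  have hsum : ∑ ω, p ω = 1 := by
    have := hsingle ⟨0, hn⟩ 0 (by norm_num)
    rw [hone] at this
    simpa using this
  have h1 : ∀ i, ∑ ω, p ω * Real.cos (2 * Real.pi * θ ω i) = corr W 1 / corr W 0 := fun i => by
    simpa using hsingle i 1 (by norm_num)
  have h2 : ∀ i, ∑ ω, p ω * Real.cos (2 * Real.pi * (θ ω i * 2)) = corr W 2 / corr W 0 := fun i => by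
    simpa using hsingle i 2 (by norm_num)
  have h4 : ∀ i, ∑ ω, p ω * (R * θ ω i) ^ 4 ≤ 1 / 1000 := fun i =>
    moment_four_le hp (fun ω => hθ ω i) hsum hRpos (h1 i) (h2 i)
  refine ⟨Ω, inst, p, fun ω i => R * θ ω i, hp, hsum, fun ω j => ?_, fun i =>
    moment_two_le hp (fun ω => hθ ω i) hsum hRpos (h1 i), h4, fun i j hij => ?_, ?_⟩
  -- The scaling u = R θ with R = M den turns ⟨u, v_j⟩ into the pairing of θ with M times the
  -- numerators of v_j, which lies in the scaled lattice.
  · obtain ⟨k, hk⟩ := hInt ω _ (smul_basis_mem hM j)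
    refine ⟨k, ?_⟩
    rw [← hk]
    refine Finset.sum_congr rfl fun i _ => ?_
    have := I.den_pos'.ne'
    simp only [hR, Pi.smul_apply, smul_eq_mul]
    push_cast
    field_simp
  · have h3 := mixed_moment_le (p := p) (θ := fun ω => θ ω i) (φ := fun ω => θ ω j) hp hR'
      ((h4 i).trans (by norm_num)) ((h4 j).trans (by norm_num)) (by
      have a1 := hpair i j 1 hij (by norm_num)
      have a2 := hpair i j (-1) hij (by norm_num)
      rw [corr_neg, ← a1] at a2
      simp only [Int.cast_one, mul_one, Int.cast_neg, mul_neg, ← sub_eq_add_neg] at a2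
      exact a2.symm)
    refine h3.trans ?_
    rw [div_le_iff₀ (by positivity)]
    rw [div_lt_iff₀ hε] at hMε
    nlinarith
  · have h5 := htar _ (far_of_gap hdist hM)
    rw [← h5]
    refine Finset.sum_congr rfl fun ω _ => ?_
    congr 3
    refine Finset.sum_congr rfl fun i _ => ?_
    have := I.den_pos'.ne'
    simp only [hR, Pi.smul_apply, smul_eq_mul]
    push_cast
    field_simp

end Instance

/-! ### Acceptance probabilities in terms of the encoded vector -/

/-- The value of a bit as a real number, with a minus sign for the leading bit. -/
def signedBit (s : ℕ → Bool) (q b : ℕ) : ℝ := if s (q + b) then (if b = 0 then -1 else 1) else 0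

/-- The `i`-th coordinate of the vector that the bits `s` encode: a number in `[-m², m²)` with
`m⁴` binary digits. -/
def coord (m : ℕ) (s : ℕ → Bool) (i : ℕ) : ℝ :=
  (m : ℝ) ^ 2 * ∑ b ∈ Finset.range (m ^ 4), signedBit s (i * m ^ 4) b / 2 ^ b

/-- The remainder modulo `Q` costs a multiple of `Q`, which is invisible after division by `Q` and
`tri`; the floor costs at most one. -/
theorem coefOf_eq {Q : ℕ} (hQ : 0 < Q) (z : ℤ) {D : ℤ} (hD : 0 < D) (b : ℕ) :
    ∃ (k : ℤ) (e : ℝ), 0 ≤ e ∧ e ≤ 1 ∧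
      (coefOf Q z D b : ℝ) = (if b = 0 then -1 else 1) * ((z : ℝ) / D) / 2 ^ b - e + Q * k := by
  have hd : 0 < D * 2 ^ b := by positivity
  set y : ℤ := if b = 0 then -z else z with hy
  set d : ℤ := D * 2 ^ b with hdd
  have hd' : (0 : ℝ) < d := by exact_mod_cast hd
  have hmod := Int.emod_add_mul_ediv (y / d) Q
  have hdiv := Int.emod_add_mul_ediv y d
  have h0 : 0 ≤ (y / d) % (Q : ℤ) := Int.emod_nonneg _ (by omega)
  refine ⟨-(y / d / Q), ((y % d : ℤ) : ℝ) / d, ?_, ?_, ?_⟩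
  · exact div_nonneg (by exact_mod_cast Int.emod_nonneg _ hd.ne') hd'.le
  · rw [div_le_one hd']
    exact_mod_cast (Int.emod_lt_of_pos y hd).le
  · have h1 : (coefOf Q z D b : ℝ) = (((y / d) % (Q : ℤ) : ℤ) : ℝ) := by
      rw [coefOf, ← hy, ← hdd]
      exact_mod_cast Int.toNat_of_nonneg h0
    have h2 : (((y / d) % (Q : ℤ) : ℤ) : ℝ) = ((y / d : ℤ) : ℝ) - Q * ((y / d / Q : ℤ) : ℝ) := by
      have : ((y / d) % (Q : ℤ)) = (y / d) - Q * (y / d / Q) := by linarith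
      rw [this]; push_cast; ring
    have h3 : ((y / d : ℤ) : ℝ) = (y : ℝ) / d - ((y % d : ℤ) : ℝ) / d := by
      rw [← sub_div, eq_div_iff hd'.ne']
      have : y / d * d = y - y % d := by linarith
      exact_mod_cast this
    have h4 : (y : ℝ) / d = (if b = 0 then -1 else 1) * ((z : ℝ) / D) / 2 ^ b := by
      rw [hy, hdd]
      have hD' : (D : ℝ) ≠ 0 := by exact_mod_cast hD.ne'
      split_ifs <;> push_cast <;> field_simp
    rw [h1, h2, h3, h4]
    push_cast
    ring

theorem tri_nonneg (x : ℝ) : 0 ≤ tri x := by rw [tri]; positivity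

theorem tri_le_one (x : ℝ) : tri x ≤ 1 := by
  rw [tri]
  linarith [abs_sub_round x]

theorem tri_le_two_mul_abs_sub_intCast (x : ℝ) (k : ℤ) : tri x ≤ 2 * |x - k| := by
  rw [tri]
  linarith [round_le x k]

theorem tri_add_intCast (x : ℝ) (k : ℤ) : tri (x + k) = tri x := by
  rw [tri, tri, round_add_intCast]
  push_cast
  ring_nf

theorem tri_le_add (x y : ℝ) : tri x ≤ tri y + 2 * |x - y| := by
  have h1 := tri_le_two_mul_abs_sub_intCast x (round y)
  have h2 := abs_sub_le x y (round y)
  have : tri y = 2 * |y - round y| := rfl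
  linarith

theorem abs_tri_sub_le (x y : ℝ) : |tri x - tri y| ≤ 2 * |x - y| := by
  rw [abs_le]
  have h1 := tri_le_add x y
  have h2 := tri_le_add y x
  rw [abs_sub_comm y x] at h2
  constructor <;> linarith

theorem tri_zero : tri 0 = 0 := by simp [tri]

theorem tri_of_mem {x : ℝ} (h0 : 0 ≤ x) (h1 : x ≤ 1 / 2) : tri x = 2 * x := by
  rw [tri, abs_sub_round_eq_min, Int.fract_eq_self.2 ⟨h0, by linarith⟩, min_eq_left (by linarith)]

/-- Two's complement: the leading bit contributes -1 or 0, the others together a number in [0, 1).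
-/
theorem sum_signedBit_mem (s : ℕ → Bool) (q w : ℕ) :
    |∑ b ∈ Finset.range w, signedBit s q b / 2 ^ b| ≤ 1 := by
  have key : ∀ w, 0 ≤ ∑ b ∈ Finset.range w, signedBit s q (b + 1) / 2 ^ (b + 1) ∧
      ∑ b ∈ Finset.range w, signedBit s q (b + 1) / 2 ^ (b + 1) ≤ 1 - 1 / 2 ^ w := by
    intro w
    induction w with
    | zero => simp
    | succ w ih =>
      rw [Finset.sum_range_succ]
      have h1 : 0 ≤ signedBit s q (w + 1) ∧ signedBit s q (w + 1) ≤ 1 := by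
        rw [signedBit]
        split_ifs <;> simp_all
      have h2 : 0 ≤ signedBit s q (w + 1) / 2 ^ (w + 1) := div_nonneg h1.1 (by positivity)
      have h3 : signedBit s q (w + 1) / 2 ^ (w + 1) ≤ 1 / 2 ^ (w + 1) :=
        div_le_div_of_nonneg_right h1.2 (by positivity)
      have h4 : (1 : ℝ) / 2 ^ w = 1 / 2 ^ (w + 1) + 1 / 2 ^ (w + 1) := by
        rw [pow_succ]; field_simp; norm_num
      constructor
      · linarith [ih.1]
      · linarith [ih.2]
  cases w with
  | zero => simp
  | succ w =>
    rw [Finset.sum_range_succ']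
    obtain ⟨h1, h2⟩ := key w
    have h3 : (0 : ℝ) < 1 / 2 ^ w := by positivity
    have h4 : -1 ≤ signedBit s q 0 ∧ signedBit s q 0 ≤ 0 := by
      rw [signedBit]
      split_ifs <;> simp_all
    rw [pow_zero, div_one, abs_le]
    constructor <;> linarith [h4.1, h4.2]

theorem abs_coord_le (m : ℕ) (s : ℕ → Bool) (i : ℕ) : |coord m s i| ≤ (m : ℝ) ^ 2 := by
  rw [coord, abs_mul, abs_of_nonneg (by positivity : (0 : ℝ) ≤ (m : ℝ) ^ 2)]
  exact mul_le_of_le_one_right (by positivity) (sum_signedBit_mem _ _ _)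

/-! ### Test probabilities as functions of the encoded vector -/

namespace TestData

variable {T : TestData}

theorem Valid.Q_pos (_ : T.Valid) : 0 < T.Q := by rw [Q]; positivity

/-- The value of the linear form, without rounding. -/
def theta (T : TestData) (f : Bool) (s : ℕ → Bool) : ℝ :=
  (T.start : ℝ) / T.Q + ∑ i ∈ Finset.range T.n,
    (T.numer f i : ℝ) / (T.denom * T.Q) * (coord T.m s i / (T.m : ℝ) ^ 2)

theorem Valid.m_pos (h : T.Valid) : (0 : ℝ) < T.m := by
  have := h.m
  exact_mod_cast (by omega : 0 < T.m)

/-- There are at most m⁵ floor errors of size at most one, and Q ≥ m¹⁶. The factor 2 is the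
Lipschitz constant of `tri`. -/
theorem tri_lin_le (h : T.Valid) (hD : 0 < T.denom) (f : Bool) (s : ℕ → Bool) :
    |tri ((T.lin f s : ℝ) / T.Q) - tri (T.theta f s)| ≤ 2 / (T.m : ℝ) ^ 11 := by
  have hQ : (0 : ℝ) < T.Q := by exact_mod_cast h.Q_pos
  have hm := h.m_pos
  choose k e he0 he1 hco using fun i b => coefOf_eq h.Q_pos (T.numer f i) hD b
  let E : ℝ := ∑ i ∈ Finset.range T.n, ∑ b ∈ Finset.range T.w, if s (i * T.w + b) then e i b else 0
  let κ' : ℤ := ∑ i ∈ Finset.range T.n, ∑ b ∈ Finset.range T.w, if s (i * T.w + b) then k i b else 0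
  have hE0 : 0 ≤ E := Finset.sum_nonneg fun i _ => Finset.sum_nonneg fun b _ => by
    split_ifs
    exacts [he0 i b, le_rfl]
  have hE1 : E ≤ T.n * T.w := by
    calc E ≤ ∑ i ∈ Finset.range T.n, ∑ b ∈ Finset.range T.w, (1 : ℝ) :=
          Finset.sum_le_sum fun i _ => Finset.sum_le_sum fun b _ => by
            split_ifs
            exacts [he1 i b, zero_le_one]
      _ = _ := by simp
  have hlin : (T.lin f s : ℝ) = T.start + ∑ i ∈ Finset.range T.n,
      (T.numer f i : ℝ) / T.denom * (coord T.m s i / (T.m : ℝ) ^ 2) - E + T.Q * κ' := by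
    have h1 : ∀ i b, (((if s (i * T.w + b) then coefOf T.Q (T.numer f i) T.denom b else 0 : ℕ)) : ℝ) =
        (T.numer f i : ℝ) / T.denom * (signedBit s (i * T.w) b / 2 ^ b) -
        (if s (i * T.w + b) then e i b else 0) +
        T.Q * ((if s (i * T.w + b) then k i b else 0 : ℤ) : ℝ) := by
      intro i b
      rw [signedBit]
      by_cases hs : s (i * T.w + b) = true
      · simp only [hs, if_true]
        rw [hco]
        ring
      · simp [hs]
    rw [lin]
    push_cast
    simp only [κ', E]
    push_cast
    push_cast at h1
    simp only [h1, Finset.sum_add_distrib, Finset.sum_sub_distrib, ← Finset.mul_sum]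
    have h2 : ∀ i, coord T.m s i / (T.m : ℝ) ^ 2 = ∑ b ∈ Finset.range T.w, signedBit s (i * T.w) b / 2 ^ b := by
      intro i
      rw [coord, mul_div_cancel_left₀ _ (by positivity)]
      rfl
    simp only [h2]
    ring
  have hth : (T.lin f s : ℝ) / T.Q = T.theta f s - E / T.Q + κ' := by
    rw [hlin, theta]
    have : ∑ i ∈ Finset.range T.n, (T.numer f i : ℝ) / (T.denom * T.Q) * (coord T.m s i / (T.m : ℝ) ^ 2) =
        (∑ i ∈ Finset.range T.n, (T.numer f i : ℝ) / T.denom * (coord T.m s i / (T.m : ℝ) ^ 2)) / T.Q := by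
      rw [Finset.sum_div]
      exact Finset.sum_congr rfl fun i _ => by rw [← div_div]; ring
    rw [this]
    field_simp
  rw [hth, tri_add_intCast]
  refine (abs_tri_sub_le _ _).trans ?_
  rw [show T.theta f s - E / T.Q - T.theta f s = -(E / T.Q) by ring, abs_neg,
    abs_of_nonneg (by positivity)]
  have h5 : E / T.Q ≤ 1 / (T.m : ℝ) ^ 11 := by
    rw [div_le_div_iff₀ hQ (by positivity)]
    have hK : (T.n * T.w : ℝ) ≤ (T.m : ℝ) ^ 5 := by exact_mod_cast h.mul_le_K
    have hQ' : (T.m : ℝ) ^ 16 ≤ T.Q := by exact_mod_cast h.le_Q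
    calc E * (T.m : ℝ) ^ 11 ≤ (T.m : ℝ) ^ 5 * (T.m : ℝ) ^ 11 :=
          mul_le_mul_of_nonneg_right (hE1.trans hK) (by positivity)
      _ = (T.m : ℝ) ^ 16 := by ring
      _ ≤ 1 * T.Q := by linarith
  calc _ ≤ 2 * (1 / (T.m : ℝ) ^ 11) := by linarith
    _ = _ := by ring

/-- The function p + q - 2pq is affine in each variable with slopes in [-1, 1] on the unit square,
so the errors of the two chains just add up. -/
theorem abs_acc_sub_le (h : T.Valid) (hD : 0 < T.denom) (s : ℕ → Bool) :
    |T.acc s - (tri (T.theta false s) + tri (T.theta true s) -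
      2 * tri (T.theta false s) * tri (T.theta true s))| ≤ 4 / (T.m : ℝ) ^ 11 := by
  have h0 := tri_lin_le h hD false s
  have h1 := tri_lin_le h hD true s
  rw [acc]
  have a1 := tri_nonneg ((T.lin false s : ℝ) / T.Q)
  have a2 := tri_le_one ((T.lin false s : ℝ) / T.Q)
  have b1 := tri_nonneg (T.theta true s)
  have b2 := tri_le_one (T.theta true s)
  generalize tri ((T.lin false s : ℝ) / T.Q) = p at *
  generalize tri ((T.lin true s : ℝ) / T.Q) = q at *
  generalize tri (T.theta false s) = p' at *
  generalize tri (T.theta true s) = q' at *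
  have e : p + q - 2 * p * q - (p' + q' - 2 * p' * q') = (p - p') * (1 - 2 * q') + (q - q') * (1 - 2 * p) := by
    ring
  rw [e]
  refine (abs_add_le _ _).trans ?_
  rw [abs_mul, abs_mul]
  have c1 : |1 - 2 * q'| ≤ 1 := by rw [abs_le]; constructor <;> linarith
  have c2 : |1 - 2 * p| ≤ 1 := by rw [abs_le]; constructor <;> linarith
  have d1 := mul_le_mul h0 c1 (abs_nonneg _) (by have := h.m_pos; positivity)
  have d2 := mul_le_mul h1 c2 (abs_nonneg _) (by have := h.m_pos; positivity)
  rw [show (4 : ℝ) / (T.m : ℝ) ^ 11 = 2 / (T.m : ℝ) ^ 11 * 1 + 2 / (T.m : ℝ) ^ 11 * 1 by ring]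
  exact add_le_add d1 d2

/-- The test of a row. -/
theorem acc_row (h : T.Valid) (hd : 0 < T.den) (hk : T.kd = 0) (s : ℕ → Bool) :
    |T.acc s - tri (T.pw * ∑ i ∈ Finset.range T.n, coord T.m s i * (T.ent i / T.den))| ≤
      4 / (T.m : ℝ) ^ 11 := by
  have hQ : (0 : ℝ) < T.Q := by exact_mod_cast h.Q_pos
  have hm := h.m_pos
  have hden : (0 : ℝ) < T.den := by exact_mod_cast hd
  have hD : T.denom = T.den := by rw [denom, if_pos hk]
  have h0 := abs_acc_sub_le h (by rw [hD]; exact_mod_cast hd) s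
  have e1 : T.theta true s = 0 := by
    simp [theta, start, hk, numer]
  have e2 : T.theta false s = T.pw * ∑ i ∈ Finset.range T.n, coord T.m s i * (T.ent i / T.den) := by
    rw [theta, start, hk, hD, Finset.mul_sum]
    simp only [numer, hk, if_true, Bool.false_eq_true, if_false]
    rw [zero_mul, Nat.cast_zero, zero_div, zero_add]
    refine Finset.sum_congr rfl fun i _ => ?_
    push_cast
    field_simp
  rw [e1, tri_zero, e2] at h0
  simpa using h0

/-- The test of a covariance. -/
theorem acc_cov (h : T.Valid) (hk : T.kd = 1) (s : ℕ → Bool) :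
    |T.acc s - (1 - (if T.d₁ < T.n then coord T.m s T.d₁ else 0) *
      (if T.d₂ < T.n then coord T.m s T.d₂ else 0) / (T.m : ℝ) ^ 4) / 2| ≤ 4 / (T.m : ℝ) ^ 11 := by
  have hQ : (0 : ℝ) < T.Q := by exact_mod_cast h.Q_pos
  have hm := h.m_pos
  have hD : T.denom = 4 := by rw [denom, if_neg (by omega)]
  have h0 := abs_acc_sub_le h (by rw [hD]; norm_num) s
  -- The exponent of `Q` is at least two, so the truncated division is exact.
  have hQ4 : ((T.Q / 4 : ℕ) : ℝ) = T.Q / 4 := by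
    have : 4 ∣ T.Q := by
      have h16 := one_lt_clog (m := T.m) (by have := h.m; omega)
      have : 2 ≤ T.κ + 1 := by rw [h.κ, modExp]; omega
      rw [Q]
      exact pow_dvd_pow 2 this
    exact Nat.cast_div this (by norm_num)
  -- The start value shifts the argument to 1/4 + c/(4m²) with |c| ≤ m², hence into [0, 1/2], where
  -- `tri` is linear.
  have e : ∀ f, tri (T.theta f s) = 1 / 2 + (if (if f then T.d₂ else T.d₁) < T.n then
      coord T.m s (if f then T.d₂ else T.d₁) else 0) / (2 * (T.m : ℝ) ^ 2) := by
    intro f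
    set d := if f then T.d₂ else T.d₁ with hd
    have e2 : T.theta f s = 1 / 4 + (if d < T.n then coord T.m s d else 0) / (4 * (T.m : ℝ) ^ 2) := by
      rw [theta, start, hk, hD, one_mul, hQ4]
      congr 1
      · field_simp
      · simp only [numer, hk, one_ne_zero, if_false, ← hd]
        have : ∀ i ∈ Finset.range T.n, (((if i = d then (T.Q : ℤ) else 0 : ℤ)) : ℝ) / (((4 : ℤ) : ℝ) * T.Q) *
            (coord T.m s i / (T.m : ℝ) ^ 2) = if i = d then coord T.m s d / (4 * (T.m : ℝ) ^ 2) else 0 := by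
          intro i _
          split_ifs with hi
          · subst hi
            push_cast
            field_simp
          · simp
        rw [Finset.sum_congr rfl this, Finset.sum_ite_eq']
        simp only [Finset.mem_range]
        split_ifs <;> simp
    have hb : |(if d < T.n then coord T.m s d else 0)| ≤ (T.m : ℝ) ^ 2 := by
      split_ifs
      · exact abs_coord_le _ _ _
      · rw [abs_zero]; positivity
    rw [abs_le] at hb
    have hb1 : -(1 / 4) ≤ (if d < T.n then coord T.m s d else 0) / (4 * (T.m : ℝ) ^ 2) := by
      rw [le_div_iff₀ (by positivity)]
      linarith
    have hb2 : (if d < T.n then coord T.m s d else 0) / (4 * (T.m : ℝ) ^ 2) ≤ 1 / 4 := by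
      rw [div_le_iff₀ (by positivity)]
      linarith
    rw [e2, tri_of_mem (by linarith) (by linarith)]
    field_simp
    ring
  -- Use p + q - 2pq = (1 - (1 - 2p)(1 - 2q)) / 2, where 1 - 2p and 1 - 2q are the two coordinates
  -- divided by -m².
  rw [e, e] at h0
  simp only [Bool.false_eq_true, if_false, if_true] at h0
  convert h0 using 2
  field_simp
  ring

end TestData

/-! ### Rounding to binary digits -/

/-- The greedy expansion: the next digit is one when its weight still fits into the remainder. -/
theorem exists_binary_digits {t : ℝ} (h0 : 0 ≤ t) (h1 : t < 1) (k : ℕ) :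
    ∃ β : ℕ → Bool, 0 ≤ t - ∑ b ∈ Finset.range k, (if β b then (1 : ℝ) else 0) / 2 ^ (b + 1) ∧
      t - ∑ b ∈ Finset.range k, (if β b then (1 : ℝ) else 0) / 2 ^ (b + 1) < 1 / 2 ^ k := by
  induction k with
  | zero => exact ⟨fun _ => false, by simpa using h0, by simpa using h1⟩
  | succ k ih =>
    obtain ⟨β, hβ0, hβ1⟩ := ih
    set r := t - ∑ b ∈ Finset.range k, (if β b then (1 : ℝ) else 0) / 2 ^ (b + 1) with hr
    refine ⟨Function.update β k (decide (1 / 2 ^ (k + 1) ≤ r)), ?_⟩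
    have hs : ∑ b ∈ Finset.range (k + 1),
        (if Function.update β k (decide (1 / 2 ^ (k + 1) ≤ r)) b then (1 : ℝ) else 0) / 2 ^ (b + 1) =
        ∑ b ∈ Finset.range k, (if β b then (1 : ℝ) else 0) / 2 ^ (b + 1) +
          (if 1 / 2 ^ (k + 1) ≤ r then (1 : ℝ) else 0) / 2 ^ (k + 1) := by
      rw [Finset.sum_range_succ, Function.update_self]
      congr 1
      · refine Finset.sum_congr rfl fun b hb => ?_
        rw [Function.update_of_ne (by rw [Finset.mem_range] at hb; omega)]
      · simp
    rw [hs, ← sub_sub, ← hr]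
    have h4 : (1 : ℝ) / 2 ^ k = 1 / 2 ^ (k + 1) + 1 / 2 ^ (k + 1) := by
      rw [pow_succ]; field_simp; norm_num
    split_ifs with h
    · constructor <;> linarith
    · rw [zero_div, sub_zero]
      exact ⟨hβ0, not_le.1 h⟩

/-- For negative `t` the sign bit is set and `t + 1` is expanded. -/
theorem exists_signed_digits {t : ℝ} (ht : |t| < 1) (w : ℕ) :
    ∃ β : ℕ → Bool, |∑ b ∈ Finset.range (w + 1), signedBit β 0 b / 2 ^ b - t| ≤ 1 / 2 ^ w := by
  rw [abs_lt] at ht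
  have key : ∀ (c : Bool) (t' : ℝ), 0 ≤ t' → t' < 1 → t = t' - (if c then 1 else 0) →
      ∃ β : ℕ → Bool, |∑ b ∈ Finset.range (w + 1), signedBit β 0 b / 2 ^ b - t| ≤ 1 / 2 ^ w := by
    intro c t' h0 h1 he
    obtain ⟨β, hβ0, hβ1⟩ := exists_binary_digits h0 h1 w
    refine ⟨fun b => if b = 0 then c else β (b - 1), ?_⟩
    have hs : ∑ b ∈ Finset.range (w + 1),
        signedBit (fun b => if b = 0 then c else β (b - 1)) 0 b / 2 ^ b =
        ∑ b ∈ Finset.range w, (if β b then (1 : ℝ) else 0) / 2 ^ (b + 1) - (if c then 1 else 0) := by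
      rw [Finset.sum_range_succ']
      congr 1
      · refine Finset.sum_congr rfl fun b _ => ?_
        simp [signedBit]
      · cases c <;> simp [signedBit]
    rw [hs, he, abs_le]
    constructor <;> linarith
  by_cases h : 0 ≤ t
  · exact key false t h ht.2 (by simp)
  · exact key true (t + 1) (by linarith) (by linarith) (by simp)

/-- The precision of the encoding. -/
def prec (m : ℕ) : ℝ := (m : ℝ) ^ 2 / 2 ^ (m ^ 4 - 1)

theorem exists_encoding {m n : ℕ} (hm : 0 < m) (hn : n ≤ m) {y : Fin n → ℝ}
    (hy : ∀ i, |y i| < (m : ℝ) ^ 2) :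
    ∃ x : Basis (m ^ 5), ∀ i : Fin n, |coord m (extend x) i - y i| ≤ prec m := by
  have hm' : (0 : ℝ) < m := by exact_mod_cast hm
  have hw : 0 < m ^ 4 := by positivity
  have h1 : ∀ i : Fin n, |y i / (m : ℝ) ^ 2| < 1 := by
    intro i
    rw [abs_div, abs_of_pos (by positivity : (0 : ℝ) < (m : ℝ) ^ 2), div_lt_one (by positivity)]
    exact hy i
  choose β hβ using fun i => exists_signed_digits (h1 i) (m ^ 4 - 1)
  refine ⟨fun q => if h : (q : ℕ) / m ^ 4 < n then β ⟨q / m ^ 4, h⟩ (q % m ^ 4) else false, fun i => ?_⟩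
  have h2 : ∀ b ∈ Finset.range (m ^ 4), signedBit (extend fun q : Fin (m ^ 5) =>
      if h : (q : ℕ) / m ^ 4 < n then β ⟨q / m ^ 4, h⟩ (q % m ^ 4) else false) (i * m ^ 4) b / 2 ^ b =
      signedBit (β i) 0 b / 2 ^ b := by
    intro b hb
    rw [Finset.mem_range] at hb
    have hlt : (i : ℕ) * m ^ 4 + b < m ^ 5 := by
      have : ((i : ℕ) + 1) * m ^ 4 ≤ m * m ^ 4 := Nat.mul_le_mul_right _ (by omega)
      have h3 : ((i : ℕ) + 1) * m ^ 4 = i * m ^ 4 + m ^ 4 := by ring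
      have h4 : m * m ^ 4 = m ^ 5 := by ring
      omega
    have hdiv : ((i : ℕ) * m ^ 4 + b) / m ^ 4 = i := by
      rw [mul_comm, Nat.mul_add_div hw, Nat.div_eq_of_lt hb, add_zero]
    have hmod : ((i : ℕ) * m ^ 4 + b) % m ^ 4 = b := by
      rw [mul_comm, Nat.mul_add_mod, Nat.mod_eq_of_lt hb]
    simp only [signedBit]
    rw [extend_apply _ hlt]
    simp only [hdiv, hmod, i.2, dif_pos, zero_add]
  rw [coord, Finset.sum_congr rfl h2]
  have h3 := hβ i
  rw [Nat.sub_add_cancel hw] at h3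
  have e : (m : ℝ) ^ 2 * ∑ b ∈ Finset.range (m ^ 4), signedBit (β i) 0 b / 2 ^ b - y i =
      (m : ℝ) ^ 2 * (∑ b ∈ Finset.range (m ^ 4), signedBit (β i) 0 b / 2 ^ b - y i / (m : ℝ) ^ 2) := by
    field_simp
  rw [e, abs_mul, abs_of_pos (by positivity : (0 : ℝ) < (m : ℝ) ^ 2), prec]
  calc _ ≤ (m : ℝ) ^ 2 * (1 / 2 ^ (m ^ 4 - 1)) := mul_le_mul_of_nonneg_left h3 (by positivity)
    _ = _ := by ring

theorem prec_nonneg (m : ℕ) : 0 ≤ prec m := by rw [prec]; positivity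

/-- A row test multiplies the rounding error by up to 2^(m³) and by entries of m bits. This is why
coordinates carry m⁴ digits. -/
theorem prec_le {m : ℕ} (hm : 100 ≤ m) :
    2 * 2 ^ (m ^ 3) * ((m : ℝ) * 2 ^ m) * prec m ≤ 1 / (m : ℝ) ^ 11 := by
  have hm' : (100 : ℝ) ≤ m := by exact_mod_cast hm
  have hT : m ^ 15 < 2 ^ (m ^ 2) := by
    have h := Nat.lt_two_pow_self (n := m)
    calc m ^ 15 < (2 ^ m) ^ 15 := Nat.pow_lt_pow_left h (by norm_num)
      _ = 2 ^ (m * 15) := by rw [pow_mul]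
      _ ≤ 2 ^ (m ^ 2) := Nat.pow_le_pow_right (by norm_num) (by nlinarith)
  have hT' : (m : ℝ) ^ 15 ≤ 2 ^ (m ^ 2) := by exact_mod_cast hT.le
  have he : m ^ 3 + m + m ^ 2 ≤ m ^ 4 := by nlinarith [pow_pos (by omega : 0 < m) 3, pow_pos (by omega : 0 < m) 2]
  have hp : (2 : ℝ) ^ (m ^ 4) = 2 * 2 ^ (m ^ 4 - 1) := by
    rw [← pow_succ', Nat.sub_add_cancel (Nat.one_le_pow _ _ (by omega))]
  rw [prec, mul_div_assoc', div_le_div_iff₀ (by positivity) (by positivity)]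
  have h1 : 4 * (m : ℝ) ^ 14 * 2 ^ (m ^ 3) * 2 ^ m ≤ 2 ^ (m ^ 4) := by
    calc 4 * (m : ℝ) ^ 14 * 2 ^ (m ^ 3) * 2 ^ m ≤ (m : ℝ) ^ 15 * 2 ^ (m ^ 3) * 2 ^ m := by
          gcongr
          nlinarith [pow_pos (by linarith : (0 : ℝ) < m) 14]
      _ ≤ 2 ^ (m ^ 2) * 2 ^ (m ^ 3) * 2 ^ m := by gcongr
      _ = 2 ^ (m ^ 3 + m + m ^ 2) := by rw [← pow_add, ← pow_add]; congr 1; ring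
      _ ≤ _ := pow_le_pow_right₀ (by norm_num) he
  nlinarith

theorem prec_le' {m : ℕ} (hm : 100 ≤ m) : (m : ℝ) * 2 ^ m * prec m ≤ 1 / (m : ℝ) ^ 11 := by
  refine le_trans ?_ (prec_le hm)
  have h1 : (1 : ℝ) ≤ 2 * 2 ^ (m ^ 3) := by
    have : (1 : ℝ) ≤ 2 ^ (m ^ 3) := one_le_pow₀ (by norm_num)
    linarith
  have h2 : 0 ≤ (m : ℝ) * 2 ^ m * prec m := mul_nonneg (by positivity) (prec_nonneg m)
  nlinarith

theorem prec_le'' {m : ℕ} (hm : 100 ≤ m) : 2 * (m : ℝ) ^ 2 * prec m ≤ 2 / (m : ℝ) ^ 10 := by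
  have hm' : (100 : ℝ) ≤ m := by exact_mod_cast hm
  have h1 := prec_le' hm
  have h2 : (m : ℝ) * ((m : ℝ) * prec m) ≤ m * ((m : ℝ) * 2 ^ m * prec m) := by
    have h3 : (1 : ℝ) ≤ 2 ^ m := one_le_pow₀ (by norm_num)
    rw [show (m : ℝ) * 2 ^ m * prec m = 2 ^ m * (m * prec m) by ring]
    exact mul_le_mul_of_nonneg_left
      (le_mul_of_one_le_left (mul_nonneg (by linarith) (prec_nonneg m)) h3) (by linarith)
  have h3 : (m : ℝ) * (1 / (m : ℝ) ^ 11) = 1 / (m : ℝ) ^ 10 := by field_simp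
  have h4 : (m : ℝ) * ((m : ℝ) * 2 ^ m * prec m) ≤ 1 / (m : ℝ) ^ 10 := by
    rw [← h3]
    exact mul_le_mul_of_nonneg_left h1 (by linarith)
  have e : (2 : ℝ) / (m : ℝ) ^ 10 = 2 * (1 / (m : ℝ) ^ 10) := by ring
  rw [e]
  nlinarith

/-- With y the distance of x to the nearest integer, sin²(πy) ≤ sin(πy) ≤ πy. It converts the
vanishing of the mean of a cosine into a lower bound for the mean of `tri`. -/
theorem sin_sq_le_tri (x : ℝ) : 2 * Real.sin (Real.pi * x) ^ 2 ≤ Real.pi * tri x := by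
  have hpi := Real.pi_pos
  have h1 : Real.sin (Real.pi * x) ^ 2 = Real.sin (Real.pi * |x - round x|) ^ 2 := by
    have e1 : Real.sin (Real.pi * |x - round x|) ^ 2 = Real.sin (Real.pi * (x - round x)) ^ 2 := by
      rcases abs_choice (x - round x) with h | h <;> rw [h]
      rw [mul_neg, Real.sin_neg, neg_sq]
    have e2 : ((-1 : ℝ) ^ round x) ^ 2 = 1 := by
      rw [← zpow_natCast, ← zpow_mul, mul_comm, zpow_mul]
      norm_num
    rw [e1, mul_sub, mul_comm Real.pi (round x : ℝ), Real.sin_sub_int_mul_pi, mul_pow, e2, one_mul]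
  rw [h1, tri]
  set y := |x - round x|
  have hy : 0 ≤ Real.pi * y := by positivity
  have h2 := Real.sin_le hy
  have h3 := Real.sin_le_one (Real.pi * y)
  have h4 : y ≤ 1 / 2 := abs_sub_round x
  have h5 : 0 ≤ Real.sin (Real.pi * y) := Real.sin_nonneg_of_nonneg_of_le_pi hy (by nlinarith)
  nlinarith

/-! ### Completeness -/

section Expectation

variable {Ω : Type*} [Fintype Ω] {p : Ω → ℝ}

theorem expect_mono (hp : ∀ ω, 0 ≤ p ω) {f g : Ω → ℝ} (h : ∀ ω, f ω ≤ g ω) :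
    ∑ ω, p ω * f ω ≤ ∑ ω, p ω * g ω :=
  Finset.sum_le_sum fun ω _ => mul_le_mul_of_nonneg_left (h ω) (hp ω)

theorem expect_const (h1 : ∑ ω, p ω = 1) (c : ℝ) : ∑ ω, p ω * c = c := by
  rw [← Finset.sum_mul, h1, one_mul]

theorem abs_expect_sub_le (hp : ∀ ω, 0 ≤ p ω) (h1 : ∑ ω, p ω = 1) {f g : Ω → ℝ} {c : ℝ}
    (h : ∀ ω, |f ω - g ω| ≤ c) : |∑ ω, p ω * f ω - ∑ ω, p ω * g ω| ≤ c := by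
  rw [← Finset.sum_sub_distrib]
  refine (Finset.abs_sum_le_sum_abs _ _).trans ?_
  rw [← expect_const h1 c]
  refine Finset.sum_le_sum fun ω _ => ?_
  rw [← mul_sub, abs_mul, abs_of_nonneg (hp ω)]
  exact mul_le_mul_of_nonneg_left (h ω) (hp ω)

end Expectation

theorem sum_mul_le {n : ℕ} {m : ℕ} (hn : n ≤ m) {a b v : Fin n → ℝ} {δ : ℝ} (hδ : 0 ≤ δ)
    (hab : ∀ i, |a i - b i| ≤ δ) (hv : ∀ i, |v i| ≤ 2 ^ m) :
    |∑ i, a i * v i - ∑ i, b i * v i| ≤ (m : ℝ) * 2 ^ m * δ := by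
  rw [← Finset.sum_sub_distrib]
  refine (Finset.abs_sum_le_sum_abs _ _).trans ?_
  calc _ ≤ ∑ _i : Fin n, δ * 2 ^ m := by
        refine Finset.sum_le_sum fun i _ => ?_
        rw [← sub_mul, abs_mul]
        exact mul_le_mul (hab i) (hv i) (abs_nonneg _) hδ
    _ = (n : ℝ) * (δ * 2 ^ m) := by simp
    _ ≤ m * (δ * 2 ^ m) := by
        have : (n : ℝ) ≤ m := by exact_mod_cast hn
        gcongr
    _ = _ := by ring

namespace Instance

variable {I : Instance}

theorem abs_div_den_le {m : ℕ} {z : ℤ} (hz : z.natAbs < 2 ^ m) : |(z : ℝ) / I.den| ≤ 2 ^ m := by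
  have hd : (1 : ℝ) ≤ I.den := by exact_mod_cast I.den_pos
  have h1 : |(z : ℝ)| ≤ 2 ^ m := by
    rw [← Int.cast_abs, Int.abs_eq_natAbs]
    exact_mod_cast hz.le
  rw [abs_div, abs_of_pos I.den_pos']
  exact (div_le_self (abs_nonneg _) hd).trans h1

/-- The encoded random dual vector. -/
theorem exists_random_encoding (hI : I.IsBasis) (hdist : 4000 * Real.sqrt I.n < I.dist)
    (hmin : ∀ u ∈ I.lattice, u ≠ 0 → 4000 * Real.sqrt I.n ≤ ‖u‖) {m : ℕ} (hm : 100 ≤ m)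
    (hn : I.n ≤ m) (hb : ∀ j i, (I.basis j i).natAbs < 2 ^ m)
    (ht : ∀ i, (I.target i).natAbs < 2 ^ m) :
    ∃ (Ω : Type) (_ : Fintype Ω) (p : Ω → ℝ) (x : Ω → Basis (m ^ 5)), (∀ ω, 0 ≤ p ω) ∧
      ∑ ω, p ω = 1 ∧ (∀ ω j, ∃ k : ℤ,
        |∑ i : Fin I.n, coord m (extend (x ω)) i * (I.basis j i / I.den) - k| ≤ (m : ℝ) * 2 ^ m * prec m) ∧
      (∀ i : Fin I.n, ∑ ω, p ω * coord m (extend (x ω)) i ^ 2 ≤ 1 / 10000 + 1 / (m : ℝ) ^ 4) ∧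
      (∀ i j : Fin I.n, i ≠ j →
        |∑ ω, p ω * (coord m (extend (x ω)) i * coord m (extend (x ω)) j)| ≤ 1 / (m : ℝ) ^ 3) ∧
      31 / 100 ≤ ∑ ω, p ω *
        tri (∑ i : Fin I.n, coord m (extend (x ω)) i * (I.target i / I.den)) := by
  have hm' : (100 : ℝ) ≤ m := by exact_mod_cast hm
  have hm0 : (0 : ℝ) < m := by linarith
  obtain ⟨Ω, inst, p, u, hp, h1, hInt, h2, h4, hij, hcos⟩ :=
    exists_random_dual hI hdist hmin (ε := 1 / (m : ℝ) ^ 4) (by positivity)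
  classical
  let good : Ω → Prop := fun ω => ∀ i, |u ω i| < (m : ℝ) ^ 2
  -- A vector with a coordinate outside the encodable range is replaced by the zero vector, which is
  -- a dual vector as well; the integrality of the pairings is not affected.
  let y : Ω → Fin I.n → ℝ := fun ω i => if good ω then u ω i else 0
  have hy : ∀ ω i, |y ω i| < (m : ℝ) ^ 2 := by
    intro ω i
    by_cases hg : good ω
    · simp only [y, if_pos hg]; exact hg i
    · simp only [y, if_neg hg, abs_zero]; positivity
  choose x hx using fun ω => exists_encoding (m := m) (by omega) hn (hy ω)
  let c : Ω → Fin I.n → ℝ := fun ω i => coord m (extend (x ω)) i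
  have hcle : ∀ ω i, |c ω i| ≤ (m : ℝ) ^ 2 := fun ω i => abs_coord_le _ _ _
  have hprec := prec_nonneg m
  have hP2 := prec_le'' hm
  have hprod : ∀ ω i j, |c ω i * c ω j - y ω i * y ω j| ≤ 2 * (m : ℝ) ^ 2 * prec m := by
    intro ω i j
    have e : c ω i * c ω j - y ω i * y ω j = (c ω i - y ω i) * c ω j + y ω i * (c ω j - y ω j) := by ring
    rw [e]
    refine (abs_add_le _ _).trans ?_
    rw [abs_mul, abs_mul]
    have a1 := mul_le_mul (hx ω i) (hcle ω j) (abs_nonneg _) hprec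
    have a2 := mul_le_mul (hy ω i).le (hx ω j) (abs_nonneg _) (by positivity)
    linarith
  have hbad : ∀ ω, ¬ good ω → ∃ k, (m : ℝ) ^ 4 ≤ u ω k ^ 2 := by
    intro ω hg
    simp only [good, not_forall, not_lt] at hg
    obtain ⟨k, hk⟩ := hg
    refine ⟨k, ?_⟩
    have := pow_le_pow_left₀ (by positivity) hk 2
    rw [sq_abs] at this
    calc (m : ℝ) ^ 4 = ((m : ℝ) ^ 2) ^ 2 := by ring
      _ ≤ _ := this
  have hnm : (I.n : ℝ) ≤ m := by exact_mod_cast hn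
  refine ⟨Ω, inst, p, x, hp, h1, fun ω j => ?_, fun i => ?_, fun i j hne => ?_, ?_⟩
  · obtain ⟨k, hk⟩ : ∃ k : ℤ, ∑ i, y ω i * (I.basis j i / I.den) = k := by
      by_cases hg : good ω
      · simp only [y, if_pos hg]; exact hInt ω j
      · exact ⟨0, by simp [y, if_neg hg]⟩
    refine ⟨k, ?_⟩
    rw [← hk]
    exact sum_mul_le hn hprec (hx ω) fun i => abs_div_den_le (hb j i)
  · have a1 := abs_expect_sub_le hp h1 (c := 2 * (m : ℝ) ^ 2 * prec m) (f := fun ω => c ω i * c ω i)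
      (g := fun ω => y ω i * y ω i) fun ω => hprod ω i i
    have a2 : ∑ ω, p ω * (y ω i * y ω i) ≤ 1 / 10000 := by
      refine le_trans (expect_mono hp fun ω => ?_) (h2 i)
      by_cases hg : good ω
      · simp only [y, if_pos hg]; rw [sq]
      · simp only [y, if_neg hg, mul_zero]; positivity
    have a3 : ∑ ω, p ω * coord m (extend (x ω)) i ^ 2 = ∑ ω, p ω * (c ω i * c ω i) :=
      Finset.sum_congr rfl fun ω _ => by rw [sq]
    have a4 : 2 / (m : ℝ) ^ 10 ≤ 1 / (m : ℝ) ^ 4 := by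
      rw [div_le_div_iff₀ (by positivity) (by positivity)]
      have : (2 : ℝ) ≤ (m : ℝ) ^ 6 := le_trans (by linarith) (le_self_pow₀ (by linarith) (by norm_num : 6 ≠ 0))
      calc 2 * (m : ℝ) ^ 4 ≤ (m : ℝ) ^ 6 * (m : ℝ) ^ 4 := by gcongr
        _ = _ := by ring
    rw [abs_le] at a1
    rw [a3]
    linarith [a1.2]
  · have a1 := abs_expect_sub_le hp h1 (c := 2 * (m : ℝ) ^ 2 * prec m) (f := fun ω => c ω i * c ω j)
      (g := fun ω => y ω i * y ω j) fun ω => hprod ω i j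
    -- On the bad event some u_k² is at least m⁴, so |u_i u_j| ≤ |u_i u_j| u_k² / m⁴, which the
    -- fourth moments bound. Summing over all k avoids choosing one.
    have a2 : |∑ ω, p ω * (y ω i * y ω j) - ∑ ω, p ω * (u ω i * u ω j)| ≤ 1 / 1000 / (m : ℝ) ^ 3 := by
      rw [← Finset.sum_sub_distrib]
      refine (Finset.abs_sum_le_sum_abs _ _).trans ?_
      have b1 : ∀ ω, |y ω i * y ω j - u ω i * u ω j| ≤
          ∑ k, 1 / (m : ℝ) ^ 4 * (u ω i ^ 4 / 4 + u ω j ^ 4 / 4 + u ω k ^ 4 / 2) := by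
        intro ω
        by_cases hg : good ω
        · simp only [y, if_pos hg, sub_self, abs_zero]
          exact Finset.sum_nonneg fun k _ => by positivity
        · obtain ⟨k, hk⟩ := hbad ω hg
          refine le_trans ?_ (Finset.single_le_sum (fun k _ => ?_) (Finset.mem_univ k))
          · simp only [y, if_neg hg, mul_zero, zero_sub, abs_neg]
            rw [one_div, ← div_eq_inv_mul, le_div_iff₀ (by positivity)]
            have c1 : |u ω i * u ω j| ≤ u ω i ^ 2 / 2 + u ω j ^ 2 / 2 := by
              rw [abs_le]
              constructor <;> nlinarith [sq_nonneg (u ω i + u ω j), sq_nonneg (u ω i - u ω j)]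
            calc _ ≤ (u ω i ^ 2 / 2 + u ω j ^ 2 / 2) * u ω k ^ 2 :=
                  mul_le_mul c1 hk (by positivity) (by positivity)
              _ ≤ _ := by nlinarith [sq_nonneg (u ω i ^ 2 - u ω k ^ 2), sq_nonneg (u ω j ^ 2 - u ω k ^ 2)]
          · positivity
      calc _ ≤ ∑ ω, p ω * ∑ k, 1 / (m : ℝ) ^ 4 * (u ω i ^ 4 / 4 + u ω j ^ 4 / 4 + u ω k ^ 4 / 2) := by
            refine Finset.sum_le_sum fun ω _ => ?_
            rw [← mul_sub, abs_mul, abs_of_nonneg (hp ω)]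
            exact mul_le_mul_of_nonneg_left (b1 ω) (hp ω)
        _ = ∑ k, 1 / (m : ℝ) ^ 4 * ((∑ ω, p ω * u ω i ^ 4) / 4 + (∑ ω, p ω * u ω j ^ 4) / 4 +
              (∑ ω, p ω * u ω k ^ 4) / 2) := by
            simp only [Finset.mul_sum, Finset.sum_div]
            rw [Finset.sum_comm]
            refine Finset.sum_congr rfl fun k _ => ?_
            rw [← Finset.sum_add_distrib, ← Finset.sum_add_distrib, Finset.mul_sum]
            exact Finset.sum_congr rfl fun ω _ => by ring
        _ ≤ ∑ _k : Fin I.n, 1 / (m : ℝ) ^ 4 * (1 / 1000) := by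
            refine Finset.sum_le_sum fun k _ => mul_le_mul_of_nonneg_left ?_ (by positivity)
            linarith [h4 i, h4 j, h4 k]
        _ = I.n * (1 / (m : ℝ) ^ 4 * (1 / 1000)) := by simp
        _ ≤ m * (1 / (m : ℝ) ^ 4 * (1 / 1000)) := by gcongr
        _ = _ := by field_simp
    have a3 := hij i j hne
    have a5 : 1 / (m : ℝ) ^ 4 ≤ 1 / 100 / (m : ℝ) ^ 3 := by
      rw [div_div, div_le_div_iff₀ (by positivity) (by positivity)]
      nlinarith [pow_pos hm0 3]
    have a4 : 2 / (m : ℝ) ^ 10 ≤ 1 / 100 / (m : ℝ) ^ 3 := by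
      rw [div_div, div_le_div_iff₀ (by positivity) (by positivity)]
      have : (200 : ℝ) ≤ (m : ℝ) ^ 7 := by
        calc (200 : ℝ) ≤ 100 ^ 7 := by norm_num
          _ ≤ _ := by gcongr
      calc 2 * (100 * (m : ℝ) ^ 3) = 200 * (m : ℝ) ^ 3 := by ring
        _ ≤ (m : ℝ) ^ 7 * (m : ℝ) ^ 3 := by gcongr
        _ = _ := by ring
    have a6 : (1 : ℝ) / 1000 / (m : ℝ) ^ 3 + 1 / 100 / (m : ℝ) ^ 3 + 1 / 100 / (m : ℝ) ^ 3 ≤ 1 / (m : ℝ) ^ 3 := by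
      rw [← add_div, ← add_div]
      gcongr
      norm_num
    rw [abs_le] at a1 a2 a3 ⊢
    change _ ≤ ∑ ω, p ω * (c ω i * c ω j) ∧ ∑ ω, p ω * (c ω i * c ω j) ≤ _
    constructor <;> linarith [a1.1, a1.2, a2.1, a2.2, a3.1, a3.2]
  -- Since tri t ≥ (1 - cos 2πt) / π and the cosine has mean zero, the mean of `tri` is at least
  -- 1/π.
  · have a1 : (2 : ℝ) / Real.pi * (1 / 2) ≤
        ∑ ω, p ω * tri (∑ i, u ω i * (I.target i / I.den)) := by
      have hpi := Real.pi_pos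
      have b1 : ∀ t : ℝ, 2 / Real.pi * (1 / 2 - Real.cos (2 * Real.pi * t) / 2) ≤ tri t := by
        intro t
        have := sin_sq_le_tri t
        rw [mul_assoc 2 Real.pi t, Real.cos_two_mul, Real.cos_sq', div_mul_eq_mul_div, div_le_iff₀ hpi]
        linarith
      refine le_trans ?_ (expect_mono hp fun ω => b1 _)
      have : ∀ ω, p ω * (2 / Real.pi * (1 / 2 - Real.cos (2 * Real.pi * ∑ i, u ω i * (I.target i / I.den)) / 2)) =
          p ω * (2 / Real.pi * (1 / 2)) - (1 / Real.pi) *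
          (p ω * Real.cos (2 * Real.pi * ∑ i, u ω i * (I.target i / I.den))) := fun ω => by ring
      rw [Finset.sum_congr rfl fun ω _ => this ω, Finset.sum_sub_distrib, ← Finset.mul_sum, hcos,
        expect_const h1]
      linarith
    -- Markov's inequality with fourth moments: the added sum is at least 1 on the bad event, where
    -- `tri` may drop by at most 1.
    have a2 : ∑ ω, p ω * tri (∑ i, u ω i * (I.target i / I.den)) ≤
        ∑ ω, p ω * (tri (∑ i, y ω i * (I.target i / I.den)) + ∑ k, u ω k ^ 4 / (m : ℝ) ^ 8) := by
      refine expect_mono hp fun ω => ?_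
      by_cases hg : good ω
      · simp only [y, if_pos hg]
        have : 0 ≤ ∑ k, u ω k ^ 4 / (m : ℝ) ^ 8 := Finset.sum_nonneg fun k _ => by positivity
        linarith
      · obtain ⟨k, hk⟩ := hbad ω hg
        have b1 : 1 ≤ u ω k ^ 4 / (m : ℝ) ^ 8 := by
          rw [le_div_iff₀ (by positivity)]
          calc 1 * (m : ℝ) ^ 8 = ((m : ℝ) ^ 4) ^ 2 := by ring
            _ ≤ (u ω k ^ 2) ^ 2 := pow_le_pow_left₀ (by positivity) hk 2
            _ = _ := by ring
        have b2 : u ω k ^ 4 / (m : ℝ) ^ 8 ≤ ∑ k, u ω k ^ 4 / (m : ℝ) ^ 8 :=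
          Finset.single_le_sum (f := fun k => u ω k ^ 4 / (m : ℝ) ^ 8) (fun k _ => by positivity)
            (Finset.mem_univ k)
        have b3 := tri_le_one (∑ i, u ω i * (I.target i / I.den))
        have b4 := tri_nonneg (∑ i, y ω i * (I.target i / I.den))
        linarith
    have a3 : ∑ ω, p ω * (tri (∑ i, y ω i * (I.target i / I.den)) + ∑ k, u ω k ^ 4 / (m : ℝ) ^ 8) ≤
        ∑ ω, p ω * tri (∑ i, y ω i * (I.target i / I.den)) + 1 / 1000 := by
      simp only [mul_add, Finset.sum_add_distrib]
      have b1 : ∑ ω, p ω * ∑ k, u ω k ^ 4 / (m : ℝ) ^ 8 ≤ 1 / 1000 := by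
        calc _ = ∑ k, (∑ ω, p ω * u ω k ^ 4) / (m : ℝ) ^ 8 := by
              simp only [Finset.mul_sum, Finset.sum_div]
              rw [Finset.sum_comm]
              exact Finset.sum_congr rfl fun k _ => Finset.sum_congr rfl fun ω _ => by ring
          _ ≤ ∑ _k : Fin I.n, (1 / 1000) / (m : ℝ) ^ 8 :=
              Finset.sum_le_sum fun k _ => div_le_div_of_nonneg_right (h4 k) (by positivity)
          _ = I.n * ((1 / 1000) / (m : ℝ) ^ 8) := by simp
          _ ≤ m * ((1 / 1000) / (m : ℝ) ^ 8) := by gcongr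
          _ = 1 / 1000 / (m : ℝ) ^ 7 := by field_simp
          _ ≤ 1 / 1000 := div_le_self (by norm_num) (one_le_pow₀ (by linarith))
      linarith
    have a4 := abs_expect_sub_le hp h1 (c := 2 * ((m : ℝ) * 2 ^ m * prec m))
      (f := fun ω => tri (∑ i, c ω i * (I.target i / I.den)))
      (g := fun ω => tri (∑ i, y ω i * (I.target i / I.den))) fun ω => by
        refine (abs_tri_sub_le _ _).trans ?_
        have := sum_mul_le hn hprec (hx ω) fun i => abs_div_den_le (I := I) (ht i)
        linarith
    have a5 := prec_le' hm
    have a6 : 1 / (m : ℝ) ^ 11 ≤ 1 / 1000 := by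
      rw [div_le_div_iff₀ (by positivity) (by norm_num)]
      have : (1000 : ℝ) ≤ (m : ℝ) ^ 11 := by
        calc (1000 : ℝ) ≤ 100 ^ 11 := by norm_num
          _ ≤ _ := by gcongr
      linarith
    have a7 : (3183 / 10000 : ℝ) ≤ 2 / Real.pi * (1 / 2) := by
      have hpi := Real.pi_pos
      rw [div_mul_eq_mul_div, le_div_iff₀ hpi]
      have := Real.pi_lt_d4
      linarith
    rw [abs_le] at a4
    change _ ≤ ∑ ω, p ω * tri (∑ i, c ω i * (I.target i / I.den))
    linarith [a4.1, a4.2]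

end Instance

/-! ### Passing every test on a YES instance -/

/-- The test belongs to the instance. -/
structure TestData.Tests (T : TestData) (I : Instance) : Prop where
  n : T.n = I.n
  den : T.den = I.den
  row : ∀ j : Fin I.n, T.d₁ = j → ∀ i : Fin I.n, T.ent i = I.basis j i
  target : T.d₁ = I.n → ∀ i : Fin I.n, T.ent i = I.target i
  zero : I.n < T.d₁ → ∀ i : Fin I.n, T.ent i = 0

namespace TestData

variable {T : TestData} {I : Instance}

theorem Tests.sum_eq (h : T.Tests I) (s : ℕ → Bool) :
    ∑ i ∈ Finset.range T.n, coord T.m s i * ((T.ent i : ℝ) / T.den) =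
      ∑ i : Fin I.n, coord T.m s i * ((T.ent i : ℝ) / I.den) := by
  rw [h.n, h.den, Finset.sum_range]

theorem Tests.den_pos (h : T.Tests I) : 0 < T.den := by rw [h.den]; exact I.den_pos

theorem acc_le_one (s : ℕ → Bool) : T.acc s ≤ 1 := by
  rw [acc]
  have a1 := tri_nonneg ((T.lin false s : ℝ) / T.Q)
  have a2 := tri_le_one ((T.lin false s : ℝ) / T.Q)
  have b1 := tri_nonneg ((T.lin true s : ℝ) / T.Q)
  have b2 := tri_le_one ((T.lin true s : ℝ) / T.Q)
  nlinarith

theorem Valid.pw_le (h : T.Valid) : (T.pw : ℝ) ≤ 2 ^ (T.m ^ 3) := by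
  have : T.pw ≤ 2 ^ (T.m ^ 3) := by
    rw [pw]
    refine Nat.pow_le_pow_right (by norm_num) ?_
    have := h.d₂
    split_ifs <;> omega
  exact_mod_cast this

/-- The circuit error 4/m¹¹ and the encoding error 1/m¹¹ together use at most half of the smallest
tolerance. -/
theorem five_div_le {m : ℕ} (hm : 100 ≤ m) : 5 / (m : ℝ) ^ 11 ≤ 1 / 2 * (1 / (10000 * (m : ℝ) ^ 5)) := by
  have hm' : (100 : ℝ) ≤ m := by exact_mod_cast hm
  have h0 : (0 : ℝ) < m := by linarith
  rw [div_mul_div_comm, div_le_div_iff₀ (by positivity) (by positivity)]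
  have : (100000 : ℝ) ≤ (m : ℝ) ^ 6 := by
    calc (100000 : ℝ) ≤ 100 ^ 6 := by norm_num
      _ ≤ _ := by gcongr
  calc 5 * (2 * (10000 * (m : ℝ) ^ 5)) = 100000 * (m : ℝ) ^ 5 := by ring
    _ ≤ (m : ℝ) ^ 6 * (m : ℝ) ^ 5 := by gcongr
    _ = _ := by ring

/-- The target test accepts the interval 13/20 ± 7/20, that is [0.3, 1], whose upper end is trivial.
The other tests have a tolerance of 1/(10⁴ m⁵), or of 1/(10⁴ m⁴) for a variance, around 0 for rows
and around 1/2 for products. -/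
theorem completeness {Ω : Type*} [Fintype Ω] {p : Ω → ℝ} {s : Ω → ℕ → Bool} (hp : ∀ ω, 0 ≤ p ω)
    (h1 : ∑ ω, p ω = 1) (hT : T.Valid) (hTI : T.Tests I)
    (hrow : ∀ ω j, ∃ k : ℤ, |∑ i : Fin I.n, coord T.m (s ω) i * (I.basis j i / I.den) - k| ≤
      (T.m : ℝ) * 2 ^ T.m * prec T.m)
    (hvar : ∀ i : Fin I.n, ∑ ω, p ω * coord T.m (s ω) i ^ 2 ≤ 1 / 10000 + 1 / (T.m : ℝ) ^ 4)
    (hcov : ∀ i j : Fin I.n, i ≠ j →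
      |∑ ω, p ω * (coord T.m (s ω) i * coord T.m (s ω) j)| ≤ 1 / (T.m : ℝ) ^ 3)
    (htar : 31 / 100 ≤ ∑ ω, p ω * tri (∑ i : Fin I.n, coord T.m (s ω) i * (I.target i / I.den))) :
    |∑ ω, p ω * T.acc (s ω) - (T.rNum : ℝ) / 20| ≤ (T.sNum : ℝ) / T.sDen := by
  have hm' : (100 : ℝ) ≤ T.m := by exact_mod_cast hT.m
  have h0 : (0 : ℝ) < T.m := by linarith
  have h5 := five_div_le hT.m
  have h5' : 5 / (T.m : ℝ) ^ 11 = 4 / (T.m : ℝ) ^ 11 + 1 / (T.m : ℝ) ^ 11 := by ring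
  have hpos : 0 < 1 / (T.m : ℝ) ^ 11 := by positivity
  have hpos' : 0 < 1 / (10000 * (T.m : ℝ) ^ 5) := by positivity
  have hsmall : 4 / (T.m : ℝ) ^ 11 ≤ 1 / 100 := by
    rw [div_le_div_iff₀ (by positivity) (by norm_num)]
    have : (400 : ℝ) ≤ (T.m : ℝ) ^ 11 := by
      calc (400 : ℝ) ≤ 100 ^ 11 := by norm_num
        _ ≤ _ := by gcongr
    linarith
  rcases Nat.le_one_iff_eq_zero_or_eq_one.1 hT.kd with hk | hk
  · have hacc := abs_expect_sub_le hp h1 fun ω => acc_row hT hTI.den_pos hk (s ω)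
    simp only [hTI.sum_eq] at hacc
    by_cases hd : T.d₁ = T.n
    · have hIt : T.IsTarget := ⟨hk, hd⟩
      have hent := hTI.target (hd.trans hTI.n)
      have hpw : T.pw = 1 := by rw [pw, if_pos hd, pow_zero]
      simp only [hent, hpw, Nat.cast_one, one_mul] at hacc
      rw [rNum, if_pos hk, if_pos hd, sNum, if_pos hIt, sDen, if_pos hIt]
      have hle : ∑ ω, p ω * T.acc (s ω) ≤ 1 := by
        rw [← expect_const h1 1]
        exact expect_mono hp fun ω => acc_le_one _
      rw [abs_le] at hacc ⊢
      push_cast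
      constructor <;> linarith [hacc.1]
    · have hIt : ¬ T.IsTarget := fun h => hd h.2
      rw [rNum, if_pos hk, if_neg hd, sNum, if_neg hIt, sDen, if_neg hIt, if_neg (by simp [hk])]
      have htri : ∀ ω, |tri (T.pw * ∑ i : Fin I.n, coord T.m (s ω) i * ((T.ent i : ℝ) / I.den)) - 0| ≤
          1 / (T.m : ℝ) ^ 11 := by
        intro ω
        rw [sub_zero, abs_of_nonneg (tri_nonneg _)]
        -- A row index beyond the target points behind the input, where all entries read as zero;
        -- such a test is passed trivially.
        rcases lt_or_gt_of_ne (show T.d₁ ≠ I.n from fun h => hd (h.trans hTI.n.symm)) with hlt | hlt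
        · obtain ⟨k, hkk⟩ := hrow ω ⟨T.d₁, hlt⟩
          have hent := hTI.row ⟨T.d₁, hlt⟩ rfl
          simp only [hent]
          have e : ((T.pw * k : ℤ) : ℝ) = T.pw * (k : ℝ) := by push_cast; ring
          refine (tri_le_two_mul_abs_sub_intCast _ (T.pw * k)).trans ?_
          rw [e, ← mul_sub, abs_mul, abs_of_nonneg (Nat.cast_nonneg _)]
          refine le_trans ?_ (prec_le hT.m)
          calc _ ≤ 2 * (2 ^ (T.m ^ 3) * ((T.m : ℝ) * 2 ^ T.m * prec T.m)) := by
                have := mul_le_mul hT.pw_le hkk (abs_nonneg _) (by positivity)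
                linarith
            _ = _ := by ring
        · simp only [hTI.zero hlt, Int.cast_zero, zero_div, mul_zero, Finset.sum_const_zero, tri_zero]
          exact hpos.le
      have h2 := abs_expect_sub_le hp h1 htri
      rw [expect_const h1 0] at h2
      have e : (((1 : ℕ) : ℝ) / ((10000 * T.m ^ 4 * T.m : ℕ) : ℝ)) = 1 / (10000 * (T.m : ℝ) ^ 5) := by
        push_cast; ring
      rw [e]
      rw [abs_le] at hacc h2 ⊢
      simp only [Nat.cast_zero, zero_div]
      constructor <;> linarith [hacc.1, hacc.2, h2.1, h2.2]
  · have hacc := abs_expect_sub_le hp h1 fun ω => acc_cov hT hk (s ω)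
    have hIt : ¬ T.IsTarget := fun h => by have := h.1; omega
    rw [rNum, if_neg (by omega), sNum, if_neg hIt, sDen, if_neg hIt]
    set A : Ω → ℝ := fun ω => (if T.d₁ < T.n then coord T.m (s ω) T.d₁ else 0) *
      (if T.d₂ < T.n then coord T.m (s ω) T.d₂ else 0) with hA
    have hE : ∑ ω, p ω * ((1 - (if T.d₁ < T.n then coord T.m (s ω) T.d₁ else 0) *
      (if T.d₂ < T.n then coord T.m (s ω) T.d₂ else 0) / (T.m : ℝ) ^ 4) / 2) =
        1 / 2 - (∑ ω, p ω * A ω) / (2 * (T.m : ℝ) ^ 4) := by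
      have : ∀ ω, p ω * ((1 - (if T.d₁ < T.n then coord T.m (s ω) T.d₁ else 0) *
          (if T.d₂ < T.n then coord T.m (s ω) T.d₂ else 0) / (T.m : ℝ) ^ 4) / 2) =
          p ω * (1 / 2) - p ω * A ω / (2 * (T.m : ℝ) ^ 4) := by
        intro ω
        simp only [hA]
        field_simp
      rw [Finset.sum_congr rfl fun ω _ => this ω, Finset.sum_sub_distrib, expect_const h1,
        Finset.sum_div]
    rw [hE] at hacc
    suffices h : |∑ ω, p ω * A ω| / (2 * (T.m : ℝ) ^ 4) + 4 / (T.m : ℝ) ^ 11 ≤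
        ((1 : ℕ) : ℝ) / ((10000 * T.m ^ 4 * (if T.kd ≠ 0 ∧ T.d₁ = T.d₂ then 1 else T.m) : ℕ) : ℝ) by
      have e : (((10 : ℕ) : ℝ) / 20) = 1 / 2 := by norm_num
      rw [e]
      refine le_trans ?_ h
      have e2 : ∑ ω, p ω * T.acc (s ω) - 1 / 2 = (∑ ω, p ω * T.acc (s ω) -
        (1 / 2 - (∑ ω, p ω * A ω) / (2 * (T.m : ℝ) ^ 4))) + -((∑ ω, p ω * A ω) / (2 * (T.m : ℝ) ^ 4)) := by
        ring
      rw [e2]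
      refine (abs_add_le _ _).trans ?_
      rw [abs_neg, abs_div, abs_of_pos (by positivity : (0 : ℝ) < 2 * (T.m : ℝ) ^ 4)]
      linarith
    by_cases hlt : T.d₁ < T.n ∧ T.d₂ < T.n
    · have hA' : ∀ ω, A ω = coord T.m (s ω) T.d₁ * coord T.m (s ω) T.d₂ := by
        intro ω
        simp only [hA, if_pos hlt.1, if_pos hlt.2]
      simp only [hA']
      have hn1 : T.d₁ < I.n := hTI.n ▸ hlt.1
      have hn2 : T.d₂ < I.n := hTI.n ▸ hlt.2
      by_cases hdd : T.d₁ = T.d₂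
      · rw [if_pos ⟨by omega, hdd⟩]
        have hv := hvar ⟨T.d₁, hn1⟩
        simp only at hv
        have e1 : ∑ ω, p ω * (coord T.m (s ω) T.d₁ * coord T.m (s ω) T.d₂) =
            ∑ ω, p ω * coord T.m (s ω) T.d₁ ^ 2 := by
          refine Finset.sum_congr rfl fun ω _ => ?_
          rw [← hdd, sq]
        rw [e1, abs_of_nonneg (Finset.sum_nonneg fun ω _ => mul_nonneg (hp ω) (by positivity))]
        have e2 : (((1 : ℕ) : ℝ) / ((10000 * T.m ^ 4 * 1 : ℕ) : ℝ)) = 1 / (10000 * (T.m : ℝ) ^ 4) := by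
          push_cast; ring
        have e3 : 1 / (10000 * (T.m : ℝ) ^ 5) ≤ 1 / 100 * (1 / (10000 * (T.m : ℝ) ^ 4)) := by
          rw [div_mul_div_comm, div_le_div_iff₀ (by positivity) (by positivity)]
          have : 0 ≤ (T.m : ℝ) ^ 4 := by positivity
          nlinarith
        have e4 : (1 / 10000 + 1 / (T.m : ℝ) ^ 4) / (2 * (T.m : ℝ) ^ 4) ≤
            6 / 10 * (1 / (10000 * (T.m : ℝ) ^ 4)) := by
          have : 1 / (T.m : ℝ) ^ 4 ≤ 1 / 100000 := by
            rw [div_le_div_iff₀ (by positivity) (by norm_num)]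
            have : (100000 : ℝ) ≤ (T.m : ℝ) ^ 4 := by
              calc (100000 : ℝ) ≤ 100 ^ 4 := by norm_num
                _ ≤ _ := by gcongr
            linarith
          rw [div_le_iff₀ (by positivity)]
          have e5 : 6 / 10 * (1 / (10000 * (T.m : ℝ) ^ 4)) * (2 * (T.m : ℝ) ^ 4) = 12 / 100000 := by
            field_simp
            norm_num
          rw [e5]
          linarith
        have e6 : (∑ ω, p ω * coord T.m (s ω) T.d₁ ^ 2) / (2 * (T.m : ℝ) ^ 4) ≤
            (1 / 10000 + 1 / (T.m : ℝ) ^ 4) / (2 * (T.m : ℝ) ^ 4) :=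
          div_le_div_of_nonneg_right hv (by positivity)
        rw [e2]
        have : 0 < 1 / (10000 * (T.m : ℝ) ^ 4) := by positivity
        linarith
      · rw [if_neg (fun h => hdd h.2)]
        have hv := hcov ⟨T.d₁, hn1⟩ ⟨T.d₂, hn2⟩ (fun h => hdd (Fin.mk.inj_iff.1 h))
        simp only at hv
        have e2 : (((1 : ℕ) : ℝ) / ((10000 * T.m ^ 4 * T.m : ℕ) : ℝ)) = 1 / (10000 * (T.m : ℝ) ^ 5) := by
          push_cast; ring
        have e6 := div_le_div_of_nonneg_right hv (by positivity : (0 : ℝ) ≤ 2 * (T.m : ℝ) ^ 4)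
        have e7 : 1 / (T.m : ℝ) ^ 3 / (2 * (T.m : ℝ) ^ 4) ≤ 1 / 2 * (1 / (10000 * (T.m : ℝ) ^ 5)) := by
          rw [div_div, div_mul_div_comm, div_le_div_iff₀ (by positivity) (by positivity)]
          have : (10000 : ℝ) ≤ (T.m : ℝ) ^ 2 := by nlinarith
          calc 1 * (2 * (10000 * (T.m : ℝ) ^ 5)) = 2 * (10000 * (T.m : ℝ) ^ 5) := by ring
            _ ≤ 2 * ((T.m : ℝ) ^ 2 * (T.m : ℝ) ^ 5) := by gcongr
            _ = _ := by ring
        rw [e2]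
        linarith
    -- An index outside the dimension contributes the zero form to its chain, so the acceptance
    -- probability is 1/2 up to the circuit error.
    · have hA' : ∀ ω, A ω = 0 := by
        intro ω
        simp only [hA]
        rw [not_and_or] at hlt
        rcases hlt with h | h <;> simp [h]
      simp only [hA', mul_zero, Finset.sum_const_zero, abs_zero, zero_div, zero_add]
      have e2 : 1 / (10000 * (T.m : ℝ) ^ 5) ≤
          ((1 : ℕ) : ℝ) / ((10000 * T.m ^ 4 * (if T.kd ≠ 0 ∧ T.d₁ = T.d₂ then 1 else T.m) : ℕ) : ℝ) := by
        push_cast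
        have hc : (if T.kd ≠ 0 ∧ T.d₁ = T.d₂ then (1 : ℝ) else T.m) ≤ T.m := by split_ifs <;> linarith
        have hc0 : 0 < (if T.kd ≠ 0 ∧ T.d₁ = T.d₂ then (1 : ℝ) else T.m) := by split_ifs <;> linarith
        rw [div_le_div_iff₀ (by positivity) (by positivity), one_mul, one_mul]
        calc _ ≤ 10000 * (T.m : ℝ) ^ 4 * T.m := by gcongr
          _ = _ := by ring
      linarith

end TestData

/-- The density matrix of a random basis state. -/
theorem exists_density {Ω : Type*} [Fintype Ω] {p : Ω → ℝ} (hp : ∀ ω, 0 ≤ p ω) (h1 : ∑ ω, p ω = 1)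
    {k : ℕ} (x : Ω → Basis k) :
    ∃ ρ : Op k, IsDensity ρ ∧ ∀ φ : Basis k → ℝ, ∑ b, (ρ b b).re * φ b = ∑ ω, p ω * φ (x ω) := by
  classical
  refine ⟨Matrix.diagonal fun b => ((∑ ω, if x ω = b then p ω else 0 : ℝ) : ℂ), ⟨?_, ?_⟩, fun φ => ?_⟩
  · refine Matrix.PosSemidef.diagonal fun b => ?_
    rw [Pi.zero_apply]
    exact Complex.zero_le_real.2 (Finset.sum_nonneg fun ω _ => by split_ifs; exacts [hp ω, le_rfl])
  · rw [Matrix.trace_diagonal, ← Complex.ofReal_sum, Finset.sum_comm]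
    simp [h1]
  · simp only [Matrix.diagonal_apply_eq, Complex.ofReal_re, Finset.sum_mul]
    rw [Finset.sum_comm]
    refine Finset.sum_congr rfl fun ω _ => ?_
    simp [ite_mul]

/-! ### Soundness -/

theorem tri_add_le (x y : ℝ) : tri (x + y) ≤ tri x + tri y := by
  have h1 := tri_le_two_mul_abs_sub_intCast (x + y) (round x + round y)
  have h2 : |x + y - ((round x + round y : ℤ) : ℝ)| ≤ |x - round x| + |y - round y| := by
    push_cast
    rw [show x + y - ((round x : ℝ) + round y) = (x - round x) + (y - round y) by ring]
    exact abs_add_le _ _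
  simp only [tri] at *
  linarith

theorem tri_sum_le {ι : Type*} (s : Finset ι) (f : ι → ℝ) : tri (∑ i ∈ s, f i) ≤ ∑ i ∈ s, tri (f i) := by
  classical
  induction s using Finset.induction_on with
  | empty => simp [tri_zero]
  | insert i s hi ih =>
    rw [Finset.sum_insert hi, Finset.sum_insert hi]
    exact (tri_add_le _ _).trans (by linarith)

theorem tri_intCast_mul_le (k : ℤ) (x : ℝ) : tri (k * x) ≤ |(k : ℝ)| * tri x := by
  have h1 := tri_le_two_mul_abs_sub_intCast (k * x) (k * round x)
  push_cast at h1
  rw [← mul_sub, abs_mul] at h1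
  rw [tri]
  simp only [tri] at h1 ⊢
  linarith

/-- Within distance 1/4 of an integer, doubling does not pass the middle between two integers, so
the distance doubles exactly. -/
theorem tri_two_mul {x : ℝ} (h : tri x ≤ 1 / 2) : tri (2 * x) = 2 * tri x := by
  have h1 : |x - round x| ≤ 1 / 4 := by rw [tri] at h; linarith
  have e : 2 * x = 2 * (x - round x) + ((2 * round x : ℤ) : ℝ) := by push_cast; ring
  rw [e, tri_add_intCast]
  have h3 : tri x = tri (x - round x) := by
    conv_lhs => rw [show x = (x - round x) + ((round x : ℤ) : ℝ) by ring]
    rw [tri_add_intCast]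
  rw [h3]
  generalize x - round x = y at *
  have hneg : ∀ y, tri (-y) = tri y := by
    intro y
    have h4 : ∀ y, tri (-y) ≤ tri y := fun y => by
      have := tri_intCast_mul_le (-1) y
      simpa using this
    refine le_antisymm (h4 y) ?_
    have := h4 (-y)
    rwa [neg_neg] at this
  rw [abs_le] at h1
  by_cases hy : 0 ≤ y
  · rw [tri_of_mem hy (by linarith), tri_of_mem (by linarith) (by linarith)]
  · rw [← hneg y, ← hneg (2 * y), tri_of_mem (by linarith) (by linarith),
      tri_of_mem (by linarith) (by linarith)]
    ring

/-- If none of the successive doublings comes too far from an integer, the distance doubles every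
time; since it stays bounded, it was at most 2^(-L) at the start. -/
theorem two_pow_mul_tri_le {x : ℝ} {L : ℕ} (h : ∀ l, l < L → tri (2 ^ l * x) ≤ 1 / 2) :
    2 ^ L * tri x ≤ 1 := by
  have key : ∀ l, l ≤ L → tri (2 ^ l * x) = 2 ^ l * tri x := by
    intro l hl
    induction l with
    | zero => simp
    | succ l ih =>
      rw [pow_succ', mul_assoc, tri_two_mul (h l (by omega)), ih (by omega), mul_assoc]
  rw [← key L le_rfl]
  exact tri_le_one _

/-- Polynomially many powers of two control a multiplier of exponential size. Either one of the
summands is already at least one, or x is within 2^(-L) of an integer and |k| times this is the last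
term. -/
theorem tri_intCast_mul_le_sum (k : ℤ) (x : ℝ) (L : ℕ) :
    tri (k * x) ≤ ∑ l ∈ Finset.range L, 2 * tri (2 ^ l * x) + |(k : ℝ)| / 2 ^ L := by
  have hnn : ∀ l, 0 ≤ 2 * tri (2 ^ l * x) := fun l => by have := tri_nonneg (2 ^ l * x); linarith
  have hk : 0 ≤ |(k : ℝ)| / 2 ^ L := by positivity
  by_cases h : ∀ l, l < L → tri (2 ^ l * x) ≤ 1 / 2
  · have h1 := two_pow_mul_tri_le h
    have h2 := tri_intCast_mul_le k x
    have h3 : |(k : ℝ)| * tri x ≤ |(k : ℝ)| / 2 ^ L := by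
      rw [le_div_iff₀ (by positivity)]
      calc _ = |(k : ℝ)| * (2 ^ L * tri x) := by ring
        _ ≤ |(k : ℝ)| * 1 := mul_le_mul_of_nonneg_left h1 (abs_nonneg _)
        _ = _ := mul_one _
    have := Finset.sum_nonneg fun l (_ : l ∈ Finset.range L) => hnn l
    linarith
  · push Not at h
    obtain ⟨l, hl, hl2⟩ := h
    have h1 := Finset.single_le_sum (fun l _ => hnn l) (Finset.mem_range.2 hl)
    have h2 := tri_le_one (k * x)
    linarith

/-- Cramer's bound for the coefficients of an integer vector. -/
theorem natAbs_le_of_vecMul {n : ℕ} {A : Matrix (Fin n) (Fin n) ℤ} (hA : A.det ≠ 0) {k t : Fin n → ℤ}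
    (hk : k ᵥ* A = t) {X : ℤ} (hX : ∀ i j, |A i j| ≤ X) (ht : ∀ i, |t i| ≤ X) (j : Fin n) :
    |k j| ≤ n.factorial * X ^ n := by
  have h1 : A.det * k j = (A.updateRow j t).det := by
    have e1 : Aᵀ.cramer t = A.det • k := by
      rw [Matrix.cramer_eq_adjugate_mulVec, ← hk, ← Matrix.mulVec_transpose, Matrix.mulVec_mulVec,
        Matrix.adjugate_mul, Matrix.det_transpose, Matrix.smul_mulVec, Matrix.one_mulVec]
    have e2 := congrFun e1 j
    rw [Matrix.cramer_transpose_apply] at e2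
    rw [e2]
    rfl
  have h2 : |(A.updateRow j t).det| ≤ n.factorial * X ^ n := by
    have := Matrix.det_le (A := A.updateRow j t) (abv := AbsoluteValue.abs) (x := X) (by
      intro a b
      by_cases hab : a = j
      · subst hab
        rw [Matrix.updateRow_self]
        exact ht b
      · rw [Matrix.updateRow_ne hab]
        exact hX a b)
    simpa using this
  rw [← h1, abs_mul] at h2
  have h3 : 1 ≤ |A.det| := Int.one_le_abs hA
  nlinarith [abs_nonneg (k j)]

theorem factorial_mul_pow_le {n m : ℕ} (hm : 100 ≤ m) (hn : n ≤ m) :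
    n.factorial * (2 ^ (m + 2)) ^ n ≤ 2 ^ (3 * m ^ 2) := by
  have h1 : n.factorial ≤ (2 ^ m) ^ m := by
    calc n.factorial ≤ n ^ n := Nat.factorial_le_pow n
      _ ≤ m ^ n := Nat.pow_le_pow_left hn n
      _ ≤ m ^ m := Nat.pow_le_pow_right (by omega) hn
      _ ≤ (2 ^ m) ^ m := Nat.pow_le_pow_left Nat.lt_two_pow_self.le m
  have h2 : (2 ^ (m + 2)) ^ n ≤ (2 ^ (m + 2)) ^ m := Nat.pow_le_pow_right (by positivity) hn
  calc _ ≤ (2 ^ m) ^ m * (2 ^ (m + 2)) ^ m := Nat.mul_le_mul h1 h2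
    _ = 2 ^ (m * m + (m + 2) * m) := by rw [← pow_mul, ← pow_mul, ← pow_add]
    _ ≤ _ := Nat.pow_le_pow_right (by norm_num) (by nlinarith)

namespace Instance

variable {I : Instance}

/-- The vector den · y is an integer combination of the numerators of the basis, and its entries are
at most 2^(m+2) because y is close to the target. Cramer's rule then bounds the coefficients. -/
theorem exists_close (hI : I.IsBasis) (hdist : I.dist ≤ 1) {m : ℕ} (hm : 100 ≤ m) (hn : I.n ≤ m)
    (hden : I.den < 2 ^ m) (hb : ∀ j i, (I.basis j i).natAbs < 2 ^ m)
    (ht : ∀ i, (I.target i).natAbs < 2 ^ m) :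
    ∃ (k : Fin I.n → ℤ) (e : Fin I.n → ℝ), (∀ j, |(k j : ℝ)| ≤ 2 ^ (3 * m ^ 2)) ∧ ∑ i, e i ^ 2 ≤ 4 ∧
      ∀ i, (I.target i : ℝ) / I.den = ∑ j, k j * ((I.basis j i : ℝ) / I.den) + e i := by
  have hd := I.den_pos'
  -- Radius 2 in place of 1, so that it is not necessary to know that the infimum is attained.
  obtain ⟨y, hy, hy2⟩ := (Metric.infDist_lt_iff (x := I.vec I.target)
    (s := (I.lattice : Set (EuclideanSpace ℝ (Fin I.n)))) (r := 2) ⟨0, I.lattice.zero_mem⟩).1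
    (lt_of_le_of_lt hdist (by norm_num))
  obtain ⟨k, hk⟩ := (Submodule.mem_span_range_iff_exists_fun ℤ).1 hy
  have hyi : ∀ i, y i = ∑ j, k j * ((I.basis j i : ℝ) / I.den) := by
    intro i
    rw [← hk]
    simp [vec, WithLp.ofLp_sum, Finset.sum_apply]
  let e : Fin I.n → ℝ := fun i => (I.target i : ℝ) / I.den - y i
  have he : ∑ i, e i ^ 2 ≤ 4 := by
    rw [EuclideanSpace.dist_eq] at hy2
    have h1 : ∑ i, Dist.dist (I.vec I.target i) (y i) ^ 2 = ∑ i, e i ^ 2 := by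
      refine Finset.sum_congr rfl fun i _ => ?_
      rw [Real.dist_eq, sq_abs]
      rfl
    rw [h1, Real.sqrt_lt' (by norm_num)] at hy2
    linarith
  refine ⟨k, e, fun j => ?_, he, fun i => by simp only [e, hyi i]; ring⟩
  let t : Fin I.n → ℤ := k ᵥ* Matrix.of I.basis
  have hte : ∀ i, (t i : ℝ) = I.target i - I.den * e i := by
    intro i
    have h1 : (t i : ℝ) = ∑ j, (k j : ℝ) * (I.basis j i : ℝ) := by
      simp only [t, Matrix.vecMul, dotProduct, Matrix.of_apply]
      push_cast
      rfl
    rw [h1]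
    simp only [e, hyi i, mul_sub, Finset.mul_sum]
    have h2 : ∀ j, (I.den : ℝ) * (k j * ((I.basis j i : ℝ) / I.den)) = k j * I.basis j i := by
      intro j; field_simp
    simp only [h2]
    field_simp
    ring
  have htb : ∀ i, |t i| ≤ 2 ^ (m + 2) := by
    intro i
    have h1 : e i ^ 2 ≤ 4 :=
      (Finset.single_le_sum (f := fun i => e i ^ 2) (fun i _ => sq_nonneg _) (Finset.mem_univ i)).trans he
    have h2 : |e i| ≤ 2 := abs_le_of_sq_le_sq (by linarith) (by norm_num)
    have h3 : |(I.target i : ℝ)| ≤ 2 ^ m := by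
      rw [← Int.cast_abs, Int.abs_eq_natAbs]
      exact_mod_cast (ht i).le
    have h4 : (I.den : ℝ) ≤ 2 ^ m := by exact_mod_cast hden.le
    have h5 : |(t i : ℝ)| ≤ 2 ^ (m + 2) := by
      rw [hte]
      refine (abs_sub _ _).trans ?_
      rw [abs_mul, abs_of_pos hd]
      have h6 := mul_le_mul h4 h2 (abs_nonneg _) (by positivity)
      rw [pow_add]
      have : (0 : ℝ) < 2 ^ m := by positivity
      nlinarith
    exact_mod_cast h5
  have hX : ∀ a b, |Matrix.of I.basis a b| ≤ (2 : ℤ) ^ (m + 2) := by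
    intro a b
    rw [Matrix.of_apply, Int.abs_eq_natAbs]
    have h1 := hb a b
    have h2 : 2 ^ m ≤ 2 ^ (m + 2) := Nat.pow_le_pow_right (by norm_num) (by omega)
    exact_mod_cast (h1.trans_le h2).le
  have h7 := natAbs_le_of_vecMul hI.det_ne_zero (k := k) (t := t) rfl hX htb j
  have h8 := factorial_mul_pow_le hm hn
  have h9 : |k j| ≤ 2 ^ (3 * m ^ 2) := h7.trans (by exact_mod_cast h8)
  exact_mod_cast h9

/-- Split the target as lattice vector plus error e. The lattice part contributes at most 2/1000 by
the row bounds. The error part contributes at most 20 · E⟨u, e⟩² + 5/100, and E⟨u, e⟩² is the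
quadratic form of the covariance matrix at e with |e|² ≤ 4. -/
theorem not_sound {Ω : Type*} [Fintype Ω] {p : Ω → ℝ} {u : Ω → Fin I.n → ℝ} (hp : ∀ ω, 0 ≤ p ω)
    (h1 : ∑ ω, p ω = 1) (hI : I.IsBasis) (hdist : I.dist ≤ 1) {m : ℕ} (hm : 100 ≤ m) (hn : I.n ≤ m)
    (hden : I.den < 2 ^ m) (hb : ∀ j i, (I.basis j i).natAbs < 2 ^ m)
    (ht : ∀ i, (I.target i).natAbs < 2 ^ m)
    (hvar : ∀ i, ∑ ω, p ω * u ω i ^ 2 ≤ 3 / 10000)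
    (hcov : ∀ i j, i ≠ j → |∑ ω, p ω * (u ω i * u ω j)| ≤ 3 / 10000 / m)
    (hrow : ∀ j l, l < m ^ 3 →
      ∑ ω, p ω * tri (2 ^ l * ∑ i, u ω i * (I.basis j i / I.den)) ≤ 2 / 10000 / (m : ℝ) ^ 5) :
    ∑ ω, p ω * tri (∑ i, u ω i * (I.target i / I.den)) ≤ 11 / 100 := by
  have hm' : (100 : ℝ) ≤ m := by exact_mod_cast hm
  have hm0 : (0 : ℝ) < m := by linarith
  have hnm : (I.n : ℝ) ≤ m := by exact_mod_cast hn
  obtain ⟨k, e, hk, he, htar⟩ := exists_close hI hdist hm hn hden hb ht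
  have hpt : ∀ ω, tri (∑ i, u ω i * (I.target i / I.den)) ≤
      ∑ j, (∑ l ∈ Finset.range (m ^ 3), 2 * tri (2 ^ l * ∑ i, u ω i * (I.basis j i / I.den)) +
        2 ^ (3 * m ^ 2) / 2 ^ (m ^ 3)) + (20 * (∑ i, u ω i * e i) ^ 2 + 5 / 100) := by
    intro ω
    have e1 : ∑ i, u ω i * ((I.target i : ℝ) / I.den) =
        ∑ j, (k j : ℝ) * ∑ i, u ω i * ((I.basis j i : ℝ) / I.den) + ∑ i, u ω i * e i := by
      simp only [htar, mul_add, Finset.sum_add_distrib, Finset.mul_sum]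
      congr 1
      rw [Finset.sum_comm]
      exact Finset.sum_congr rfl fun i _ => Finset.sum_congr rfl fun j _ => by ring
    rw [e1]
    refine (tri_add_le _ _).trans (add_le_add ((tri_sum_le _ _).trans ?_) ?_)
    · refine Finset.sum_le_sum fun j _ => ?_
      refine (tri_intCast_mul_le_sum _ _ (m ^ 3)).trans ?_
      have := div_le_div_of_nonneg_right (hk j) (by positivity : (0 : ℝ) ≤ 2 ^ (m ^ 3))
      linarith
    · have h2 := tri_le_two_mul_abs_sub_intCast (∑ i, u ω i * e i) 0
      rw [Int.cast_zero, sub_zero] at h2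
      refine h2.trans ?_
      have h3 : (∑ i, u ω i * e i) ^ 2 = |∑ i, u ω i * e i| ^ 2 := (sq_abs _).symm
      rw [h3]
      -- From 20 (t - 1/20)² ≥ 0 one gets 2t ≤ 20 t² + 1/20, which replaces the first absolute
      -- moment by the second moment.
      nlinarith [sq_nonneg (|∑ i, u ω i * e i| - 1 / 20)]
  refine (expect_mono hp hpt).trans ?_
  -- The diagonal gives 3/10⁴ · 4. The off-diagonal entries, of size at most 3/(10⁴ m), give at most
  -- 3/(10⁴ m) · n · 4; here the accuracy 1/m of the covariances is needed.
  have hB : ∑ ω, p ω * (∑ i, u ω i * e i) ^ 2 ≤ 24 / 10000 := by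
    have e2 : ∑ ω, p ω * (∑ i, u ω i * e i) ^ 2 =
        ∑ i, ∑ j, e i * e j * ∑ ω, p ω * (u ω i * u ω j) := by
      have h2 : ∀ ω, p ω * (∑ i, u ω i * e i) ^ 2 =
          ∑ i, ∑ j, e i * e j * (p ω * (u ω i * u ω j)) := by
        intro ω
        rw [sq, Finset.sum_mul_sum, Finset.mul_sum]
        refine Finset.sum_congr rfl fun i _ => ?_
        rw [Finset.mul_sum]
        exact Finset.sum_congr rfl fun j _ => by ring
      rw [Finset.sum_congr rfl fun ω _ => h2 ω, Finset.sum_comm]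
      refine Finset.sum_congr rfl fun i _ => ?_
      rw [Finset.sum_comm]
      exact Finset.sum_congr rfl fun j _ => by rw [← Finset.mul_sum]
    rw [e2]
    have e3 : ∀ i j, e i * e j * ∑ ω, p ω * (u ω i * u ω j) ≤
        (if i = j then 3 / 10000 * e i ^ 2 else 0) + 3 / 10000 / m * (e i ^ 2 / 2 + e j ^ 2 / 2) := by
      intro i j
      have hq : 0 ≤ 3 / 10000 / m * (e i ^ 2 / 2 + e j ^ 2 / 2) := by positivity
      by_cases hij : i = j
      · subst hij
        rw [if_pos rfl]
        have h2 := hvar i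
        simp only [sq] at h2
        have := mul_le_mul_of_nonneg_left h2 (mul_self_nonneg (e i))
        rw [sq] at *
        linarith
      · rw [if_neg hij, zero_add]
        have h2 := hcov i j hij
        have h3 : |e i * e j| ≤ e i ^ 2 / 2 + e j ^ 2 / 2 := by
          rw [abs_le]
          constructor <;> nlinarith [sq_nonneg (e i + e j), sq_nonneg (e i - e j)]
        refine (le_abs_self _).trans ?_
        rw [abs_mul, mul_comm]
        exact mul_le_mul h2 h3 (abs_nonneg _) (by positivity)
    refine (Finset.sum_le_sum fun i _ => Finset.sum_le_sum fun j _ => e3 i j).trans ?_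
    have e4 : ∑ i, ∑ j, ((if i = j then 3 / 10000 * e i ^ 2 else 0) +
        3 / 10000 / m * (e i ^ 2 / 2 + e j ^ 2 / 2)) =
        3 / 10000 * (∑ i, e i ^ 2) + 3 / 10000 / m * (I.n * ∑ i, e i ^ 2) := by
      simp only [Finset.sum_add_distrib, Finset.sum_ite_eq, Finset.mem_univ, if_true, ← Finset.mul_sum,
        Finset.sum_const, Finset.card_univ, Fintype.card_fin, nsmul_eq_mul, ← Finset.sum_div]
      ring
    rw [e4]
    have hs0 : 0 ≤ ∑ i, e i ^ 2 := Finset.sum_nonneg fun i _ => sq_nonneg _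
    have e5 : 3 / 10000 / (m : ℝ) * (I.n * ∑ i, e i ^ 2) ≤ 3 / 10000 / m * (m * 4) := by gcongr
    have e6 : 3 / 10000 / (m : ℝ) * (m * 4) = 12 / 10000 := by field_simp; norm_num
    linarith
  -- The exponents up to m³ exceed the 3m² bits of the coefficients by far.
  have hpow : (2 : ℝ) ^ (3 * m ^ 2) / 2 ^ (m ^ 3) ≤ 1 / 1000 / m := by
    rw [div_div, div_le_div_iff₀ (by positivity) (by positivity)]
    have h2 : (1000 * m : ℝ) ≤ 2 ^ (10 + m) := by
      have : (m : ℝ) ≤ 2 ^ m := by exact_mod_cast Nat.lt_two_pow_self.le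
      rw [pow_add]
      nlinarith
    calc (2 : ℝ) ^ (3 * m ^ 2) * (1000 * m) ≤ 2 ^ (3 * m ^ 2) * 2 ^ (10 + m) := by gcongr
      _ = 2 ^ (3 * m ^ 2 + (10 + m)) := by rw [← pow_add]
      _ ≤ 2 ^ (m ^ 3) := pow_le_pow_right₀ (by norm_num) (by nlinarith)
      _ = _ := by ring
  have hE : ∑ ω, p ω * (∑ j, (∑ l ∈ Finset.range (m ^ 3),
      2 * tri (2 ^ l * ∑ i, u ω i * (I.basis j i / I.den)) + 2 ^ (3 * m ^ 2) / 2 ^ (m ^ 3)) +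
      (20 * (∑ i, u ω i * e i) ^ 2 + 5 / 100)) =
      ∑ j, (∑ l ∈ Finset.range (m ^ 3), 2 * ∑ ω, p ω * tri (2 ^ l * ∑ i, u ω i * (I.basis j i / I.den)) +
        2 ^ (3 * m ^ 2) / 2 ^ (m ^ 3)) + (20 * ∑ ω, p ω * (∑ i, u ω i * e i) ^ 2 + 5 / 100) := by
    simp only [mul_add, Finset.sum_add_distrib, expect_const h1]
    congr 1
    · congr 1
      · simp only [Finset.mul_sum]
        rw [Finset.sum_comm]
        refine Finset.sum_congr rfl fun j _ => ?_
        rw [Finset.sum_comm]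
        exact Finset.sum_congr rfl fun l _ => Finset.sum_congr rfl fun ω _ => by ring
    · congr 1
      rw [Finset.mul_sum]
      exact Finset.sum_congr rfl fun ω _ => by ring
  rw [hE]
  have hJ : ∑ j, (∑ l ∈ Finset.range (m ^ 3), 2 * ∑ ω, p ω * tri (2 ^ l * ∑ i, u ω i * (I.basis j i / I.den)) +
        2 ^ (3 * m ^ 2) / 2 ^ (m ^ 3)) ≤ 2 / 1000 := by
    calc _ ≤ ∑ _j : Fin I.n, (∑ _l ∈ Finset.range (m ^ 3), 2 * (2 / 10000 / (m : ℝ) ^ 5) + 1 / 1000 / (m : ℝ)) := by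
          refine Finset.sum_le_sum fun j _ => add_le_add (Finset.sum_le_sum fun l hl => ?_) hpow
          have := hrow j l (Finset.mem_range.1 hl)
          linarith
      _ = I.n * ((m : ℝ) ^ 3 * (2 * (2 / 10000 / (m : ℝ) ^ 5)) + 1 / 1000 / m) := by
          simp only [Finset.sum_const, Finset.card_range, Finset.card_univ, Fintype.card_fin, nsmul_eq_mul]
          push_cast
          ring
      _ ≤ m * ((m : ℝ) ^ 3 * (2 * (2 / 10000 / (m : ℝ) ^ 5)) + 1 / 1000 / m) := by gcongr
      _ = 4 / 10000 / m + 1 / 1000 := by field_simp; norm_num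
      _ ≤ _ := by
          have : (4 : ℝ) / 10000 / m ≤ 4 / 10000 := div_le_self (by norm_num) (by linarith)
          linarith
  linarith

end Instance

theorem small_error {m : ℕ} (hm : 100 ≤ m) {ε : ℝ} (hε : ε ≤ 1 / (m : ℝ) ^ 10) :
    4 / (m : ℝ) ^ 11 + ε ≤ 1 / 10000 / (m : ℝ) ^ 6 := by
  have hm' : (100 : ℝ) ≤ m := by exact_mod_cast hm
  have h0 : (0 : ℝ) < m := by linarith
  have h1 : 4 / (m : ℝ) ^ 11 ≤ 1 / (m : ℝ) ^ 10 := by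
    rw [div_le_div_iff₀ (by positivity) (by positivity)]
    calc 4 * (m : ℝ) ^ 10 ≤ m * (m : ℝ) ^ 10 := by gcongr; linarith
      _ = _ := by ring
  have h2 : 2 / (m : ℝ) ^ 10 ≤ 1 / 10000 / (m : ℝ) ^ 6 := by
    rw [div_div, div_le_div_iff₀ (by positivity) (by positivity)]
    have : (20000 : ℝ) ≤ (m : ℝ) ^ 4 := by
      calc (20000 : ℝ) ≤ 100 ^ 4 := by norm_num
        _ ≤ _ := by gcongr
    calc 2 * (10000 * (m : ℝ) ^ 6) = 20000 * (m : ℝ) ^ 6 := by ring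
      _ ≤ (m : ℝ) ^ 4 * (m : ℝ) ^ 6 := by gcongr
      _ = _ := by ring
  have e : 2 / (m : ℝ) ^ 10 = 1 / (m : ℝ) ^ 10 + 1 / (m : ℝ) ^ 10 := by ring
  linarith

/-- If one distribution passes all tests, the tests hand over the hypotheses of
`Instance.not_sound`, and the bound 0.11 contradicts the lower end 0.3 of the target test. -/
theorem soundness {Ω : Type*} [Fintype Ω] {p : Ω → ℝ} {s : Ω → ℕ → Bool} {I : Instance}
    (hp : ∀ ω, 0 ≤ p ω) (h1 : ∑ ω, p ω = 1) (hI : I.IsBasis) (hdist : I.dist ≤ 1) {m : ℕ}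
    {ε : ℝ} (hε : ε ≤ 1 / (m : ℝ) ^ 10) (hm : 100 ≤ m)
    (hall : ∀ kd d₁ d₂, kd ≤ 1 → d₁ < m ^ 3 → d₂ < m ^ 3 → ∃ T : TestData, T.Valid ∧ T.m = m ∧
      T.Tests I ∧ T.kd = kd ∧ T.d₁ = d₁ ∧ T.d₂ = d₂ ∧
      |∑ ω, p ω * T.acc (s ω) - (T.rNum : ℝ) / 20| ≤ (T.sNum : ℝ) / T.sDen + ε) : False := by
  have hm' : (100 : ℝ) ≤ m := by exact_mod_cast hm
  have h0 : (0 : ℝ) < m := by linarith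
  have hm3 : m < m ^ 3 := by
    calc m < m * m := by nlinarith
      _ ≤ m ^ 3 := by rw [pow_succ, sq]; exact Nat.le_mul_of_pos_right _ (by omega)
  have hsm := small_error hm hε
  -- The size bounds for the instance are read off from the validity of suitable tests.
  obtain ⟨hn, hden⟩ : I.n ≤ m ∧ I.den < 2 ^ m := by
    obtain ⟨T, hT, hTm, hTI, -⟩ := hall 0 0 0 (by norm_num) (by omega) (by omega)
    exact ⟨hTI.n ▸ hTm ▸ hT.n, hTI.den ▸ hTm ▸ hT.den⟩
  have hb : ∀ j i, (I.basis j i).natAbs < 2 ^ m := by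
    intro j i
    obtain ⟨T, hT, hTm, hTI, -, hd, -⟩ := hall 0 j 0 (by norm_num) (by omega) (by omega)
    have := hT.ent i
    rwa [hTI.row j hd i, hTm] at this
  have ht : ∀ i, (I.target i).natAbs < 2 ^ m := by
    intro i
    obtain ⟨T, hT, hTm, hTI, -, hd, -⟩ := hall 0 I.n 0 (by norm_num) (by omega) (by omega)
    have := hT.ent i
    rwa [hTI.target hd i, hTm] at this
  -- The acceptance probability is 1/2 - E(u_i u_j)/(2m⁴), so all tolerances are multiplied by 2m⁴.
  have hcov' : ∀ i j : Fin I.n, |∑ ω, p ω * (coord m (s ω) i * coord m (s ω) j)| ≤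
      2 * (m : ℝ) ^ 4 * (1 / (10000 * (m : ℝ) ^ 4 * (if i = j then (1 : ℝ) else m)) + 1 / 10000 / (m : ℝ) ^ 6) := by
    intro i j
    obtain ⟨T, hT, hTm, hTI, hk, hd, hd', hle⟩ := hall 1 i j le_rfl (by omega) (by omega)
    have hacc := abs_expect_sub_le hp h1 fun ω => TestData.acc_cov hT hk (s ω)
    have hIt : ¬ T.IsTarget := fun h => by have := h.1; omega
    rw [TestData.rNum, if_neg (by omega), TestData.sNum, if_neg hIt, TestData.sDen, if_neg hIt, hk, hd, hd',
      hTm] at hle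
    simp only [hd, hd', hTI.n, i.2, j.2, if_true, hTm] at hacc
    have hE : ∑ ω, p ω * ((1 - coord m (s ω) i * coord m (s ω) j / (m : ℝ) ^ 4) / 2) =
        1 / 2 - (∑ ω, p ω * (coord m (s ω) i * coord m (s ω) j)) / (2 * (m : ℝ) ^ 4) := by
      have : ∀ ω, p ω * ((1 - coord m (s ω) i * coord m (s ω) j / (m : ℝ) ^ 4) / 2) =
          p ω * (1 / 2) - p ω * (coord m (s ω) i * coord m (s ω) j) / (2 * (m : ℝ) ^ 4) := by
        intro ω
        field_simp
      rw [Finset.sum_congr rfl fun ω _ => this ω, Finset.sum_sub_distrib, expect_const h1,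
        Finset.sum_div]
    rw [hE] at hacc
    have e3 : ((1 : ℕ) : ℝ) / ((10000 * m ^ 4 * (if 1 ≠ 0 ∧ (i : ℕ) = j then 1 else m) : ℕ) : ℝ) =
        1 / (10000 * (m : ℝ) ^ 4 * (if i = j then (1 : ℝ) else m)) := by
      by_cases hij : i = j
      · simp [hij]
      · have : (i : ℕ) ≠ j := fun h => hij (Fin.ext h)
        simp [hij, this]
    rw [e3] at hle
    have e4 : |(∑ ω, p ω * (coord m (s ω) i * coord m (s ω) j)) / (2 * (m : ℝ) ^ 4)| ≤
        1 / (10000 * (m : ℝ) ^ 4 * (if i = j then (1 : ℝ) else m)) + 1 / 10000 / (m : ℝ) ^ 6 := by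
      have e5 : (((10 : ℕ) : ℝ) / 20) = 1 / 2 := by norm_num
      rw [e5] at hle
      rw [abs_le] at hle hacc ⊢
      constructor <;> linarith [hle.1, hle.2, hacc.1, hacc.2]
    rw [abs_div, abs_of_pos (by positivity : (0 : ℝ) < 2 * (m : ℝ) ^ 4), div_le_iff₀ (by positivity)] at e4
    linarith
  have hp6 : 2 * (m : ℝ) ^ 4 * (1 / 10000 / (m : ℝ) ^ 6) ≤ 1 / 10000 / m := by
    have : 2 * (m : ℝ) ^ 4 * (1 / 10000 / (m : ℝ) ^ 6) = 1 / 10000 / m * (2 / m) := by field_simp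
    rw [this]
    refine mul_le_of_le_one_right (by positivity) ?_
    rw [div_le_one h0]
    linarith
  have hvar : ∀ i : Fin I.n, ∑ ω, p ω * coord m (s ω) i ^ 2 ≤ 3 / 10000 := by
    intro i
    have h2 := hcov' i i
    rw [if_pos rfl] at h2
    have e1 : 2 * (m : ℝ) ^ 4 * (1 / (10000 * (m : ℝ) ^ 4 * 1) + 1 / 10000 / (m : ℝ) ^ 6) =
        2 / 10000 + 2 * (m : ℝ) ^ 4 * (1 / 10000 / (m : ℝ) ^ 6) := by
      rw [mul_add]
      congr 1
      field_simp
    have e2 : 1 / 10000 / (m : ℝ) ≤ 1 / 10000 := div_le_self (by norm_num) (by linarith)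
    have e3 : ∑ ω, p ω * coord m (s ω) i ^ 2 = ∑ ω, p ω * (coord m (s ω) i * coord m (s ω) i) :=
      Finset.sum_congr rfl fun ω _ => by rw [sq]
    rw [e1] at h2
    rw [e3]
    linarith [le_abs_self (∑ ω, p ω * (coord m (s ω) i * coord m (s ω) i))]
  have hcov : ∀ i j : Fin I.n, i ≠ j →
      |∑ ω, p ω * (coord m (s ω) i * coord m (s ω) j)| ≤ 3 / 10000 / m := by
    intro i j hij
    have h2 := hcov' i j
    rw [if_neg hij] at h2
    have e1 : 2 * (m : ℝ) ^ 4 * (1 / (10000 * (m : ℝ) ^ 4 * m) + 1 / 10000 / (m : ℝ) ^ 6) =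
        2 / 10000 / m + 2 * (m : ℝ) ^ 4 * (1 / 10000 / (m : ℝ) ^ 6) := by
      rw [mul_add]
      congr 1
      field_simp
    have e2 : 3 / 10000 / (m : ℝ) = 2 / 10000 / m + 1 / 10000 / m := by ring
    linarith
  have hrow : ∀ (j : Fin I.n) (l : ℕ), l < m ^ 3 →
      ∑ ω, p ω * tri (2 ^ l * ∑ i : Fin I.n, coord m (s ω) i * (I.basis j i / I.den)) ≤
        2 / 10000 / (m : ℝ) ^ 5 := by
    intro j l hl
    obtain ⟨T, hT, hTm, hTI, hk, hd, hd', hle⟩ := hall 0 j l (by norm_num) (by omega) hl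
    have hacc := abs_expect_sub_le hp h1 fun ω => TestData.acc_row hT hTI.den_pos hk (s ω)
    have hne : ¬ T.d₁ = T.n := by rw [hd, hTI.n]; exact j.2.ne
    have hIt : ¬ T.IsTarget := fun h => hne h.2
    have hpw : (T.pw : ℝ) = 2 ^ l := by
      rw [TestData.pw, if_neg hne, hd']
      push_cast
      rfl
    simp only [hTI.sum_eq] at hacc
    simp only [hpw, hTI.row j hd, hTm] at hacc
    rw [TestData.rNum, if_pos hk, if_neg hne, TestData.sNum, if_neg hIt, TestData.sDen, if_neg hIt,
      if_neg (by simp [hk]), hTm] at hle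
    have e : (((1 : ℕ) : ℝ) / ((10000 * m ^ 4 * m : ℕ) : ℝ)) = 1 / 10000 / (m : ℝ) ^ 5 := by
      push_cast
      rw [div_div]
      congr 1
      ring
    have e2 : 1 / 10000 / (m : ℝ) ^ 6 ≤ 1 / 10000 / (m : ℝ) ^ 5 := by
      have : (1 : ℝ) ≤ m := by linarith
      gcongr
      norm_num
    have e3 : 2 / 10000 / (m : ℝ) ^ 5 = 1 / 10000 / (m : ℝ) ^ 5 + 1 / 10000 / (m : ℝ) ^ 5 := by ring
    rw [e, Nat.cast_zero, zero_div] at hle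
    rw [abs_le] at hle hacc
    linarith [hle.2, hacc.1]
  have hfin := Instance.not_sound (u := fun ω i => coord m (s ω) i) hp h1 hI hdist hm hn hden hb ht
    hvar hcov hrow
  obtain ⟨T, hT, hTm, hTI, hk, hd, hd', hle⟩ := hall 0 I.n 0 (by norm_num) (by omega) (by omega)
  have hacc := abs_expect_sub_le hp h1 fun ω => TestData.acc_row hT hTI.den_pos hk (s ω)
  have hne : T.d₁ = T.n := by rw [hd, hTI.n]
  have hIt : T.IsTarget := ⟨hk, hne⟩
  have hpw : T.pw = 1 := by rw [TestData.pw, if_pos hne, pow_zero]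
  simp only [hTI.sum_eq] at hacc
  simp only [hpw, hTI.target hd, hTm, Nat.cast_one, one_mul] at hacc
  rw [TestData.rNum, if_pos hk, if_pos hne, TestData.sNum, if_pos hIt, TestData.sDen, if_pos hIt] at hle
  have e2 : 1 / 10000 / (m : ℝ) ^ 6 ≤ 1 / 10000 := div_le_self (by norm_num) (one_le_pow₀ (by linarith))
  push_cast at hle
  rw [abs_le] at hle hacc
  linarith [hle.1, hacc.2]

/-! ### Reading the input -/

theorem readUnaryL_encUnary (n : ℕ) (l : List Bool) : readUnaryL (encUnary n ++ l) = (n, l) := by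
  induction n with
  | zero => simp [encUnary, readUnaryL]
  | succ n ih =>
    have : encUnary (n + 1) ++ l = true :: (encUnary n ++ l) := by simp [encUnary, List.replicate_succ]
    rw [this, readUnaryL, ih]

theorem readNatL_encNat (n : ℕ) (l : List Bool) : readNatL (encNat n ++ l) = (n, false :: l) := by
  induction n using Nat.binaryRec' with
  | zero => simp [encNat, readNatL]
  | bit b n h ih =>
    have : encNat (Nat.bit b n) ++ l = true :: b :: (encNat n ++ l) := by
      rw [encNat, Nat.bits_append_bit n b h]
      simp [encNat]
    rw [this, readNatL, ih, Nat.bit_val]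
    simp only [Prod.mk.injEq, and_true]
    ring

theorem readIntL_encInt (z : ℤ) (l : List Bool) : readIntL (encInt z ++ l) = (z, l) := by
  simp only [readIntL, encInt, List.cons_append, List.tail_cons, List.headD_cons, readNatL_encNat,
    Prod.mk.injEq, and_true]
  by_cases h : z < 0
  · simp only [h, decide_true, Bool.toNat_true]
    push_cast
    rw [abs_of_neg h]
    ring
  · simp only [h, decide_false, Bool.toNat_false]
    push_cast
    rw [abs_of_nonneg (not_lt.1 h)]
    ring

theorem dropInts_encInts (zs : List ℤ) (k : ℕ) :
    dropInts (zs.flatMap encInt) k = (zs.drop k).flatMap encInt := by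
  induction k with
  | zero => rfl
  | succ k ih =>
    rw [dropInts, ih]
    cases h : zs.drop k with
    | nil =>
      rw [← List.tail_drop, h]
      rfl
    | cons a t =>
      rw [← List.tail_drop, h, List.flatMap_cons, readIntL_encInt, List.tail_cons]

theorem entry_encInts (zs : List ℤ) (k : ℕ) : entry (zs.flatMap encInt) k = zs.getD k 0 := by
  rw [entry, dropInts_encInts]
  have h1 : zs.getD k 0 = (zs.drop k).headD 0 := by
    rw [List.headD_eq_head?_getD, List.head?_drop, List.getD_eq_getElem?_getD]
  rw [h1]
  cases h : zs.drop k with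
  | nil => rfl
  | cons a t => rw [List.flatMap_cons, readIntL_encInt]; rfl

theorem getD_flatten {α : Type*} (a : α) {n : ℕ} (L : List (List α)) (hL : ∀ r ∈ L, r.length = n) (j i : ℕ)
    (hi : i < n) : L.flatten.getD (j * n + i) a = (L.getD j []).getD i a := by
  induction L generalizing j with
  | nil => simp
  | cons r L ih =>
    have hr := hL r List.mem_cons_self
    cases j with
    | zero =>
      rw [List.flatten_cons, zero_mul, zero_add, List.getD_append _ _ _ _ (by omega)]
      rfl
    | succ j =>
      rw [List.flatten_cons, List.getD_append_right _ _ _ _ (by rw [hr]; nlinarith), hr,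
        show (j + 1) * n + i - n = j * n + i by rw [Nat.succ_mul]; omega,
        ih (fun r hr => hL r (List.mem_cons_of_mem _ hr))]
      rfl

namespace Instance

/-- The rows of the input. -/
def rows (I : Instance) : List (List ℤ) :=
  (List.ofFn fun j => List.ofFn (I.basis j)) ++ [List.ofFn I.target]

theorem encode_eq (I : Instance) :
    I.encode = encUnary I.n ++ (encNat I.den ++ I.rows.flatten.flatMap encInt) := by
  have h1 : ∀ (f : Fin I.n → ℤ), (List.ofFn fun j => encInt (f j)).flatten = (List.ofFn f).flatMap encInt := by
    intro f
    rw [List.flatMap_def, List.map_ofFn]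
    rfl
  simp only [encode, rows, h1, List.flatten_append, List.flatMap_append, List.append_assoc]
  congr 3
  · rw [List.flatMap_def, List.map_flatten, List.flatten_flatten, List.map_map, List.map_ofFn]
    rfl
  · simp

/-- All rows have length `n`, so skipping `d₁ * n` numbers leads to row `d₁`. The target counts as
row `n`, and behind it the reader delivers zeros. -/
theorem testOf_tests (I : Instance) (co : List Bool) : (testOf I.encode co).Tests I := by
  have e1 : readUnaryL I.encode = (I.n, encNat I.den ++ I.rows.flatten.flatMap encInt) := by
    rw [encode_eq, readUnaryL_encUnary]
  have hn : (testOf I.encode co).n = I.n := by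
    simp only [testOf, e1]
  have e2 : entryBits I.encode = I.rows.flatten.flatMap encInt := by
    rw [entryBits, e1, readNatL_encNat, List.tail_cons]
  have hlen : ∀ r ∈ I.rows, r.length = I.n := by
    intro r hr
    simp only [rows, List.mem_append, List.mem_ofFn, List.mem_singleton] at hr
    rcases hr with ⟨j, rfl⟩ | rfl <;> simp
  have hent : ∀ i : Fin I.n, (testOf I.encode co).ent i =
      (I.rows.getD (testOf I.encode co).d₁ []).getD i 0 := by
    intro i
    rw [← getD_flatten 0 I.rows hlen _ i i.2, ← entry_encInts, ← e2]
    simp only [testOf, e1, entry]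
    rw [dropInts_add]
  refine ⟨hn, ?_, fun j hj i => ?_, fun hd i => ?_, fun hd i => ?_⟩
  · simp only [testOf, e1, readNatL_encNat]
  · rw [hent, hj]
    simp [rows, List.getD_append]
  · rw [hent, hd, rows, List.getD_append_right _ _ _ _ (by simp)]
    simp
  · rw [hent, List.getD_eq_default I.rows]
    · simp
    · simp [rows]
      omega

end Instance

/-! ### Counting the coins -/

theorem val_ofFn_testBit (k c : ℕ) : val (List.ofFn fun i : Fin k => c.testBit i) = c % 2 ^ k := by
  induction k generalizing c with
  | zero => simp [val, Nat.mod_one]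
  | succ k ih =>
    rw [List.ofFn_succ, val]
    simp only [Fin.val_zero, Fin.val_succ, Nat.testBit_succ]
    rw [ih, Nat.testBit_zero, pow_succ', Nat.mod_mul]
    congr 1
    rcases Nat.mod_two_eq_zero_or_one c with h | h <;> simp [h]

theorem two_mul_pow_six_le {m : ℕ} (hm : 100 ≤ m) : 2 * m ^ 6 ≤ 2 ^ m := by
  induction m, hm using Nat.le_induction with
  | base => norm_num
  | succ m hm ih =>
    have h1 : 100 ^ 6 * (m + 1) ^ 6 ≤ 101 ^ 6 * m ^ 6 := by
      rw [← mul_pow, ← mul_pow]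
      exact Nat.pow_le_pow_left (by omega) 6
    have h2 : 101 ^ 6 * m ^ 6 ≤ 100 ^ 6 * (2 * m ^ 6) := by
      rw [← mul_assoc]
      exact Nat.mul_le_mul_right _ (by norm_num)
    have h3 : (m + 1) ^ 6 ≤ 2 * m ^ 6 := Nat.le_of_mul_le_mul_left (h1.trans h2) (by norm_num)
    rw [pow_succ 2]
    omega

/-- An event of large probability meets every residue class of the coins. -/
theorem exists_coins {k m : ℕ} (hk : k = m) (hm : 100 ≤ m) {P : (Fin k → Bool) → Prop}
    (hP : 1 - 1 / (m : ℝ) ^ 8 < ({ω | P ω}.ncard : ℝ) / 2 ^ k) {c : ℕ} (hc : c < 2 * m ^ 6) :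
    ∃ ω, P ω ∧ val (List.ofFn ω) % (2 * m ^ 6) = c := by
  classical
  subst hk
  by_contra! hno
  have h6 := two_mul_pow_six_le hm
  have hM : 0 < 2 * k ^ 6 := by positivity
  -- The residue class of `c` contains at least the `q` numbers `c + 2 * k ^ 6 * t` below `2 ^ k`.
  set q := 2 ^ k / (2 * k ^ 6) with hq
  have hq1 : 1 ≤ q := (Nat.one_le_div_iff hM).2 h6
  have hqle : 2 * k ^ 6 * q ≤ 2 ^ k := Nat.mul_div_le _ _
  have hqlt : 2 ^ k < 2 * k ^ 6 * (q + 1) := Nat.lt_mul_div_succ _ hM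
  have hlt : ∀ t, t < q → c + 2 * k ^ 6 * t < 2 ^ k := by
    intro t ht
    calc c + 2 * k ^ 6 * t < 2 * k ^ 6 * (t + 1) := by rw [mul_add]; omega
      _ ≤ 2 * k ^ 6 * q := Nat.mul_le_mul_left _ ht
      _ ≤ 2 ^ k := hqle
  let f : ℕ → Fin k → Bool := fun t i => (c + 2 * k ^ 6 * t).testBit i
  have hf : ∀ t, t < q → val (List.ofFn (f t)) = c + 2 * k ^ 6 * t := fun t ht => by
    rw [val_ofFn_testBit, Nat.mod_eq_of_lt (hlt t ht)]
  have hinj : Set.InjOn f (Finset.range q : Finset ℕ) := by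
    intro t ht t' ht' h
    have ht := Finset.mem_range.1 (Finset.mem_coe.1 ht)
    have ht' := Finset.mem_range.1 (Finset.mem_coe.1 ht')
    have e := hf t ht
    rw [h, hf t' ht'] at e
    exact (Nat.eq_of_mul_eq_mul_left hM (Nat.add_left_cancel e)).symm
  have hcard : {ω | P ω}.ncard + q ≤ 2 ^ k := by
    have e : Disjoint (Finset.univ.filter P) ((Finset.range q).image f) := by
      rw [Finset.disjoint_left]
      intro ω h1 h2
      obtain ⟨t, ht, rfl⟩ := Finset.mem_image.1 h2
      refine hno _ (Finset.mem_filter.1 h1).2 ?_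
      rw [hf t (Finset.mem_range.1 ht), Nat.add_mul_mod_self_left, Nat.mod_eq_of_lt hc]
    have h2 := Finset.card_le_univ ((Finset.univ.filter P) ∪ (Finset.range q).image f)
    rw [Finset.card_union_of_disjoint e, Finset.card_image_of_injOn hinj, Finset.card_range,
      Fintype.card_fun, Fintype.card_bool, Fintype.card_fin] at h2
    rwa [Set.ncard_eq_toFinset_card', Set.toFinset_ofPred]
  have hk0 : (100 : ℝ) ≤ k := by exact_mod_cast hm
  have hk' : (0 : ℝ) < k := by linarith
  have hcard' : ({ω | P ω}.ncard : ℝ) + q ≤ 2 ^ k := by exact_mod_cast hcard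
  -- A residue class has frequency at least 1/(4k⁶), which exceeds 1/k⁸; an event that misses it is
  -- not likely enough.
  have hq2 : (2 : ℝ) ^ k ≤ 4 * (k : ℝ) ^ 6 * q := by
    have : 2 ^ k ≤ 4 * k ^ 6 * q := by nlinarith
    exact_mod_cast this
  have h2 : (0 : ℝ) < 2 ^ k := by positivity
  rw [lt_div_iff₀ h2, sub_mul, one_mul] at hP
  have h3 : (q : ℝ) < 1 / (k : ℝ) ^ 8 * 2 ^ k := by linarith
  rw [one_div_mul_eq_div, lt_div_iff₀ (by positivity)] at h3
  have h4 : (4 : ℝ) ≤ (k : ℝ) ^ 2 := by nlinarith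
  have h5 : 4 * (k : ℝ) ^ 6 * q ≤ q * (k : ℝ) ^ 8 := by
    calc 4 * (k : ℝ) ^ 6 * q ≤ (k : ℝ) ^ 2 * (k : ℝ) ^ 6 * q := by gcongr
      _ = _ := by ring
  linarith

theorem coins_decode {M c kd d₁ d₂ : ℕ} (hkd : kd ≤ 1) (h₁ : d₁ < M) (h₂ : d₂ < M)
    (h : c % (2 * (M * M)) = kd + 2 * (d₁ + M * d₂)) :
    c % 2 = kd ∧ c / 2 % M = d₁ ∧ c / 2 / M % M = d₂ := by
  have hM : 0 < M := by omega
  have e := Nat.mod_add_div c (2 * (M * M))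
  rw [h] at e
  set t := c / (2 * (M * M))
  have e1 : c = kd + 2 * (d₁ + M * (d₂ + M * t)) := by rw [← e]; ring
  have e2 : c / 2 = d₁ + M * (d₂ + M * t) := by omega
  refine ⟨by omega, ?_, ?_⟩
  · rw [e2, Nat.add_mul_mod_self_left, Nat.mod_eq_of_lt h₁]
  · rw [e2, Nat.add_mul_div_left _ _ hM, Nat.div_eq_of_lt h₁, zero_add, Nat.add_mul_mod_self_left,
      Nat.mod_eq_of_lt h₂]

theorem code_lt {M kd d₁ d₂ : ℕ} (hkd : kd ≤ 1) (h₁ : d₁ < M) (h₂ : d₂ < M) :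
    kd + 2 * (d₁ + M * d₂) < 2 * (M * M) := by
  have : M * d₂ + M ≤ M * M := by
    rw [← Nat.mul_succ]
    exact Nat.mul_le_mul_left _ h₂
  omega

/-! ### The error terms -/

/-- The polynomial `(X / 101) ^ k`. -/
def errPoly (k : ℕ) : ℝ[X] := (Polynomial.C (1 / 101) * Polynomial.X) ^ k

theorem eval_errPoly (k : ℕ) (y : ℝ) : (errPoly k).eval y = (1 / 101 * y) ^ k := by
  simp [errPoly]

theorem errPoly_pos (k : ℕ) {N : ℕ} (hN : 0 < N) : 0 < (errPoly k).eval (1 / (N : ℝ)) := by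
  have : (0 : ℝ) < N := by exact_mod_cast hN
  rw [eval_errPoly]
  positivity

/-- For N ≥ 1 one has N + 100 ≤ 101 N, whence the constant 101 in `errPoly`: the errors are
polynomials in 1/N, while the tests are measured in N + 100. -/
theorem errPoly_le (k N : ℕ) (hN : 0 < N) :
    (errPoly k).eval (1 / (N : ℝ)) ≤ 1 / ((N + 100 : ℕ) : ℝ) ^ k := by
  have h1 : (1 : ℝ) ≤ N := by exact_mod_cast hN
  rw [eval_errPoly, ← one_div_pow, one_div_mul_one_div]
  push_cast
  gcongr
  linarith

/-! ### The super-verifier on YES and NO instances -/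

theorem IsDensity.diag_nonneg {k : ℕ} {ρ : Op k} (h : IsDensity ρ) (b : Basis k) : 0 ≤ (ρ b b).re :=
  (Complex.nonneg_iff.1 h.1.diag_nonneg).1

theorem IsDensity.sum_diag {k : ℕ} {ρ : Op k} (h : IsDensity ρ) : ∑ b, (ρ b b).re = 1 := by
  have := congrArg Complex.re h.2
  simpa [Matrix.trace] using this

theorem Instance.encode_length_pos (I : Instance) : 0 < I.encode.length := by
  rw [I.encode_eq]
  simp [encUnary]

/-- The bounds follow from the validity of the tests, once coins are chosen that point to the row in
question: the binary digits of `2 * d` select row `d`. -/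
theorem Instance.natAbs_lt (I : Instance) :
    I.n ≤ I.encode.length + 100 ∧ (∀ j i, (I.basis j i).natAbs < 2 ^ (I.encode.length + 100)) ∧
      ∀ i, (I.target i).natAbs < 2 ^ (I.encode.length + 100) := by
  have hn : I.n ≤ I.encode.length + 100 := by
    rw [← (I.testOf_tests []).n]
    exact (testOf_valid I.encode []).n
  have hd : ∀ d, d ≤ I.n → ∃ co, (testOf I.encode co).d₁ = d := by
    intro d h
    refine ⟨List.ofFn fun i : Fin (2 * d) => (2 * d).testBit i, ?_⟩
    simp only [testOf]
    rw [val_ofFn_testBit, Nat.mod_eq_of_lt Nat.lt_two_pow_self, Nat.mul_div_cancel_left _ two_pos,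
      Nat.mod_eq_of_lt]
    calc d < (I.encode.length + 100) * 2 := by omega
      _ ≤ (I.encode.length + 100) * (I.encode.length + 100) ^ 2 := by gcongr; nlinarith
      _ = _ := by ring
  refine ⟨hn, fun j i => ?_, fun i => ?_⟩
  · obtain ⟨co, h⟩ := hd j j.2.le
    rw [← (I.testOf_tests co).row j h i]
    exact (testOf_valid I.encode co).ent i
  · obtain ⟨co, h⟩ := hd I.n le_rfl
    rw [← (I.testOf_tests co).target h i]
    exact (testOf_valid I.encode co).ent i

/-- One diagonal density matrix serves all coin strings, so every test passes and the probability is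
exactly one. -/
theorem superVerifier_complete {I : Instance} (hI : I.IsBasis)
    (hdist : 4000 * Real.sqrt I.n < I.dist)
    (hmin : ∀ u ∈ I.lattice, u ≠ 0 → 4000 * Real.sqrt I.n ≤ ‖u‖) :
    ∃ ρ : Op (((Polynomial.X + 100 : ℕ[X]) ^ 5).eval I.encode.length), IsDensity ρ ∧
      superVerifier.prob I.encode (fun o => |o.V.accept ρ - o.r| ≤ o.s) = 1 := by
  obtain ⟨hn, hb, ht⟩ := I.natAbs_lt
  have hex := I.exists_random_encoding hI hdist hmin (by omega) hn hb ht
  -- The number of witness qubits is brought into the form that the type of the super-verifier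
  -- demands.
  rw [← eval_X_add_pow 5] at hex
  obtain ⟨Ω, _, p, y, hp, h1, hrow, hvar, hcov, htar⟩ := hex
  obtain ⟨ρ, hρ, hE⟩ := exists_density hp h1 y
  refine ⟨ρ, hρ, ?_⟩
  have hall : ∀ ω, |(superVerifier.triple I.encode ω).V.accept ρ - (superVerifier.triple I.encode ω).r| ≤
      (superVerifier.triple I.encode ω).s := by
    intro ω
    simp only [superVerifier]
    rw [TestData.accept_triple, TestData.r_triple, TestData.s_triple]
    refine (congrArg (fun a => |a - _| ≤ _)
      (hE fun b => (testOf I.encode (List.ofFn ω)).acc (extend b))).mpr ?_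
    exact TestData.completeness hp h1 (testOf_valid _ _) (I.testOf_tests _) hrow hvar hcov htar
  have huniv : {ω | |(superVerifier.triple I.encode ω).V.accept ρ - (superVerifier.triple I.encode ω).r| ≤
      (superVerifier.triple I.encode ω).s} = Set.univ := Set.eq_univ_of_forall hall
  rw [SuperVerifier.prob, huniv, Set.ncard_univ, Nat.card_eq_fintype_card,
    Fintype.card_fun, Fintype.card_bool, Fintype.card_fin]
  push_cast
  exact div_self (by positivity)

/-- A larger probability would meet every residue class of the coins, so the one distribution on the
diagonal of `ρ` would pass every test, which `soundness` excludes. -/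
theorem superVerifier_sound {I : Instance} (hI : I.IsBasis) (hdist : I.dist ≤ 1)
    {ρ : Op (((Polynomial.X + 100 : ℕ[X]) ^ 5).eval I.encode.length)} (hρ : IsDensity ρ) {ε : ℝ}
    (hε : ε ≤ 1 / ((I.encode.length + 100 : ℕ) : ℝ) ^ 10) :
    superVerifier.prob I.encode (fun o => |o.V.accept ρ - o.r| ≤ o.s + ε) ≤
      1 - 1 / ((I.encode.length + 100 : ℕ) : ℝ) ^ 8 := by
  by_contra! hP
  refine soundness (p := fun b => (ρ b b).re) (s := fun b => extend b) hρ.diag_nonneg hρ.sum_diag hI hdist hε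
    (by omega) fun kd d₁ d₂ hkd h₁ h₂ => ?_
  have e6 : (I.encode.length + 100) ^ 3 * (I.encode.length + 100) ^ 3 = (I.encode.length + 100) ^ 6 := by ring
  have hlt := code_lt hkd h₁ h₂
  rw [e6] at hlt
  obtain ⟨ω, hω, hc⟩ := exists_coins (by rw [superVerifier, eval_X_add_pow, pow_one]) (by omega) hP hlt
  rw [← e6] at hc
  obtain ⟨a1, a2, a3⟩ := coins_decode hkd h₁ h₂ hc
  refine ⟨testOf I.encode (List.ofFn ω), testOf_valid _ _, rfl, I.testOf_tests _, a1, a2, a3, ?_⟩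
  simp only [superVerifier] at hω
  rwa [TestData.accept_triple, TestData.r_triple, TestData.s_triple] at hω

end QMAPlus
end

theorem theorem3 :
    ∃ c : ℝ, 0 < c ∧ QMAPlus.MemQMAPlus (QMAPlus.coGapCVP' fun n => c * Real.sqrt n) := by
  -- The constant 4000 exceeds the 2002 that `Instance.short_of_gap` needs. Exponent 8 beats the
  -- frequency 1/(4m⁶) of a test, and exponent 10 keeps the additional error far below the
  -- tolerances of order m⁻⁵.
  refine ⟨4000, by norm_num, _, QMAPlus.errPoly 8, QMAPlus.errPoly 10, QMAPlus.superVerifier,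
    fun N hN => ⟨QMAPlus.errPoly_pos 8 hN, QMAPlus.errPoly_pos 10 hN⟩, ?_, ?_⟩
  · rintro _ ⟨I, rfl, hI, hdist, hmin⟩
    exact QMAPlus.superVerifier_complete hI hdist hmin
  · rintro _ ⟨I, rfl, hI, hdist⟩ ρ hρ
    exact (QMAPlus.superVerifier_sound hI hdist hρ (QMAPlus.errPoly_le 10 _ I.encode_length_pos)).trans
      (sub_le_sub_left (QMAPlus.errPoly_le 8 _ I.encode_length_pos) 1)
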